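/- **Setting.** Let $n\ge 3$ and $\mathfrak b\ge 1$ be integers, $\tau$ real, $\Omega=\mathbb T^2\times(0,1)$, $x=(x_\shortparallel,x_3)$, $x_\shortparallel=(x_1,x_2)$. Let $\mu(v)=(2\pi)^{-3/2}e^{-|v|^2/2}$ on $\mathbb R^3$, let $$Q(F,G)(v)=\int_{\mathbb R^3}\!\int_{\mathbb S^2}|(v-u)\cdot\omega|\,\big[F(u')G(v')-F(u)G(v)\big]\,d\omega\,du,\qquad u'=u+[(v-u)\cdot\omega]\omega,\quad v'=v-[(v-u)\cdot\omega]\omega,$$ be the hard sphere operator, $\mathbf Lg=-\mu^{-1/2}[Q(\mu,\sqrt\mu g)+Q(\sqrt\mu g,\mu)]$, $\Gamma(g,h)=\mu^{-1/2}Q(\sqrt\mu g,\sqrt\mu h)$, $\Gamma^s(g,h)=\Gamma(g,h)+\Gamma(h,g)$. $\langle\cdot,\cdot\rangle$ is the $L^2(\mathbb R^3_v)$ product, $\mathbf P$ the orthogonal projection onto $\mathcal N=\ker\mathbf L=\mathrm{span}\{\sqrt\mu,v_i\sqrt\mu,|v|^2\sqrt\mu\}$, written $\mathbf Pg=\{\rho+u\cdot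 v+\tfrac12\theta(|v|^2-3)\}\sqrt\mu$, and $\mathbf L^{-1}:\mathcal N^\perp\to\mathcal N^\perp$ is the inverse of $\mathbf L$ in $L^2$. Put $\mathcal A_{ij}=(v_iv_j-\delta_{ij}\tfrac{|v|^2}3)\sqrt\mu$, $\mathcal B_i=\tfrac{v_i}2(|v|^2-5)\sqrt\mu$, $\lambda=\langle\mathcal A_{ij},\mathbf L^{-1}\mathcal A_{ij}\rangle$ ($i\ne j$), $\kappa=\langle\mathcal B_i,\mathbf L^{-1}\mathcal B_i\rangle$. *Interior terms.* $f_i(t,x,v)$, $i\ge0$ ($f_i=0$ for $i<0$), $0<t<\tau$, $x\in\overline\Omega$, with macroscopic part $(\rho_i,u_i,\theta_i)$, satisfy for all $k\in\mathbb Z$ $$\partial_tf_{k+2-n}+v\cdot\nabla_xf_k=-\mathbf Lf_{k+n}+\sum_{i+j=k+2,\ i,j\ge0}\tfrac12\Gamma^s(f_i,f_j),$$ and $u_{0,3}=0$ on $x_3=0,1$. *Viscous layer terms.* Fix a wall: the upper sign is used for $x_3=1$, the lower sign for $x_3=0$. For functions of $(t,x,v)$ or $(t,x)$ the superscript $\pm$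 means the restriction to that wall ($f_i^\pm$, $\partial_{x_3}^lf_i^\pm$, $u_i^\pm,\dots$). $\bar f_i^\pm(t,x_\shortparallel,y,v)$, $i\ge1$ ($\bar f_i^\pm=0$ for $i\le0$), $0<t<\tau$, $x_\shortparallel\in\mathbb T^2$, $y>0$, with macroscopic part $(\bar\rho_i^\pm,\bar u_i^\pm,\bar\theta_i^\pm)$, satisfy for all $k\in\mathbb Z$ $$\begin{aligned}\partial_t\bar f^\pm_{k+2-n}+v_\shortparallel\cdot\nabla_\shortparallel\bar f_k^\pm\mp v_3\partial_y\bar f^\pm_{k+1}=&-\mathbf L\bar f^\pm_{k+n}+\sum_{i+j=k+2,\ i\ge0,\,j\ge1}\Gamma^s(f_i^\pm,\bar f_j^\pm)\\&+\sum_{i+j+l=k+2,\ i\ge0,\,j\ge1,\,1\le l\le\mathfrak b}\tfrac{(\mp y)^l}{l!}\Gamma^s(\partial_{x_3}^lf_i^\pm,\bar f_j^\pm)+\sum_{i+j=k+2,\ i,j\ge1}\tfrac12\Gamma^s(\bar f_i^\pm,\bar f_j^\pm),\end{aligned}$$ and $\bar f_i^\pm(t,x_\shortparallel,y,\cdot)\to0$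 in $L^2_v$ as $y\to\infty$, for all $i\ge 1$. Solutions are classical: all functions are continuous in $v$, the $f_i$ are $C^{\mathfrak b}$ in $(t,x)$ up to the walls, the $\bar f_i^\pm$ are $C^2$ in $(t,x_\shortparallel,y)$, and these derivatives decay in $v$ faster than any power, locally uniformly in the other variables. **Notation.** $\int_y^\infty$ is the improper integral $\lim_{R\to\infty}\int_y^R$. For $k\ge1$ (and $H_m$, $W_m$ for all $m\in\mathbb Z$ by the same formulas) $$\begin{aligned}W_{k-1}^\pm=\mathbf L^{-1}\Big\{&-(\mathbf I-\mathbf P)(\partial_t\bar f^\pm_{k-n}+v_\shortparallel\cdot\nabla_\shortparallel\bar f^\pm_{k-2})\pm(\mathbf I-\mathbf P)[v_3\partial_y\bar f^\pm_{k-1}]+\sum_{i+j=k,\ i,j\ge1}\big[\Gamma^s(f_i^\pm,\bar f_j^\pm)+\tfrac12\Gamma^s(\bar f_i^\pm,\bar f_j^\pm)\big]\\&+\sum_{i+j+l=k,\ i\ge0,\,j\ge1,\,1\le l\le\mathfrak b}\tfrac{(\mp y)^l}{l!}\Gamma^s(\partial_{x_3}^lf_i^\pm,\bar f_j^\pm)+\Gamma^s(f_0^\pm,(\mathbf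 I-\mathbf P)\bar f_k^\pm)\Big\},\end{aligned}$$ $$H_{k-1}^\pm=-\partial_t\bar u^\pm_{k-1,3}-\sum_{j=1}^2\partial_j\langle\mathcal A_{3j},(\mathbf I-\mathbf P)\bar f^\pm_{k+n-3}\rangle\pm\partial_y\langle\mathcal A_{33},W^\pm_{k-1}\rangle,$$ $$\begin{aligned}J_{k-1}^\pm=\mathbf L^{-1}\Big\{&-(\mathbf I-\mathbf P)(\partial_t\bar f^\pm_{k+1-n}+v_\shortparallel\cdot\nabla_\shortparallel\bar f^\pm_{k-1})\pm(\mathbf I-\mathbf P)[v_3\partial_y(\mathbf I-\mathbf P)\bar f_k^\pm]+\sum_{i+j=k+1,\ i\ge2,\,j\ge1}\Gamma^s(f_i^\pm,\bar f_j^\pm)\\&+\sum_{i+j=k+1,\ i,j\ge2}\tfrac12\Gamma^s(\bar f_i^\pm,\bar f_j^\pm)+\sum_{i+j+l=k+1,\ i\ge0,\,1\le j\le k-1,\,1\le l\le\mathfrak b}\tfrac{(\mp y)^l}{l!}\Gamma^s(\partial_{x_3}^lf_i^\pm,\bar f_j^\pm)\\&+\Gamma^s(f_0^\pm,(\mathbf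 I-\mathbf P)\bar f^\pm_{k+1})+\Gamma^s(f_1^\pm,(\mathbf I-\mathbf P)\bar f_k^\pm)+\Gamma^s((\mathbf I-\mathbf P)f_1^\pm,\mathbf P\bar f_k^\pm)\\&\mp y\,\Gamma^s(\partial_{x_3}f_0^\pm,(\mathbf I-\mathbf P)\bar f_k^\pm)+\Gamma^s(\bar f_1^\pm,(\mathbf I-\mathbf P)\bar f_k^\pm)\Big\}.\end{aligned}$$ **Proposition 3.1.** The coefficients $\lambda$ and $\kappa$ are well defined (independent of the indices chosen) and positive. For every $k\ge1$ the functions $W_{k-1}^\pm$, $H_{k-1}^\pm$, $J_{k-1}^\pm$ are well defined, the improper integrals below converge, the derivatives below exist, and for $0<t<\tau$, $x_\shortparallel\in\mathbb T^2$, $y>0$ the following holds. (1) For $i=1,2$, $$\begin{aligned}&\partial_t\bar u_{k,i}^\pm+(y\,\partial_{x_3}u_{0,3}^\pm\mp u_{1,3}^\pm)\partial_y\bar u_{k,i}^\pm-\lambda\,\partial_y^2\bar u_{k,i}^\pm+(u_{0,\shortparallel}^\pm\cdot\nabla_\shortparallel)\bar u_{k,i}^\pm+(\bar u_{k,\shortparallel}^\pm\cdot\nabla_\shortparallel)u_{0,i}^\pm=\mathfrak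 f_{k-1,i}^\pm\\&\quad:=\pm\partial_y\big[(u_{1,i}^\pm\mp y\,\partial_{x_3}u_{0,i}^\pm+\bar u_{1,i}^\pm)\bar u_{k,3}^\pm\big]-\sum_{j=1}^2\partial_j\langle\mathcal A_{ij},W_{k-1}^\pm\rangle\pm\partial_y\langle\mathcal A_{3i},J_{k-1}^\pm\rangle\mp\partial_{x_i}\!\int_y^\infty\!H_{k-1}^\pm ds+u_{0,i}^\pm\partial_t\bar\rho^\pm_{k+2-n},\end{aligned}$$ $$\begin{aligned}&\partial_t\bar\theta_k^\pm+(y\,\partial_{x_3}u_{0,3}^\pm\mp u_{1,3}^\pm)\partial_y\bar\theta_k^\pm-\tfrac25\kappa\,\partial_y^2\bar\theta_k^\pm+(u_{0,\shortparallel}^\pm\cdot\nabla_\shortparallel)\bar\theta_k^\pm+(\bar u_{k,\shortparallel}^\pm\cdot\nabla_\shortparallel)\theta_0^\pm=\mathfrak g_{k-1}^\pm:=\tfrac25\partial_t(\bar\rho_k^\pm+\bar\theta_k^\pm)\\&\quad\pm\partial_y\big[(\mp y\,\partial_{x_3}\theta_0^\pm+\bar\theta_1^\pm+\theta_1^\pm)\bar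 u_{k,3}^\pm\big]\pm\tfrac25\partial_y\langle\mathcal B_3,J_{k-1}^\pm\rangle-\tfrac25\sum_{j=1}^2\partial_j\langle\mathcal B_j,W_{k-1}^\pm\rangle+\theta_0^\pm\partial_t\bar\rho^\pm_{k+2-n},\end{aligned}$$ $$\bar\rho_k^\pm+\bar\theta_k^\pm=\mathfrak s_{k-1}^\pm:=\tfrac23u_{0,\shortparallel}^\pm\cdot\bar u_{k+2-n,\shortparallel}^\pm\pm\int_y^\infty H_{k+1-n}^\pm(t,x_\shortparallel,s)\,ds.$$ (2) Moreover, $$\partial_y\bar u_{k+1,3}^\pm=\pm\partial_t\bar\rho^\pm_{k+2-n}\pm\mathrm{div}_\shortparallel\bar u_{k,\shortparallel}^\pm,\qquad(\mathbf I-\mathbf P)\bar f^\pm_{k+n-2}=\mathbf L^{-1}\Gamma^s(f_0^\pm,\mathbf P\bar f_k^\pm)+W_{k-1}^\pm,$$ $$\partial_y(\bar\rho^\pm_{n-2+k}+\bar\theta^\pm_{n-2+k})=\tfrac23\partial_y(u_{0,\shortparallel}^\pm\cdot\bar u_{k,\shortparallel}^\pm)\mp H_{k-1}^\pm.$$ (3)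 The sources $\mathfrak f_{k-1,1}^\pm,\mathfrak f_{k-1,2}^\pm,\mathfrak g_{k-1}^\pm,\mathfrak s_{k-1}^\pm$ depend only on $f_i$ $(0\le i\le k)$ and $\bar f_j^\pm$ $(1\le j\le k-1)$: they coincide for any two solutions of the two hierarchies (with the same $n,\mathfrak b,\tau$ and wall) for which these functions coincide. If in addition $(\bar u_{k,\shortparallel}^\pm,\bar\theta_k^\pm)$ coincide, then so do $\bar u_{k+1,3}^\pm$, $\partial_y(\bar\rho^\pm_{n-2+k}+\bar\theta^\pm_{n-2+k})$ and $(\mathbf I-\mathbf P)\bar f^\pm_{k+n-2}$. -/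

import Mathlib

open MeasureTheory Filter Topology

noncomputable section

namespace ViscousLayer

/-! ### Velocity space and the hard sphere collision operator -/

/-- Velocities `v = (v₁, v₂, v₃)`; the components are `v 0`, `v 1`, `v 2`. -/
abbrev Vel : Type := EuclideanSpace ℝ (Fin 3)

/-- The normalized global Maxwellian `μ(v) = (2π)^{-3/2} exp(-|v|²/2)`. -/
def maxwellian (v : Vel) : ℝ :=
  (2 * Real.pi) ^ (-(3 / 2) : ℝ) * Real.exp (-‖v‖ ^ 2 / 2)

/-- `√μ`. -/
def sqrtM (v : Vel) : ℝ := Real.sqrt (maxwellian v)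

/-- Surface measure of the unit sphere of `ℝ³`. -/
def sphereMeasure : Measure (Metric.sphere (0 : Vel) 1) := (volume : Measure Vel).toSphere

/-- The hard sphere collision operator
`Q(F,G)(v) = ∫∫ |(v-u)·ω| F(u') G(v') dω du - ∫∫ |(v-u)·ω| F(u) G(v) dω du`,
`u' = u + [(v-u)·ω]ω`, `v' = v - [(v-u)·ω]ω`. -/
def collision (F G : Vel → ℝ) (v : Vel) : ℝ :=
  (∫ u : Vel, ∫ ω : Metric.sphere (0 : Vel) 1,
      |inner ℝ (v - u) (ω : Vel)| *
        (F (u + inner ℝ (v - u) (ω : Vel) • (ω : Vel)) *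
          G (v - inner ℝ (v - u) (ω : Vel) • (ω : Vel))) ∂sphereMeasure)
  - ∫ u : Vel, ∫ ω : Metric.sphere (0 : Vel) 1,
      |inner ℝ (v - u) (ω : Vel)| * (F u * G v) ∂sphereMeasure

/-- The linearized operator `L g = -μ^{-1/2} [Q(μ, √μ g) + Q(√μ g, μ)]`. -/
def linL (g : Vel → ℝ) (v : Vel) : ℝ :=
  -(1 / sqrtM v) * (collision maxwellian (fun w => sqrtM w * g w) v +
    collision (fun w => sqrtM w * g w) maxwellian v)

/-- `Γ(g, h) = μ^{-1/2} Q(√μ g, √μ h)`. -/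
def Gam (g h : Vel → ℝ) (v : Vel) : ℝ :=
  (1 / sqrtM v) * collision (fun w => sqrtM w * g w) (fun w => sqrtM w * h w) v

/-- `Γ(g, h) + Γ(h, g)`. -/
def GamS (g h : Vel → ℝ) (v : Vel) : ℝ := Gam g h v + Gam h g v

/-- The `L²` inner product in velocity. -/
def ip (g h : Vel → ℝ) : ℝ := ∫ v : Vel, g v * h v

/-- The density `ρ` of `g`. -/
def rho (g : Vel → ℝ) : ℝ := ip g sqrtM

/-- The `i`-th component of the velocity `u` of `g`. -/
def vel (i : Fin 3) (g : Vel → ℝ) : ℝ := ip g (fun v => v i * sqrtM v)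

/-- The temperature `θ` of `g`. -/
def temp (g : Vel → ℝ) : ℝ := ip g (fun v => (‖v‖ ^ 2 - 3) * sqrtM v) / 3

/-- The orthogonal projection `P g = {ρ + u·v + θ(|v|²-3)/2} √μ` onto the null space `𝒩`. -/
def proj (g : Vel → ℝ) (v : Vel) : ℝ :=
  (rho g + ∑ i : Fin 3, vel i g * v i + temp g / 2 * (‖v‖ ^ 2 - 3)) * sqrtM v

/-- The microscopic part `(I-P) g`. -/
def micro (g : Vel → ℝ) (v : Vel) : ℝ := g v - proj g v

/-- The Burnett functions `𝒜_{ij} = {v_i v_j - δ_{ij}|v|²/3} √μ`. -/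
def burnettA (i j : Fin 3) (v : Vel) : ℝ :=
  (v i * v j - (if i = j then ‖v‖ ^ 2 / 3 else 0)) * sqrtM v

/-- The Burnett functions `ℬ_i = (v_i/2)(|v|²-5) √μ`. -/
def burnettB (i : Fin 3) (v : Vel) : ℝ := v i / 2 * (‖v‖ ^ 2 - 5) * sqrtM v

/-- `g = L⁻¹ h`: the function `g` belongs to `L²((1+|v|)dv)` (the collision frequency is comparable
to `1+|v|`), is orthogonal to `𝒩`, and `L g = h` as functions in `L²`. -/
structure IsLinvOf (h g : Vel → ℝ) : Prop where
  measurable : Measurable g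
  integrable : Integrable (fun v : Vel => (1 + ‖v‖) * g v ^ 2)
  rho_eq : rho g = 0
  vel_eq : ∀ i, vel i g = 0
  temp_eq : temp g = 0
  eq : linL g =ᵐ[volume] h

open Classical in
/-- The operator `L⁻¹` (its values are functions modulo null sets; `0` outside the range of `L`). -/
def Linv (h : Vel → ℝ) : Vel → ℝ :=
  if hg : ∃ g, IsLinvOf h g then Classical.choose hg else 0

/-- The viscosity `λ = ⟨𝒜_{12}, L⁻¹ 𝒜_{12}⟩`. -/
def viscosity : ℝ := ip (burnettA 0 1) (Linv (burnettA 0 1))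

/-- The thermal conductivity `κ = ⟨ℬ_1, L⁻¹ ℬ_1⟩`. -/
def conductivity : ℝ := ip (burnettB 0) (Linv (burnettB 0))

/-! ### Points, domains, derivatives, regularity -/

/-- Points `(t, x₁, x₂, x₃)` of the channel, or `(t, x₁, x₂, y)` of a layer. The index `0` is time,
and `i.succ` is the space coordinate that belongs to the velocity component `i`. -/
abbrev Pt : Type := Fin 4 → ℝ

/-- `(0,τ) × ℝ² × [0,1]`; functions on `𝕋²` are `1`-periodic functions on `ℝ²`. -/
def channel (τ : ℝ) : Set Pt := {z | 0 < z 0 ∧ z 0 < τ ∧ 0 ≤ z 3 ∧ z 3 ≤ 1}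

/-- `(0,τ) × ℝ² × (0,∞)`. -/
def layer (τ : ℝ) : Set Pt := {z | 0 < z 0 ∧ z 0 < τ ∧ 0 < z 3}

/-- The partial derivative in the coordinate `i` on the domain `D` (one-sided on the boundary). -/
def pd (D : Set Pt) (i : Fin 4) (g : Pt → ℝ) (z : Pt) : ℝ :=
  lineDerivWithin ℝ g D z (Pi.single i 1)

/-- `g` is differentiable at `z ∈ D` in the coordinate `i`. -/
def PartialDiff (D : Set Pt) (i : Fin 4) (g : Pt → ℝ) (z : Pt) : Prop :=
  LineDifferentiableWithinAt ℝ g D z (Pi.single i 1)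

/-- Classical regularity of order `r` in `(t,x)`, with all these derivatives rapidly decreasing in
`v`, locally uniformly in `(t,x)`; continuity in `v`; periodicity in `(x₁,x₂)`. -/
structure RegularOn (D : Set Pt) (r : ℕ) (g : Pt → Vel → ℝ) : Prop where
  continuous_vel : ∀ z ∈ D, Continuous (g z)
  contDiffOn : ∀ v, ContDiffOn ℝ r (fun z => g z v) D
  decay : ∀ K ⊆ D, IsCompact K → ∀ m ≤ r, ∀ q : ℕ, ∃ C : ℝ, ∀ z ∈ K, ∀ v : Vel,
    (1 + ‖v‖) ^ q * ‖iteratedFDerivWithin ℝ m (fun z => g z v) D z‖ ≤ C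
  periodic : ∀ z ∈ D, ∀ v, ∀ j : Fin 2, g (z + Pi.single j.castSucc.succ 1) v = g z v

/-- The two walls `x₃ = 0` and `x₃ = 1`. -/
inductive Side
  | lower
  | upper

/-- The sign `±`: `+1` at the upper wall and `-1` at the lower wall. -/
def Side.sgn : Side → ℝ
  | .lower => -1
  | .upper => 1

/-- The value of `x₃` on the wall. -/
def Side.wall : Side → ℝ
  | .lower => 0
  | .upper => 1

/-! ### The two hierarchies -/

/-- The data of the expansion: the integer `n`, the order `b` of the Taylor expansion of the
interior terms at the wall, the life span `τ`, the wall `s`, the interior terms `f_i` and the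
viscous layer terms `f̄_i` at that wall. There is no condition here; see `LayerData.IsSolution`. -/
structure LayerData where
  n : ℤ
  b : ℕ
  τ : ℝ
  s : Side
  f : ℤ → Pt → Vel → ℝ
  fb : ℤ → Pt → Vel → ℝ

namespace LayerData

variable (D : LayerData)

/-- The sign `±`. -/
def sg : ℝ := D.s.sgn

/-- The projection of a point `(t,x₁,x₂,y)` to the wall. -/
def toWall (z : Pt) : Pt := Function.update z 3 D.s.wall

/-- The trace `f_i^±` of `f_i` on the wall. -/
def fw (i : ℤ) (z : Pt) : Vel → ℝ := D.f i (D.toWall z)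

/-- The trace `∂_{x₃}^l f_i^±` of the normal derivatives. -/
def dfw (l : ℕ) (i : ℤ) (z : Pt) : Vel → ℝ := fun v =>
  (pd (channel D.τ) 3)^[l] (fun z => D.f i z v) (D.toWall z)

/-- The trace `∂_{x₃} q^±` for a function `q` of `(t,x)`. -/
def normalTrace (q : Pt → ℝ) (z : Pt) : ℝ := pd (channel D.τ) 3 q (D.toWall z)

/-- `∂_i` on functions of `(t,x₁,x₂,y)`. -/
def dl (i : Fin 4) (q : Pt → ℝ) (z : Pt) : ℝ := pd (layer D.τ) i q z

/-- `∂_t f̄_m`. -/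
def dtfb (m : ℤ) (z : Pt) (v : Vel) : ℝ := D.dl 0 (fun z => D.fb m z v) z

/-- `v_∥ · ∇_∥ f̄_m`. -/
def tangfb (m : ℤ) (z : Pt) (v : Vel) : ℝ :=
  ∑ j : Fin 2, v j.castSucc * D.dl j.castSucc.succ (fun z => D.fb m z v) z

/-- `v₃ ∂_y f̄_m`. -/
def normfb (m : ℤ) (z : Pt) (v : Vel) : ℝ := v 2 * D.dl 3 (fun z => D.fb m z v) z

/-- `v₃ ∂_y (I-P) f̄_m`. -/
def normMicrofb (m : ℤ) (z : Pt) (v : Vel) : ℝ :=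
  v 2 * D.dl 3 (fun z => micro (D.fb m z) v) z

/-- `(∓ y)^l / l!`. -/
def taylorCoeff (l : ℕ) (z : Pt) : ℝ := (-(D.sg * z 3)) ^ l / (l.factorial : ℝ)

/-- The interior hierarchy, divided by `√μ`, with `f_i = 0` for `i < 0`. All orders `ε^k` are
written in one line: the sums are empty, or terms vanish, for the small values of `k`. -/
structure IsInterior : Prop where
  zero : ∀ i < 0, D.f i = 0
  regular : ∀ i, RegularOn (channel D.τ) D.b (D.f i)
  eq : ∀ k : ℤ, ∀ z ∈ channel D.τ, ∀ v : Vel,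
    pd (channel D.τ) 0 (fun z => D.f (k + 2 - D.n) z v) z
      + ∑ j : Fin 3, v j * pd (channel D.τ) j.succ (fun z => D.f k z v) z
    = -linL (D.f (k + D.n) z) v
      + ∑ i ∈ Finset.Icc (0 : ℤ) (k + 2), 1 / 2 * GamS (D.f i z) (D.f (k + 2 - i) z) v
  /-- the slip condition `u_0 · n = 0` on both walls -/
  slip : ∀ z ∈ channel D.τ, z 3 = 0 ∨ z 3 = 1 → vel 2 (D.f 0 z) = 0

/-- The viscous layer hierarchy, divided by `√μ`, with `f̄_i = 0` for `i ≤ 0`, and the far field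
condition (in `L²` with respect to `v`). All orders `ε^k` are written in one line. -/
structure IsViscousLayer : Prop where
  zero : ∀ i ≤ 0, D.fb i = 0
  regular : ∀ i, RegularOn (layer D.τ) 2 (D.fb i)
  eq : ∀ k : ℤ, ∀ z ∈ layer D.τ, ∀ v : Vel,
    D.dtfb (k + 2 - D.n) z v + D.tangfb k z v - D.sg * D.normfb (k + 1) z v
    = -linL (D.fb (k + D.n) z) v
      + ∑ i ∈ Finset.Icc (0 : ℤ) (k + 1), GamS (D.fw i z) (D.fb (k + 2 - i) z) v
      + ∑ l ∈ Finset.Icc 1 D.b, ∑ i ∈ Finset.Icc (0 : ℤ) (k + 1 - l),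
          D.taylorCoeff l z * GamS (D.dfw l i z) (D.fb (k + 2 - l - i) z) v
      + ∑ i ∈ Finset.Icc (1 : ℤ) (k + 1), 1 / 2 * GamS (D.fb i z) (D.fb (k + 2 - i) z) v
  farField : ∀ i, ∀ z ∈ layer D.τ,
    Tendsto (fun y : ℝ => ∫ v : Vel, D.fb i (Function.update z 3 y) v ^ 2) atTop (𝓝 0)

/-- The `f_i` solve the interior hierarchy and the `f̄_i` solve the viscous layer hierarchy. -/
structure IsSolution : Prop where
  interior : D.IsInterior
  viscous : D.IsViscousLayer

/-! ### Macroscopic quantities -/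

/-- `ρ̄_k + θ̄_k`. -/
def pbar (k : ℤ) (z : Pt) : ℝ := rho (D.fb k z) + temp (D.fb k z)

/-- `u_{0,∥}^± · ū_{k,∥}`. -/
def u0dot (k : ℤ) (z : Pt) : ℝ :=
  ∑ j : Fin 2, vel j.castSucc (D.fw 0 z) * vel j.castSucc (D.fb k z)

/-- `(u_{0,∥}^± · ∇_∥) q`. -/
def adv0 (q : Pt → ℝ) (z : Pt) : ℝ :=
  ∑ j : Fin 2, vel j.castSucc (D.fw 0 z) * D.dl j.castSucc.succ q z

/-- `(ū_{k,∥} · ∇_∥) q`. -/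
def advb (k : ℤ) (q : Pt → ℝ) (z : Pt) : ℝ :=
  ∑ j : Fin 2, vel j.castSucc (D.fb k z) * D.dl j.castSucc.succ q z

/-- `div_∥ ū_{k,∥}`. -/
def divb (k : ℤ) (z : Pt) : ℝ :=
  ∑ j : Fin 2, D.dl j.castSucc.succ (fun z => vel j.castSucc (D.fb k z)) z

/-- The linearly growing transport coefficient `y ∂_{x₃}u_{0,3}^± ∓ u_{1,3}^±`. -/
def driftCoeff (z : Pt) : ℝ :=
  z 3 * D.normalTrace (fun z => vel 2 (D.f 0 z)) z - D.sg * vel 2 (D.fw 1 z)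

/-! ### The functions `W`, `H`, `J` -/

/-- The argument of `L⁻¹` in `W_{k-1}`. -/
def WArg (k : ℤ) (z : Pt) (v : Vel) : ℝ :=
  -micro (fun v => D.dtfb (k - D.n) z v + D.tangfb (k - 2) z v) v
  + D.sg * micro (D.normfb (k - 1) z) v
  + ∑ i ∈ Finset.Icc (1 : ℤ) (k - 1), GamS (D.fw i z) (D.fb (k - i) z) v
  + ∑ i ∈ Finset.Icc (1 : ℤ) (k - 1), 1 / 2 * GamS (D.fb i z) (D.fb (k - i) z) v
  + ∑ l ∈ Finset.Icc 1 D.b, ∑ i ∈ Finset.Icc (0 : ℤ) (k - 1 - l),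
      D.taylorCoeff l z * GamS (D.dfw l i z) (D.fb (k - l - i) z) v
  + GamS (D.fw 0 z) (micro (D.fb k z)) v

/-- `W_m`. -/
def W (m : ℤ) (z : Pt) : Vel → ℝ := Linv (D.WArg (m + 1) z)

/-- `H_m = -∂_t ū_{m,3} - ∑_{j ≤ 2} ∂_j ⟨𝒜_{3j}, (I-P) f̄_{m+n-2}⟩ ± ∂_y ⟨𝒜_{33}, W_m⟩`. -/
def H (m : ℤ) (z : Pt) : ℝ :=
  -D.dl 0 (fun z => vel 2 (D.fb m z)) z
  - ∑ j : Fin 2, D.dl j.castSucc.succ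
      (fun z => ip (burnettA 2 j.castSucc) (micro (D.fb (m + D.n - 2) z))) z
  + D.sg * D.dl 3 (fun z => ip (burnettA 2 2) (D.W m z)) z

/-- `∫_y^R H_m(t,x_∥,s) ds`. -/
def intH (m : ℤ) (z : Pt) (R : ℝ) : ℝ := ∫ s in (z 3)..R, D.H m (Function.update z 3 s)

/-- The improper integral `∫_y^∞ H_m(t,x_∥,s) ds`. -/
def tailH (m : ℤ) (z : Pt) : ℝ := limUnder atTop (D.intH m z)

/-- The argument of `L⁻¹` in `J_{k-1}`. -/
def JArg (k : ℤ) (z : Pt) (v : Vel) : ℝ :=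
  -micro (fun v => D.dtfb (k + 1 - D.n) z v + D.tangfb (k - 1) z v) v
  + D.sg * micro (D.normMicrofb k z) v
  + ∑ i ∈ Finset.Icc (2 : ℤ) k, GamS (D.fw i z) (D.fb (k + 1 - i) z) v
  + ∑ i ∈ Finset.Icc (2 : ℤ) (k - 1), 1 / 2 * GamS (D.fb i z) (D.fb (k + 1 - i) z) v
  + ∑ l ∈ Finset.Icc 1 D.b, ∑ j ∈ Finset.Icc (1 : ℤ) (min (k - 1) (k + 1 - l)),
      D.taylorCoeff l z * GamS (D.dfw l (k + 1 - l - j) z) (D.fb j z) v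
  + GamS (D.fw 0 z) (micro (D.fb (k + 1) z)) v
  + GamS (D.fw 1 z) (micro (D.fb k z)) v
  + GamS (micro (D.fw 1 z)) (proj (D.fb k z)) v
  - D.sg * z 3 * GamS (D.dfw 1 0 z) (micro (D.fb k z)) v
  + GamS (D.fb 1 z) (micro (D.fb k z)) v

/-- `J_m`. -/
def J (m : ℤ) (z : Pt) : Vel → ℝ := Linv (D.JArg (m + 1) z)

/-! ### The source terms -/

/-- `𝔣_{k-1,i}`, `i = 1, 2`. -/
def srcU (k : ℤ) (i : Fin 2) (z : Pt) : ℝ :=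
  D.sg * D.dl 3 (fun z =>
      (vel i.castSucc (D.fw 1 z)
        - D.sg * z 3 * D.normalTrace (fun z => vel i.castSucc (D.f 0 z)) z
        + vel i.castSucc (D.fb 1 z)) * vel 2 (D.fb k z)) z
  - ∑ j : Fin 2, D.dl j.castSucc.succ
      (fun z => ip (burnettA i.castSucc j.castSucc) (D.W (k - 1) z)) z
  + D.sg * D.dl 3 (fun z => ip (burnettA 2 i.castSucc) (D.J (k - 1) z)) z
  - D.sg * D.dl i.castSucc.succ (D.tailH (k - 1)) z
  + vel i.castSucc (D.fw 0 z) * D.dl 0 (fun z => rho (D.fb (k + 2 - D.n) z)) z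

/-- `𝔤_{k-1}`. -/
def srcTheta (k : ℤ) (z : Pt) : ℝ :=
  2 / 5 * D.dl 0 (D.pbar k) z
  + D.sg * D.dl 3 (fun z =>
      (-(D.sg * z 3) * D.normalTrace (fun z => temp (D.f 0 z)) z
        + temp (D.fb 1 z) + temp (D.fw 1 z)) * vel 2 (D.fb k z)) z
  + 2 / 5 * D.sg * D.dl 3 (fun z => ip (burnettB 2) (D.J (k - 1) z)) z
  - 2 / 5 * ∑ j : Fin 2, D.dl j.castSucc.succ
      (fun z => ip (burnettB j.castSucc) (D.W (k - 1) z)) z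
  + temp (D.fw 0 z) * D.dl 0 (fun z => rho (D.fb (k + 2 - D.n) z)) z

/-- `𝔰_{k-1}`. -/
def srcP (k : ℤ) (z : Pt) : ℝ :=
  2 / 3 * D.u0dot (k + 2 - D.n) z + D.sg * D.tailH (k + 1 - D.n) z

/-- The improper integral `∫_y^∞ H_m ds` converges. -/
def TailConverges (m : ℤ) (z : Pt) : Prop :=
  (∀ R > z 3, IntervalIntegrable (fun s => D.H m (Function.update z 3 s)) volume (z 3) R) ∧
    Tendsto (D.intH m z) atTop (𝓝 (D.tailH m z))

/-- All terms of the sources with index `k - 1` are meaningful at `z`: the functions to which `L⁻¹`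
is applied are in the range of `L`, the derivatives exist, the integrals converge. -/
structure SourcesMeaningful (k : ℤ) (z : Pt) : Prop where
  W_spec : IsLinvOf (D.WArg k z) (D.W (k - 1) z)
  J_spec : IsLinvOf (D.JArg k z) (D.J (k - 1) z)
  diff_AW : ∀ i j : Fin 2, PartialDiff (layer D.τ) j.castSucc.succ
    (fun z => ip (burnettA i.castSucc j.castSucc) (D.W (k - 1) z)) z
  diff_AW₃ : PartialDiff (layer D.τ) 3 (fun z => ip (burnettA 2 2) (D.W (k - 1) z)) z
  diff_BW : ∀ j : Fin 2, PartialDiff (layer D.τ) j.castSucc.succ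
    (fun z => ip (burnettB j.castSucc) (D.W (k - 1) z)) z
  diff_AJ : ∀ i : Fin 2, PartialDiff (layer D.τ) 3
    (fun z => ip (burnettA 2 i.castSucc) (D.J (k - 1) z)) z
  diff_BJ : PartialDiff (layer D.τ) 3 (fun z => ip (burnettB 2) (D.J (k - 1) z)) z
  tail : D.TailConverges (k - 1) z
  tail' : D.TailConverges (k + 1 - D.n) z
  diff_tail : ∀ i : Fin 2, PartialDiff (layer D.τ) i.castSucc.succ (D.tailH (k - 1)) z

end LayerData

end ViscousLayer

end

open ViscousLayer

/-! The analytic input is the invertibility of `L` on the complement of its null space. For `φ =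
g/√μ` the Dirichlet form of `L` is the square integral of `φ(v) + φ(u) - φ(v') - φ(u')` against the
collision measure, and `PerpInv.coercive` shows that it controls the norm with weight `1 + |v|` when
`φ` is orthogonal to the invariants. A collision with direction `ω` exchanges the components of the
two velocities along `ω`. Passing through an intermediate component removes the hard sphere weight
(`dissip₀_le`). Exchanges along two vectors of an orthonormal frame show that small dissipation
makes `φ` close to a sum of functions of one component each (`lintegral_sub_marg_le`). For two
frames in general position, such sums are only weakly correlated apart from their quadratic parts,
by a bound for the Mehler kernel (`abs_correlation_sub_le`); orthogonality to the energy tames the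
quadratic parts, so `φ` cannot be close to both sums (`PerpInv.integral_sq_le_frames`). Cones around
the six directions recover the weight, and averaging over the orthogonal group turns six directions
into the whole sphere. The Lax-Milgram theorem yields `exists_isLinvOf`.

Two algebraic facts make `L⁻¹` explicit where this is needed. On collision invariants `Γˢ` of a pair
is `L` of their product (`GamS_invP_eq_linL`), so `L⁻¹ Γˢ(Pg, Ph)` is the microscopic part of a
polynomial times `√μ`, called `prodMicro`; its Burnett moments follow by Gaussian integration by
parts. And `L` commutes with linear isometries, so reflections and permutations reduce the required
moments of `L⁻¹𝒜` and `L⁻¹ℬ` to `λ` and `κ`.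

The collision terms of the hierarchy are orthogonal to the invariants. Hence the transport terms of
each order satisfy balances of mass, momentum and energy (`perpN_transport`). Solving the same
relations for the microscopic part gives `(I-P) f̄_{k+n-2}` as `prodMicro` plus `W`, and one order
higher as an explicit flux plus `J`. Inserted into the balances, these give everything: mass gives
the next normal velocity; normal momentum shows that `H` is a `y`-derivative (`H_eq`), so that the
far field condition evaluates the improper integral; tangential momentum and energy give the two
parabolic equations. The condition `div u₀ = 0`, read off at the wall, removes the remaining zero
order terms.

For the dependence statement the difficulty is `J`, whose definition contains `P f̄_k` and `(I-P)
f̄_{k+1}`. The parts of these that are not determined by the data enter the argument of `L⁻¹` only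
through functions even in `v₃`, while `𝒜_{3i}` with `i = 1, 2` and `ℬ_3` are odd, so the moments in
the sources do not see them (`Agree.ip_J`). When `k = 1` the undetermined `f̄_1` is harmless because
`(I-P) f̄_1 = 0` and `ū_{1,3} = 0`. -/

noncomputable section
namespace ViscousLayer
open ProbabilityTheory
open scoped RealInnerProductSpace

/-! ### Gaussian measures and linear maps -/

section GaussianMaps

set_option linter.unusedSectionVars false

variable {E F E' F' : Type*}
  [NormedAddCommGroup E] [InnerProductSpace ℝ E] [FiniteDimensional ℝ E]
  [MeasurableSpace E] [BorelSpace E]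
  [NormedAddCommGroup F] [InnerProductSpace ℝ F] [FiniteDimensional ℝ F]
  [MeasurableSpace F] [BorelSpace F]
  [NormedAddCommGroup E'] [InnerProductSpace ℝ E'] [FiniteDimensional ℝ E']
  [MeasurableSpace E'] [BorelSpace E']
  [NormedAddCommGroup F'] [InnerProductSpace ℝ F'] [FiniteDimensional ℝ F']
  [MeasurableSpace F'] [BorelSpace F']

lemma norm_dual_eq_of_forall_inner (L : StrongDual ℝ E) (a : E) (h : ∀ x, L x = ⟪x, a⟫) :
    ‖L‖ = ‖a‖ := by
  have : L = InnerProductSpace.toDual ℝ E a := by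
    ext x; rw [h, InnerProductSpace.toDual_apply_apply, real_inner_comm]
  rw [this]; simp

/-- A linear map with isometric adjoint maps the standard Gaussian measure on a product to the
standard Gaussian measure. -/
lemma measurePreserving_gaussian_prod (A : E × F →L[ℝ] E' × F') (S : E' → F' → E × F)
    (hS : ∀ p a b, ⟪(A p).1, a⟫ + ⟪(A p).2, b⟫ = ⟪p.1, (S a b).1⟫ + ⟪p.2, (S a b).2⟫)
    (hn : ∀ a b, ‖(S a b).1‖ ^ 2 + ‖(S a b).2‖ ^ 2 = ‖a‖ ^ 2 + ‖b‖ ^ 2) :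
    MeasurePreserving A ((stdGaussian E).prod (stdGaussian F))
      ((stdGaussian E').prod (stdGaussian F')) where
  measurable := A.continuous.measurable
  map_eq := by
    apply Measure.ext_of_charFunDual
    ext L
    -- The product type carries the sup norm, so a functional on it is represented by one Riesz
    -- vector per factor.
    obtain ⟨a, ha⟩ : ∃ a : E', ∀ x, L (x, 0) = ⟪x, a⟫ :=
      ⟨(InnerProductSpace.toDual ℝ E').symm (L.comp (.inl ℝ E' F')), fun x => by
        rw [real_inner_comm, InnerProductSpace.toDual_symm_apply]; simp⟩
    obtain ⟨b, hb⟩ : ∃ b : F', ∀ x, L (0, x) = ⟪x, b⟫ :=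
      ⟨(InnerProductSpace.toDual ℝ F').symm (L.comp (.inr ℝ E' F')), fun x => by
        rw [real_inner_comm, InnerProductSpace.toDual_symm_apply]; simp⟩
    have hL : ∀ q : E' × F', L q = ⟪q.1, a⟫ + ⟪q.2, b⟫ := fun q => by
      rw [← ha, ← hb, ← map_add]; simp
    rw [charFunDual_map, charFunDual_prod, charFunDual_prod]
    simp only [charFunDual_stdGaussian]
    rw [norm_dual_eq_of_forall_inner _ (S a b).1 (fun x => by simp [hL, hS]),
      norm_dual_eq_of_forall_inner _ (S a b).2 (fun x => by simp [hL, hS]),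
      norm_dual_eq_of_forall_inner _ a (fun x => by simp [ha]),
      norm_dual_eq_of_forall_inner _ b (fun x => by simp [hb]), ← Complex.exp_add,
      ← Complex.exp_add]
    congr 1
    have := hn a b
    have h2 : (((‖(S a b).1‖ ^ 2 + ‖(S a b).2‖ ^ 2 : ℝ)) : ℂ) = ((‖a‖ ^ 2 + ‖b‖ ^ 2 : ℝ) : ℂ) := by
      rw [this]
    push_cast at h2
    linear_combination (-1 / 2 : ℂ) * h2

/-- This is the independence of orthogonal components of one Gaussian vector; `S` is the adjoint of
`A`. -/
lemma measurePreserving_gaussian_to_prod (A : E →L[ℝ] E' × F') (S : E' → F' → E)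
    (hS : ∀ p a b, ⟪(A p).1, a⟫ + ⟪(A p).2, b⟫ = ⟪p, S a b⟫)
    (hn : ∀ a b, ‖S a b‖ ^ 2 = ‖a‖ ^ 2 + ‖b‖ ^ 2) :
    MeasurePreserving A (stdGaussian E) ((stdGaussian E').prod (stdGaussian F')) where
  measurable := A.continuous.measurable
  map_eq := by
    apply Measure.ext_of_charFunDual
    ext L
    obtain ⟨a, ha⟩ : ∃ a : E', ∀ x, L (x, 0) = ⟪x, a⟫ :=
      ⟨(InnerProductSpace.toDual ℝ E').symm (L.comp (.inl ℝ E' F')), fun x => by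
        rw [real_inner_comm, InnerProductSpace.toDual_symm_apply]; simp⟩
    obtain ⟨b, hb⟩ : ∃ b : F', ∀ x, L (0, x) = ⟪x, b⟫ :=
      ⟨(InnerProductSpace.toDual ℝ F').symm (L.comp (.inr ℝ E' F')), fun x => by
        rw [real_inner_comm, InnerProductSpace.toDual_symm_apply]; simp⟩
    have hL : ∀ q : E' × F', L q = ⟪q.1, a⟫ + ⟪q.2, b⟫ := fun q => by
      rw [← ha, ← hb, ← map_add]; simp
    rw [charFunDual_map, charFunDual_prod]
    simp only [charFunDual_stdGaussian]
    rw [norm_dual_eq_of_forall_inner _ (S a b) (fun x => by simp [hL, hS]),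
      norm_dual_eq_of_forall_inner _ a (fun x => by simp [ha]),
      norm_dual_eq_of_forall_inner _ b (fun x => by simp [hb]), ← Complex.exp_add]
    congr 1
    have := hn a b
    have h2 : (((‖S a b‖ ^ 2 : ℝ)) : ℂ) = ((‖a‖ ^ 2 + ‖b‖ ^ 2 : ℝ) : ℂ) := by
      rw [this]
    push_cast at h2
    linear_combination (-1 / 2 : ℂ) * h2

lemma stdGaussian_real : stdGaussian ℝ = gaussianReal 0 1 := by
  apply Measure.ext_of_charFun
  ext t
  rw [charFun_stdGaussian, charFun_gaussianReal]
  congr 1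
  simp only [Real.norm_eq_abs]
  norm_cast
  simp
  ring

end GaussianMaps

/-! ### The Maxwellian -/

lemma maxwellian_pos (v : Vel) : 0 < maxwellian v := by
  unfold maxwellian; positivity

lemma continuous_maxwellian : Continuous maxwellian := by
  unfold maxwellian; fun_prop

lemma sqrtM_pos (v : Vel) : 0 < sqrtM v := Real.sqrt_pos.2 (maxwellian_pos v)

lemma continuous_sqrtM : Continuous sqrtM := continuous_maxwellian.sqrt

lemma sqrtM_mul_self (v : Vel) : sqrtM v * sqrtM v = maxwellian v :=
  Real.mul_self_sqrt (maxwellian_pos v).le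

lemma sqrtM_eq (v : Vel) :
    sqrtM v = (2 * Real.pi) ^ (-(3 / 4) : ℝ) * Real.exp (-‖v‖ ^ 2 / 4) := by
  unfold sqrtM
  rw [Real.sqrt_eq_iff_mul_self_eq (maxwellian_pos v).le (by positivity)]
  unfold maxwellian
  have h1 : ((2 * Real.pi) ^ (-(3 / 4) : ℝ)) * ((2 * Real.pi) ^ (-(3 / 4) : ℝ))
      = (2 * Real.pi) ^ (-(3 / 2) : ℝ) := by
    rw [← Real.rpow_add (by positivity)]; norm_num
  have h2 : Real.exp (-‖v‖ ^ 2 / 4) * Real.exp (-‖v‖ ^ 2 / 4) = Real.exp (-‖v‖ ^ 2 / 2) := by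
    rw [← Real.exp_add]; ring_nf
  rw [← h1, ← h2]; ring

lemma integral_exp_neg_sq :
    ∫ v : Vel, Real.exp (-‖v‖ ^ 2 / 2) = (2 * Real.pi) ^ (3 / 2 : ℝ) := by
  have := GaussianFourier.integral_rexp_neg_mul_sq_norm (V := Vel) (b := 1 / 2) (by norm_num)
  simp only [finrank_euclideanSpace, Fintype.card_fin] at this
  rw [show (2 * Real.pi : ℝ) = Real.pi / (1 / 2) by ring]
  convert this using 2
  · ext v; ring_nf
  · norm_num

lemma integrable_maxwellian : Integrable maxwellian := by
  have h : Integrable (fun v : Vel => Real.exp (-‖v‖ ^ 2 / 2)) := by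
    -- A function that is not integrable has integral zero by convention, but the integral was found
    -- to be positive.
    refine (not_imp_comm.1 integral_undef) ?_
    rw [integral_exp_neg_sq]; positivity
  exact h.const_mul _

/-- The standard Gaussian measure on velocity space has density `μ`. -/
lemma stdGaussian_eq_withDensity :
    stdGaussian Vel = volume.withDensity (fun v => ENNReal.ofReal (maxwellian v)) := by
  have : IsFiniteMeasure (volume.withDensity (fun v => ENNReal.ofReal (maxwellian v))) :=
    isFiniteMeasure_withDensity_ofReal integrable_maxwellian.2
  apply Measure.ext_of_charFun
  ext t
  rw [charFun_stdGaussian, charFun_apply, integral_withDensity_eq_integral_toReal_smul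
    continuous_maxwellian.measurable.ennreal_ofReal (by simp)]
  have h := GaussianFourier.integral_cexp_neg_mul_sq_norm_add (V := Vel) (b := 1 / 2)
    (by norm_num) Complex.I t
  simp only [finrank_euclideanSpace, Fintype.card_fin] at h
  have h3 : ∀ v : Vel, (ENNReal.ofReal (maxwellian v)).toReal • Complex.exp (⟪v, t⟫ * Complex.I) =
      (((2 * Real.pi) ^ (-(3 / 2) : ℝ) : ℝ) : ℂ) *
        Complex.exp (-(1 / 2) * ‖v‖ ^ 2 + Complex.I * ⟪t, v⟫) := by
    intro v
    rw [ENNReal.toReal_ofReal (maxwellian_pos v).le, Complex.real_smul, maxwellian,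
      Complex.ofReal_mul, mul_assoc, Complex.ofReal_exp, ← Complex.exp_add, real_inner_comm]
    congr 2
    push_cast; ring
  simp_rw [h3]
  rw [integral_const_mul, h, ← mul_assoc]
  have h4 : (((2 * Real.pi) ^ (-(3 / 2) : ℝ) : ℝ) : ℂ) * (Real.pi / (1 / 2)) ^ ((3 : ℕ) / 2 : ℂ)
      = 1 := by
    have : ((Real.pi : ℂ) / (1 / 2)) ^ ((3 : ℕ) / 2 : ℂ)
        = (((2 * Real.pi) ^ (3 / 2 : ℝ) : ℝ) : ℂ) := by
      rw [Complex.ofReal_cpow (by positivity)]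
      congr 1
      · push_cast; ring
      · push_cast; ring
    rw [this, ← Complex.ofReal_mul, ← Real.rpow_add (by positivity)]
    norm_num
  rw [h4, one_mul]
  congr 1
  rw [Complex.I_sq]; ring

lemma integral_gaussian (f : Vel → ℝ) :
    ∫ v, f v ∂(stdGaussian Vel) = ∫ v, maxwellian v * f v := by
  rw [stdGaussian_eq_withDensity, integral_withDensity_eq_integral_toReal_smul
    continuous_maxwellian.measurable.ennreal_ofReal (by simp)]
  simp [ENNReal.toReal_ofReal (maxwellian_pos _).le]

lemma integrable_gaussian_iff (f : Vel → ℝ) :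
    Integrable f (stdGaussian Vel) ↔ Integrable (fun v => maxwellian v * f v) := by
  rw [stdGaussian_eq_withDensity, integrable_withDensity_iff_integrable_smul'
    continuous_maxwellian.measurable.ennreal_ofReal (by simp)]
  simp [ENNReal.toReal_ofReal (maxwellian_pos _).le]

lemma ae_gaussian_iff {p : Vel → Prop} : (∀ᵐ v ∂(stdGaussian Vel), p v) ↔ ∀ᵐ v : Vel, p v := by
  have h : (stdGaussian Vel) ≪ (volume : Measure Vel) := by
    rw [stdGaussian_eq_withDensity]; exact withDensity_absolutelyContinuous _ _
  have h' : (volume : Measure Vel) ≪ stdGaussian Vel := by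
    rw [stdGaussian_eq_withDensity]
    refine withDensity_absolutelyContinuous' continuous_maxwellian.measurable.ennreal_ofReal.aemeasurable ?_
    exact ae_of_all _ fun v => by simp [maxwellian_pos v]
  exact ⟨fun hh => h'.ae_le hh, fun hh => h.ae_le hh⟩

/-! ### The collision map -/

/-- The unit sphere. -/
abbrev Sph : Type := Metric.sphere (0 : Vel) 1

/-- The collision `(v, u) ↦ (v', u')` with impact direction `ω`. -/
def coll (ω : Vel) : Vel × Vel →L[ℝ] Vel × Vel :=
  let l : Vel × Vel →L[ℝ] Vel :=
    ((innerSL ℝ ω).comp (.fst ℝ Vel Vel - .snd ℝ Vel Vel)).smulRight ω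
  (.fst ℝ Vel Vel - l).prod (.snd ℝ Vel Vel + l)

lemma coll_apply (ω v u : Vel) :
    coll ω (v, u) = (v - ⟪v - u, ω⟫ • ω, u + ⟪v - u, ω⟫ • ω) := by
  simp [coll, real_inner_comm ω, inner_sub_right]

lemma coll_fst (ω v u : Vel) : (coll ω (v, u)).1 = v - ⟪v - u, ω⟫ • ω := by rw [coll_apply]

lemma coll_snd (ω v u : Vel) : (coll ω (v, u)).2 = u + ⟪v - u, ω⟫ • ω := by rw [coll_apply]

lemma coll_swap (ω v u : Vel) : coll ω (u, v) = (coll ω (v, u)).swap := by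
  simp only [coll_apply, Prod.swap]
  rw [show u - v = -(v - u) by abel, inner_neg_left]
  simp [sub_eq_add_neg]

lemma inner_self_of_norm_one {ω : Vel} (hω : ‖ω‖ = 1) : ⟪ω, ω⟫ = 1 := by
  rw [real_inner_self_eq_norm_sq, hω]; norm_num

lemma coll_coll {ω : Vel} (hω : ‖ω‖ = 1) (p : Vel × Vel) : coll ω (coll ω p) = p := by
  obtain ⟨v, u⟩ := p
  have h := inner_self_of_norm_one hω
  simp only [coll_apply, inner_sub_left, inner_add_left, real_inner_smul_left, h, Prod.mk.injEq]
  constructor <;> module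

lemma coll_inner_sub {ω : Vel} (hω : ‖ω‖ = 1) (v u : Vel) :
    ⟪(coll ω (v, u)).1 - (coll ω (v, u)).2, ω⟫ = -⟪v - u, ω⟫ := by
  have h := inner_self_of_norm_one hω
  simp only [coll_apply, inner_sub_left, inner_add_left, real_inner_smul_left, h]
  ring

lemma coll_norm_sq {ω : Vel} (hω : ‖ω‖ = 1) (v u : Vel) :
    ‖(coll ω (v, u)).1‖ ^ 2 + ‖(coll ω (v, u)).2‖ ^ 2 = ‖v‖ ^ 2 + ‖u‖ ^ 2 := by
  have h := inner_self_of_norm_one hω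
  simp only [coll_apply, ← real_inner_self_eq_norm_sq, inner_sub_left, inner_add_left,
    inner_sub_right, inner_add_right, real_inner_smul_left, real_inner_smul_right, h,
    real_inner_comm ω]
  ring

lemma coll_add (ω v u : Vel) : (coll ω (v, u)).1 + (coll ω (v, u)).2 = v + u := by
  rw [coll_apply]; simp

/-- `coll ω` is symmetric and preserves `|v|² + |u|²`, so it is its own isometric adjoint. As the
Gaussian measure has density `μ`, this contains both the unit Jacobian of the collision and the
invariance of the product of Maxwellians. -/
lemma measurePreserving_coll_gaussian {ω : Vel} (hω : ‖ω‖ = 1) :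
    MeasurePreserving (coll ω) ((stdGaussian Vel).prod (stdGaussian Vel))
      ((stdGaussian Vel).prod (stdGaussian Vel)) := by
  refine measurePreserving_gaussian_prod _ (fun a b => coll ω (a, b)) ?_
    fun a b => coll_norm_sq hω a b
  rintro ⟨v, u⟩ a b
  simp only [coll_apply, inner_sub_left, inner_add_left,
    inner_sub_right, inner_add_right, real_inner_smul_left, real_inner_smul_right,
    real_inner_comm ω]
  ring

lemma maxwellian_coll {ω : Vel} (hω : ‖ω‖ = 1) (v u : Vel) :
    maxwellian (coll ω (v, u)).1 * maxwellian (coll ω (v, u)).2 = maxwellian v * maxwellian u := by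
  have h := coll_norm_sq hω v u
  unfold maxwellian
  rw [mul_mul_mul_comm, ← Real.exp_add, mul_mul_mul_comm, ← Real.exp_add]
  congr 2
  linarith

lemma sqrtM_coll {ω : Vel} (hω : ‖ω‖ = 1) (v u : Vel) :
    sqrtM (coll ω (v, u)).1 * sqrtM (coll ω (v, u)).2 = sqrtM v * sqrtM u := by
  unfold sqrtM
  rw [← Real.sqrt_mul (maxwellian_pos _).le, maxwellian_coll hω,
    Real.sqrt_mul (maxwellian_pos _).le]

/-! ### Rotations -/

/-- The action of a linear isometry on the unit sphere. -/
def rotSph (R : Vel ≃ₗᵢ[ℝ] Vel) (ω : Sph) : Sph := ⟨R ω, by simp⟩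

@[simp] lemma coe_rotSph (R : Vel ≃ₗᵢ[ℝ] Vel) (ω : Sph) : (rotSph R ω : Vel) = R ω := rfl

lemma continuous_rotSph (R : Vel ≃ₗᵢ[ℝ] Vel) : Continuous (rotSph R) :=
  Continuous.subtype_mk (R.continuous.comp continuous_subtype_val) _

-- The surface measure of a set is a multiple of the volume of the cone over it, and an isometry
-- maps cones to cones of equal volume.
open scoped Pointwise in
lemma measurePreserving_rotSph (R : Vel ≃ₗᵢ[ℝ] Vel) :
    MeasurePreserving (rotSph R) sphereMeasure sphereMeasure where
  measurable := (continuous_rotSph R).measurable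
  map_eq := by
    ext s hs
    have hm := (continuous_rotSph R).measurable
    rw [Measure.map_apply hm hs, sphereMeasure, Measure.toSphere_apply' _ (hm hs),
      Measure.toSphere_apply' _ hs]
    congr 1
    rw [← R.measurePreserving.measure_preimage_emb R.toHomeomorph.measurableEmbedding
      (Set.Ioo (0 : ℝ) 1 • (Subtype.val '' s : Set Vel))]
    congr 1
    ext v
    simp only [Set.mem_smul, Set.mem_image, Set.mem_preimage]
    constructor
    · rintro ⟨r, hr, _, ⟨ω, hω, rfl⟩, rfl⟩
      exact ⟨r, hr, _, ⟨rotSph R ω, hω, rfl⟩, by simp⟩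
    · rintro ⟨r, hr, _, ⟨ω, hω, rfl⟩, h⟩
      refine ⟨r, hr, _, ⟨rotSph R.symm ω, ?_, rfl⟩, ?_⟩
      · have : rotSph R (rotSph R.symm ω) = ω := by ext1; simp
        rw [this]; exact hω
      · apply R.injective
        simp at h ⊢
        exact h

instance : IsFiniteMeasure sphereMeasure := by unfold sphereMeasure; infer_instance

lemma norm_sph (ω : Sph) : ‖(ω : Vel)‖ = 1 := by simp

lemma maxwellian_rot (R : Vel ≃ₗᵢ[ℝ] Vel) (v : Vel) : maxwellian (R v) = maxwellian v := by
  simp [maxwellian]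

lemma sqrtM_rot (R : Vel ≃ₗᵢ[ℝ] Vel) (v : Vel) : sqrtM (R v) = sqrtM v := by
  simp [sqrtM, maxwellian_rot]

end ViscousLayer
end

/-! ### Correlations of functions of two jointly Gaussian variables. -/

noncomputable section
namespace ViscousLayer
open ProbabilityTheory
open scoped RealInnerProductSpace

/-! ### The Mehler kernel -/

lemma integrable_mul_of_memLp {α : Type*} [MeasurableSpace α] {μ : Measure α} {f g : α → ℝ}
    (hf : MemLp f 2 μ) (hg : MemLp g 2 μ) : Integrable (fun x => f x * g x) μ :=
  hf.integrable_mul hg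

/-- The Cauchy-Schwarz inequality for real functions. -/
lemma sq_integral_mul_le {α : Type*} [MeasurableSpace α] {μ : Measure α} {f g : α → ℝ}
    (hf : MemLp f 2 μ) (hg : MemLp g 2 μ) :
    (∫ x, f x * g x ∂μ) ^ 2 ≤ (∫ x, f x ^ 2 ∂μ) * ∫ x, g x ^ 2 ∂μ := by
  have i1 := hf.integrable_sq
  have i2 := hg.integrable_sq
  have i3 : Integrable (fun x => f x * g x) μ := integrable_mul_of_memLp hf hg
  have h : ∀ t : ℝ, 0 ≤ (∫ x, g x ^ 2 ∂μ) * (t * t) + (2 * ∫ x, f x * g x ∂μ) * t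
      + ∫ x, f x ^ 2 ∂μ := by
    intro t
    have : ∫ x, (f x + t * g x) ^ 2 ∂μ = (∫ x, g x ^ 2 ∂μ) * (t * t)
        + (2 * ∫ x, f x * g x ∂μ) * t + ∫ x, f x ^ 2 ∂μ := by
      have e : ∀ x, (f x + t * g x) ^ 2 = (t * t * g x ^ 2 + 2 * t * (f x * g x)) + f x ^ 2 :=
        fun x => by ring
      simp only [e]
      refine (integral_add ((i2.const_mul _).add (i3.const_mul _)) i1).trans ?_
      rw [integral_add' (i2.const_mul _) (i3.const_mul _), integral_const_mul, integral_const_mul]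
      ring
    rw [← this]
    exact integral_nonneg fun x => sq_nonneg _
  have := discrim_le_zero h
  rw [discrim] at this
  nlinarith

/-- The standard Gaussian measure on the line. -/
abbrev γ : Measure ℝ := gaussianReal 0 1

lemma integrable_gaussianReal_iff {f : ℝ → ℝ} :
    Integrable f γ ↔ Integrable (fun x => gaussianPDFReal 0 1 x * f x) := by
  unfold γ
  rw [gaussianReal_of_var_ne_zero _ one_ne_zero,
    integrable_withDensity_iff_integrable_smul' (measurable_gaussianPDF _ _)
      (ae_of_all _ fun _ => gaussianPDF_lt_top)]
  simp

lemma integral_gaussianReal_eq (f : ℝ → ℝ) :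
    ∫ x, f x ∂γ = ∫ x, gaussianPDFReal 0 1 x * f x := by
  rw [integral_gaussianReal_eq_integral_smul one_ne_zero]; simp

lemma integrable_pow_gaussian (n : ℕ) : Integrable (fun x : ℝ => x ^ n) γ := by
  have := (memLp_id_gaussianReal (μ := 0) (v := 1) (n : NNReal))
  rcases Nat.eq_zero_or_pos n with rfl | hn
  · simp
  have h := this.integrable_norm_pow (p := n) hn.ne'
  refine Integrable.mono' h (by fun_prop) (ae_of_all _ fun x => by simp)

/-- Integration by parts against the Gaussian weight, for powers. -/
lemma integral_pow_gaussian (n : ℕ) :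
    ∫ x, x ^ (n + 2) ∂γ = (n + 1) * ∫ x, x ^ n ∂γ := by
  have h1 : ∀ k : ℕ, ∫ x, x ^ k ∂γ = ∫ x, gaussianPDFReal 0 1 x * x ^ k := fun k =>
    integral_gaussianReal_eq _
  have h2 : ∀ k : ℕ, Integrable (fun x => gaussianPDFReal 0 1 x * x ^ k) := fun k =>
    integrable_gaussianReal_iff.1 (integrable_pow_gaussian k)
  have hd : ∀ x : ℝ, HasDerivAt (fun x => gaussianPDFReal 0 1 x) (-x * gaussianPDFReal 0 1 x) x := by
    intro x
    unfold gaussianPDFReal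
    have : HasDerivAt (fun x : ℝ => -(x - 0) ^ 2 / (2 * ((1 : NNReal) : ℝ)))
        (-(2 * (x - 0)) / (2 * ((1 : NNReal) : ℝ))) x := by
      have := ((((hasDerivAt_id' x).sub_const 0).fun_pow 2).fun_neg).div_const
        (2 * ((1 : NNReal) : ℝ))
      simpa using this
    refine ((this.exp).const_mul ((√(2 * Real.pi * (1 : NNReal)))⁻¹)).congr_deriv ?_
    push_cast; ring
  have hp : ∀ x : ℝ, HasDerivAt (fun x : ℝ => x ^ (n + 1)) ((n + 1) * x ^ n) x := fun x => by
    simpa using hasDerivAt_pow (n + 1) x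
  have := integral_mul_deriv_eq_deriv_mul_of_integrable (u := fun x : ℝ => x ^ (n + 1))
    (v := fun x => gaussianPDFReal 0 1 x) (u' := fun x => (n + 1) * x ^ n)
    (v' := fun x => -x * gaussianPDFReal 0 1 x) (fun x _ => hp x) (fun x _ => hd x)
    ((h2 (n + 2)).neg.congr (ae_of_all _ fun x => by simp only [Pi.neg_apply, Pi.mul_apply]; ring))
    (((h2 n).const_mul (n + 1 : ℝ)).congr (ae_of_all _ fun x => by simp only [Pi.mul_apply]; ring))
    ((h2 (n + 1)).congr (ae_of_all _ fun x => by simp only [Pi.mul_apply]; ring))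
  rw [h1, h1, ← integral_const_mul]
  have e1 : (fun x : ℝ => gaussianPDFReal 0 1 x * x ^ (n + 2))
      = fun x => -(x ^ (n + 1) * (-x * gaussianPDFReal 0 1 x)) := by ext x; ring
  have e2 : (fun x : ℝ => (n + 1) * (gaussianPDFReal 0 1 x * x ^ n))
      = fun x => (n + 1) * x ^ n * gaussianPDFReal 0 1 x := by ext x; ring
  rw [e1, integral_neg, e2, this, neg_neg]

lemma integral_pow_one_gaussian : ∫ x, x ^ 1 ∂γ = 0 := by
  simp

/-- Integrals of polynomials of degree at most four. -/
lemma integral_quartic_gaussian (c₀ c₁ c₂ c₃ c₄ : ℝ) :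
    Integrable (fun x : ℝ => c₀ + c₁ * x + c₂ * x ^ 2 + c₃ * x ^ 3 + c₄ * x ^ 4) γ ∧
    ∫ x : ℝ, (c₀ + c₁ * x + c₂ * x ^ 2 + c₃ * x ^ 3 + c₄ * x ^ 4) ∂γ = c₀ + c₂ + 3 * c₄ := by
  have i0 : Integrable (fun _ : ℝ => c₀) γ := integrable_const _
  have i1 : Integrable (fun x : ℝ => c₁ * x) γ := by
    simpa using (integrable_pow_gaussian 1).const_mul c₁
  have i2 := (integrable_pow_gaussian 2).const_mul c₂
  have i3 := (integrable_pow_gaussian 3).const_mul c₃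
  have i4 := (integrable_pow_gaussian 4).const_mul c₄
  have m1 := integral_pow_one_gaussian
  have m2 : ∫ x, x ^ 2 ∂γ = 1 := by simpa using integral_pow_gaussian 0
  have m3 : ∫ x, x ^ 3 ∂γ = 0 := by rw [integral_pow_gaussian 1, m1, mul_zero]
  have m4 : ∫ x, x ^ 4 ∂γ = 3 := by rw [integral_pow_gaussian 2, m2]; norm_num
  refine ⟨(((i0.add i1).add i2).add i3).add i4, ?_⟩
  have m1' : ∫ x, c₁ * x ∂γ = 0 := by rw [integral_const_mul, show ∫ x, x ∂γ = 0 by simp, mul_zero]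
  refine (integral_add (((i0.add i1).add i2).add i3) i4).trans ?_
  rw [integral_add' ((i0.add i1).add i2) i3, integral_add' (i0.add i1) i2, integral_add' i0 i1]
  rw [m1']
  simp only [integral_const_mul, m2, m3, m4]
  simp; ring

/-- The Mehler kernel. -/
def mehler (ρ x y : ℝ) : ℝ :=
  (√(1 - ρ ^ 2))⁻¹ * Real.exp (-(ρ ^ 2 * x ^ 2 - 2 * ρ * x * y + ρ ^ 2 * y ^ 2) / (2 * (1 - ρ ^ 2)))

lemma mehler_comm (ρ x y : ℝ) : mehler ρ x y = mehler ρ y x := by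
  unfold mehler; congr 2; ring

lemma continuous_mehler (ρ : ℝ) : Continuous (fun p : ℝ × ℝ => mehler ρ p.1 p.2) := by
  unfold mehler; fun_prop

section Mehler

variable {ρ : ℝ} (hρ : ρ ^ 2 < 1)
include hρ

/-- `mehler ρ x` is the density relative to `γ` of a standard Gaussian variable, conditioned on a
second one with correlation `ρ` having the value `x`. -/
lemma gaussianPDFReal_eq_mehler (x y : ℝ) :
    gaussianPDFReal (ρ * x) (1 - ρ ^ 2).toNNReal y = mehler ρ x y * gaussianPDFReal 0 1 y := by
  have h : 0 < 1 - ρ ^ 2 := by linarith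
  unfold gaussianPDFReal mehler
  rw [Real.coe_toNNReal _ h.le, Real.sqrt_mul (by positivity), mul_inv, NNReal.coe_one, mul_one]
  have : Real.exp (-(y - ρ * x) ^ 2 / (2 * (1 - ρ ^ 2))) =
      Real.exp (-(ρ ^ 2 * x ^ 2 - 2 * ρ * x * y + ρ ^ 2 * y ^ 2) / (2 * (1 - ρ ^ 2))) *
      Real.exp (-(y - 0) ^ 2 / 2) := by
    rw [← Real.exp_add]; congr 1; field_simp; ring
  rw [mul_one, this]; ring

lemma integral_shift_eq_mehler {f : ℝ → ℝ} (hf : Measurable f) (x : ℝ) :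
    ∫ z, f (ρ * x + √(1 - ρ ^ 2) * z) ∂γ = ∫ y, mehler ρ x y * f y ∂γ := by
  have h : 0 < 1 - ρ ^ 2 := by linarith
  have hm : γ.map (fun z => ρ * x + √(1 - ρ ^ 2) * z)
      = gaussianReal (ρ * x) (1 - ρ ^ 2).toNNReal := by
    have := gaussianReal_map_const_mul (μ := 0) (v := 1) (√(1 - ρ ^ 2))
    rw [show (fun z => ρ * x + √(1 - ρ ^ 2) * z) = (fun w => ρ * x + w) ∘ (√(1 - ρ ^ 2) * ·) from rfl,
      ← Measure.map_map (by fun_prop) (by fun_prop), this, gaussianReal_map_const_add]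
    congr 1
    · simp
    · ext; simp [Real.sq_sqrt h.le, h.le]
  rw [← integral_map (f := f) (by fun_prop) hf.aestronglyMeasurable, hm,
    integral_gaussianReal_eq_integral_smul (by simpa using h),
    integral_gaussianReal_eq_integral_smul one_ne_zero]
  congr 1; ext y
  simp only [smul_eq_mul, gaussianPDFReal_eq_mehler hρ]; ring

/-- Completing the square in `y` produces a Gaussian density with mean `2ρx/(1+ρ²)` and variance
`(1-ρ²)/(1+ρ²)`. -/
lemma integral_mehler_sq_right (x : ℝ) :
    Integrable (fun y => mehler ρ x y ^ 2) γ ∧ ∫ y, mehler ρ x y ^ 2 ∂γ =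
      (1 - ρ ^ 2)⁻¹ * √((1 - ρ ^ 2) / (1 + ρ ^ 2)) * Real.exp (ρ ^ 2 * x ^ 2 / (1 + ρ ^ 2)) := by
  have h : 0 < 1 - ρ ^ 2 := by linarith
  have h' : 0 < 1 + ρ ^ 2 := by positivity
  have hs : 0 < (1 - ρ ^ 2) / (1 + ρ ^ 2) := by positivity
  have key : ∀ y, gaussianPDFReal 0 1 y * mehler ρ x y ^ 2 =
      (1 - ρ ^ 2)⁻¹ * √((1 - ρ ^ 2) / (1 + ρ ^ 2)) * Real.exp (ρ ^ 2 * x ^ 2 / (1 + ρ ^ 2)) *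
      gaussianPDFReal (2 * ρ * x / (1 + ρ ^ 2)) ((1 - ρ ^ 2) / (1 + ρ ^ 2)).toNNReal y := by
    intro y
    unfold gaussianPDFReal mehler
    rw [Real.coe_toNNReal _ hs.le, Real.sqrt_mul (by positivity) ((1 - ρ ^ 2) / (1 + ρ ^ 2)),
      mul_inv (√(2 * Real.pi)), mul_pow, inv_pow, Real.sq_sqrt h.le, NNReal.coe_one, mul_one,
      mul_one, ← Real.exp_nat_mul]
    have e : Real.exp (-(y - 0) ^ 2 / 2) * Real.exp ((2 : ℕ) *
        (-(ρ ^ 2 * x ^ 2 - 2 * ρ * x * y + ρ ^ 2 * y ^ 2) / (2 * (1 - ρ ^ 2)))) =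
        Real.exp (ρ ^ 2 * x ^ 2 / (1 + ρ ^ 2)) * Real.exp (-(y - 2 * ρ * x / (1 + ρ ^ 2)) ^ 2 /
          (2 * ((1 - ρ ^ 2) / (1 + ρ ^ 2)))) := by
      rw [← Real.exp_add, ← Real.exp_add]; congr 1; push_cast; field_simp; ring
    have hss : √((1 - ρ ^ 2) / (1 + ρ ^ 2)) ≠ 0 := (Real.sqrt_pos.2 hs).ne'
    calc _ = (1 - ρ ^ 2)⁻¹ * (√(2 * Real.pi))⁻¹ * (Real.exp (-(y - 0) ^ 2 / 2) * Real.exp ((2 : ℕ) *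
        (-(ρ ^ 2 * x ^ 2 - 2 * ρ * x * y + ρ ^ 2 * y ^ 2) / (2 * (1 - ρ ^ 2))))) := by ring
      _ = _ := by rw [e]; field_simp
  constructor
  · rw [integrable_gaussianReal_iff]
    simp only [key]
    exact (integrable_gaussianPDFReal _ _).const_mul _
  · rw [integral_gaussianReal_eq]
    simp only [key]
    rw [integral_const_mul, integral_gaussianPDFReal_eq_one _ (by simpa using hs), mul_one]

/-- The value is `∑ ρ^(2n)`, the squared Hilbert-Schmidt norm of the operator that multiplies the
Hermite polynomial of degree `n` by `ρ^n`. The direct computation avoids Hermite expansions. -/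
lemma integral_mehler_sq :
    Integrable (fun p : ℝ × ℝ => mehler ρ p.1 p.2 ^ 2) (γ.prod γ) ∧
    ∫ p, mehler ρ p.1 p.2 ^ 2 ∂(γ.prod γ) = (1 - ρ ^ 2)⁻¹ := by
  have h : 0 < 1 - ρ ^ 2 := by linarith
  have h' : 0 < 1 + ρ ^ 2 := by positivity
  have hs : 0 < (1 + ρ ^ 2) / (1 - ρ ^ 2) := by positivity
  have key : ∀ x, gaussianPDFReal 0 1 x * ((1 - ρ ^ 2)⁻¹ * √((1 - ρ ^ 2) / (1 + ρ ^ 2)) *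
      Real.exp (ρ ^ 2 * x ^ 2 / (1 + ρ ^ 2))) = (1 - ρ ^ 2)⁻¹ *
      gaussianPDFReal 0 ((1 + ρ ^ 2) / (1 - ρ ^ 2)).toNNReal x := by
    intro x
    unfold gaussianPDFReal
    rw [Real.coe_toNNReal _ hs.le, Real.sqrt_mul (by positivity) ((1 + ρ ^ 2) / (1 - ρ ^ 2)),
      mul_inv (√(2 * Real.pi)), NNReal.coe_one, mul_one, mul_one,
      ← Real.sqrt_inv ((1 + ρ ^ 2) / (1 - ρ ^ 2)), inv_div]
    have e : Real.exp (-(x - 0) ^ 2 / 2) * Real.exp (ρ ^ 2 * x ^ 2 / (1 + ρ ^ 2)) =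
        Real.exp (-(x - 0) ^ 2 / (2 * ((1 + ρ ^ 2) / (1 - ρ ^ 2)))) := by
      rw [← Real.exp_add]; congr 1; field_simp; ring
    rw [← e]; ring
  have hint : Integrable (fun x => (1 - ρ ^ 2)⁻¹ * √((1 - ρ ^ 2) / (1 + ρ ^ 2)) *
      Real.exp (ρ ^ 2 * x ^ 2 / (1 + ρ ^ 2))) γ := by
    rw [integrable_gaussianReal_iff]
    simp only [key]
    exact (integrable_gaussianPDFReal _ _).const_mul _
  have hI : Integrable (fun p : ℝ × ℝ => mehler ρ p.1 p.2 ^ 2) (γ.prod γ) := by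
    rw [integrable_prod_iff (by have := continuous_mehler ρ; fun_prop)]
    refine ⟨ae_of_all _ fun x => (integral_mehler_sq_right hρ x).1, ?_⟩
    simp only [norm_pow, Real.norm_eq_abs, sq_abs, (integral_mehler_sq_right hρ _).2]
    exact hint
  refine ⟨hI, ?_⟩
  rw [integral_prod _ hI]
  simp only [(integral_mehler_sq_right hρ _).2]
  rw [integral_gaussianReal_eq]
  simp only [key]
  rw [integral_const_mul, integral_gaussianPDFReal_eq_one _ (by simpa using hs), mul_one]

omit hρ in
lemma memLp_mul_prod {f g : ℝ → ℝ} (hf : MemLp f 2 γ) (hg : MemLp g 2 γ) :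
    MemLp (fun p : ℝ × ℝ => f p.1 * g p.2) 2 (γ.prod γ) := by
  refine (memLp_two_iff_integrable_sq (hf.1.comp_fst.mul hg.1.comp_snd)).2 ?_
  have := hf.integrable_sq.mul_prod hg.integrable_sq
  refine this.congr (ae_of_all _ fun p => ?_)
  simp only [Pi.mul_apply]; ring

lemma memLp_mehler : MemLp (fun p : ℝ × ℝ => mehler ρ p.1 p.2) 2 (γ.prod γ) := by
  rw [memLp_two_iff_integrable_sq (continuous_mehler ρ).aestronglyMeasurable]
  exact (integral_mehler_sq hρ).1

omit hρ in
lemma memLp_hermite (c₀ c₁ c₂ : ℝ) : MemLp (fun x : ℝ => c₀ + c₁ * x + c₂ * x ^ 2) 2 γ := by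
  rw [memLp_two_iff_integrable_sq (by fun_prop)]
  refine (integral_quartic_gaussian (c₀ ^ 2) (2 * c₀ * c₁) (c₁ ^ 2 + 2 * c₀ * c₂) (2 * c₁ * c₂)
    (c₂ ^ 2)).1.congr (ae_of_all _ fun x => ?_)
  simp only; ring

omit hρ in
lemma memLp_linear : MemLp (fun x : ℝ => x) 2 γ := by simpa using memLp_hermite 0 1 0

omit hρ in
lemma memLp_quad : MemLp (fun x : ℝ => x ^ 2 - 1) 2 γ := by
  have e : (fun x : ℝ => x ^ 2 - 1) = fun x => -1 + 0 * x + 1 * x ^ 2 := by ext x; ring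
  rw [e]; exact memLp_hermite (-1) 0 1

/-- The part of degree at most two of the Mehler kernel. -/
def mehlerLow (ρ x y : ℝ) : ℝ := 1 + ρ * (x * y) + ρ ^ 2 / 2 * ((x ^ 2 - 1) * (y ^ 2 - 1))

omit hρ in
lemma memLp_mehlerLow : MemLp (fun p : ℝ × ℝ => mehlerLow ρ p.1 p.2) 2 (γ.prod γ) := by
  have h1 : MemLp (fun _ : ℝ × ℝ => (1 : ℝ)) 2 (γ.prod γ) := memLp_const 1
  have h2 := (memLp_mul_prod memLp_linear memLp_linear).const_mul ρ
  have h3 := (memLp_mul_prod memLp_quad memLp_quad).const_mul (ρ ^ 2 / 2)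
  exact (h1.add h2).add h3

omit hρ in
lemma integral_mehlerLow_sq :
    ∫ p, mehlerLow ρ p.1 p.2 ^ 2 ∂(γ.prod γ) = 1 + ρ ^ 2 + ρ ^ 4 := by
  rw [integral_prod _ memLp_mehlerLow.integrable_sq]
  have h : ∀ x, ∫ y, mehlerLow ρ x y ^ 2 ∂γ = 1 + ρ ^ 2 * x ^ 2 + ρ ^ 4 / 2 * (x ^ 2 - 1) ^ 2 := by
    intro x
    have e : ∀ y, mehlerLow ρ x y ^ 2 = (1 - ρ ^ 2 / 2 * (x ^ 2 - 1)) ^ 2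
        + (2 * (1 - ρ ^ 2 / 2 * (x ^ 2 - 1)) * (ρ * x)) * y
        + ((ρ * x) ^ 2 + 2 * (1 - ρ ^ 2 / 2 * (x ^ 2 - 1)) * (ρ ^ 2 / 2 * (x ^ 2 - 1))) * y ^ 2
        + (2 * (ρ * x) * (ρ ^ 2 / 2 * (x ^ 2 - 1))) * y ^ 3
        + (ρ ^ 2 / 2 * (x ^ 2 - 1)) ^ 2 * y ^ 4 := fun y => by unfold mehlerLow; ring
    simp only [e]
    rw [(integral_quartic_gaussian _ _ _ _ _).2]; ring
  simp only [h]
  have e : ∀ x : ℝ, 1 + ρ ^ 2 * x ^ 2 + ρ ^ 4 / 2 * (x ^ 2 - 1) ^ 2 =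
      (1 + ρ ^ 4 / 2) + 0 * x + (ρ ^ 2 - ρ ^ 4) * x ^ 2 + 0 * x ^ 3 + ρ ^ 4 / 2 * x ^ 4 :=
    fun x => by ring
  simp only [e]
  rw [(integral_quartic_gaussian _ _ _ _ _).2]; ring

lemma integral_mehler_quadratic (c₀ c₁ c₂ x : ℝ) :
    ∫ y, mehler ρ x y * (c₀ + c₁ * y + c₂ * y ^ 2) ∂γ
      = c₀ + c₁ * (ρ * x) + c₂ * (ρ ^ 2 * x ^ 2 + (1 - ρ ^ 2)) := by
  have h : 0 < 1 - ρ ^ 2 := by linarith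
  rw [← integral_shift_eq_mehler hρ (f := fun y => c₀ + c₁ * y + c₂ * y ^ 2) (by fun_prop) x]
  have e : ∀ z, c₀ + c₁ * (ρ * x + √(1 - ρ ^ 2) * z) + c₂ * (ρ * x + √(1 - ρ ^ 2) * z) ^ 2 =
      (c₀ + c₁ * (ρ * x) + c₂ * (ρ * x) ^ 2)
      + (c₁ * √(1 - ρ ^ 2) + 2 * c₂ * (ρ * x) * √(1 - ρ ^ 2)) * z
      + (c₂ * √(1 - ρ ^ 2) ^ 2) * z ^ 2 + 0 * z ^ 3 + 0 * z ^ 4 := fun z => by ring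
  simp only [e]
  rw [(integral_quartic_gaussian _ _ _ _ _).2, Real.sq_sqrt h.le]; ring

lemma integral_mehler_mul_mehlerLow :
    ∫ p, mehler ρ p.1 p.2 * mehlerLow ρ p.1 p.2 ∂(γ.prod γ) = 1 + ρ ^ 2 + ρ ^ 4 := by
  rw [integral_prod _ (integrable_mul_of_memLp (memLp_mehler hρ) memLp_mehlerLow)]
  have h : ∀ x, ∫ y, mehler ρ x y * mehlerLow ρ x y ∂γ
      = 1 + ρ ^ 2 * x ^ 2 + ρ ^ 4 / 2 * (x ^ 2 - 1) ^ 2 := by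
    intro x
    have e : ∀ y, mehlerLow ρ x y = (1 - ρ ^ 2 / 2 * (x ^ 2 - 1)) + (ρ * x) * y
        + (ρ ^ 2 / 2 * (x ^ 2 - 1)) * y ^ 2 := fun y => by unfold mehlerLow; ring
    simp only [e]
    rw [integral_mehler_quadratic hρ]; ring
  simp only [h]
  have e : ∀ x : ℝ, 1 + ρ ^ 2 * x ^ 2 + ρ ^ 4 / 2 * (x ^ 2 - 1) ^ 2 =
      (1 + ρ ^ 4 / 2) + 0 * x + (ρ ^ 2 - ρ ^ 4) * x ^ 2 + 0 * x ^ 3 + ρ ^ 4 / 2 * x ^ 4 :=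
    fun x => by ring
  simp only [e]
  rw [(integral_quartic_gaussian _ _ _ _ _).2]; ring

/-- The part of degree at least three of the Mehler kernel. -/
def mehlerHigh (ρ x y : ℝ) : ℝ := mehler ρ x y - mehlerLow ρ x y

omit hρ in
lemma mehlerHigh_comm (x y : ℝ) : mehlerHigh ρ x y = mehlerHigh ρ y x := by
  unfold mehlerHigh mehlerLow; rw [mehler_comm]; ring

lemma memLp_mehlerHigh : MemLp (fun p : ℝ × ℝ => mehlerHigh ρ p.1 p.2) 2 (γ.prod γ) :=
  (memLp_mehler hρ).sub memLp_mehlerLow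

/-- The tail `∑_{n≥3} ρ^(2n)`. Its smallness for moderate `ρ` is the source of the spectral gap. -/
lemma integral_mehlerHigh_sq :
    ∫ p, mehlerHigh ρ p.1 p.2 ^ 2 ∂(γ.prod γ) = ρ ^ 6 / (1 - ρ ^ 2) := by
  have h : 0 < 1 - ρ ^ 2 := by linarith
  have i1 := (memLp_mehler hρ).integrable_sq
  have i2 := (integrable_mul_of_memLp (memLp_mehler hρ) (memLp_mehlerLow (ρ := ρ))).const_mul 2
  have i3 := (memLp_mehlerLow (ρ := ρ)).integrable_sq
  have e : ∀ p : ℝ × ℝ, mehlerHigh ρ p.1 p.2 ^ 2 = (mehler ρ p.1 p.2 ^ 2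
      - 2 * (mehler ρ p.1 p.2 * mehlerLow ρ p.1 p.2)) + mehlerLow ρ p.1 p.2 ^ 2 :=
    fun p => by unfold mehlerHigh; ring
  simp only [e]
  refine (integral_add (i1.sub i2) i3).trans ?_
  have := integral_sub i1 i2
  rw [integral_mehlerLow_sq]
  simp only [Pi.sub_apply]
  rw [this, integral_const_mul, integral_mehler_mul_mehlerLow hρ, (integral_mehler_sq hρ).2]
  field_simp; ring

/-- Of the three removed degrees only the second has to be tested: the first function in the
correlation estimate is orthogonal to `1` and `x` by hypothesis. -/
lemma integral_mehlerHigh_quad (x : ℝ) : ∫ y, mehlerHigh ρ x y * (y ^ 2 - 1) ∂γ = 0 := by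
  have h : 0 < 1 - ρ ^ 2 := by linarith
  have hx : MemLp (fun y => mehler ρ x y) 2 γ := by
    rw [memLp_two_iff_integrable_sq (by
      have := continuous_mehler ρ
      exact (this.comp (Continuous.prodMk_right x)).aestronglyMeasurable)]
    exact (integral_mehler_sq_right hρ x).1
  have i1 : Integrable (fun y => mehler ρ x y * (y ^ 2 - 1)) γ := integrable_mul_of_memLp hx memLp_quad
  have e2 : ∀ y, mehlerLow ρ x y * (y ^ 2 - 1) = (-1 + ρ ^ 2 / 2 * (x ^ 2 - 1))
      + (-(ρ * x)) * y + (1 - ρ ^ 2 * (x ^ 2 - 1)) * y ^ 2 + (ρ * x) * y ^ 3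
      + (ρ ^ 2 / 2 * (x ^ 2 - 1)) * y ^ 4 := fun y => by unfold mehlerLow; ring
  have i2 : Integrable (fun y => mehlerLow ρ x y * (y ^ 2 - 1)) γ := by
    simp only [e2]; exact (integral_quartic_gaussian _ _ _ _ _).1
  have e : ∀ y, mehlerHigh ρ x y * (y ^ 2 - 1)
      = mehler ρ x y * (y ^ 2 - 1) - mehlerLow ρ x y * (y ^ 2 - 1) :=
    fun y => by unfold mehlerHigh; ring
  simp only [e]
  rw [integral_sub i1 i2]
  simp only [e2]
  rw [(integral_quartic_gaussian _ _ _ _ _).2]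
  have := integral_mehler_quadratic hρ (-1) 0 1 x
  have e3 : ∀ y : ℝ, (y ^ 2 - 1) = -1 + 0 * y + 1 * y ^ 2 := fun y => by ring
  simp only [e3]
  rw [this]; ring

/-- Correlation of functions of two Gaussian variables with correlation `ρ`, up to the
contributions of degree at most two. -/
theorem abs_correlation_sub_le {θ : ℝ} (hθ : 0 ≤ θ) (hρθ : ρ ^ 6 / (1 - ρ ^ 2) ≤ θ ^ 2)
    {a c : ℝ → ℝ} (ha : MemLp a 2 γ) (hc : MemLp c 2 γ) (hcm : Measurable c)
    (ha0 : ∫ x, a x ∂γ = 0) (ha1 : ∫ x, a x * x ∂γ = 0) {s t : ℝ}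
    (hs : ∫ x, a x * (x ^ 2 - 1) ∂γ = s) (ht : ∫ x, c x * (x ^ 2 - 1) ∂γ = t) :
    |∫ x, a x * ∫ z, c (ρ * x + √(1 - ρ ^ 2) * z) ∂γ ∂γ - ρ ^ 2 / 2 * (s * t)|
      ≤ θ / 2 * ((∫ x, a x ^ 2 ∂γ - s ^ 2 / 2) + (∫ x, c x ^ 2 ∂γ - t ^ 2 / 2)) := by
  have hq2 : ∫ x : ℝ, (x ^ 2 - 1) ^ 2 ∂γ = 2 := by
    have e : ∀ x : ℝ, (x ^ 2 - 1) ^ 2 = 1 + 0 * x + (-2) * x ^ 2 + 0 * x ^ 3 + 1 * x ^ 4 :=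
      fun x => by ring
    simp only [e]
    rw [(integral_quartic_gaussian _ _ _ _ _).2]; norm_num
  -- Removal of the component along `x² - 1`, whose squared norm is 2.
  have perp : ∀ {b : ℝ → ℝ} {r : ℝ}, MemLp b 2 γ → ∫ x, b x * (x ^ 2 - 1) ∂γ = r →
      MemLp (fun x => b x - r / 2 * (x ^ 2 - 1)) 2 γ ∧
      ∫ x, (b x - r / 2 * (x ^ 2 - 1)) ^ 2 ∂γ = ∫ x, b x ^ 2 ∂γ - r ^ 2 / 2 := by
    intro b r hb hr
    refine ⟨hb.sub (memLp_quad.const_mul _), ?_⟩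
    have e : ∀ x, (b x - r / 2 * (x ^ 2 - 1)) ^ 2
      = (b x ^ 2 - r * (b x * (x ^ 2 - 1))) + r ^ 2 / 4 * (x ^ 2 - 1) ^ 2 := fun x => by ring
    simp only [e]
    have j1 := hb.integrable_sq
    have j2 : Integrable (fun x => r * (b x * (x ^ 2 - 1))) γ :=
      (integrable_mul_of_memLp hb memLp_quad).const_mul r
    have j3 := memLp_quad.integrable_sq.const_mul (r ^ 2 / 4)
    refine (integral_add (j1.sub j2) j3).trans ?_
    rw [integral_sub' j1 j2, integral_const_mul, integral_const_mul, hr, hq2]; ring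
  obtain ⟨ma, na⟩ := perp ha hs
  obtain ⟨mc, nc⟩ := perp hc ht
  set a' := fun x => a x - s / 2 * (x ^ 2 - 1) with ha'
  set c' := fun x => c x - t / 2 * (x ^ 2 - 1) with hc'
  have hN := memLp_mehlerHigh hρ
  have hM := memLp_mehler hρ
  have hP := memLp_mehlerLow (ρ := ρ)
  -- the correlation as a double integral
  have hac := memLp_mul_prod ha hc
  have X1 : ∫ x, a x * ∫ z, c (ρ * x + √(1 - ρ ^ 2) * z) ∂γ ∂γ
      = ∫ p, mehler ρ p.1 p.2 * (a p.1 * c p.2) ∂(γ.prod γ) := by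
    rw [integral_prod _ (integrable_mul_of_memLp hM hac)]
    congr 1; ext x
    rw [integral_shift_eq_mehler hρ hcm, ← integral_const_mul]
    congr 1; ext y; ring
  -- The terms of degree 0 and 1 vanish because `a` is orthogonal to `1` and `x`.
  have X2 : ∫ p, mehlerLow ρ p.1 p.2 * (a p.1 * c p.2) ∂(γ.prod γ) = ρ ^ 2 / 2 * (s * t) := by
    have e : ∀ p : ℝ × ℝ, mehlerLow ρ p.1 p.2 * (a p.1 * c p.2) = (a p.1 * c p.2
        + ρ * ((a p.1 * p.1) * (c p.2 * p.2)))
        + ρ ^ 2 / 2 * ((a p.1 * (p.1 ^ 2 - 1)) * (c p.2 * (p.2 ^ 2 - 1))) := fun p => by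
      unfold mehlerLow; ring
    simp only [e]
    have q1 : Integrable (fun p : ℝ × ℝ => a p.1 * c p.2) (γ.prod γ) :=
      (ha.integrable one_le_two).mul_prod (hc.integrable one_le_two)
    have q2 : Integrable (fun p : ℝ × ℝ => ρ * ((a p.1 * p.1) * (c p.2 * p.2))) (γ.prod γ) :=
      (Integrable.mul_prod (f := fun x => a x * x) (g := fun x => c x * x)
        (integrable_mul_of_memLp ha memLp_linear) (integrable_mul_of_memLp hc memLp_linear)).const_mul ρ
    have q3 : Integrable (fun p : ℝ × ℝ => ρ ^ 2 / 2 *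
        ((a p.1 * (p.1 ^ 2 - 1)) * (c p.2 * (p.2 ^ 2 - 1)))) (γ.prod γ) :=
      (Integrable.mul_prod (f := fun x => a x * (x ^ 2 - 1)) (g := fun x => c x * (x ^ 2 - 1))
        (integrable_mul_of_memLp ha memLp_quad) (integrable_mul_of_memLp hc memLp_quad)).const_mul (ρ ^ 2 / 2)
    refine (integral_add (q1.add q2) q3).trans ?_
    rw [integral_add' q1 q2, integral_const_mul, integral_const_mul,
      integral_prod_mul (fun x => a x) (fun x => c x),
      integral_prod_mul (fun x => a x * x) (fun x => c x * x),
      integral_prod_mul (fun x => a x * (x ^ 2 - 1)) (fun x => c x * (x ^ 2 - 1)), ha0, ha1, hs, ht]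
    ring
  have Z1 : ∀ {b : ℝ → ℝ}, MemLp b 2 γ →
      ∫ p, mehlerHigh ρ p.1 p.2 * (b p.1 * (p.2 ^ 2 - 1)) ∂(γ.prod γ) = 0 := by
    intro b hb
    rw [integral_prod _ (integrable_mul_of_memLp hN (memLp_mul_prod hb memLp_quad))]
    simp only [mul_left_comm _ (b _), integral_const_mul, integral_mehlerHigh_quad hρ, mul_zero,
      integral_zero]
  have Z2 : ∀ {b : ℝ → ℝ}, MemLp b 2 γ →
      ∫ p, mehlerHigh ρ p.1 p.2 * ((p.1 ^ 2 - 1) * b p.2) ∂(γ.prod γ) = 0 := by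
    intro b hb
    rw [← integral_prod_swap, ← Z1 hb]
    congr 1; ext p
    simp only [Prod.fst_swap, Prod.snd_swap]
    rw [mehlerHigh_comm]; ring
  -- The kernel of high degree does not see quadratic components, so `a` and `c` may be replaced by
  -- `a'` and `c'`.
  have X3 : ∫ p, mehlerHigh ρ p.1 p.2 * (a p.1 * c p.2) ∂(γ.prod γ)
      = ∫ p, mehlerHigh ρ p.1 p.2 * (a' p.1 * c' p.2) ∂(γ.prod γ) := by
    have e : ∀ p : ℝ × ℝ, mehlerHigh ρ p.1 p.2 * (a p.1 * c p.2) =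
        (mehlerHigh ρ p.1 p.2 * (a' p.1 * c' p.2)
        + t / 2 * (mehlerHigh ρ p.1 p.2 * (a p.1 * (p.2 ^ 2 - 1))))
        + s / 2 * (mehlerHigh ρ p.1 p.2 * ((p.1 ^ 2 - 1) * c' p.2)) := fun p => by
      simp only [ha', hc']; ring
    simp only [e]
    have q1 : Integrable (fun p : ℝ × ℝ => mehlerHigh ρ p.1 p.2 * (a' p.1 * c' p.2)) (γ.prod γ) :=
      integrable_mul_of_memLp hN (memLp_mul_prod ma mc)
    have q2 : Integrable (fun p : ℝ × ℝ => t / 2 *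
        (mehlerHigh ρ p.1 p.2 * (a p.1 * (p.2 ^ 2 - 1)))) (γ.prod γ) :=
      (integrable_mul_of_memLp hN (memLp_mul_prod ha memLp_quad)).const_mul _
    have q3 : Integrable (fun p : ℝ × ℝ => s / 2 *
        (mehlerHigh ρ p.1 p.2 * ((p.1 ^ 2 - 1) * c' p.2))) (γ.prod γ) :=
      (integrable_mul_of_memLp hN (memLp_mul_prod memLp_quad mc)).const_mul _
    refine (integral_add (q1.add q2) q3).trans ?_
    rw [integral_add' q1 q2, integral_const_mul, integral_const_mul, Z1 ha, Z2 mc]; ring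
  have X4 : ∫ x, a x * ∫ z, c (ρ * x + √(1 - ρ ^ 2) * z) ∂γ ∂γ - ρ ^ 2 / 2 * (s * t)
      = ∫ p, mehlerHigh ρ p.1 p.2 * (a' p.1 * c' p.2) ∂(γ.prod γ) := by
    rw [X1, ← X2, ← X3, ← integral_sub (integrable_mul_of_memLp hM hac) (integrable_mul_of_memLp hP hac)]
    congr 1; ext p; unfold mehlerHigh; ring
  rw [X4, ← na, ← nc]
  set A := ∫ x, a' x ^ 2 ∂γ
  set C := ∫ x, c' x ^ 2 ∂γ
  have hA : 0 ≤ A := integral_nonneg fun x => sq_nonneg _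
  have hC : 0 ≤ C := integral_nonneg fun x => sq_nonneg _
  -- Cauchy-Schwarz on the product space, with the Hilbert-Schmidt norm of the high part bounded by
  -- `θ`. The geometric mean of `A` and `C` is replaced by the arithmetic mean afterwards.
  have X5 : (∫ p, mehlerHigh ρ p.1 p.2 * (a' p.1 * c' p.2) ∂(γ.prod γ)) ^ 2
      ≤ θ ^ 2 * (A * C) := by
    have hT := memLp_mul_prod ma mc
    have hAC : ∫ p, (a' p.1 * c' p.2) ^ 2 ∂(γ.prod γ) = A * C := by
      simp only [mul_pow]
      exact integral_prod_mul (fun x => a' x ^ 2) (fun x => c' x ^ 2)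
    have cs := sq_integral_mul_le hN hT
    rw [integral_mehlerHigh_sq hρ, hAC] at cs
    exact cs.trans (mul_le_mul_of_nonneg_right hρθ (mul_nonneg hA hC))
  refine abs_le_of_sq_le_sq (X5.trans ?_) (by positivity)
  rw [show (θ / 2 * (A + C)) ^ 2 = θ ^ 2 * ((A + C) ^ 2 / 4) by ring]
  gcongr
  nlinarith [sq_nonneg (A - C)]

end Mehler

end ViscousLayer
end

/-! ### Removal of the hard sphere weight for one impact direction. -/

noncomputable section
namespace ViscousLayer
open ProbabilityTheory
open scoped RealInnerProductSpace ENNReal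

/-! ### The dissipation for a fixed impact direction -/

/-- The standard Gaussian measure on velocity space. -/
abbrev GV : Measure Vel := stdGaussian Vel

/-- `φ(v) + φ(u) - φ(v') - φ(u')`. -/
def collDiff (φ : Vel → ℝ) (ω : Vel) (p : Vel × Vel) : ℝ :=
  φ p.1 + φ p.2 - φ (coll ω p).1 - φ (coll ω p).2

/-- The dissipation functional with the hard sphere weight. -/
def dissip (φ : Vel → ℝ) (ω : Vel) : ℝ≥0∞ :=
  ∫⁻ p, ENNReal.ofReal (|⟪p.1 - p.2, ω⟫| * collDiff φ ω p ^ 2) ∂(GV.prod GV)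

/-- The dissipation functional without weight. -/
def dissip₀ (φ : Vel → ℝ) (ω : Vel) : ℝ≥0∞ :=
  ∫⁻ p, ENNReal.ofReal (collDiff φ ω p ^ 2) ∂(GV.prod GV)

lemma measurable_coll (ω : Vel) : Measurable (coll ω) := (coll ω).continuous.measurable

lemma measurable_collDiff {φ : Vel → ℝ} (hφ : Measurable φ) (ω : Vel) :
    Measurable (collDiff φ ω) := by
  have := measurable_coll ω
  unfold collDiff
  fun_prop

lemma measurePreserving_coll_snd {ω : Vel} (hω : ‖ω‖ = 1) :
    MeasurePreserving (fun p => (coll ω p).2) (GV.prod GV) GV :=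
  measurePreserving_snd.comp (measurePreserving_coll_gaussian hω)

lemma measurePreserving_coll_fst {ω : Vel} (hω : ‖ω‖ = 1) :
    MeasurePreserving (fun p => (coll ω p).1) (GV.prod GV) GV :=
  measurePreserving_fst.comp (measurePreserving_coll_gaussian hω)

lemma measurePreserving_inner {ω : Vel} (hω : ‖ω‖ = 1) :
    MeasurePreserving (fun v : Vel => ⟪v, ω⟫) GV γ where
  measurable := by fun_prop
  map_eq := by
    apply Measure.ext_of_charFun
    ext t
    have : (fun v : Vel => ⟪v, ω⟫) = innerSL ℝ ω := by ext v; simp [real_inner_comm]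
    change _ = charFun (gaussianReal 0 1) t
    rw [← stdGaussian_real, charFun_stdGaussian, this, charFun_eq_charFunDual_toDualMap,
      charFunDual_map, charFunDual_stdGaussian]
    rw [norm_dual_eq_of_forall_inner _ (t • ω) (fun x => by
      simp [real_inner_comm ω, real_inner_smul_right, mul_comm]), norm_smul, hω, mul_one]

/-- The Gaussian density is at most 1 because `2π ≥ 1`, and the interval has length `1/4`. -/
lemma gaussian_near_le (x : ℝ) : γ {z | |x - z| < 1 / 8} ≤ 1 / 4 := by
  have h : {z : ℝ | |x - z| < 1 / 8} = Set.Ioo (x - 1 / 8) (x + 1 / 8) := by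
    ext z; simp only [Set.mem_ofPred_eq, abs_lt, Set.mem_Ioo]
    constructor <;> rintro ⟨h1, h2⟩ <;> constructor <;> linarith
  rw [h, gaussianReal_apply _ one_ne_zero]
  have hle : ∀ z, gaussianPDF 0 1 z ≤ 1 := by
    intro z
    rw [gaussianPDF, ENNReal.ofReal_le_one, gaussianPDFReal]
    have h1 : (√(2 * Real.pi * (1 : NNReal)))⁻¹ ≤ 1 := by
      apply inv_le_one_of_one_le₀
      rw [Real.one_le_sqrt]
      have := Real.pi_gt_three
      push_cast; linarith
    have h2 : Real.exp (-(z - 0) ^ 2 / (2 * (1 : NNReal))) ≤ 1 := by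
      rw [Real.exp_le_one_iff]
      have := sq_nonneg (z - 0)
      push_cast; linarith
    exact mul_le_one₀ h1 (Real.exp_pos _).le h2
  calc ∫⁻ z in Set.Ioo (x - 1 / 8) (x + 1 / 8), gaussianPDF 0 1 z
      ≤ ∫⁻ z in Set.Ioo (x - 1 / 8) (x + 1 / 8), 1 := lintegral_mono fun z => hle z
    _ = ENNReal.ofReal (1 / 4) := by
        rw [setLIntegral_one, Real.volume_Ioo]; congr 1; ring
    _ = 1 / 4 := by
        rw [ENNReal.ofReal_div_of_pos (by norm_num)]; simp

/-- The weight may be removed from the dissipation, by inserting an intermediate value of the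
exchanged component. -/
theorem dissip₀_le {φ : Vel → ℝ} (hφ : Measurable φ) {ω : Vel} (hω : ‖ω‖ = 1) :
    dissip₀ φ ω ≤ 64 * dissip φ ω := by
  have h1 := inner_self_of_norm_one hω
  set F : Vel × Vel → ℝ≥0∞ := fun p => ENNReal.ofReal (|⟪p.1 - p.2, ω⟫| * collDiff φ ω p ^ 2) with hF
  have hFm : Measurable F := by
    have := measurable_collDiff hφ ω
    have h2 : Measurable fun p : Vel × Vel => ⟪p.1 - p.2, ω⟫ := by fun_prop
    exact ((h2.abs).mul (this.pow_const 2)).ennreal_ofReal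
  have hpt : ∀ v u : Vel, ENNReal.ofReal (collDiff φ ω (v, u) ^ 2) ≤
      32 * ∫⁻ w, (F (v, (coll ω (w, u)).2) + F ((coll ω (v, w)).1, u)) ∂GV := by
    intro v u
    -- The intermediate velocities whose component along `ω` is at distance at least `1/8` from
    -- those of `v` and of `u`. The two excluded intervals have probability at most `1/4` each.
    set S : Set Vel := {w | 1 / 8 ≤ |⟪v, ω⟫ - ⟪w, ω⟫| ∧ 1 / 8 ≤ |⟪u, ω⟫ - ⟪w, ω⟫|} with hS
    have hSm : MeasurableSet S := by
      have e : Continuous fun w : Vel => ⟪w, ω⟫ := by fun_prop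
      exact (measurableSet_le measurable_const ((continuous_const.sub e).abs.measurable)).inter
        (measurableSet_le measurable_const ((continuous_const.sub e).abs.measurable))
    have hSc : GV Sᶜ ≤ 1 / 2 := by
      have hsub : Sᶜ ⊆ (fun w : Vel => ⟪w, ω⟫) ⁻¹' {z | |⟪v, ω⟫ - z| < 1 / 8} ∪
          (fun w : Vel => ⟪w, ω⟫) ⁻¹' {z | |⟪u, ω⟫ - z| < 1 / 8} := by
        intro w hw
        simp only [hS, Set.mem_compl_iff, Set.mem_ofPred_eq, not_and_or, not_le] at hw
        exact hw
      have ho : ∀ x : ℝ, MeasurableSet {z : ℝ | |x - z| < 1 / 8} := fun x =>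
        measurableSet_lt (by fun_prop) measurable_const
      refine (measure_mono hsub).trans ((measure_union_le _ _).trans ?_)
      rw [(measurePreserving_inner hω).measure_preimage (ho _).nullMeasurableSet,
        (measurePreserving_inner hω).measure_preimage (ho _).nullMeasurableSet]
      refine (add_le_add (gaussian_near_le _) (gaussian_near_le _)).trans ?_
      rw [← ENNReal.add_div, ENNReal.div_le_iff (by simp) (by simp)]
      rw [show (4 : ℝ≥0∞) = 2 * 2 by norm_num, ← mul_assoc,
        ENNReal.div_mul_cancel (by simp) (by simp)]
      norm_num
    have hSge : 1 / 2 ≤ GV S := by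
      have hu : GV S + GV Sᶜ = 1 := by rw [measure_add_measure_compl hSm, measure_univ]
      by_contra hlt
      push Not at hlt
      have : GV S + GV Sᶜ < 1 / 2 + 1 / 2 :=
        ENNReal.add_lt_add_of_lt_of_le (ne_top_of_le_ne_top (by simp) hSc) hlt hSc
      rw [hu, ENNReal.add_halves] at this
      exact lt_irrefl _ this
    have hle : ∀ w ∈ S, ENNReal.ofReal (collDiff φ ω (v, u) ^ 2) ≤
        16 * (F (v, (coll ω (w, u)).2) + F ((coll ω (v, w)).1, u)) := by
      intro w hw
      -- A collision exchanges components along `ω`. Give `u` the component of `w` and collide with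
      -- `v`; give `v` the component of `w` and collide with `u`. In the sum the two velocities that
      -- carry the component of `w` cancel.
      have hdec : collDiff φ ω (v, u) = collDiff φ ω (v, (coll ω (w, u)).2)
          + collDiff φ ω ((coll ω (v, w)).1, u) := by
        simp only [collDiff, coll_apply]
        have e1 : ⟪v - (u + ⟪w - u, ω⟫ • ω), ω⟫ = ⟪v, ω⟫ - ⟪w, ω⟫ := by
          simp only [inner_sub_left, inner_add_left, real_inner_smul_left, h1]; ring
        have e2 : ⟪v - ⟪v - w, ω⟫ • ω - u, ω⟫ = ⟪w, ω⟫ - ⟪u, ω⟫ := by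
          simp only [inner_sub_left, real_inner_smul_left, h1]; ring
        have e3 : u + ⟪w - u, ω⟫ • ω + (⟪v, ω⟫ - ⟪w, ω⟫) • ω = u + ⟪v - u, ω⟫ • ω := by
          simp only [inner_sub_left]; module
        have e4 : v - ⟪v - w, ω⟫ • ω - (⟪w, ω⟫ - ⟪u, ω⟫) • ω = v - ⟪v - u, ω⟫ • ω := by
          simp only [inner_sub_left]; module
        have e5 : v - (⟪v, ω⟫ - ⟪w, ω⟫) • ω = v - ⟪v - w, ω⟫ • ω := by rw [inner_sub_left]
        have e6 : u + (⟪w, ω⟫ - ⟪u, ω⟫) • ω = u + ⟪w - u, ω⟫ • ω := by rw [inner_sub_left]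
        rw [e1, e2, e3, e4, e5, e6]; ring
      have f1 : ⟪v - (coll ω (w, u)).2, ω⟫ = ⟪v, ω⟫ - ⟪w, ω⟫ := by
        simp only [coll_apply, inner_sub_left, inner_add_left, real_inner_smul_left, h1]; ring
      have f2 : ⟪(coll ω (v, w)).1 - u, ω⟫ = ⟪w, ω⟫ - ⟪u, ω⟫ := by
        simp only [coll_apply, inner_sub_left, real_inner_smul_left, h1]; ring
      simp only [hF, f1, f2]
      rw [← ENNReal.ofReal_add (by positivity) (by positivity),
        show (16 : ℝ≥0∞) = ENNReal.ofReal 16 by simp, ← ENNReal.ofReal_mul (by norm_num)]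
      apply ENNReal.ofReal_le_ofReal
      rw [hdec, abs_sub_comm ⟪w, ω⟫]
      obtain ⟨g1, g2⟩ := hw
      generalize collDiff φ ω (v, (coll ω (w, u)).2) = a
      generalize collDiff φ ω ((coll ω (v, w)).1, u) = b
      -- `(a + b)² ≤ 2a² + 2b²` and both weights are at least `1/8`, whence the factor 16.
      nlinarith [sq_nonneg (a - b), mul_le_mul_of_nonneg_right g1 (sq_nonneg a),
        mul_le_mul_of_nonneg_right g2 (sq_nonneg b)]
    have hm : Measurable fun w => F (v, (coll ω (w, u)).2) + F ((coll ω (v, w)).1, u) := by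
      have := measurable_coll ω
      fun_prop
    calc ENNReal.ofReal (collDiff φ ω (v, u) ^ 2)
        = 2 * (ENNReal.ofReal (collDiff φ ω (v, u) ^ 2) * (1 / 2)) := by
          rw [mul_comm, mul_assoc, ENNReal.div_mul_cancel (by simp) (by simp), mul_one]
      _ ≤ 2 * (ENNReal.ofReal (collDiff φ ω (v, u) ^ 2) * GV S) := by gcongr
      _ = 2 * ∫⁻ w in S, ENNReal.ofReal (collDiff φ ω (v, u) ^ 2) ∂GV := by
          rw [setLIntegral_const]
      _ ≤ 2 * ∫⁻ w in S, 16 * (F (v, (coll ω (w, u)).2) + F ((coll ω (v, w)).1, u)) ∂GV := by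
          gcongr 2 * ?_
          exact setLIntegral_mono (hm.const_mul _) hle
      _ ≤ 2 * ∫⁻ w, 16 * (F (v, (coll ω (w, u)).2) + F ((coll ω (v, w)).1, u)) ∂GV := by
          gcongr 2 * ?_
          exact setLIntegral_le_lintegral _ _
      _ = _ := by rw [lintegral_const_mul _ hm, ← mul_assoc]; norm_num
  have hcm := measurable_coll ω
  -- The velocity `u` with the component of `w` is again Gaussian and independent of `v`, so each
  -- half integrates to the weighted dissipation.
  have I1 : ∫⁻ v, ∫⁻ u, ∫⁻ w, F (v, (coll ω (w, u)).2) ∂GV ∂GV ∂GV = dissip φ ω := by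
    rw [dissip, lintegral_prod _ hFm.aemeasurable]
    congr 1; ext v
    have hv : Measurable fun u => F (v, u) := hFm.comp (by fun_prop)
    rw [lintegral_lintegral_swap (f := fun u w => F (v, (coll ω (w, u)).2))
      (by exact (hFm.comp (by fun_prop)).aemeasurable),
      ← lintegral_prod (f := fun q : Vel × Vel => F (v, (coll ω q).2))
        (by exact (hFm.comp (by fun_prop)).aemeasurable)]
    exact (measurePreserving_coll_snd hω).lintegral_comp hv
  have I2 : ∫⁻ v, ∫⁻ u, ∫⁻ w, F ((coll ω (v, w)).1, u) ∂GV ∂GV ∂GV = dissip φ ω := by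
    rw [dissip, lintegral_prod_symm _ hFm.aemeasurable,
      lintegral_lintegral_swap (f := fun v u => ∫⁻ w, F ((coll ω (v, w)).1, u) ∂GV)]
    · congr 1; ext u
      have hv : Measurable fun v => F (v, u) := hFm.comp (by fun_prop)
      rw [← lintegral_prod (f := fun q : Vel × Vel => F ((coll ω q).1, u))
        (by exact (hFm.comp (by fun_prop)).aemeasurable)]
      exact (measurePreserving_coll_fst hω).lintegral_comp hv
    · refine Measurable.aemeasurable ?_
      exact Measurable.lintegral_prod_right' (f := fun q : (Vel × Vel) × Vel =>
        F ((coll ω (q.1.1, q.2)).1, q.1.2)) (hFm.comp (by fun_prop))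
  have hm1 : Measurable fun q : (Vel × Vel) × Vel => F (q.1.1, (coll ω (q.2, q.1.2)).2) :=
    hFm.comp (by fun_prop)
  have hm2 : Measurable fun q : (Vel × Vel) × Vel => F ((coll ω (q.1.1, q.2)).1, q.1.2) :=
    hFm.comp (by fun_prop)
  have hm1' := hm1.lintegral_prod_right' (ν := GV)
  have hm2' := hm2.lintegral_prod_right' (ν := GV)
  calc dissip₀ φ ω ≤ ∫⁻ p, 32 * ∫⁻ w, (F (p.1, (coll ω (w, p.2)).2)
        + F ((coll ω (p.1, w)).1, p.2)) ∂GV ∂(GV.prod GV) :=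
        lintegral_mono fun p => hpt p.1 p.2
    _ = 32 * (∫⁻ p, ∫⁻ w, F (p.1, (coll ω (w, p.2)).2) ∂GV ∂(GV.prod GV)
        + ∫⁻ p, ∫⁻ w, F ((coll ω (p.1, w)).1, p.2) ∂GV ∂(GV.prod GV)) := by
        have hsum : ∀ p : Vel × Vel, ∫⁻ w, (F (p.1, (coll ω (w, p.2)).2)
            + F ((coll ω (p.1, w)).1, p.2)) ∂GV = ∫⁻ w, F (p.1, (coll ω (w, p.2)).2) ∂GV
            + ∫⁻ w, F ((coll ω (p.1, w)).1, p.2) ∂GV := fun p =>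
          lintegral_add_left (hm1.comp (by fun_prop : Measurable fun w : Vel => (p, w))) _
        simp only [hsum]
        exact (lintegral_const_mul _ (hm1'.add hm2')).trans
          (congrArg _ (lintegral_add_left hm1' _))
    _ = 32 * (dissip φ ω + dissip φ ω) := by
        rw [lintegral_prod _ hm1'.aemeasurable, lintegral_prod _ hm2'.aemeasurable, I1, I2]
    _ = 64 * dissip φ ω := by rw [← two_mul, ← mul_assoc]; norm_num

end ViscousLayer
end

/-! ### Small dissipation along a frame forces almost additive separation of variables. -/

noncomputable section
namespace ViscousLayer
open ProbabilityTheory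
open scoped RealInnerProductSpace ENNReal

/-! ### Separation of variables in an orthonormal frame -/

/-- Jensen's inequality. If `f` is not square integrable the right side is infinite, so no
integrability is required. -/
lemma ofReal_sq_integral_le {α : Type*} [MeasurableSpace α] {μ : Measure α}
    [IsProbabilityMeasure μ] {f : α → ℝ} (hf : AEMeasurable f μ) :
    ENNReal.ofReal ((∫ x, f x ∂μ) ^ 2) ≤ ∫⁻ x, ENNReal.ofReal (f x ^ 2) ∂μ := by
  by_cases h2 : MemLp f 2 μ
  · have h1 : MemLp (fun _ : α => (1 : ℝ)) 2 μ := memLp_const 1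
    have := sq_integral_mul_le h2 h1
    simp only [mul_one, one_pow, integral_const, probReal_univ, smul_eq_mul] at this
    rw [← ofReal_integral_eq_lintegral_ofReal h2.integrable_sq (ae_of_all _ fun x => sq_nonneg _)]
    exact ENNReal.ofReal_le_ofReal this
  · have : ∫⁻ x, ENNReal.ofReal (f x ^ 2) ∂μ = ∞ := by
      by_contra hne
      apply h2
      rw [memLp_two_iff_integrable_sq hf.aestronglyMeasurable]
      refine ⟨(hf.pow_const 2).aestronglyMeasurable, ?_⟩
      rw [hasFiniteIntegral_iff_ofReal (ae_of_all _ fun x => sq_nonneg _)]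
      exact lt_top_iff_ne_top.2 hne
    rw [this]; exact le_top

lemma integral_comp_measurePreserving {α β : Type*} [MeasurableSpace α] [MeasurableSpace β]
    {μ : Measure α} {ν : Measure β} {T : α → β} (h : MeasurePreserving T μ ν) {f : β → ℝ}
    (hf : Measurable f) : ∫ x, f (T x) ∂μ = ∫ y, f y ∂ν := by
  rw [← h.map_eq, integral_map h.measurable.aemeasurable hf.aestronglyMeasurable]

/-- The replacement of the component of `u` along `b` by `x`, as a map from `ℝ × Vel`. -/
def setComp (b : Vel) (x : ℝ) (u : Vel) : Vel := u + (x - ⟪u, b⟫) • b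

lemma inner_setComp {b : Vel} (hb : ‖b‖ = 1) (x : ℝ) (u : Vel) : ⟪setComp b x u, b⟫ = x := by
  simp [setComp, inner_add_left, real_inner_smul_left, hb]

lemma coll_snd_eq_setComp (b v u : Vel) : (coll b (v, u)).2 = setComp b ⟪v, b⟫ u := by
  rw [coll_snd, setComp, inner_sub_left]

lemma continuous_setComp (b : Vel) : Continuous fun q : ℝ × Vel => setComp b q.1 q.2 := by
  unfold setComp; fun_prop

/-- The discarded component `⟪u, b⟫` completes the map to an orthogonal one from `ℝ × Vel` to `Vel ×
ℝ`, to which invariance of Gaussian measures applies. -/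
lemma measurePreserving_setComp {b : Vel} (hb : ‖b‖ = 1) :
    MeasurePreserving (fun q : ℝ × Vel => setComp b q.1 q.2) (γ.prod GV) GV := by
  have hbb := inner_self_of_norm_one hb
  let l : ℝ × Vel →L[ℝ] ℝ := (innerSL ℝ b).comp (.snd ℝ ℝ Vel)
  let A : ℝ × Vel →L[ℝ] Vel × ℝ :=
    (ContinuousLinearMap.snd ℝ ℝ Vel + (ContinuousLinearMap.fst ℝ ℝ Vel - l).smulRight b).prod l
  have hA : ∀ q, A q = (setComp b q.1 q.2, ⟪q.2, b⟫) := fun q => by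
    simp [A, l, setComp, real_inner_comm b]
  have := measurePreserving_gaussian_prod (E := ℝ) (F := Vel) (E' := Vel) (F' := ℝ) A
    (fun a r => (⟪a, b⟫, a - ⟪a, b⟫ • b + r • b)) (by
      rintro ⟨x, u⟩ a r
      rw [hA]
      simp only [setComp, inner_add_left, inner_add_right, inner_sub_right, real_inner_smul_left,
        real_inner_smul_right, real_inner_comm a b]
      simp only [RCLike.inner_apply, conj_trivial]
      ring) (by
      intro a r
      simp only [← real_inner_self_eq_norm_sq, inner_add_left, inner_add_right, inner_sub_right,
        inner_sub_left, real_inner_smul_left, real_inner_smul_right, real_inner_comm a b, hbb]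
      simp only [RCLike.inner_apply, conj_trivial]
      ring)
  rw [stdGaussian_real] at this
  have h2 := measurePreserving_fst.comp this
  convert h2 using 1
  ext1 q
  simp [hA]

/-- The average of `φ` over the velocities with prescribed component along `b`. -/
def marg (φ : Vel → ℝ) (b : Vel) (x : ℝ) : ℝ := ∫ u, φ (setComp b x u) ∂GV

section Marg

variable {φ : Vel → ℝ} (hφ : Measurable φ) {b : Vel} (hb : ‖b‖ = 1)
include hφ

lemma measurable_marg : Measurable (marg φ b) :=
  (StronglyMeasurable.integral_prod_right'
    (f := fun q : ℝ × Vel => φ (setComp b q.1 q.2))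
    (hφ.comp (continuous_setComp b).measurable).stronglyMeasurable).measurable

include hb

lemma memLp_marg (h2 : MemLp φ 2 GV) : MemLp (marg φ b) 2 γ := by
  rw [memLp_two_iff_integrable_sq (measurable_marg hφ).aestronglyMeasurable]
  refine ⟨((measurable_marg hφ).pow_const 2).aestronglyMeasurable, ?_⟩
  rw [hasFiniteIntegral_iff_ofReal (ae_of_all _ fun x => sq_nonneg _)]
  have hm : Measurable fun q : ℝ × Vel => ENNReal.ofReal (φ (setComp b q.1 q.2) ^ 2) :=
    ((hφ.comp (continuous_setComp b).measurable).pow_const 2).ennreal_ofReal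
  calc ∫⁻ x, ENNReal.ofReal (marg φ b x ^ 2) ∂γ
      ≤ ∫⁻ x, ∫⁻ u, ENNReal.ofReal (φ (setComp b x u) ^ 2) ∂GV ∂γ :=
        lintegral_mono fun x => ofReal_sq_integral_le (hφ.comp
          ((continuous_setComp b).measurable.comp measurable_prodMk_left)).aemeasurable
    _ = ∫⁻ v, ENNReal.ofReal (φ v ^ 2) ∂GV := by
        rw [← lintegral_prod _ hm.aemeasurable]
        exact (measurePreserving_setComp hb).lintegral_comp (f := fun v => ENNReal.ofReal (φ v ^ 2))
          (hφ.pow_const 2).ennreal_ofReal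
    _ < ∞ := by
        have := h2.integrable_sq.2
        rwa [hasFiniteIntegral_iff_ofReal (ae_of_all _ fun x => sq_nonneg _)] at this

/-- Testing `φ` against a function of one component. -/
lemma integral_mul_comp_inner (h2 : MemLp φ 2 GV) {f : ℝ → ℝ} (hf : Measurable f)
    (hf2 : MemLp f 2 γ) :
    ∫ v, φ v * f ⟪v, b⟫ ∂GV = ∫ x, marg φ b x * f x ∂γ := by
  have hmp := measurePreserving_setComp hb
  have e : ∫ v, φ v * f ⟪v, b⟫ ∂GV
      = ∫ q, φ (setComp b q.1 q.2) * f q.1 ∂(γ.prod GV) := by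
    rw [← integral_comp_measurePreserving hmp (f := fun v => φ v * f ⟪v, b⟫) (by fun_prop)]
    simp only [inner_setComp hb]
  rw [e, integral_prod]
  · simp only [integral_mul_const]; rfl
  · refine integrable_mul_of_memLp ?_ ?_
    · exact h2.comp_measurePreserving hmp
    · exact hf2.comp_measurePreserving measurePreserving_fst

end Marg

/-- Correlation of functions of two components. -/
lemma integral_comp_inner_mul_comp_inner {e ξ : Vel} (he : ‖e‖ = 1) (hξ : ‖ξ‖ = 1) {ρ : ℝ}
    (hρ : ⟪e, ξ⟫ = ρ) (hρ1 : ρ ^ 2 < 1) {a c : ℝ → ℝ} (ha : Measurable a) (hc : Measurable c)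
    (ha2 : MemLp a 2 γ) (hc2 : MemLp c 2 γ) :
    ∫ v, a ⟪v, e⟫ * c ⟪v, ξ⟫ ∂GV = ∫ x, a x * ∫ z, c (ρ * x + √(1 - ρ ^ 2) * z) ∂γ ∂γ := by
  have h : 0 < 1 - ρ ^ 2 := by linarith
  set σ := √(1 - ρ ^ 2) with hσ
  have hσ2 : σ ^ 2 = 1 - ρ ^ 2 := Real.sq_sqrt h.le
  have hσ0 : σ ≠ 0 := (Real.sqrt_pos.2 h).ne'
  -- Gram-Schmidt: `⟪v, e⟫` and `⟪v, η⟫` are independent standard Gaussian variables and `⟪v, ξ⟫` is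
  -- their combination with coefficients `ρ` and `σ`.
  set η : Vel := σ⁻¹ • (ξ - ρ • e) with hη
  have hee := inner_self_of_norm_one he
  have hξξ := inner_self_of_norm_one hξ
  have heη : ⟪e, η⟫ = 0 := by
    simp only [hη, real_inner_smul_right, inner_sub_right, hρ, hee]; ring
  have hηη : ⟪η, η⟫ = 1 := by
    simp only [hη, real_inner_smul_right, inner_sub_right, real_inner_smul_left, inner_sub_left, hρ,
      hee, hξξ, real_inner_comm e ξ]
    field_simp; rw [hσ2]; ring
  have hξe : ∀ v : Vel, ⟪v, ξ⟫ = ρ * ⟪v, e⟫ + σ * ⟪v, η⟫ := fun v => by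
    simp only [hη, real_inner_smul_right, inner_sub_right]; field_simp; ring
  let A : Vel →L[ℝ] ℝ × ℝ := (innerSL ℝ e).prod (innerSL ℝ η)
  have hA : ∀ v, A v = (⟪v, e⟫, ⟪v, η⟫) := fun v => by simp [A, real_inner_comm v]
  have hmp := measurePreserving_gaussian_to_prod (E := Vel) (E' := ℝ) (F' := ℝ) A
    (fun r s => r • e + s • η) (by
      intro v r s
      rw [hA]
      simp only [inner_add_right, real_inner_smul_right, RCLike.inner_apply, conj_trivial]) (by
      intro r s
      simp only [← real_inner_self_eq_norm_sq, inner_add_left, inner_add_right,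
        real_inner_smul_left, real_inner_smul_right, hee, heη, hηη, real_inner_comm e η]
      simp only [RCLike.inner_apply, conj_trivial]
      ring)
  rw [stdGaussian_real] at hmp
  have hlin : MeasurePreserving (fun q : ℝ × ℝ => ρ * q.1 + σ * q.2) (γ.prod γ) γ := by
    have hcomp : (fun q : ℝ × ℝ => ρ * q.1 + σ * q.2) ∘ A = fun v => ⟪v, ξ⟫ := by
      ext v; simp [hA, hξe]
    have h3 := measurePreserving_inner hξ
    refine ⟨by fun_prop, ?_⟩
    rw [← hmp.map_eq, Measure.map_map (by fun_prop) hmp.measurable, hcomp, h3.map_eq]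
  have e1 : ∫ v, a ⟪v, e⟫ * c ⟪v, ξ⟫ ∂GV
      = ∫ q, a q.1 * c (ρ * q.1 + σ * q.2) ∂(γ.prod γ) := by
    rw [← integral_comp_measurePreserving hmp (f := fun q : ℝ × ℝ => a q.1 * c (ρ * q.1 + σ * q.2))
      (by fun_prop)]
    simp only [hA, hξe]
  rw [e1, integral_prod]
  · simp only [integral_const_mul]
  · exact integrable_mul_of_memLp (ha2.comp_measurePreserving measurePreserving_fst)
      (hc2.comp_measurePreserving hlin)

/-- A function with small dissipation in two directions of an orthonormal frame is close to a sum
of functions of one component each. -/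
theorem lintegral_sub_marg_le {φ : Vel → ℝ} (hφ : Measurable φ) (h2 : MemLp φ 2 GV)
    (h0 : ∫ v, φ v ∂GV = 0) (b : OrthonormalBasis (Fin 3) ℝ Vel) :
    ∫⁻ v, ENNReal.ofReal ((φ v - ∑ i, marg φ (b i) ⟪v, b i⟫) ^ 2) ∂GV
      ≤ 2 * dissip₀ φ (b 0) + 2 * dissip₀ φ (b 1) := by
  have hb : ∀ i, ‖b i‖ = 1 := fun i => b.norm_eq_one i
  have horth : ∀ i j, ⟪b i, b j⟫ = if i = j then (1 : ℝ) else 0 := fun i j => by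
    have := orthonormal_iff_ite.1 b.orthonormal i j
    exact this
  have hexp : ∀ v : Vel, ⟪v, b 0⟫ • b 0 + ⟪v, b 1⟫ • b 1 + ⟪v, b 2⟫ • b 2 = v := fun v => by
    have := b.sum_repr v
    simpa [Fin.sum_univ_three, b.repr_apply_apply, real_inner_comm v] using this
  let ν : Measure (Vel × (Vel × Vel)) := GV.prod (GV.prod GV)
  have p1 : MeasurePreserving (fun q : Vel × (Vel × Vel) => q.1) ν GV := measurePreserving_fst
  have p2 : MeasurePreserving (fun q : Vel × (Vel × Vel) => q.2.1) ν GV :=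
    measurePreserving_fst.comp measurePreserving_snd
  have p3 : MeasurePreserving (fun q : Vel × (Vel × Vel) => q.2.2) ν GV :=
    measurePreserving_snd.comp measurePreserving_snd
  have p12 : MeasurePreserving (fun q : Vel × (Vel × Vel) => (q.1, q.2.1)) ν (GV.prod GV) :=
    (MeasurePreserving.id GV).prod measurePreserving_fst
  have p13 : MeasurePreserving (fun q : Vel × (Vel × Vel) => (q.1, q.2.2)) ν (GV.prod GV) :=
    (MeasurePreserving.id GV).prod measurePreserving_snd
  have pY : MeasurePreserving (fun q : Vel × (Vel × Vel) => (q.1, (coll (b 1) q.2).1)) ν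
      (GV.prod GV) := (MeasurePreserving.id GV).prod (measurePreserving_coll_fst (hb 1))
  have p4 := (measurePreserving_coll_snd (hb 0)).comp p12
  have p5 := (measurePreserving_coll_snd (hb 1)).comp p13
  have p6 := (measurePreserving_coll_snd (hb 2)).comp pY
  have pD : MeasurePreserving (fun q : Vel × (Vel × Vel) => ((coll (b 0) (q.1, q.2.1)).1, q.2.2)) ν
      (GV.prod GV) := by
    have h := (measurePreserving_coll_fst (hb 0)).prod (MeasurePreserving.id GV)
    have ha : MeasurePreserving (MeasurableEquiv.prodAssoc (α := Vel) (β := Vel) (γ := Vel)).symm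
        (GV.prod (GV.prod GV)) ((GV.prod GV).prod GV) :=
      (measurePreserving_prodAssoc GV GV GV).symm
    exact h.comp ha
  have hone : MemLp φ 1 GV := h2.mono_exponent one_le_two
  have hint : Integrable φ GV := h2.integrable one_le_two
  have i1 : ∀ {T : Vel × (Vel × Vel) → Vel}, MeasurePreserving T ν GV →
      Integrable (fun q => φ (T q)) ν := fun hT => hT.integrable_comp_of_integrable hint
  have j2 := (i1 p2).prod_right_ae
  have j3 := (i1 p3).prod_right_ae
  have j4 := (i1 p4).prod_right_ae
  have j5 := (i1 p5).prod_right_ae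
  have j6 := (i1 p6).prod_right_ae
  -- Two successive collisions of `v`, with `u` along `b 0` and with `w` along `b 1`. The outcome
  -- keeps only the component of `v` along `b 2`.
  set F : Vel × (Vel × Vel) → ℝ := fun q => collDiff φ (b 0) (q.1, q.2.1)
    + collDiff φ (b 1) ((coll (b 0) (q.1, q.2.1)).1, q.2.2) with hF
  have hFm : Measurable F := by
    have m0 := measurable_collDiff hφ (b 0)
    have m1 := measurable_collDiff hφ (b 1)
    have m2 := measurable_coll (b 0)
    fun_prop
  -- Every subtracted term depends on `v` through a single component: along `b 0`, `b 1` and `b 2`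
  -- respectively.
  have hFeq : ∀ v u w, F (v, u, w) = φ v + φ u + φ w - φ (coll (b 0) (v, u)).2
      - φ (coll (b 1) (v, w)).2 - φ (coll (b 2) (v, (coll (b 1) (u, w)).1)).2 := by
    intro v u w
    have e1 : (coll (b 1) ((coll (b 0) (v, u)).1, w)).2 = (coll (b 1) (v, w)).2 := by
      simp only [coll_apply, inner_sub_left, real_inner_smul_left, horth]
      simp
    have e2 : (coll (b 1) ((coll (b 0) (v, u)).1, w)).1
        = (coll (b 2) (v, (coll (b 1) (u, w)).1)).2 := by
      simp only [coll_apply, inner_sub_left, real_inner_smul_left, horth]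
      have := hexp (v - u)
      simp only [inner_sub_left] at this
      simp only [Fin.isValue, zero_ne_one, if_false, mul_zero, sub_zero,
        show ((1 : Fin 3) = 2) = False by simp]
      rw [← sub_eq_zero] at this ⊢
      rw [← neg_eq_zero, ← this]
      module
    simp only [hF, collDiff, e1, e2]
    ring
  -- Averaging over `u` and `w` turns the three subtracted terms into the marginals, since the other
  -- components are Gaussian; `φ u` and `φ w` have mean zero.
  have hval : ∀ᵐ v ∂GV, φ v - ∑ i, marg φ (b i) ⟪v, b i⟫ = ∫ p, F (v, p) ∂(GV.prod GV) := by
    filter_upwards [j2, j3, j4, j5, j6] with v k2 k3 k4 k5 k6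
    have k1 : Integrable (fun _ : Vel × Vel => φ v) (GV.prod GV) := integrable_const _
    have e2 : ∫ p : Vel × Vel, φ p.1 ∂(GV.prod GV) = 0 := by
      rw [← h0]
      exact integral_comp_measurePreserving measurePreserving_fst hφ
    have e3 : ∫ p : Vel × Vel, φ p.2 ∂(GV.prod GV) = 0 := by
      rw [← h0]
      exact integral_comp_measurePreserving measurePreserving_snd hφ
    have e4 : ∫ p : Vel × Vel, φ (coll (b 0) (v, p.1)).2 ∂(GV.prod GV) = marg φ (b 0) ⟪v, b 0⟫ := by
      rw [integral_fun_fst (f := fun u => φ (coll (b 0) (v, u)).2)]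
      simp [marg, coll_snd_eq_setComp]
    have e5 : ∫ p : Vel × Vel, φ (coll (b 1) (v, p.2)).2 ∂(GV.prod GV) = marg φ (b 1) ⟪v, b 1⟫ := by
      rw [integral_fun_snd (f := fun u => φ (coll (b 1) (v, u)).2)]
      simp [marg, coll_snd_eq_setComp]
    have e6 : ∫ p : Vel × Vel, φ (coll (b 2) (v, (coll (b 1) p).1)).2 ∂(GV.prod GV)
        = marg φ (b 2) ⟪v, b 2⟫ := by
      have hmp := measurePreserving_coll_fst (hb 1)
      have hmm : Measurable fun u => φ (coll (b 2) (v, u)).2 := by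
        have := measurable_coll (b 2); fun_prop
      rw [← integral_map (f := fun u => φ (coll (b 2) (v, u)).2) hmp.measurable.aemeasurable
        hmm.aestronglyMeasurable, hmp.map_eq]
      simp [marg, coll_snd_eq_setComp]
    have : ∀ p : Vel × Vel, F (v, p) = φ v + φ p.1 + φ p.2 - φ (coll (b 0) (v, p.1)).2
      - φ (coll (b 1) (v, p.2)).2 - φ (coll (b 2) (v, (coll (b 1) p).1)).2 := fun p => hFeq v p.1 p.2
    simp only [this]
    refine Eq.symm ((integral_sub ((((k1.add k2).add k3).sub k4).sub k5) k6).trans ?_)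
    rw [integral_sub' (((k1.add k2).add k3).sub k4) k5, integral_sub' ((k1.add k2).add k3) k4,
      integral_add' (k1.add k2) k3, integral_add' k1 k2]
    simp only [Function.comp_def] at *
    rw [e2, e3, e4, e5, e6, Fin.sum_univ_three]
    simp; ring
  have hD1 : ∫⁻ q, ENNReal.ofReal (collDiff φ (b 0) (q.1, q.2.1) ^ 2) ∂ν = dissip₀ φ (b 0) :=
    p12.lintegral_comp (f := fun p => ENNReal.ofReal (collDiff φ (b 0) p ^ 2))
      ((measurable_collDiff hφ _).pow_const 2).ennreal_ofReal
  have hD2 : ∫⁻ q, ENNReal.ofReal (collDiff φ (b 1) ((coll (b 0) (q.1, q.2.1)).1, q.2.2) ^ 2) ∂ν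
      = dissip₀ φ (b 1) :=
    pD.lintegral_comp (f := fun p => ENNReal.ofReal (collDiff φ (b 1) p ^ 2))
      ((measurable_collDiff hφ _).pow_const 2).ennreal_ofReal
  calc ∫⁻ v, ENNReal.ofReal ((φ v - ∑ i, marg φ (b i) ⟪v, b i⟫) ^ 2) ∂GV
      = ∫⁻ v, ENNReal.ofReal ((∫ p, F (v, p) ∂(GV.prod GV)) ^ 2) ∂GV :=
        lintegral_congr_ae (hval.mono fun v hv => by simp only [hv])
    _ ≤ ∫⁻ v, ∫⁻ p, ENNReal.ofReal (F (v, p) ^ 2) ∂(GV.prod GV) ∂GV :=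
        lintegral_mono fun v => ofReal_sq_integral_le (by fun_prop)
    _ = ∫⁻ q, ENNReal.ofReal (F q ^ 2) ∂ν :=
        (lintegral_prod _ (hFm.pow_const 2).ennreal_ofReal.aemeasurable).symm
    _ ≤ ∫⁻ q, (2 * ENNReal.ofReal (collDiff φ (b 0) (q.1, q.2.1) ^ 2)
        + 2 * ENNReal.ofReal (collDiff φ (b 1) ((coll (b 0) (q.1, q.2.1)).1, q.2.2) ^ 2)) ∂ν := by
        refine lintegral_mono fun q => ?_
        simp only [hF]
        rw [← mul_add, ← ENNReal.ofReal_add (sq_nonneg _) (sq_nonneg _)]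
        refine (ENNReal.ofReal_le_ofReal add_sq_le).trans_eq ?_
        rw [ENNReal.ofReal_mul zero_le_two, ENNReal.ofReal_ofNat]
    _ = 2 * dissip₀ φ (b 0) + 2 * dissip₀ φ (b 1) := by
        have m1 : Measurable fun q : Vel × (Vel × Vel) =>
            ENNReal.ofReal (collDiff φ (b 0) (q.1, q.2.1) ^ 2) := by
          have := measurable_collDiff hφ (b 0); fun_prop
        have m2 : Measurable fun q : Vel × (Vel × Vel) =>
            ENNReal.ofReal (collDiff φ (b 1) ((coll (b 0) (q.1, q.2.1)).1, q.2.2) ^ 2) := by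
          have := measurable_collDiff hφ (b 1)
          have := measurable_coll (b 0)
          fun_prop
        rw [lintegral_add_left (m1.const_mul 2), lintegral_const_mul _ m1, lintegral_const_mul _ m2,
          hD1, hD2]

end ViscousLayer
end

/-! ### A spectral gap from two frames in general position. -/

noncomputable section
namespace ViscousLayer
open ProbabilityTheory
open scoped RealInnerProductSpace ENNReal

/-! ### The spectral gap -/

/-- Orthogonality to the collision invariants. -/
structure PerpInv (φ : Vel → ℝ) : Prop where
  measurable : Measurable φ
  memLp : MemLp φ 2 GV
  mass : ∫ v, φ v ∂GV = 0
  momentum : ∀ e : Vel, ∫ v, φ v * ⟪v, e⟫ ∂GV = 0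
  energy : ∫ v, φ v * ‖v‖ ^ 2 ∂GV = 0

lemma memLp_comp_inner {f : ℝ → ℝ} (hf : MemLp f 2 γ) {b : Vel} (hb : ‖b‖ = 1) :
    MemLp (fun v : Vel => f ⟪v, b⟫) 2 GV :=
  hf.comp_measurePreserving (measurePreserving_inner hb)

/-- The inner products of the two frames. -/
def frameTable (i j : Fin 3) : ℝ := if i.val + j.val = 2 then -(1 / 3) else 2 / 3

/-- With `J` the matrix of ones and `Π` the permutation that reverses the order, the table is `2/3 J
- Π`, which is orthogonal because `J² = 3J`. All entries stay away from `±1`, so no direction of one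
frame is close to one of the other. -/
lemma exists_frame_table : ∃ b' : OrthonormalBasis (Fin 3) ℝ Vel,
    ∀ i j, ⟪EuclideanSpace.basisFun (Fin 3) ℝ i, b' j⟫ = frameTable i j := by
  let w : Fin 3 → Vel := fun j => WithLp.toLp 2 fun i => frameTable i j
  have hw : Orthonormal ℝ w := by
    rw [orthonormal_iff_ite]
    have key : ∀ i j : Fin 3, ∑ k, frameTable k j * frameTable k i = if i = j then 1 else 0 := by
      intro i j
      fin_cases i <;> fin_cases j <;>
        norm_num [Fin.sum_univ_three, frameTable, show ¬(2 : Fin 3) = 0 by decide]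
    intro i j
    rw [← key i j]
    simp [w, PiLp.inner_apply]
  obtain ⟨b', hb'⟩ := Orthonormal.exists_orthonormalBasis_extension_of_card_eq (𝕜 := ℝ)
    (E := Vel) (ι := Fin 3) (by simp) (v := w) (s := Set.univ)
    (by
      exact hw.comp _ Subtype.val_injective)
  refine ⟨b', fun i j => ?_⟩
  rw [hb' j (Set.mem_univ j)]
  simp [w, EuclideanSpace.inner_single_left]

section Frame

variable {φ : Vel → ℝ} (h : PerpInv φ)
include h

lemma PerpInv.marg_mass {b : Vel} (hb : ‖b‖ = 1) : ∫ x, marg φ b x ∂γ = 0 := by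
  have := integral_mul_comp_inner h.measurable hb h.memLp (f := fun _ => 1) measurable_const
    (memLp_const 1)
  simpa [h.mass] using this.symm

lemma PerpInv.marg_momentum {b : Vel} (hb : ‖b‖ = 1) : ∫ x, marg φ b x * x ∂γ = 0 := by
  have := integral_mul_comp_inner h.measurable hb h.memLp (f := fun x => x) measurable_id
    memLp_linear
  rw [← this]; exact h.momentum b

/-- In any orthonormal frame `∑ (⟪v, b i⟫² - 1) = |v|² - 3`. Orthogonality to the energy enters the
spectral gap only through this relation. -/
lemma PerpInv.sum_marg_energy (b : OrthonormalBasis (Fin 3) ℝ Vel) :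
    ∑ i, ∫ x, marg φ (b i) x * (x ^ 2 - 1) ∂γ = 0 := by
  have hb : ∀ i, ‖b i‖ = 1 := fun i => b.norm_eq_one i
  have e : ∀ i, ∫ x, marg φ (b i) x * (x ^ 2 - 1) ∂γ = ∫ v, φ v * (⟪v, b i⟫ ^ 2 - 1) ∂GV :=
    fun i => (integral_mul_comp_inner h.measurable (hb i) h.memLp (f := fun x => x ^ 2 - 1)
      (by fun_prop) memLp_quad).symm
  have hi : ∀ i, Integrable (fun v => φ v * (⟪v, b i⟫ ^ 2 - 1)) GV := fun i =>
    integrable_mul_of_memLp h.memLp (memLp_comp_inner memLp_quad (hb i))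
  simp only [e]
  rw [← integral_finsetSum _ fun i _ => hi i]
  have hs : ∀ v : Vel, ∑ i, φ v * (⟪v, b i⟫ ^ 2 - 1) = φ v * ‖v‖ ^ 2 - 3 * φ v := fun v => by
    rw [← Finset.mul_sum, Finset.sum_sub_distrib]
    have := b.sum_sq_norm_inner_left v
    simp only [Real.norm_eq_abs, sq_abs] at this
    rw [this]; simp; ring
  have hin : Integrable (fun v => φ v * ‖v‖ ^ 2) GV := by
    have := (integrable_finsetSum Finset.univ fun i _ => hi i).add
      ((h.memLp.integrable one_le_two).const_mul 3)
    refine this.congr (ae_of_all _ fun v => ?_)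
    simp [hs]
  simp only [hs]
  rw [integral_sub hin ((h.memLp.integrable one_le_two).const_mul 3), integral_const_mul, h.mass,
    h.energy]
  simp

/-- Orthogonality of the marginals in one frame. -/
lemma PerpInv.integral_marg_mul_marg (b : OrthonormalBasis (Fin 3) ℝ Vel) (i j : Fin 3) :
    ∫ v, marg φ (b i) ⟪v, b i⟫ * marg φ (b j) ⟪v, b j⟫ ∂GV
      = if i = j then ∫ x, marg φ (b i) x ^ 2 ∂γ else 0 := by
  have hb : ∀ i, ‖b i‖ = 1 := fun i => b.norm_eq_one i
  have hm := fun i => measurable_marg h.measurable (b := b i)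
  split_ifs with hij
  · subst hij
    simp only [← pow_two]
    exact integral_comp_measurePreserving (measurePreserving_inner (hb i)) ((hm i).pow_const 2)
  · rw [integral_comp_inner_mul_comp_inner (hb i) (hb j) (ρ := 0)
      (b.orthonormal.2 hij) (by norm_num) (hm i) (hm j) (memLp_marg h.measurable (hb i) h.memLp)
      (memLp_marg h.measurable (hb j) h.memLp)]
    simp [h.marg_mass (hb j)]

/-- Pythagoras: each marginal is the projection of `φ` to the functions of one component, and
marginals along distinct vectors of a frame are orthogonal. -/
lemma PerpInv.integral_sub_marg_sq (b : OrthonormalBasis (Fin 3) ℝ Vel) :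
    ∫ v, (φ v - ∑ i, marg φ (b i) ⟪v, b i⟫) ^ 2 ∂GV
      = ∫ v, φ v ^ 2 ∂GV - ∑ i, ∫ x, marg φ (b i) x ^ 2 ∂γ := by
  have hb : ∀ i, ‖b i‖ = 1 := fun i => b.norm_eq_one i
  have ha := fun i => memLp_marg h.measurable (hb i) h.memLp
  have ha' := fun i => memLp_comp_inner (ha i) (hb i)
  have hm := fun i => measurable_marg h.measurable (b := b i)
  have e1 : ∀ i, ∫ v, φ v * marg φ (b i) ⟪v, b i⟫ ∂GV = ∫ x, marg φ (b i) x ^ 2 ∂γ := fun i => by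
    rw [integral_mul_comp_inner h.measurable (hb i) h.memLp (hm i) (ha i)]; simp only [pow_two]
  have e2 : ∀ v : Vel, (φ v - ∑ i, marg φ (b i) ⟪v, b i⟫) ^ 2
      = φ v ^ 2 - ∑ i, (2 * (φ v * marg φ (b i) ⟪v, b i⟫)
        - ∑ j, marg φ (b i) ⟪v, b i⟫ * marg φ (b j) ⟪v, b j⟫) := fun v => by
    simp only [Fin.sum_univ_three]; ring
  have i1 : ∀ i, Integrable (fun v => 2 * (φ v * marg φ (b i) ⟪v, b i⟫)) GV := fun i =>
    (integrable_mul_of_memLp h.memLp (ha' i)).const_mul 2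
  have i2 : ∀ i j, Integrable (fun v => marg φ (b i) ⟪v, b i⟫ * marg φ (b j) ⟪v, b j⟫) GV :=
    fun i j => integrable_mul_of_memLp (ha' i) (ha' j)
  have i3 := fun i => integrable_finsetSum Finset.univ fun j _ => i2 i j
  simp only [e2]
  rw [integral_sub h.memLp.integrable_sq
    (integrable_finsetSum _ fun i _ => (i1 i).sub' (i3 i)),
    integral_finsetSum _ fun i _ => (i1 i).sub' (i3 i)]
  congr 1
  refine Finset.sum_congr rfl fun i _ => ?_
  rw [integral_sub (i1 i) (i3 i), integral_const_mul, e1, integral_finsetSum _ fun j _ => i2 i j]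
  simp only [h.integral_marg_mul_marg b]
  simp; ring

lemma PerpInv.corr_le {b b' : Vel} (hb : ‖b‖ = 1) (hb' : ‖b'‖ = 1) {ρ θ : ℝ} (hρ : ⟪b, b'⟫ = ρ)
    (hρ1 : ρ ^ 2 < 1) (hθ : 0 ≤ θ) (hρθ : ρ ^ 6 / (1 - ρ ^ 2) ≤ θ ^ 2) {s t : ℝ}
    (hs : ∫ x, marg φ b x * (x ^ 2 - 1) ∂γ = s) (ht : ∫ x, marg φ b' x * (x ^ 2 - 1) ∂γ = t) :
    ∫ v, marg φ b ⟪v, b⟫ * marg φ b' ⟪v, b'⟫ ∂GV ≤ ρ ^ 2 / 2 * (s * t)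
      + θ / 2 * ((∫ x, marg φ b x ^ 2 ∂γ - s ^ 2 / 2) + (∫ x, marg φ b' x ^ 2 ∂γ - t ^ 2 / 2)) := by
  have hm := measurable_marg h.measurable (b := b)
  have hm' := measurable_marg h.measurable (b := b')
  have ha := memLp_marg h.measurable hb h.memLp
  have ha' := memLp_marg h.measurable hb' h.memLp
  rw [integral_comp_inner_mul_comp_inner hb hb' hρ hρ1 hm hm' ha ha']
  have := (abs_le.1 (abs_correlation_sub_le hρ1 hθ hρθ ha ha' hm' (h.marg_mass hb)
    (h.marg_momentum hb) hs ht)).2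
  linarith

/-- Marginals in two frames in general position cannot both be almost equal to `φ`. -/
theorem PerpInv.integral_sq_le_frames {b b' : OrthonormalBasis (Fin 3) ℝ Vel}
    (hbb : ∀ i j, ⟪b i, b' j⟫ = frameTable i j) :
    4 / 27 * ∫ v, φ v ^ 2 ∂GV ≤ ∫ v, (φ v - ∑ i, marg φ (b i) ⟪v, b i⟫) ^ 2 ∂GV
      + ∫ v, (φ v - ∑ i, marg φ (b' i) ⟪v, b' i⟫) ^ 2 ∂GV := by
  have hb : ∀ i, ‖b i‖ = 1 := fun i => b.norm_eq_one i
  have hb' : ∀ i, ‖b' i‖ = 1 := fun i => b'.norm_eq_one i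
  have ha : ∀ i, MemLp (fun v => marg φ (b i) ⟪v, b i⟫) 2 GV := fun i =>
    memLp_comp_inner (memLp_marg h.measurable (hb i) h.memLp) (hb i)
  have hc : ∀ i, MemLp (fun v => marg φ (b' i) ⟪v, b' i⟫) 2 GV := fun i =>
    memLp_comp_inner (memLp_marg h.measurable (hb' i) h.memLp) (hb' i)
  have hS := h.sum_marg_energy b
  have hT := h.sum_marg_energy b'
  -- The numbers `2/5` and `1/25` dominate `|ρ|³/√(1-ρ²)` for `ρ = 2/3` and `ρ = -1/3`: indeed
  -- `64/405 ≤ (2/5)²` and `1/648 ≤ (1/25)²`.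
  have hX : ∀ i j, ∫ v, marg φ (b i) ⟪v, b i⟫ * marg φ (b' j) ⟪v, b' j⟫ ∂GV
      ≤ frameTable i j ^ 2 / 2 * ((∫ x, marg φ (b i) x * (x ^ 2 - 1) ∂γ)
        * ∫ x, marg φ (b' j) x * (x ^ 2 - 1) ∂γ)
      + (if i.val + j.val = 2 then 1 / 25 else 2 / 5) / 2 * ((∫ x, marg φ (b i) x ^ 2 ∂γ
          - (∫ x, marg φ (b i) x * (x ^ 2 - 1) ∂γ) ^ 2 / 2)
        + (∫ x, marg φ (b' j) x ^ 2 ∂γ - (∫ x, marg φ (b' j) x * (x ^ 2 - 1) ∂γ) ^ 2 / 2)) := by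
    intro i j
    refine h.corr_le (hb i) (hb' j) (hbb i j) ?_ ?_ ?_ rfl rfl <;> (try unfold frameTable) <;>
      split_ifs <;> norm_num
  have hd1 := h.integral_sub_marg_sq b
  have hd2 := h.integral_sub_marg_sq b'
  set F := fun v => φ v - ∑ i, marg φ (b i) ⟪v, b i⟫ with hF
  set G := fun v => φ v - ∑ i, marg φ (b' i) ⟪v, b' i⟫ with hG
  have hFm : MemLp F 2 GV := h.memLp.sub (memLp_finsetSum _ fun i _ => ha i)
  have hGm : MemLp G 2 GV := h.memLp.sub (memLp_finsetSum _ fun i _ => hc i)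
  have hcross : ∫ v, F v * G v ∂GV = ∫ v, φ v ^ 2 ∂GV - ∑ i, ∫ x, marg φ (b i) x ^ 2 ∂γ
      - ∑ i, ∫ x, marg φ (b' i) x ^ 2 ∂γ
      + ∑ i, ∑ j, ∫ v, marg φ (b i) ⟪v, b i⟫ * marg φ (b' j) ⟪v, b' j⟫ ∂GV := by
    have e1 : ∀ i, ∫ v, φ v * marg φ (b i) ⟪v, b i⟫ ∂GV = ∫ x, marg φ (b i) x ^ 2 ∂γ := fun i => by
      rw [integral_mul_comp_inner h.measurable (hb i) h.memLp (measurable_marg h.measurable)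
        (memLp_marg h.measurable (hb i) h.memLp)]; simp only [pow_two]
    have e2 : ∀ i, ∫ v, φ v * marg φ (b' i) ⟪v, b' i⟫ ∂GV = ∫ x, marg φ (b' i) x ^ 2 ∂γ :=
      fun i => by
      rw [integral_mul_comp_inner h.measurable (hb' i) h.memLp (measurable_marg h.measurable)
        (memLp_marg h.measurable (hb' i) h.memLp)]; simp only [pow_two]
    have e : ∀ v : Vel, F v * G v = φ v ^ 2 - ∑ i, φ v * marg φ (b i) ⟪v, b i⟫
        - ∑ i, φ v * marg φ (b' i) ⟪v, b' i⟫
        + ∑ i, ∑ j, marg φ (b i) ⟪v, b i⟫ * marg φ (b' j) ⟪v, b' j⟫ := fun v => by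
      simp only [hF, hG, Fin.sum_univ_three]; ring
    have i1 := integrable_finsetSum Finset.univ fun i _ => integrable_mul_of_memLp h.memLp (ha i)
    have i2 := integrable_finsetSum Finset.univ fun i _ => integrable_mul_of_memLp h.memLp (hc i)
    have i3 := fun i => integrable_finsetSum Finset.univ fun j _ =>
      integrable_mul_of_memLp (ha i) (hc j)
    have i4 := integrable_finsetSum Finset.univ fun i _ => i3 i
    simp only [e]
    rw [integral_add ((h.memLp.integrable_sq.sub' i1).sub' i2) i4,
      integral_sub (h.memLp.integrable_sq.sub' i1) i2, integral_sub h.memLp.integrable_sq i1,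
      integral_finsetSum _ fun i _ => integrable_mul_of_memLp h.memLp (ha i),
      integral_finsetSum _ fun i _ => integrable_mul_of_memLp h.memLp (hc i),
      integral_finsetSum _ fun i _ => i3 i]
    simp only [e1, e2]
    congr 1
    exact Finset.sum_congr rfl fun i _ =>
      integral_finsetSum _ fun j _ => integrable_mul_of_memLp (ha i) (hc j)
  -- With `N` the squared norm of `φ`, `M` the sum of those of all six marginals and `X` the cross
  -- terms, this reads `4N - 3M + 2X ≥ 0`. Rows and columns of the constants sum to `2 · 2/5 + 1/25
  -- = 21/25`, so up to quadratic terms `2X ≤ 21/25 M` and `M ≤ 50/27 N`. The claim has `2N - M` on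
  -- its right side, and `2 - 50/27 = 4/27`.
  have hpos : 0 ≤ ∫ v, (F v + G v) ^ 2 ∂GV := integral_nonneg fun v => sq_nonneg _
  have hexp : ∫ v, (F v + G v) ^ 2 ∂GV
      = ∫ v, F v ^ 2 ∂GV + 2 * ∫ v, F v * G v ∂GV + ∫ v, G v ^ 2 ∂GV := by
    have e : ∀ v, (F v + G v) ^ 2 = F v ^ 2 + 2 * (F v * G v) + G v ^ 2 := fun v => by ring
    simp only [e]
    rw [integral_add (hFm.integrable_sq.fun_add ((integrable_mul_of_memLp hFm hGm).const_mul 2))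
      hGm.integrable_sq, integral_add hFm.integrable_sq
      ((integrable_mul_of_memLp hFm hGm).const_mul 2), integral_const_mul]
  rw [hexp, hcross, hd1, hd2] at hpos
  rw [hd1, hd2]
  have hXs := Finset.sum_le_sum fun i (_ : i ∈ Finset.univ) =>
    Finset.sum_le_sum fun j (_ : j ∈ Finset.univ) => hX i j
  generalize ∑ i, ∑ j, ∫ v, marg φ (b i) ⟪v, b i⟫ * marg φ (b' j) ⟪v, b' j⟫ ∂GV = X at *
  generalize ∫ v, φ v ^ 2 ∂GV = N at *
  clear hX hcross hexp hd1 hd2 hF hG hFm hGm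
  simp only [Fin.sum_univ_three] at *
  norm_num [frameTable] at hXs
  generalize ∫ x, marg φ (b 0) x * (x ^ 2 - 1) ∂γ = s0 at *
  generalize ∫ x, marg φ (b 1) x * (x ^ 2 - 1) ∂γ = s1 at *
  generalize ∫ x, marg φ (b 2) x * (x ^ 2 - 1) ∂γ = s2 at *
  generalize ∫ x, marg φ (b' 0) x * (x ^ 2 - 1) ∂γ = t0 at *
  generalize ∫ x, marg φ (b' 1) x * (x ^ 2 - 1) ∂γ = t1 at *
  generalize ∫ x, marg φ (b' 2) x * (x ^ 2 - 1) ∂γ = t2 at *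
  -- Since the sums vanish, the quadratic terms in the bound for `X` reduce to `-1/6 ∑ s_i t_{2-i}`,
  -- which is absorbed by the available `-21/100 ∑ (s_i² + t_i²)`.
  have hST : (s0 + s1 + s2) * (t0 + t1 + t2) = 0 := by rw [hS, zero_mul]
  nlinarith [sq_nonneg (s0 + t2), sq_nonneg (s1 + t1), sq_nonneg (s2 + t0), sq_nonneg s0,
    sq_nonneg s1, sq_nonneg s2, sq_nonneg t0, sq_nonneg t1, sq_nonneg t2]

end Frame

end ViscousLayer
end

/-! ### Recovery of the weight `1 + |v|`. -/

noncomputable section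
namespace ViscousLayer
open ProbabilityTheory
open scoped RealInnerProductSpace ENNReal

/-! ### Coercivity with the collision frequency -/

lemma lintegral_le_of_integral_le {F : Vel → ℝ} (hF : MemLp F 2 GV) {C : ℝ≥0∞}
    (h : ∫⁻ v, ENNReal.ofReal (F v ^ 2) ∂GV ≤ C) :
    ENNReal.ofReal (∫ v, F v ^ 2 ∂GV) ≤ C := by
  rwa [ofReal_integral_eq_lintegral_ofReal hF.integrable_sq (ae_of_all _ fun v => sq_nonneg _)]

/-- The constant is `27/4 · 2 · 64`: the inverse of the gap, the two collisions, and the removal of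
the weight. -/
lemma PerpInv.lintegral_sq_le {φ : Vel → ℝ} (h : PerpInv φ)
    {b b' : OrthonormalBasis (Fin 3) ℝ Vel} (hbb : ∀ i j, ⟪b i, b' j⟫ = frameTable i j) :
    ∫⁻ v, ENNReal.ofReal (φ v ^ 2) ∂GV
      ≤ 864 * ∑ i, (dissip φ (b i) + dissip φ (b' i)) := by
  have key : ∀ c : OrthonormalBasis (Fin 3) ℝ Vel,
      ENNReal.ofReal (∫ v, (φ v - ∑ i, marg φ (c i) ⟪v, c i⟫) ^ 2 ∂GV)
        ≤ 128 * ∑ i, dissip φ (c i) := fun c => by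
    refine (lintegral_le_of_integral_le ?_ (lintegral_sub_marg_le h.measurable h.memLp h.mass c)).trans ?_
    · exact h.memLp.sub (memLp_finsetSum _ fun i _ => memLp_comp_inner
        (memLp_marg h.measurable (c.norm_eq_one i) h.memLp) (c.norm_eq_one i))
    · have h0 := dissip₀_le h.measurable (c.norm_eq_one 0)
      have h1 := dissip₀_le h.measurable (c.norm_eq_one 1)
      calc 2 * dissip₀ φ (c 0) + 2 * dissip₀ φ (c 1)
          ≤ 2 * (64 * dissip φ (c 0)) + 2 * (64 * dissip φ (c 1)) := by gcongr
        _ = 128 * (dissip φ (c 0) + dissip φ (c 1)) := by ring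
        _ ≤ _ := by
          rw [Fin.sum_univ_three]
          refine mul_le_mul_right ?_ _
          exact le_self_add (a := dissip φ (c 0) + dissip φ (c 1))
  have hf := ENNReal.ofReal_le_ofReal (h.integral_sq_le_frames hbb)
  rw [ENNReal.ofReal_mul (by norm_num), ofReal_integral_eq_lintegral_ofReal h.memLp.integrable_sq
    (ae_of_all _ fun v => sq_nonneg _), ENNReal.ofReal_add (integral_nonneg fun v => sq_nonneg _)
    (integral_nonneg fun v => sq_nonneg _)] at hf
  have hf2 := hf.trans (add_le_add (key b) (key b'))
  calc ∫⁻ v, ENNReal.ofReal (φ v ^ 2) ∂GV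
      = ENNReal.ofReal (27 / 4) * (ENNReal.ofReal (4 / 27) *
          ∫⁻ v, ENNReal.ofReal (φ v ^ 2) ∂GV) := by
        rw [← mul_assoc, ← ENNReal.ofReal_mul (by norm_num)]; norm_num
    _ ≤ ENNReal.ofReal (27 / 4) * (128 * ∑ i, dissip φ (b i) + 128 * ∑ i, dissip φ (b' i)) := by
        gcongr
    _ = (ENNReal.ofReal (27 / 4) * ENNReal.ofReal 128) *
          ∑ i, (dissip φ (b i) + dissip φ (b' i)) := by
        rw [Finset.sum_add_distrib, ENNReal.ofReal_ofNat]; ring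
    _ = _ := by
        rw [← ENNReal.ofReal_mul (by norm_num)]; norm_num

/-- Velocities with comparable components along and across `ω`. -/
def cone (ω : Vel) : Set Vel := {v | ‖v‖ ^ 2 ≤ 10 * ⟪v, ω⟫ ^ 2 ∧ 10 * ⟪v, ω⟫ ^ 2 ≤ 9 * ‖v‖ ^ 2}

lemma measurableSet_cone (ω : Vel) : MeasurableSet (cone ω) := by
  apply IsClosed.measurableSet
  have c1 : Continuous fun v : Vel => ‖v‖ ^ 2 := by fun_prop
  have c2 : Continuous fun v : Vel => 10 * ⟪v, ω⟫ ^ 2 := by fun_prop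
  exact (isClosed_le c1 c2).inter (isClosed_le c2 (c1.const_mul 9))

/-- Outside the cones of the first frame every squared component is below `1/10` or above `9/10` of
`|v|²`. They cannot all be small, so `v` is nearly parallel to some `b i`; a vector of the second
frame with entry `2/3` against `b i` then has `v` in its cone. -/
lemma exists_mem_cone {b b' : OrthonormalBasis (Fin 3) ℝ Vel}
    (hbb : ∀ i j, ⟪b i, b' j⟫ = frameTable i j) (v : Vel) :
    ∃ i, v ∈ cone (b i) ∨ v ∈ cone (b' i) := by
  have hN := b.sum_sq_norm_inner_left v
  simp only [Real.norm_eq_abs, sq_abs, Fin.sum_univ_three] at hN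
  have hexp : ∀ j, ⟪v, b' j⟫ = ∑ i, ⟪v, b i⟫ * frameTable i j := fun j => by
    rw [← b.sum_inner_mul_inner v (b' j)]
    simp only [hbb]
  by_contra! hcon
  have h0 := hcon 0
  have h1 := hcon 1
  have h2 := hcon 2
  simp only [cone, Set.mem_ofPred_eq, not_and_or, not_le, hexp, Fin.sum_univ_three] at h0 h1 h2
  norm_num [frameTable, show ¬(2 : Fin 3) = 0 by decide] at h0 h1 h2
  generalize ⟪v, b 0⟫ = x at *
  generalize ⟪v, b 1⟫ = y at *
  generalize ⟪v, b 2⟫ = z at *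
  rw [← hN] at h0 h1 h2
  obtain ⟨hx, hx'⟩ := h0
  obtain ⟨hy, hy'⟩ := h1
  obtain ⟨hz, hz'⟩ := h2
  -- `p` is the dominant component, `s` the sum of the squares of the other two, and `e` their
  -- contribution to the component along the second frame; Cauchy-Schwarz gives `5/9 = (2/3)² +
  -- (1/3)²`.
  have key : ∀ p s e w : ℝ, 0 ≤ s → 9 * (p ^ 2 + s) < 10 * p ^ 2 → w = 2 / 3 * p + e →
      e ^ 2 ≤ 5 / 9 * s → (10 * w ^ 2 < p ^ 2 + s ∨ 9 * (p ^ 2 + s) < 10 * w ^ 2) → False := by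
    rintro p s e w hs hp rfl he (hw | hw)
    · nlinarith [sq_nonneg (2 / 3 * p + 2 * e)]
    · nlinarith [sq_nonneg (2 / 3 * p - 2 * e)]
  rcases hx with hx | hx
  · rcases hy with hy | hy
    · rcases hz with hz | hz
      · nlinarith [sq_nonneg x, sq_nonneg y, sq_nonneg z]
      · refine key z (x ^ 2 + y ^ 2) (2 / 3 * x - 1 / 3 * y) _ (by positivity) (by linarith) ?_
          ?_ (hy'.imp (fun h => h.trans_eq ?_) fun h => Eq.trans_lt ?_ h) <;>
          first | ring1 | nlinarith [sq_nonneg (x + 2 * y)]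
    · refine key y (x ^ 2 + z ^ 2) (2 / 3 * x - 1 / 3 * z) _ (by positivity) (by linarith) ?_
        ?_ (hx'.imp (fun h => h.trans_eq ?_) fun h => Eq.trans_lt ?_ h) <;>
        first | ring1 | nlinarith [sq_nonneg (x + 2 * z)]
  · refine key x (y ^ 2 + z ^ 2) (2 / 3 * y - 1 / 3 * z) _ (by positivity) (by linarith) ?_
      ?_ (hx'.imp (fun h => h.trans_eq ?_) fun h => Eq.trans_lt ?_ h) <;>
      first | ring1 | nlinarith [sq_nonneg (y + 2 * z)]

/-- Control of the collision frequency near one direction. -/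
lemma lintegral_cone_le : ∃ C : ℝ≥0∞, C ≠ ∞ ∧ ∀ φ : Vel → ℝ, Measurable φ → ∀ ω : Vel, ‖ω‖ = 1 →
    ∫⁻ v in cone ω, ENNReal.ofReal (‖v‖ * φ v ^ 2) ∂GV
      ≤ C * (dissip φ ω + ∫⁻ v, ENNReal.ofReal (φ v ^ 2) ∂GV) := by
  set m := GV (Metric.closedBall 0 1) with hm
  have hm0 : m ≠ 0 := by
    intro h0
    have h1 : ∀ᵐ v ∂GV, v ∉ Metric.closedBall (0 : Vel) 1 := by
      rw [ae_iff]; simp only [not_not]; exact h0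
    rw [ae_gaussian_iff, ae_iff] at h1
    simp only [not_not] at h1
    exact (Metric.measure_closedBall_pos volume (0 : Vel) one_pos).ne' h1
  have hmt : m ≠ ∞ := measure_ne_top _ _
  set M := ∫⁻ u, ENNReal.ofReal (1 + 3 * ‖u‖) ∂GV with hM
  have hMt : M ≠ ∞ := by
    have : Integrable (fun u : Vel => 1 + 3 * ‖u‖) GV :=
      (integrable_const _).add (IsGaussian.integrable_id.norm.const_mul 3)
    have h2 := this.2
    rw [hasFiniteIntegral_iff_ofReal (ae_of_all _ fun u => by positivity)] at h2
    exact h2.ne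
  refine ⟨m⁻¹ * (12 + 72 * M), ?_, fun φ hφ ω hω => ?_⟩
  · exact ENNReal.mul_ne_top (ENNReal.inv_ne_top.2 hm0)
      (ENNReal.add_ne_top.2 ⟨by simp, ENNReal.mul_ne_top (by simp) hMt⟩)
  set N := ∫⁻ v, ENNReal.ofReal (φ v ^ 2) ∂GV with hN
  have hωω := inner_self_of_norm_one hω
  have hcm := measurable_coll ω
  have hcd := measurable_collDiff hφ ω
  have hS : MeasurableSet (cone ω ×ˢ Metric.closedBall (0 : Vel) 1) :=
    (measurableSet_cone ω).prod measurableSet_closedBall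
  have mφ : Measurable fun v => ENNReal.ofReal (φ v ^ 2) := by fun_prop
  have mw : Measurable fun v : Vel => ENNReal.ofReal (1 + 3 * ‖v‖) := by fun_prop
  -- pointwise bound
  have hpt : ∀ p ∈ cone ω ×ˢ Metric.closedBall (0 : Vel) 1, ENNReal.ofReal (‖p.1‖ * φ p.1 ^ 2)
      ≤ 8 * ENNReal.ofReal (|⟪p.1 - p.2, ω⟫| * collDiff φ ω p ^ 2)
        + 12 * (ENNReal.ofReal (φ p.1 ^ 2) * 1)
        + 24 * (ENNReal.ofReal (1 + 3 * ‖p.1‖) * ENNReal.ofReal (φ p.2 ^ 2))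
        + 24 * (ENNReal.ofReal (φ (coll ω p).1 ^ 2) * ENNReal.ofReal (1 + 3 * ‖(coll ω p).2‖))
        + 24 * (ENNReal.ofReal (1 + 3 * ‖(coll ω p).1‖) * ENNReal.ofReal (φ (coll ω p).2 ^ 2)) := by
    rintro ⟨v, u⟩ ⟨hv, hu⟩
    simp only [mem_closedBall_zero_iff] at hu
    simp only [cone, Set.mem_ofPred_eq] at hv
    obtain ⟨hv1, hv2⟩ := hv
    set z := ⟪v, ω⟫ with hz
    set y := ⟪u, ω⟫ with hy
    have hd : ⟪v - u, ω⟫ = z - y := inner_sub_left _ _ _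
    have hzy : |z - y| ≤ |z| + |y| := abs_sub z y
    have hzy' : |z| - |y| ≤ |z - y| := abs_sub_abs_le_abs_sub z y
    have hy1 : |y| ≤ 1 := ((abs_real_inner_le_norm u ω).trans_eq (by rw [hω, mul_one])).trans hu
    have hz1 : |z| ≤ ‖v‖ := (abs_real_inner_le_norm v ω).trans_eq (by rw [hω, mul_one])
    -- The first condition of the cone, with `√10 ≤ 4`.
    have hz4 : ‖v‖ ≤ 4 * |z| := by
      refine abs_le_of_sq_le_sq' ?_ (by positivity) |>.2
      rw [mul_pow, sq_abs]; linarith [sq_nonneg z]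
    have hn1 : ‖(coll ω (v, u)).1‖ ^ 2 = ‖v‖ ^ 2 - z ^ 2 + y ^ 2 := by
      rw [← real_inner_self_eq_norm_sq, ← real_inner_self_eq_norm_sq, coll_apply]
      simp only [hd, inner_sub_left, inner_sub_right, real_inner_smul_left, real_inner_smul_right,
        hωω, real_inner_comm v ω, ← hz]
      ring
    have hn2 : ⟪(coll ω (v, u)).2, ω⟫ = z := by
      rw [coll_apply]
      simp only [hd, inner_add_left, real_inner_smul_left, hωω, ← hy]
      ring
    -- In the cone both outgoing velocities are large: `u'` receives the component `z`, and `v'`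
    -- keeps the part of `v` across `ω`, which is at least `|z|/3` by the second condition.
    have hzu : |z| ≤ ‖(coll ω (v, u)).2‖ := by
      rw [← hn2]; exact (abs_real_inner_le_norm _ ω).trans_eq (by rw [hω, mul_one])
    have hzv : |z| ≤ 3 * ‖(coll ω (v, u)).1‖ := by
      refine abs_le_of_sq_le_sq ?_ (by positivity)
      rw [mul_pow, hn1]; nlinarith [sq_nonneg y]
    simp only [collDiff, hd]
    set c := φ (coll ω (v, u)).1
    set d := φ (coll ω (v, u)).2
    set nv := ‖(coll ω (v, u)).1‖
    set nu := ‖(coll ω (v, u)).2‖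
    have ha : φ v ^ 2 ≤ 2 * (φ v + φ u - c - d) ^ 2 + 6 * (φ u ^ 2 + c ^ 2 + d ^ 2) := by
      nlinarith [sq_nonneg (φ v + φ u - c - d + (φ u - c - d)), sq_nonneg (φ u + c),
        sq_nonneg (φ u + d), sq_nonneg (c - d)]
    rw [mul_one, ← ENNReal.ofReal_mul (by positivity), ← ENNReal.ofReal_mul (by positivity),
      ← ENNReal.ofReal_mul (by positivity), ← ENNReal.ofReal_ofNat 8, ← ENNReal.ofReal_ofNat 12,
      ← ENNReal.ofReal_ofNat 24, ← ENNReal.ofReal_mul (by positivity),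
      ← ENNReal.ofReal_mul (by positivity), ← ENNReal.ofReal_mul (by positivity),
      ← ENNReal.ofReal_mul (by positivity), ← ENNReal.ofReal_mul (by positivity),
      ← ENNReal.ofReal_add (by positivity) (by positivity),
      ← ENNReal.ofReal_add (by positivity) (by positivity),
      ← ENNReal.ofReal_add (by positivity) (by positivity),
      ← ENNReal.ofReal_add (by positivity) (by positivity)]
    refine ENNReal.ofReal_le_ofReal ?_
    have hw0 := abs_nonneg (z - y)
    -- The relative speed along `ω` is comparable to `|v|`. In each of the terms with `φ(u)`,
    -- `φ(v')`, `φ(u')` the weight is put on the partner velocity, so that the Gaussian integrals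
    -- factor and only the unweighted norm of `φ` appears.
    have s1 : ‖v‖ * φ v ^ 2 ≤ 4 * (|z - y| + 1) * φ v ^ 2 := by
      gcongr; linarith
    have s2 := mul_le_mul_of_nonneg_left ha hw0
    have s3 : |z - y| * φ u ^ 2 ≤ (1 + 3 * ‖v‖) * φ u ^ 2 := by
      gcongr; linarith [norm_nonneg v]
    have s4 : |z - y| * c ^ 2 ≤ (1 + 3 * nu) * c ^ 2 := by
      gcongr; linarith [norm_nonneg (coll ω (v, u)).2]
    have s5 : |z - y| * d ^ 2 ≤ (1 + 3 * nv) * d ^ 2 := by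
      gcongr; linarith [norm_nonneg (coll ω (v, u)).1]
    nlinarith [sq_nonneg (φ v)]
  have hprod : ∀ f g : Vel → ℝ≥0∞, Measurable f → Measurable g →
      ∫⁻ p, f p.1 * g p.2 ∂(GV.prod GV) = (∫⁻ v, f v ∂GV) * ∫⁻ v, g v ∂GV := fun f g hf hg =>
    lintegral_prod_mul hf.aemeasurable hg.aemeasurable
  have hmp := measurePreserving_coll_gaussian hω
  have hprod' : ∀ f g : Vel → ℝ≥0∞, Measurable f → Measurable g →
      ∫⁻ p, f (coll ω p).1 * g (coll ω p).2 ∂(GV.prod GV) = (∫⁻ v, f v ∂GV) * ∫⁻ v, g v ∂GV :=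
    fun f g hf hg => by
      rw [← hprod f g hf hg]
      exact hmp.lintegral_comp (f := fun p : Vel × Vel => f p.1 * g p.2) (by fun_prop)
  have hle : (∫⁻ v in cone ω, ENNReal.ofReal (‖v‖ * φ v ^ 2) ∂GV) * m
      ≤ 8 * dissip φ ω + 12 * N + 24 * (M * N) + 24 * (N * M) + 24 * (M * N) := by
    calc (∫⁻ v in cone ω, ENNReal.ofReal (‖v‖ * φ v ^ 2) ∂GV) * m
        = ∫⁻ p in cone ω ×ˢ Metric.closedBall (0 : Vel) 1,
            ENNReal.ofReal (‖p.1‖ * φ p.1 ^ 2) ∂(GV.prod GV) := by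
          rw [← Measure.prod_restrict]
          have := lintegral_prod_mul (μ := GV.restrict (cone ω))
            (ν := GV.restrict (Metric.closedBall 0 1))
            (f := fun v => ENNReal.ofReal (‖v‖ * φ v ^ 2)) (g := fun _ => 1)
            (by fun_prop) (by fun_prop)
          simp only [mul_one, lintegral_const, one_mul, Measure.restrict_apply_univ] at this
          rw [this]
      _ ≤ _ := (setLIntegral_mono' hS hpt).trans (setLIntegral_le_lintegral _ _)
      _ = _ := by
          rw [lintegral_add_right _ (by fun_prop), lintegral_add_right _ (by fun_prop),
            lintegral_add_right _ (by fun_prop), lintegral_add_right _ (by fun_prop),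
            lintegral_const_mul _ (by fun_prop), lintegral_const_mul _ (by fun_prop),
            lintegral_const_mul _ (by fun_prop), lintegral_const_mul _ (by fun_prop),
            lintegral_const_mul _ (by fun_prop),
            hprod _ _ mφ measurable_const, hprod _ _ mw mφ,
            hprod' _ _ mφ mw, hprod' _ _ mw mφ]
          simp only [dissip, lintegral_one, measure_univ, mul_one, hN, hM]
  calc ∫⁻ v in cone ω, ENNReal.ofReal (‖v‖ * φ v ^ 2) ∂GV
      = m⁻¹ * ((∫⁻ v in cone ω, ENNReal.ofReal (‖v‖ * φ v ^ 2) ∂GV) * m) := by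
        rw [mul_comm _ m, ← mul_assoc, ENNReal.inv_mul_cancel hm0 hmt, one_mul]
    _ ≤ m⁻¹ * (8 * dissip φ ω + 12 * N + 24 * (M * N) + 24 * (N * M) + 24 * (M * N)) := by gcongr
    _ ≤ m⁻¹ * ((12 * dissip φ ω + 72 * M * dissip φ ω) + 12 * N + 24 * (M * N) + 24 * (N * M)
          + 24 * (M * N)) := by
        gcongr
        exact le_add_right (by gcongr; norm_num)
    _ = _ := by ring

/-- Control of the weighted norm by six directions. -/
lemma PerpInv.lintegral_weight_le : ∃ C : ℝ≥0∞, C ≠ ∞ ∧ ∀ φ : Vel → ℝ, PerpInv φ →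
    ∀ b b' : OrthonormalBasis (Fin 3) ℝ Vel, (∀ i j, ⟪b i, b' j⟫ = frameTable i j) →
    ∫⁻ v, ENNReal.ofReal ((1 + ‖v‖) * φ v ^ 2) ∂GV
      ≤ C * ∑ i, (dissip φ (b i) + dissip φ (b' i)) := by
  obtain ⟨C, hC, hcone⟩ := lintegral_cone_le
  refine ⟨864 + C * (1 + 6 * 864), ?_, fun φ h b b' hbb => ?_⟩
  · exact ENNReal.add_ne_top.2 ⟨by simp, ENNReal.mul_ne_top hC (by norm_num)⟩
  set S := ∑ i, (dissip φ (b i) + dissip φ (b' i)) with hS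
  have hL := h.lintegral_sq_le hbb
  set N := ∫⁻ v, ENNReal.ofReal (φ v ^ 2) ∂GV with hN
  have hφ := h.measurable
  have hW : ∫⁻ v, ENNReal.ofReal (‖v‖ * φ v ^ 2) ∂GV ≤ C * (S + 6 * N) := by
    calc ∫⁻ v, ENNReal.ofReal (‖v‖ * φ v ^ 2) ∂GV
        ≤ ∫⁻ v, ∑ i, ((cone (b i)).indicator (fun v => ENNReal.ofReal (‖v‖ * φ v ^ 2)) v
          + (cone (b' i)).indicator (fun v => ENNReal.ofReal (‖v‖ * φ v ^ 2)) v) ∂GV := by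
          refine lintegral_mono fun v => ?_
          obtain ⟨i, hi⟩ := exists_mem_cone hbb v
          refine le_trans ?_ (Finset.single_le_sum (fun _ _ => zero_le) (Finset.mem_univ i))
          rcases hi with hi | hi
          · rw [Set.indicator_of_mem hi]; exact le_self_add
          · rw [Set.indicator_of_mem hi (s := cone (b' i))]; exact le_add_self
      _ = ∑ i, (∫⁻ v in cone (b i), ENNReal.ofReal (‖v‖ * φ v ^ 2) ∂GV
          + ∫⁻ v in cone (b' i), ENNReal.ofReal (‖v‖ * φ v ^ 2) ∂GV) := by
          have mi : ∀ c : Vel, Measurable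
              ((cone c).indicator fun v => ENNReal.ofReal (‖v‖ * φ v ^ 2)) := fun c =>
            Measurable.indicator (by fun_prop) (measurableSet_cone c)
          rw [lintegral_finsetSum _ fun i _ => (mi _).fun_add (mi _)]
          refine Finset.sum_congr rfl fun i _ => ?_
          rw [lintegral_add_left (mi _), lintegral_indicator (measurableSet_cone _),
            lintegral_indicator (measurableSet_cone _)]
      _ ≤ ∑ i, (C * (dissip φ (b i) + N) + C * (dissip φ (b' i) + N)) := by
          gcongr with i
          · exact hcone φ hφ _ (b.norm_eq_one i)
          · exact hcone φ hφ _ (b'.norm_eq_one i)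
      _ = _ := by
          simp only [hS, Fin.sum_univ_three]; ring
  calc ∫⁻ v, ENNReal.ofReal ((1 + ‖v‖) * φ v ^ 2) ∂GV
      = N + ∫⁻ v, ENNReal.ofReal (‖v‖ * φ v ^ 2) ∂GV := by
        rw [hN, ← lintegral_add_left (by fun_prop)]
        refine lintegral_congr fun v => ?_
        rw [← ENNReal.ofReal_add (by positivity) (by positivity)]; congr 1; ring
    _ ≤ 864 * S + C * (S + 6 * (864 * S)) := by
        refine add_le_add hL (hW.trans ?_); gcongr
    _ = _ := by ring

end ViscousLayer
end

/-! ### From six directions to the average over the sphere. -/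

noncomputable section
namespace ViscousLayer
open ProbabilityTheory
open scoped RealInnerProductSpace ENNReal

/-! ### Averaging over the orthogonal group -/

/-- The orthogonal group of velocity space. -/
abbrev Orth : Type := unitary (Vel →L[ℝ] Vel)

instance : ContinuousStar (Vel →L[ℝ] Vel) := ⟨ContinuousLinearMap.adjoint.continuous⟩

instance : MeasurableSpace Orth := borel Orth
instance : BorelSpace Orth := ⟨rfl⟩

instance : CompactSpace Orth := by
  refine isCompact_iff_compactSpace.1 (?_ : IsCompact (unitary (Vel →L[ℝ] Vel) : Set (Vel →L[ℝ] Vel)))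
  have : FiniteDimensional ℝ (Vel →L[ℝ] Vel) := inferInstance
  have : ProperSpace (Vel →L[ℝ] Vel) := FiniteDimensional.proper ℝ _
  refine Metric.isCompact_of_isClosed_isBounded isClosed_unitary ?_
  refine (Metric.isBounded_closedBall (x := (0 : Vel →L[ℝ] Vel)) (r := 1)).subset fun U hU => ?_
  rw [mem_closedBall_zero_iff]
  exact (CStarRing.norm_of_mem_unitary hU).le

instance : SecondCountableTopology Orth := by
  have : ProperSpace (Vel →L[ℝ] Vel) := FiniteDimensional.proper ℝ _
  have : SecondCountableTopology (Vel →L[ℝ] Vel) := secondCountable_of_proper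
  infer_instance

/-- The normalized Haar measure of the orthogonal group. -/
def haarOrth : Measure Orth := Measure.haarMeasure ⊤

instance : IsProbabilityMeasure haarOrth :=
  ⟨by unfold haarOrth; exact Measure.haarMeasure_self (K₀ := (⊤ : TopologicalSpace.PositiveCompacts Orth))⟩
instance : haarOrth.IsHaarMeasure := by unfold haarOrth; infer_instance

/-- A right translate is again a Haar probability measure, hence the same measure by uniqueness. -/
instance : haarOrth.IsMulRightInvariant where
  map_mul_right_eq_self g := by
    have : IsProbabilityMeasure (Measure.map (· * g) haarOrth) :=
      Measure.isProbabilityMeasure_map (by fun_prop)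
    exact Measure.isHaarMeasure_eq_of_isProbabilityMeasure _ _

/-- The isometry of an element of the orthogonal group. -/
def orthIso (U : Orth) : Vel ≃ₗᵢ[ℝ] Vel := Unitary.linearIsometryEquiv U

lemma orthIso_apply (U : Orth) (v : Vel) : orthIso U v = (U : Vel →L[ℝ] Vel) v := rfl

lemma exists_orthIso (e ω : Sph) : ∃ U : Orth, rotSph (orthIso U) e = ω := by
  refine ⟨Unitary.linearIsometryEquiv.symm (Submodule.reflection (ℝ ∙ ((e : Vel) - ω))ᗮ), ?_⟩
  ext1
  simp only [orthIso, coe_rotSph, MulEquiv.apply_symm_apply]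
  exact Submodule.reflection_sub (by simp)

lemma continuous_orthIso : Continuous fun p : Orth × Vel => orthIso p.1 p.2 := by
  simp only [orthIso_apply]
  exact (continuous_subtype_val.comp continuous_fst).clm_apply continuous_snd

lemma continuous_rotSph_orth : Continuous fun p : Orth × Sph => rotSph (orthIso p.1) p.2 := by
  refine Continuous.subtype_mk ?_ _
  exact continuous_orthIso.comp (continuous_fst.prodMk (continuous_subtype_val.comp continuous_snd))

/-- The group acts transitively on the sphere and the Haar measure is right invariant, so the
average of `F(Ue)` over `U` does not depend on `e`. Integrating over `e` and exchanging the
integrals gives the spherical integral. -/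
lemma lintegral_orth (F : Sph → ℝ≥0∞) (hF : Measurable F) (e : Sph) :
    (∫⁻ U, F (rotSph (orthIso U) e) ∂haarOrth) * sphereMeasure Set.univ
      = ∫⁻ ω, F ω ∂sphereMeasure := by
  have hm : Measurable fun p : Orth × Sph => F (rotSph (orthIso p.1) p.2) :=
    hF.comp continuous_rotSph_orth.measurable
  have h1 : ∀ ω : Sph, ∫⁻ U, F (rotSph (orthIso U) ω) ∂haarOrth
      = ∫⁻ U, F (rotSph (orthIso U) e) ∂haarOrth := fun ω => by
    obtain ⟨V, rfl⟩ := exists_orthIso e ω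
    have := lintegral_mul_right_eq_self (μ := haarOrth) (fun U => F (rotSph (orthIso U) e)) V
    rw [← this]
    rfl
  calc (∫⁻ U, F (rotSph (orthIso U) e) ∂haarOrth) * sphereMeasure Set.univ
      = ∫⁻ ω, ∫⁻ U, F (rotSph (orthIso U) ω) ∂haarOrth ∂sphereMeasure := by
        simp only [h1, lintegral_const]
    _ = ∫⁻ U, ∫⁻ ω, F (rotSph (orthIso U) ω) ∂sphereMeasure ∂haarOrth :=
        (lintegral_lintegral_swap hm.aemeasurable).symm
    _ = ∫⁻ U, ∫⁻ ω, F ω ∂sphereMeasure ∂haarOrth :=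
        lintegral_congr fun U => (measurePreserving_rotSph (orthIso U)).lintegral_comp hF
    _ = _ := by simp

lemma measurable_dissip {φ : Vel → ℝ} (hφ : Measurable φ) :
    Measurable fun ω : Sph => dissip φ ω := by
  refine Measurable.lintegral_prod_right'
    (f := fun q : Sph × (Vel × Vel) => ENNReal.ofReal (|⟪q.2.1 - q.2.2, (q.1 : Vel)⟫|
      * collDiff φ q.1 q.2 ^ 2)) ?_
  have e : (fun q : Sph × (Vel × Vel) => ENNReal.ofReal (|⟪q.2.1 - q.2.2, (q.1 : Vel)⟫|
      * collDiff φ q.1 q.2 ^ 2)) = fun q => ENNReal.ofReal (|⟪q.2.1 - q.2.2, (q.1 : Vel)⟫|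
      * (φ q.2.1 + φ q.2.2 - φ (q.2.1 - ⟪q.2.1 - q.2.2, (q.1 : Vel)⟫ • (q.1 : Vel))
        - φ (q.2.2 + ⟪q.2.1 - q.2.2, (q.1 : Vel)⟫ • (q.1 : Vel))) ^ 2) := by
    ext ⟨ω, v, u⟩; simp only [collDiff, coll_fst, coll_snd]
  rw [e]
  fun_prop

lemma measurable_rotSph_orth (e : Sph) : Measurable fun U : Orth => rotSph (orthIso U) e := by
  have h : Continuous fun U : Orth => ((U, e) : Orth × Sph) := by fun_prop
  exact (continuous_rotSph_orth.comp h).measurable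

lemma measurable_dissip_orth {φ : Vel → ℝ} (hφ : Measurable φ) (e : Sph) :
    Measurable fun U : Orth => dissip φ (orthIso U (e : Vel)) := by
  have h1 := measurable_rotSph_orth e
  have h2 := measurable_dissip hφ
  have h3 : Measurable fun U : Orth => dissip φ (rotSph (orthIso U) e) := h2.comp h1
  exact h3

lemma lintegral_const_mul_sum {α : Type*} [MeasurableSpace α] {μ : Measure α} (C : ℝ≥0∞)
    {f g : Fin 3 → α → ℝ≥0∞} (hf : ∀ i, Measurable (f i)) (hg : ∀ i, Measurable (g i)) {c : ℝ≥0∞}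
    (hf' : ∀ i, ∫⁻ x, f i x ∂μ = c) (hg' : ∀ i, ∫⁻ x, g i x ∂μ = c) :
    ∫⁻ x, C * ∑ i, (f i x + g i x) ∂μ = C * (6 * c) := by
  have m3 := fun i => (hf i).fun_add (hg i)
  rw [lintegral_const_mul _ (Finset.measurable_fun_sum _ fun i _ => m3 i),
    lintegral_finsetSum _ fun i _ => m3 i]
  have : ∀ i, ∫⁻ x, (f i x + g i x) ∂μ = 2 * c := fun i => by
    rw [lintegral_add_left (hf i), hf', hg', two_mul]
  simp only [this, Fin.sum_univ_three]
  ring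

/-- The dissipation of the linearized collision operator controls the norm with the weight of the
collision frequency, on the orthogonal complement of the collision invariants. -/
theorem PerpInv.coercive : ∃ C : ℝ≥0∞, C ≠ ∞ ∧ ∀ φ : Vel → ℝ, PerpInv φ →
    ∫⁻ v, ENNReal.ofReal ((1 + ‖v‖) * φ v ^ 2) ∂GV
      ≤ C * ∫⁻ ω : Sph, dissip φ ω ∂sphereMeasure := by
  obtain ⟨C, hC, hw⟩ := PerpInv.lintegral_weight_le
  obtain ⟨b, b', hb'⟩ : ∃ b b' : OrthonormalBasis (Fin 3) ℝ Vel,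
      ∀ i j, ⟪b i, b' j⟫ = frameTable i j := ⟨_, exists_frame_table⟩
  set σ := sphereMeasure Set.univ with hσ
  have hσ0 : σ ≠ 0 := by
    rw [hσ, sphereMeasure, ne_eq, Measure.measure_univ_eq_zero]
    exact Measure.toSphere_ne_zero _
  refine ⟨C * 6 * σ⁻¹, ENNReal.mul_ne_top (ENNReal.mul_ne_top hC (by simp))
    (ENNReal.inv_ne_top.2 hσ0), fun φ h => ?_⟩
  set E := ∫⁻ ω : Sph, dissip φ ω ∂sphereMeasure with hE
  have hav : ∀ e : Vel, ‖e‖ = 1 → ∫⁻ U, dissip φ (orthIso U e) ∂haarOrth = E * σ⁻¹ := fun e he => by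
    have := lintegral_orth (fun ω => dissip φ ω) (measurable_dissip h.measurable)
      ⟨e, by simpa using he⟩
    simp only [coe_rotSph] at this
    rw [hE, ← this, mul_assoc, ENNReal.mul_inv_cancel hσ0 (measure_ne_top _ _), mul_one]
  have hmeas : ∀ e : Vel, ‖e‖ = 1 → Measurable fun U : Orth => dissip φ (orthIso U e) :=
    fun e he => measurable_dissip_orth h.measurable ⟨e, by simpa using he⟩
  calc ∫⁻ v, ENNReal.ofReal ((1 + ‖v‖) * φ v ^ 2) ∂GV
      = ∫⁻ _U, ∫⁻ v, ENNReal.ofReal ((1 + ‖v‖) * φ v ^ 2) ∂GV ∂haarOrth := by simp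
    -- The bound holds for the pair of frames rotated by `U`, because only the inner products
    -- between the frames enter its hypotheses.
    _ ≤ ∫⁻ U, C * ∑ i, (dissip φ (orthIso U (b i)) + dissip φ (orthIso U (b' i))) ∂haarOrth := by
        refine lintegral_mono fun U => ?_
        have := hw φ h (b.map (orthIso U)) (b'.map (orthIso U)) (fun i j => by
          simp only [OrthonormalBasis.map_apply, LinearIsometryEquiv.inner_map_map]; exact hb' i j)
        simpa only [OrthonormalBasis.map_apply] using this
    _ = C * 6 * σ⁻¹ * E := by
        rw [lintegral_const_mul_sum C (fun i => hmeas _ (b.norm_eq_one i))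
          (fun i => hmeas _ (b'.norm_eq_one i)) (fun i => hav _ (b.norm_eq_one i))
          (fun i => hav _ (b'.norm_eq_one i))]
        ring

end ViscousLayer
end

/-! ### The collision measure and its symmetries. -/

noncomputable section
namespace ViscousLayer
open ProbabilityTheory
open scoped RealInnerProductSpace ENNReal

/-! ### The weak form of the collision operator -/

/-- Pairs of velocities and impact directions. -/
abbrev Coll : Type := (Vel × Vel) × Sph

/-- The hard sphere kernel. -/
def kern (q : Coll) : ℝ := |⟪q.1.1 - q.1.2, (q.2 : Vel)⟫|

/-- The collision measure, without kernel. -/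
def collMeasure₀ : Measure Coll := (GV.prod GV).prod sphereMeasure

/-- The collision measure. -/
def collMeasure : Measure Coll := collMeasure₀.withDensity fun q => ENNReal.ofReal (kern q)

def preV (q : Coll) : Vel := q.1.1
def preU (q : Coll) : Vel := q.1.2
def postV (q : Coll) : Vel := (coll q.2 q.1).1
def postU (q : Coll) : Vel := (coll q.2 q.1).2

/-- The change of pre- and post-collisional velocities. -/
def collMap (q : Coll) : Coll := (coll q.2 q.1, q.2)

/-- The exchange of the two particles. -/
def exch (q : Coll) : Coll := (q.1.swap, q.2)

/-- The distribution of `v` under the collision measure. -/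
def freqMeasure : Measure Vel := collMeasure.map preV

instance : SFinite collMeasure₀ := by unfold collMeasure₀; infer_instance

lemma kern_nonneg (q : Coll) : 0 ≤ kern q := abs_nonneg _

lemma continuous_kern : Continuous kern := by unfold kern; fun_prop

lemma continuous_postV : Continuous postV := by
  have : postV = fun q : Coll => q.1.1 - ⟪q.1.1 - q.1.2, (q.2 : Vel)⟫ • (q.2 : Vel) := by
    ext1 ⟨⟨v, u⟩, ω⟩; simp only [postV, coll_fst]
  rw [this]; fun_prop

lemma continuous_postU : Continuous postU := by
  have : postU = fun q : Coll => q.1.2 + ⟪q.1.1 - q.1.2, (q.2 : Vel)⟫ • (q.2 : Vel) := by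
    ext1 ⟨⟨v, u⟩, ω⟩; simp only [postU, coll_snd]
  rw [this]; fun_prop

lemma continuous_preV : Continuous preV := by unfold preV; fun_prop
lemma continuous_preU : Continuous preU := by unfold preU; fun_prop

@[simp] lemma preV_collMap (q : Coll) : preV (collMap q) = postV q := rfl
@[simp] lemma preU_collMap (q : Coll) : preU (collMap q) = postU q := rfl
@[simp] lemma postV_collMap (q : Coll) : postV (collMap q) = preV q := by
  simp [postV, collMap, coll_coll, preV]
@[simp] lemma postU_collMap (q : Coll) : postU (collMap q) = preU q := by
  simp [postU, collMap, coll_coll, preU]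
@[simp] lemma preV_exch (q : Coll) : preV (exch q) = preU q := rfl
@[simp] lemma preU_exch (q : Coll) : preU (exch q) = preV q := rfl
@[simp] lemma postV_exch (q : Coll) : postV (exch q) = postU q := by
  obtain ⟨⟨v, u⟩, ω⟩ := q
  simp only [postV, postU, exch, Prod.swap, coll_swap _ v u]
@[simp] lemma postU_exch (q : Coll) : postU (exch q) = postV q := by
  obtain ⟨⟨v, u⟩, ω⟩ := q
  simp only [postV, postU, exch, Prod.swap, coll_swap _ v u]

lemma kern_collMap (q : Coll) : kern (collMap q) = kern q := by
  obtain ⟨⟨v, u⟩, ω⟩ := q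
  simp only [kern, collMap, coll_inner_sub (norm_sph ω), abs_neg]

lemma kern_exch (q : Coll) : kern (exch q) = kern q := by
  obtain ⟨⟨v, u⟩, ω⟩ := q
  simp only [kern, exch, Prod.swap]
  rw [← abs_neg, ← inner_neg_left, neg_sub]

/-- For each fixed direction the collision preserves the Gaussian product measure, so the map is a
skew product over the identity of the sphere. -/
lemma measurePreserving_collMap₀ : MeasurePreserving collMap collMeasure₀ collMeasure₀ := by
  let g : Sph → Vel × Vel → Vel × Vel := fun ω p => coll (ω : Vel) p
  have hm : Measurable (Function.uncurry g) := by
    have e : Function.uncurry g = fun q : Sph × (Vel × Vel) => (postV q.swap, postU q.swap) := by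
      ext1 ⟨ω, p⟩; rfl
    rw [e]
    exact ((continuous_postV.prodMk continuous_postU).comp continuous_swap).measurable
  have hg : ∀ᵐ ω ∂sphereMeasure, Measure.map (g ω) (GV.prod GV) = GV.prod GV :=
    ae_of_all _ fun ω => (measurePreserving_coll_gaussian (norm_sph ω)).map_eq
  have h1 : MeasurePreserving (fun q : Sph × (Vel × Vel) => (id q.1, g q.1 q.2))
      (sphereMeasure.prod (GV.prod GV)) (sphereMeasure.prod (GV.prod GV)) :=
    MeasurePreserving.skew_product (MeasurePreserving.id sphereMeasure) hm hg
  have h2 : MeasurePreserving (Prod.swap : Sph × (Vel × Vel) → Coll)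
      (sphereMeasure.prod (GV.prod GV)) collMeasure₀ := Measure.measurePreserving_swap
  have h3 : MeasurePreserving (Prod.swap : Coll → Sph × (Vel × Vel)) collMeasure₀
      (sphereMeasure.prod (GV.prod GV)) := Measure.measurePreserving_swap
  have h4 := h2.comp (h1.comp h3)
  have e : collMap = Prod.swap ∘ (fun q : Sph × (Vel × Vel) => (id q.1, g q.1 q.2)) ∘ Prod.swap := by
    ext1 q; rfl
  rw [e]
  exact h4

lemma measurePreserving_exch₀ : MeasurePreserving exch collMeasure₀ collMeasure₀ :=
  Measure.measurePreserving_swap.prod (MeasurePreserving.id _)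

lemma lintegral_collMeasure {f : Coll → ℝ≥0∞} (hf : Measurable f) :
    ∫⁻ q, f q ∂collMeasure = ∫⁻ q, ENNReal.ofReal (kern q) * f q ∂collMeasure₀ := by
  rw [collMeasure, lintegral_withDensity_eq_lintegral_mul _
    continuous_kern.measurable.ennreal_ofReal hf]
  rfl

lemma measurePreserving_withKern {T : Coll → Coll}
    (hT : MeasurePreserving T collMeasure₀ collMeasure₀) (hk : ∀ q, kern (T q) = kern q) :
    MeasurePreserving T collMeasure collMeasure where
  measurable := hT.measurable
  map_eq := by
    refine Measure.ext_of_lintegral _ fun f hf => ?_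
    have hc := lintegral_collMeasure (hf.comp hT.measurable)
    simp only [Function.comp_apply] at hc
    rw [lintegral_map hf hT.measurable, hc, lintegral_collMeasure hf]
    have := hT.lintegral_comp (f := fun q => ENNReal.ofReal (kern q) * f q)
      (continuous_kern.measurable.ennreal_ofReal.mul hf)
    simpa only [hk] using this

lemma measurePreserving_collMap : MeasurePreserving collMap collMeasure collMeasure :=
  measurePreserving_withKern measurePreserving_collMap₀ kern_collMap

lemma measurePreserving_exch : MeasurePreserving exch collMeasure collMeasure :=
  measurePreserving_withKern measurePreserving_exch₀ kern_exch

lemma measurePreserving_preV : MeasurePreserving preV collMeasure freqMeasure :=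
  ⟨continuous_preV.measurable, rfl⟩
lemma measurePreserving_preU : MeasurePreserving preU collMeasure freqMeasure :=
  measurePreserving_preV.comp measurePreserving_exch
lemma measurePreserving_postV : MeasurePreserving postV collMeasure freqMeasure :=
  measurePreserving_preV.comp measurePreserving_collMap
lemma measurePreserving_postU : MeasurePreserving postU collMeasure freqMeasure :=
  measurePreserving_preU.comp measurePreserving_collMap

lemma integrable_collMeasure_iff {f : Coll → ℝ} :
    Integrable f collMeasure ↔ Integrable (fun q => kern q * f q) collMeasure₀ := by
  rw [collMeasure, integrable_withDensity_iff_integrable_smul'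
    continuous_kern.measurable.ennreal_ofReal (by simp)]
  simp [ENNReal.toReal_ofReal (kern_nonneg _)]

lemma integral_collMeasure (f : Coll → ℝ) :
    ∫ q, f q ∂collMeasure = ∫ q, kern q * f q ∂collMeasure₀ := by
  rw [collMeasure, integral_withDensity_eq_integral_toReal_smul
    continuous_kern.measurable.ennreal_ofReal (by simp)]
  simp [ENNReal.toReal_ofReal (kern_nonneg _)]

/-- Square integrability with the weight `1 + |v|` with respect to the Gaussian measure. -/
structure WG (φ : Vel → ℝ) : Prop where
  measurable : Measurable φ
  integrable : Integrable (fun v => (1 + ‖v‖) * φ v ^ 2) GV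

lemma kern_le (q : Coll) : kern q ≤ (1 + ‖preU q‖) * (1 + ‖preV q‖) := by
  have h := abs_real_inner_le_norm (q.1.1 - q.1.2) (q.2 : Vel)
  rw [norm_sph, mul_one] at h
  have h2 := norm_sub_le q.1.1 q.1.2
  have h3 : 0 ≤ ‖q.1.1‖ * ‖q.1.2‖ := by positivity
  simp only [kern, preU, preV]
  nlinarith

/-- The kernel is at most `(1 + |u|)(1 + |v|)`, so a product of one function of each velocity is
square integrable for the collision measure. This is the reason for the weight in `WG`. -/
lemma WG.memLp_mul {φ ψ : Vel → ℝ} (hφ : WG φ) (hψ : WG ψ) :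
    MemLp (fun q => φ (preU q) * ψ (preV q)) 2 collMeasure := by
  have m1 := hφ.measurable
  have m2 := hψ.measurable
  have mm : Measurable fun q => φ (preU q) * ψ (preV q) :=
    (m1.comp continuous_preU.measurable).mul (m2.comp continuous_preV.measurable)
  rw [memLp_two_iff_integrable_sq mm.aestronglyMeasurable, integrable_collMeasure_iff]
  have h0 : Integrable (fun q : Coll => (((1 + ‖q.1.1‖) * ψ q.1.1 ^ 2) *
      ((1 + ‖q.1.2‖) * φ q.1.2 ^ 2)) * 1) collMeasure₀ :=
    (hψ.integrable.mul_prod hφ.integrable).mul_prod (integrable_const (1 : ℝ))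
  refine h0.mono' (continuous_kern.measurable.mul (mm.pow_const 2)).aestronglyMeasurable
    (ae_of_all _ fun q => ?_)
  rw [Real.norm_of_nonneg (mul_nonneg (kern_nonneg _) (sq_nonneg _))]
  calc kern q * (φ (preU q) * ψ (preV q)) ^ 2
      ≤ ((1 + ‖preU q‖) * (1 + ‖preV q‖)) * (φ (preU q) * ψ (preV q)) ^ 2 := by
        gcongr; exact kern_le q
    _ = _ := by simp only [preU, preV]; ring

lemma wg_one : WG fun _ => 1 where
  measurable := measurable_const
  integrable := by
    simpa using (integrable_const (1 : ℝ)).add (IsGaussian.integrable_id (μ := GV)).norm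

lemma WG.memLp_freq {φ : Vel → ℝ} (hφ : WG φ) : MemLp φ 2 freqMeasure := by
  have h := wg_one.memLp_mul hφ
  simp only [one_mul] at h
  rw [← measurePreserving_preV.map_eq]
  exact (memLp_map_measure_iff hφ.measurable.aestronglyMeasurable
    continuous_preV.measurable.aemeasurable).2 h

lemma WG.memLp {φ : Vel → ℝ} (hφ : WG φ) : MemLp φ 2 GV := by
  rw [memLp_two_iff_integrable_sq hφ.measurable.aestronglyMeasurable]
  refine hφ.integrable.mono' (hφ.measurable.pow_const 2).aestronglyMeasurable
    (ae_of_all _ fun v => ?_)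
  rw [Real.norm_of_nonneg (sq_nonneg _)]
  nlinarith [norm_nonneg v, sq_nonneg (φ v), mul_nonneg (norm_nonneg v) (sq_nonneg (φ v))]

lemma WG.add {φ ψ : Vel → ℝ} (hφ : WG φ) (hψ : WG ψ) : WG fun v => φ v + ψ v where
  measurable := hφ.measurable.add hψ.measurable
  integrable := by
    have m1 := hφ.measurable
    have m2 := hψ.measurable
    refine ((hφ.integrable.const_mul 2).add (hψ.integrable.const_mul 2)).mono' (by fun_prop)
      (ae_of_all _ fun v => ?_)
    have h1 : 0 ≤ 1 + ‖v‖ := by positivity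
    rw [Real.norm_of_nonneg (by positivity)]
    simp only [Pi.add_apply]
    nlinarith [mul_nonneg h1 (sq_nonneg (φ v - ψ v))]

lemma WG.const_mul {φ : Vel → ℝ} (hφ : WG φ) (c : ℝ) : WG fun v => c * φ v where
  measurable := hφ.measurable.const_mul c
  integrable := (hφ.integrable.const_mul (c ^ 2)).congr (ae_of_all _ fun v => by simp only; ring)

lemma WG.sub {φ ψ : Vel → ℝ} (hφ : WG φ) (hψ : WG ψ) : WG fun v => φ v - ψ v := by
  simpa [sub_eq_add_neg] using hφ.add (hψ.const_mul (-1))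

/-- `χ(v) + χ(u) - χ(v') - χ(u')`. -/
def cd (χ : Vel → ℝ) (q : Coll) : ℝ := χ (preV q) + χ (preU q) - χ (postV q) - χ (postU q)

lemma memLp_collDiff {χ : Vel → ℝ} (hχ : MemLp χ 2 freqMeasure) : MemLp (cd χ) 2 collMeasure :=
  (((hχ.comp_measurePreserving measurePreserving_preV).add
    (hχ.comp_measurePreserving measurePreserving_preU)).sub
    (hχ.comp_measurePreserving measurePreserving_postV)).sub
    (hχ.comp_measurePreserving measurePreserving_postU)

lemma cd_collMap (χ : Vel → ℝ) (q : Coll) : cd χ (collMap q) = -cd χ q := by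
  simp [cd]; ring

lemma cd_exch (χ : Vel → ℝ) (q : Coll) : cd χ (exch q) = cd χ q := by
  simp [cd]; ring

/-- The collision operator with respect to the Gaussian measure. -/
def gaussColl (φ ψ : Vel → ℝ) (v : Vel) : ℝ :=
  (∫ u, ∫ ω : Sph, kern ((v, u), ω) * (φ (postU ((v, u), ω)) * ψ (postV ((v, u), ω)))
      ∂sphereMeasure ∂GV)
  - ∫ u, ∫ ω : Sph, kern ((v, u), ω) * (φ u * ψ v) ∂sphereMeasure ∂GV

/-- Because `μ(u')μ(v') = μ(u)μ(v)`, one Maxwellian becomes the Gaussian measure in `u` and the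
other a prefactor. -/
lemma Gam_eq (φ ψ : Vel → ℝ) (v : Vel) :
    Gam (fun v => sqrtM v * φ v) (fun v => sqrtM v * ψ v) v = sqrtM v * gaussColl φ ψ v := by
  have hs := (sqrtM_pos v).ne'
  have h : collision (fun w => sqrtM w * (sqrtM w * φ w)) (fun w => sqrtM w * (sqrtM w * ψ w)) v
      = maxwellian v * gaussColl φ ψ v := by
    unfold collision gaussColl
    rw [integral_gaussian, integral_gaussian, mul_sub]
    congr 1
    · rw [← integral_const_mul]
      refine integral_congr_ae (ae_of_all _ fun u => ?_)
      simp only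
      rw [← integral_const_mul, ← integral_const_mul]
      refine integral_congr_ae (ae_of_all _ fun ω => ?_)
      have := maxwellian_coll (norm_sph ω) v u
      rw [coll_apply] at this
      simp only [kern, postU, postV, coll_apply, ← mul_assoc, sqrtM_mul_self] at this ⊢
      linear_combination (|⟪v - u, (ω : Vel)⟫| * φ (u + ⟪v - u, (ω : Vel)⟫ • (ω : Vel))
        * ψ (v - ⟪v - u, (ω : Vel)⟫ • (ω : Vel))) * this
    · rw [← integral_const_mul]
      refine integral_congr_ae (ae_of_all _ fun u => ?_)
      simp only
      rw [← integral_const_mul, ← integral_const_mul]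
      refine integral_congr_ae (ae_of_all _ fun ω => ?_)
      simp only [kern, ← mul_assoc, sqrtM_mul_self]
      ring
  rw [Gam, h, ← sqrtM_mul_self]
  field_simp

lemma integral_collMeasure_iterated {Φ : Coll → ℝ} (hΦ : Integrable Φ collMeasure) :
    Integrable (fun v => ∫ u, ∫ ω : Sph, kern ((v, u), ω) * Φ ((v, u), ω) ∂sphereMeasure ∂GV) GV ∧
    ∫ v, ∫ u, ∫ ω : Sph, kern ((v, u), ω) * Φ ((v, u), ω) ∂sphereMeasure ∂GV ∂GV
      = ∫ q, Φ q ∂collMeasure := by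
  rw [integrable_collMeasure_iff] at hΦ
  have h1 := hΦ.integral_prod_left
  refine ⟨h1.integral_prod_left, ?_⟩
  rw [integral_collMeasure, collMeasure₀, integral_prod _ hΦ, integral_prod _ h1]

/-- The change between velocities before and after collision moves the primes of the gain term to
the test function. Square integrability of all factors justifies the separation of gain and loss. -/
lemma integral_gaussColl_mul {φ ψ χ : Vel → ℝ} (hφ : WG φ) (hψ : WG ψ) (hχ : WG χ) :
    Integrable (fun v => gaussColl φ ψ v * χ v) GV ∧
    ∫ v, gaussColl φ ψ v * χ v ∂GV
      = ∫ q, φ (preU q) * ψ (preV q) * (χ (postV q) - χ (preV q)) ∂collMeasure := by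
  have hp := hφ.memLp_mul hψ
  have h1 := hχ.memLp_freq.comp_measurePreserving measurePreserving_preV
  have h2 := hχ.memLp_freq.comp_measurePreserving measurePreserving_postV
  have i1 : Integrable (fun q => φ (preU q) * ψ (preV q) * χ (preV q)) collMeasure :=
    integrable_mul_of_memLp hp h1
  have i2 : Integrable (fun q => φ (preU q) * ψ (preV q) * χ (postV q)) collMeasure :=
    integrable_mul_of_memLp hp h2
  have i3 : Integrable (fun q => φ (postU q) * ψ (postV q) * χ (preV q)) collMeasure := by
    have := measurePreserving_collMap.integrable_comp_of_integrable i2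
    simpa [Function.comp_def] using this
  have e3 : ∫ q, φ (postU q) * ψ (postV q) * χ (preV q) ∂collMeasure
      = ∫ q, φ (preU q) * ψ (preV q) * χ (postV q) ∂collMeasure := by
    have m : Measurable fun q => φ (preU q) * ψ (preV q) * χ (postV q) :=
      ((hφ.measurable.comp continuous_preU.measurable).mul
        (hψ.measurable.comp continuous_preV.measurable)).mul
        (hχ.measurable.comp continuous_postV.measurable)
    rw [← integral_comp_measurePreserving measurePreserving_collMap m]
    simp
  obtain ⟨j1, k1⟩ := integral_collMeasure_iterated i1
  obtain ⟨j3, k3⟩ := integral_collMeasure_iterated i3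
  have e : ∀ v, gaussColl φ ψ v * χ v
      = (∫ u, ∫ ω : Sph, kern ((v, u), ω) * (φ (postU ((v, u), ω)) * ψ (postV ((v, u), ω))
          * χ (preV ((v, u), ω))) ∂sphereMeasure ∂GV)
        - ∫ u, ∫ ω : Sph, kern ((v, u), ω) * (φ (preU ((v, u), ω)) * ψ (preV ((v, u), ω))
          * χ (preV ((v, u), ω))) ∂sphereMeasure ∂GV := fun v => by
    simp only [gaussColl, preV, preU, ← mul_assoc, integral_mul_const]
    ring
  simp only [e]
  refine ⟨j3.sub j1, ?_⟩
  rw [integral_sub j3 j1, k3, k1, e3, ← integral_sub i2 i1]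
  simp only [mul_sub]

end ViscousLayer
end

/-! ### The linearized operator as a symmetric form. -/

noncomputable section
namespace ViscousLayer
open ProbabilityTheory
open scoped RealInnerProductSpace ENNReal

/-! ### The energy form of the linearized operator -/

/-- The quotient by `√μ`. -/
def quot (g : Vel → ℝ) (v : Vel) : ℝ := g v / sqrtM v

lemma sqrtM_mul_quot (g : Vel → ℝ) (v : Vel) : sqrtM v * quot g v = g v :=
  mul_div_cancel₀ _ (sqrtM_pos v).ne'

lemma quot_sqrtM_mul (φ : Vel → ℝ) : quot (fun v => sqrtM v * φ v) = φ := by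
  ext v; exact mul_div_cancel_left₀ _ (sqrtM_pos v).ne'

lemma quot_add (g h : Vel → ℝ) : quot (fun v => g v + h v) = fun v => quot g v + quot h v := by
  ext v; simp [quot, add_div]

lemma quot_sub (g h : Vel → ℝ) : quot (fun v => g v - h v) = fun v => quot g v - quot h v := by
  ext v; simp [quot, sub_div]

lemma quot_const_mul (c : ℝ) (g : Vel → ℝ) : quot (fun v => c * g v) = fun v => c * quot g v := by
  ext v; simp [quot, mul_div_assoc]

/-- Square integrability with the weight `1 + |v|`. -/
structure WL2 (g : Vel → ℝ) : Prop where
  measurable : Measurable g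
  integrable : Integrable (fun v : Vel => (1 + ‖v‖) * g v ^ 2)

lemma IsLinvOf.wl2 {h g : Vel → ℝ} (H : IsLinvOf h g) : WL2 g := ⟨H.measurable, H.integrable⟩

lemma measurable_sqrtM : Measurable sqrtM := continuous_sqrtM.measurable

lemma maxwellian_mul_quot_sq (g : Vel → ℝ) (v : Vel) : maxwellian v * quot g v ^ 2 = g v ^ 2 := by
  rw [← sqrtM_mul_self, ← sqrtM_mul_quot g v]; ring

lemma wl2_iff {g : Vel → ℝ} : WL2 g ↔ WG (quot g) := by
  have e : (fun v : Vel => maxwellian v * ((1 + ‖v‖) * quot g v ^ 2))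
      = fun v => (1 + ‖v‖) * g v ^ 2 := by
    ext v; rw [← maxwellian_mul_quot_sq g]; ring
  constructor
  · intro h
    refine ⟨h.measurable.div measurable_sqrtM, ?_⟩
    rw [integrable_gaussian_iff, e]; exact h.integrable
  · intro h
    refine ⟨?_, ?_⟩
    · have := measurable_sqrtM.mul h.measurable
      have e2 : sqrtM * quot g = g := funext fun v => sqrtM_mul_quot g v
      rwa [e2] at this
    · have := h.integrable
      rwa [integrable_gaussian_iff, e] at this

lemma WG.wl2 {φ : Vel → ℝ} (h : WG φ) : WL2 fun v => sqrtM v * φ v := by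
  rw [wl2_iff, quot_sqrtM_mul]; exact h

lemma WL2.wg {g : Vel → ℝ} (h : WL2 g) : WG (quot g) := wl2_iff.1 h

lemma WL2.add {g h : Vel → ℝ} (hg : WL2 g) (hh : WL2 h) : WL2 fun v => g v + h v := by
  rw [wl2_iff]
  have := hg.wg.add hh.wg
  rwa [quot_add]

lemma WL2.sub {g h : Vel → ℝ} (hg : WL2 g) (hh : WL2 h) : WL2 fun v => g v - h v := by
  rw [wl2_iff]
  have := hg.wg.sub hh.wg
  rwa [quot_sub]

lemma WL2.const_mul {g : Vel → ℝ} (hg : WL2 g) (c : ℝ) : WL2 fun v => c * g v := by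
  rw [wl2_iff]
  have := hg.wg.const_mul c
  rwa [quot_const_mul]

lemma WL2.memLp {g : Vel → ℝ} (hg : WL2 g) : MemLp g 2 volume := by
  rw [memLp_two_iff_integrable_sq hg.measurable.aestronglyMeasurable]
  refine hg.integrable.mono' (hg.measurable.pow_const 2).aestronglyMeasurable
    (ae_of_all _ fun v => ?_)
  rw [Real.norm_of_nonneg (sq_nonneg _)]
  nlinarith [mul_nonneg (norm_nonneg v) (sq_nonneg (g v))]

lemma WL2.integrable_mul {g h : Vel → ℝ} (hg : WL2 g) (hh : WL2 h) :
    Integrable fun v => g v * h v := integrable_mul_of_memLp hg.memLp hh.memLp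

lemma ip_eq_gaussian (g h : Vel → ℝ) : ip g h = ∫ v, quot g v * quot h v ∂GV := by
  rw [integral_gaussian]
  refine integral_congr_ae (ae_of_all _ fun v => ?_)
  simp only
  rw [← sqrtM_mul_quot g v, ← sqrtM_mul_quot h v, ← sqrtM_mul_self]; ring

lemma Gam_eq' (g h : Vel → ℝ) (v : Vel) : Gam g h v = sqrtM v * gaussColl (quot g) (quot h) v := by
  rw [← Gam_eq]
  simp only [sqrtM_mul_quot]

lemma integral_Gam_mul {g h k : Vel → ℝ} (hg : WL2 g) (hh : WL2 h) (hk : WL2 k) :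
    Integrable (fun v => Gam g h v * k v) ∧
    ip (Gam g h) k = ∫ q, quot g (preU q) * quot h (preV q)
      * (quot k (postV q) - quot k (preV q)) ∂collMeasure := by
  obtain ⟨h1, h2⟩ := integral_gaussColl_mul hg.wg hh.wg hk.wg
  rw [integrable_gaussian_iff] at h1
  rw [integral_gaussian] at h2
  have e : (fun v => Gam g h v * k v)
      = fun v => maxwellian v * (gaussColl (quot g) (quot h) v * quot k v) := by
    ext v
    rw [Gam_eq', ← sqrtM_mul_self]
    conv_lhs => rw [← sqrtM_mul_quot k v]
    ring
  exact ⟨by rw [e]; exact h1, by rw [ip, e, h2]⟩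

/-- Exchanging the particles in `Γ(h, g)` makes the product of the two arguments common to both
halves, and the test functions combine to a collision difference. -/
lemma integral_GamS_mul {g h k : Vel → ℝ} (hg : WL2 g) (hh : WL2 h) (hk : WL2 k) :
    Integrable (fun v => GamS g h v * k v) ∧
    ip (GamS g h) k = -∫ q, quot g (preU q) * quot h (preV q) * cd (quot k) q ∂collMeasure := by
  obtain ⟨i1, e1⟩ := integral_Gam_mul hg hh hk
  obtain ⟨i2, e2⟩ := integral_Gam_mul hh hg hk
  have e : (fun v => GamS g h v * k v) = fun v => Gam g h v * k v + Gam h g v * k v := by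
    ext v; simp only [GamS]; ring
  refine ⟨by rw [e]; exact i1.add i2, ?_⟩
  have hp := hg.wg.memLp_mul hh.wg
  have hk1 := hk.wg.memLp_freq.comp_measurePreserving measurePreserving_preV
  have hk2 := hk.wg.memLp_freq.comp_measurePreserving measurePreserving_postV
  have hk3 := hk.wg.memLp_freq.comp_measurePreserving measurePreserving_preU
  have hk4 := hk.wg.memLp_freq.comp_measurePreserving measurePreserving_postU
  have m1 : Measurable fun q => quot h (preU q) * quot g (preV q)
      * (quot k (postV q) - quot k (preV q)) :=
    ((hh.wg.measurable.comp continuous_preU.measurable).mul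
      (hg.wg.measurable.comp continuous_preV.measurable)).mul
      ((hk.wg.measurable.comp continuous_postV.measurable).sub
        (hk.wg.measurable.comp continuous_preV.measurable))
  rw [← integral_comp_measurePreserving measurePreserving_exch m1] at e2
  simp only [preU_exch, preV_exch, postV_exch] at e2
  have j1 : Integrable (fun q => quot g (preU q) * quot h (preV q)
      * (quot k (postV q) - quot k (preV q))) collMeasure := integrable_mul_of_memLp hp (hk2.sub hk1)
  have j2 : Integrable (fun q => quot h (preV q) * quot g (preU q)
      * (quot k (postU q) - quot k (preU q))) collMeasure := by
    have := integrable_mul_of_memLp hp (hk4.sub hk3)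
    refine this.congr (ae_of_all _ fun q => ?_)
    simp only [Pi.sub_apply, Function.comp_apply]; ring
  have : ip (GamS g h) k = ip (Gam g h) k + ip (Gam h g) k := by
    rw [ip, e, integral_add i1 i2]; rfl
  rw [this, e1, e2, ← integral_add j1 j2, ← integral_neg]
  refine integral_congr_ae (ae_of_all _ fun q => ?_)
  simp only [cd]; ring

/-- The Dirichlet form of the linearized operator. -/
def energy (g h : Vel → ℝ) : ℝ := (1 / 4) * ∫ q, cd (quot g) q * cd (quot h) q ∂collMeasure

lemma quot_sqrtM : quot sqrtM = fun _ => 1 := by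
  ext v; exact div_self (sqrtM_pos v).ne'

lemma wl2_sqrtM : WL2 sqrtM := by rw [wl2_iff, quot_sqrtM]; exact wg_one

lemma linL_eq (g : Vel → ℝ) (v : Vel) : linL g v = -GamS sqrtM g v := by
  have : maxwellian = fun v => sqrtM v * sqrtM v := by ext v; rw [sqrtM_mul_self]
  simp only [linL, GamS, Gam, ← this]
  ring

lemma WL2.memLp_cd {g : Vel → ℝ} (hg : WL2 g) : MemLp (cd (quot g)) 2 collMeasure :=
  memLp_collDiff hg.wg.memLp_freq

lemma measurable_cd {φ : Vel → ℝ} (hφ : Measurable φ) : Measurable (cd φ) :=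
  (((hφ.comp continuous_preV.measurable).add (hφ.comp continuous_preU.measurable)).sub
    (hφ.comp continuous_postV.measurable)).sub (hφ.comp continuous_postU.measurable)

/-- The collision difference of `k` is invariant under exchange of particles and odd under the
collision map. Averaging over the four resulting forms of the integral replaces `g` by its own
collision difference, with factor `1/4`. -/
lemma integral_linL_mul {g k : Vel → ℝ} (hg : WL2 g) (hk : WL2 k) :
    Integrable (fun v => linL g v * k v) ∧ ip (linL g) k = energy g k := by
  obtain ⟨i, e⟩ := integral_GamS_mul wl2_sqrtM hg hk
  have e0 : (fun v => linL g v * k v) = fun v => -(GamS sqrtM g v * k v) := by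
    ext v; rw [linL_eq]; ring
  refine ⟨by rw [e0]; exact i.neg, ?_⟩
  simp only [quot_sqrtM, one_mul] at e
  have hc := hk.memLp_cd
  have mg := hg.wg.measurable
  have mc := measurable_cd hk.wg.measurable
  have p1 := hg.wg.memLp_freq.comp_measurePreserving measurePreserving_preV
  have p2 := hg.wg.memLp_freq.comp_measurePreserving measurePreserving_preU
  have p3 := hg.wg.memLp_freq.comp_measurePreserving measurePreserving_postV
  have p4 := hg.wg.memLp_freq.comp_measurePreserving measurePreserving_postU
  have m1 : Measurable fun q => quot g (preV q) * cd (quot k) q :=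
    (mg.comp continuous_preV.measurable).mul mc
  have m3 : Measurable fun q => quot g (preU q) * cd (quot k) q :=
    (mg.comp continuous_preU.measurable).mul mc
  have k2 := integral_comp_measurePreserving measurePreserving_exch m1
  have k3 := integral_comp_measurePreserving measurePreserving_collMap m1
  have k4 := integral_comp_measurePreserving measurePreserving_collMap m3
  simp only [preV_exch, cd_exch, preV_collMap, preU_collMap, cd_collMap, mul_neg] at k2 k3 k4
  rw [integral_neg] at k3 k4
  have i1 := integrable_mul_of_memLp p1 hc
  have i2 := integrable_mul_of_memLp p2 hc
  have i3 := integrable_mul_of_memLp p3 hc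
  have i4 := integrable_mul_of_memLp p4 hc
  simp only [Function.comp_apply] at i1 i2 i3 i4
  have es : ∀ q, cd (quot g) q * cd (quot k) q = quot g (preV q) * cd (quot k) q
      + quot g (preU q) * cd (quot k) q - quot g (postV q) * cd (quot k) q
      - quot g (postU q) * cd (quot k) q := fun q => by
    rw [cd]; ring
  have : ip (linL g) k = ∫ q, quot g (preV q) * cd (quot k) q ∂collMeasure := by
    rw [ip, e0, integral_neg]
    rw [ip] at e
    rw [e, neg_neg]
  rw [this, energy]
  simp only [es]
  rw [integral_sub ((i1.fun_add i2).sub' i3) i4, integral_sub (i1.fun_add i2) i3,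
    integral_add i1 i2]
  linarith

lemma energy_comm (g h : Vel → ℝ) : energy g h = energy h g := by
  simp only [energy, mul_comm]

lemma cd_add (φ ψ : Vel → ℝ) (q : Coll) : cd (fun v => φ v + ψ v) q = cd φ q + cd ψ q := by
  simp only [cd]; ring

lemma cd_sub (φ ψ : Vel → ℝ) (q : Coll) : cd (fun v => φ v - ψ v) q = cd φ q - cd ψ q := by
  simp only [cd]; ring

lemma cd_const_mul (c : ℝ) (φ : Vel → ℝ) (q : Coll) : cd (fun v => c * φ v) q = c * cd φ q := by
  simp only [cd]; ring

lemma energy_add_left {g h k : Vel → ℝ} (hg : WL2 g) (hh : WL2 h) (hk : WL2 k) :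
    energy (fun v => g v + h v) k = energy g k + energy h k := by
  simp only [energy, quot_add, cd_add, add_mul]
  rw [integral_add (integrable_mul_of_memLp hg.memLp_cd hk.memLp_cd)
    (integrable_mul_of_memLp hh.memLp_cd hk.memLp_cd), mul_add]

lemma energy_const_mul_left (c : ℝ) (g k : Vel → ℝ) :
    energy (fun v => c * g v) k = c * energy g k := by
  simp only [energy, quot_const_mul, cd_const_mul, mul_assoc]
  rw [integral_const_mul]; ring

lemma energy_sub_left {g h k : Vel → ℝ} (hg : WL2 g) (hh : WL2 h) (hk : WL2 k) :
    energy (fun v => g v - h v) k = energy g k - energy h k := by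
  simp only [energy, quot_sub, cd_sub, sub_mul]
  rw [integral_sub (integrable_mul_of_memLp hg.memLp_cd hk.memLp_cd)
    (integrable_mul_of_memLp hh.memLp_cd hk.memLp_cd), mul_sub]

lemma energy_self_nonneg (g : Vel → ℝ) : 0 ≤ energy g g :=
  mul_nonneg (by norm_num) (integral_nonneg fun q => mul_self_nonneg _)

/-- A function that is tested to zero vanishes. -/
lemma ae_eq_zero_of_forall_ip {w : Vel → ℝ} (hi : ∀ k, WL2 k → Integrable fun v => w v * k v)
    (h : ∀ k, WL2 k → ip w k = 0) : w =ᵐ[volume] 0 := by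
  have h1 : (fun v => w v * sqrtM v) =ᵐ[volume] 0 := by
    refine Integrable.ae_eq_zero_of_forall_setIntegral_eq_zero (hi _ wl2_sqrtM) fun s hs _ => ?_
    -- Restrictions of `√μ` to measurable sets suffice as test functions, since `√μ` is positive.
    have hk : WL2 (s.indicator sqrtM) := by
      refine ⟨measurable_sqrtM.indicator hs, ?_⟩
      refine (wl2_sqrtM.integrable.indicator hs).congr (ae_of_all _ fun v => ?_)
      by_cases hv : v ∈ s <;> simp [hv]
    rw [← h _ hk, ip, ← integral_indicator hs]
    refine integral_congr_ae (ae_of_all _ fun v => ?_)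
    by_cases hv : v ∈ s <;> simp [hv]
  filter_upwards [h1] with v hv
  exact (mul_eq_zero.1 hv).resolve_right (sqrtM_pos v).ne'

/-- For functions that are only in the weighted `L²` space the collision integrals need not converge
at every velocity, so additivity is obtained almost everywhere, by pairing with test functions. -/
lemma linL_add_ae {g h : Vel → ℝ} (hg : WL2 g) (hh : WL2 h) :
    linL (fun v => g v + h v) =ᵐ[volume] fun v => linL g v + linL h v := by
  have e : ∀ k : Vel → ℝ, (fun v => (linL (fun v => g v + h v) v - (linL g v + linL h v)) * k v)
      = fun v => linL (fun v => g v + h v) v * k v - (linL g v * k v + linL h v * k v) := by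
    intro k; ext v; ring
  have := ae_eq_zero_of_forall_ip
    (w := fun v => linL (fun v => g v + h v) v - (linL g v + linL h v)) ?_ ?_
  · filter_upwards [this] with v hv
    exact sub_eq_zero.1 hv
  · intro k hk
    rw [e]
    exact (integral_linL_mul (hg.add hh) hk).1.sub
      ((integral_linL_mul hg hk).1.add (integral_linL_mul hh hk).1)
  · intro k hk
    obtain ⟨i1, e1⟩ := integral_linL_mul (hg.add hh) hk
    obtain ⟨i2, e2⟩ := integral_linL_mul hg hk
    obtain ⟨i3, e3⟩ := integral_linL_mul hh hk
    rw [ip] at e1 e2 e3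
    rw [ip, e, integral_sub i1 (i2.fun_add i3), integral_add i2 i3, e1, e2, e3,
      energy_add_left hg hh hk, sub_self]

lemma linL_const_mul_ae {g : Vel → ℝ} (c : ℝ) : linL (fun v => c * g v) = fun v => c * linL g v := by
  ext v
  simp only [linL_eq, GamS, Gam_eq', quot_const_mul, gaussColl, mul_assoc, integral_const_mul,
    mul_left_comm _ c]
  ring

/-! ### Coercivity -/

/-- This connects the estimates for fixed directions to the Dirichlet form. -/
lemma lintegral_dissip {φ : Vel → ℝ} (hφ : Measurable φ) :
    ∫⁻ ω : Sph, dissip φ ω ∂sphereMeasure = ∫⁻ q, ENNReal.ofReal (cd φ q ^ 2) ∂collMeasure := by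
  have mc := measurable_cd hφ
  rw [lintegral_collMeasure (mc.pow_const 2).ennreal_ofReal, collMeasure₀, lintegral_prod_symm]
  · refine lintegral_congr fun ω => lintegral_congr fun p => ?_
    rw [ENNReal.ofReal_mul (abs_nonneg _)]
    rfl
  · exact (continuous_kern.measurable.ennreal_ofReal.mul
      (mc.pow_const 2).ennreal_ofReal).aemeasurable

end ViscousLayer
end

/-! ### Rapidly decreasing functions and Gaussian moments of polynomials. -/

noncomputable section
namespace ViscousLayer
open ProbabilityTheory
open scoped RealInnerProductSpace ENNReal

/-! ### Rapidly decreasing functions of the velocity -/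

/-- Measurable functions that decay faster than any power. -/
structure Rapid (g : Vel → ℝ) : Prop where
  measurable : Measurable g
  bound : ∀ q : ℕ, ∃ C : ℝ, ∀ v : Vel, (1 + ‖v‖) ^ q * |g v| ≤ C

lemma Rapid.add {g h : Vel → ℝ} (hg : Rapid g) (hh : Rapid h) : Rapid fun v => g v + h v where
  measurable := hg.measurable.add hh.measurable
  bound q := by
    obtain ⟨C, hC⟩ := hg.bound q
    obtain ⟨C', hC'⟩ := hh.bound q
    refine ⟨C + C', fun v => ?_⟩
    calc (1 + ‖v‖) ^ q * |g v + h v| ≤ (1 + ‖v‖) ^ q * (|g v| + |h v|) := by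
          gcongr; exact abs_add_le _ _
      _ ≤ C + C' := by rw [mul_add]; exact add_le_add (hC v) (hC' v)

lemma Rapid.const_mul {g : Vel → ℝ} (hg : Rapid g) (c : ℝ) : Rapid fun v => c * g v where
  measurable := hg.measurable.const_mul c
  bound q := by
    obtain ⟨C, hC⟩ := hg.bound q
    refine ⟨|c| * C, fun v => ?_⟩
    rw [abs_mul, mul_left_comm]
    exact mul_le_mul_of_nonneg_left (hC v) (abs_nonneg c)

lemma Rapid.neg {g : Vel → ℝ} (hg : Rapid g) : Rapid fun v => -g v := by
  simpa using hg.const_mul (-1)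

lemma Rapid.sub {g h : Vel → ℝ} (hg : Rapid g) (hh : Rapid h) : Rapid fun v => g v - h v := by
  simpa [sub_eq_add_neg] using hg.add hh.neg

lemma rapid_zero : Rapid fun _ => 0 := ⟨measurable_const, fun q => ⟨0, fun v => by simp⟩⟩

lemma Rapid.sum {ι : Type*} (s : Finset ι) {g : ι → Vel → ℝ} (hg : ∀ i ∈ s, Rapid (g i)) :
    Rapid fun v => ∑ i ∈ s, g i v := by
  classical
  induction s using Finset.induction_on with
  | empty => simpa using rapid_zero
  | insert i s hi ih =>
    simp only [Finset.sum_insert hi]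
    exact (hg i (Finset.mem_insert_self i s)).add
      (ih fun j hj => hg j (Finset.mem_insert_of_mem hj))

lemma Rapid.coord_mul {g : Vel → ℝ} (hg : Rapid g) (i : Fin 3) : Rapid fun v => v i * g v where
  measurable := by
    have := hg.measurable
    fun_prop
  bound q := by
    obtain ⟨C, hC⟩ := hg.bound (q + 1)
    refine ⟨C, fun v => le_trans ?_ (hC v)⟩
    rw [abs_mul, pow_succ, mul_assoc]
    have h1 : |v i| ≤ 1 + ‖v‖ := by
      have := PiLp.norm_apply_le v i
      rw [Real.norm_eq_abs] at this
      linarith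
    gcongr

lemma rapid_sqrtM : Rapid sqrtM where
  measurable := measurable_sqrtM
  bound q := by
    -- The factorial comes from `s^q ≤ q! e^s` with `s = 1 + |v|`; the exponent 2 is the maximum of
    -- `1 + r - r²/4` over `r`.
    refine ⟨(q.factorial : ℝ) * Real.exp 2 * (2 * Real.pi) ^ (-(3 / 4) : ℝ), fun v => ?_⟩
    rw [abs_of_pos (sqrtM_pos v), sqrtM_eq]
    have h1 : (1 + ‖v‖) ^ q ≤ q.factorial * Real.exp (1 + ‖v‖) := by
      have := Real.pow_div_factorial_le_exp (1 + ‖v‖) (by positivity) q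
      rwa [div_le_iff₀ (by positivity), mul_comm] at this
    have h2 : Real.exp (1 + ‖v‖) * Real.exp (-‖v‖ ^ 2 / 4) ≤ Real.exp 2 := by
      rw [← Real.exp_add]
      apply Real.exp_le_exp.2
      nlinarith [sq_nonneg (‖v‖ / 2 - 1)]
    calc (1 + ‖v‖) ^ q * ((2 * Real.pi) ^ (-(3 / 4) : ℝ) * Real.exp (-‖v‖ ^ 2 / 4))
        ≤ (q.factorial * Real.exp (1 + ‖v‖))
          * ((2 * Real.pi) ^ (-(3 / 4) : ℝ) * Real.exp (-‖v‖ ^ 2 / 4)) := by gcongr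
      _ = q.factorial * (Real.exp (1 + ‖v‖) * Real.exp (-‖v‖ ^ 2 / 4))
          * (2 * Real.pi) ^ (-(3 / 4) : ℝ) := by ring
      _ ≤ _ := by gcongr

lemma Rapid.wl2 {g : Vel → ℝ} (hg : Rapid g) : WL2 g where
  measurable := hg.measurable
  integrable := by
    obtain ⟨C, hC⟩ := hg.bound 3
    have h4 : Integrable (fun v : Vel => (1 + ‖v‖) ^ (-(4 : ℝ))) :=
      integrable_one_add_norm (by simp; norm_num)
    refine (h4.const_mul (C ^ 2)).mono' ?_ (ae_of_all _ fun v => ?_)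
    · have := hg.measurable
      exact Measurable.aestronglyMeasurable (by fun_prop)
    · have h0 : (0 : ℝ) < 1 + ‖v‖ := by positivity
      rw [Real.norm_of_nonneg (by positivity), Real.rpow_neg h0.le, ← div_eq_mul_inv,
        le_div_iff₀ (by positivity)]
      have h1 : (1 + ‖v‖) ^ (4 : ℝ) = (1 + ‖v‖) ^ 4 := by
        rw [← Real.rpow_natCast]; norm_num
      have h2 : ((1 + ‖v‖) ^ 3 * |g v|) ^ 2 ≤ C ^ 2 := by
        have := hC v
        gcongr
      have h3 : 1 ≤ 1 + ‖v‖ := by linarith [norm_nonneg v]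
      rw [h1]
      rw [mul_pow, sq_abs] at h2
      have h5 : (1 + ‖v‖) ^ 5 ≤ (1 + ‖v‖) ^ 6 := pow_le_pow_right₀ h3 (by norm_num)
      calc (1 + ‖v‖) * g v ^ 2 * (1 + ‖v‖) ^ 4 = (1 + ‖v‖) ^ 5 * g v ^ 2 := by ring
        _ ≤ (1 + ‖v‖) ^ 6 * g v ^ 2 := by gcongr
        _ = ((1 + ‖v‖) ^ 3) ^ 2 * g v ^ 2 := by ring
        _ ≤ C ^ 2 := h2

/-! ### Polynomials times `√μ` -/

open MvPolynomial in
/-- The product of a polynomial and `√μ`. -/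
def pf (P : MvPolynomial (Fin 3) ℝ) (v : Vel) : ℝ := eval (fun i => v i) P * sqrtM v

lemma rapid_pf (P : MvPolynomial (Fin 3) ℝ) : Rapid (pf P) := by
  induction P using MvPolynomial.induction_on with
  | C a =>
    have e : pf (MvPolynomial.C a) = fun v => a * sqrtM v := by ext v; simp [pf]
    rw [e]; exact rapid_sqrtM.const_mul a
  | add p q hp hq =>
    have e : pf (p + q) = fun v => pf p v + pf q v := by ext v; simp [pf, add_mul]
    rw [e]; exact hp.add hq
  | mul_X p i hp =>
    have e : pf (p * MvPolynomial.X i) = fun v => v i * pf p v := by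
      ext v; simp only [pf, map_mul, MvPolynomial.eval_X]; ring
    rw [e]; exact hp.coord_mul i

lemma quot_pf (P : MvPolynomial (Fin 3) ℝ) (v : Vel) :
    quot (pf P) v = MvPolynomial.eval (fun i => v i) P :=
  mul_div_cancel_right₀ _ (sqrtM_pos v).ne'

lemma pf_one : pf 1 = sqrtM := by ext v; simp [pf]

lemma integrable_eval (P : MvPolynomial (Fin 3) ℝ) :
    Integrable (fun v : Vel => MvPolynomial.eval (fun i => v i) P) GV := by
  have := integrable_mul_of_memLp (rapid_pf P).wl2.wg.memLp wg_one.memLp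
  simpa only [quot_pf, mul_one] using this

/-- Integration of polynomials with respect to the Gaussian measure. -/
def gm : MvPolynomial (Fin 3) ℝ →ₗ[ℝ] ℝ where
  toFun P := ∫ v : Vel, MvPolynomial.eval (fun i => v i) P ∂GV
  map_add' P Q := by
    simp only [map_add]; exact integral_add (integrable_eval P) (integrable_eval Q)
  map_smul' c P := by
    simp only [MvPolynomial.smul_eval, RingHom.id_apply, smul_eq_mul]
    exact integral_const_mul _ _

lemma ip_pf (P Q : MvPolynomial (Fin 3) ℝ) : ip (pf P) (pf Q) = gm (P * Q) := by
  rw [ip_eq_gaussian]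
  simp only [quot_pf, gm, LinearMap.coe_mk, AddHom.coe_mk, map_mul]

lemma gm_one : gm 1 = 1 := by simp [gm]

/-- The components of a standard Gaussian vector are independent, so monomials factor into
one-dimensional moments. -/
lemma gm_monomial (s : Fin 3 →₀ ℕ) (c : ℝ) :
    gm (MvPolynomial.monomial s c) = c * ∏ i, ∫ x, x ^ s i ∂γ := by
  have e : gm (MvPolynomial.monomial s c)
      = ∫ x : Fin 3 → ℝ, c * ∏ i, x i ^ s i ∂(Measure.pi fun _ => γ) := by
    simp only [gm, LinearMap.coe_mk, AddHom.coe_mk, MvPolynomial.eval_monomial]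
    have hGV : GV = _ :=
      stdGaussian_eq_map_pi_orthonormalBasis (EuclideanSpace.basisFun (Fin 3) ℝ)
    rw [hGV, integral_map]
    · refine integral_congr_ae (ae_of_all _ fun x => ?_)
      simp only [EuclideanSpace.basisFun_apply, Fin.sum_univ_three]
      rw [Finsupp.prod_fintype _ _ (by simp)]
      congr 1
      refine Finset.prod_congr rfl fun i _ => ?_
      fin_cases i <;> simp
    · exact Measurable.aemeasurable (by fun_prop)
    · refine Continuous.aestronglyMeasurable ?_
      simp only [Finsupp.prod]
      fun_prop
  rw [e, integral_const_mul, integral_fintype_prod_eq_prod (f := fun i x => x ^ s i)]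

/-- Gaussian integration by parts. -/
lemma gm_X_mul (i : Fin 3) (P : MvPolynomial (Fin 3) ℝ) :
    gm (MvPolynomial.X i * P) = gm (MvPolynomial.pderiv i P) := by
  induction P using MvPolynomial.induction_on' with
  | monomial s c =>
    rw [MvPolynomial.pderiv_monomial, MvPolynomial.X, MvPolynomial.monomial_mul, gm_monomial,
      gm_monomial, one_mul, mul_assoc]
    congr 1
    rw [Fintype.prod_eq_mul_prod_compl i, Fintype.prod_eq_mul_prod_compl i, ← mul_assoc]
    congr 1
    · simp only [Finsupp.add_apply, Finsupp.single_eq_same, Finsupp.tsub_apply]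
      rcases s i with _ | n
      · simp
      · have := integral_pow_gaussian n
        rw [show 1 + (n + 1) = n + 2 by ring, this]
        simp
    · refine Finset.prod_congr rfl fun j hj => ?_
      have : i ≠ j := by
        rintro rfl; simp at hj
      simp [this]
  | add p q hp hq => rw [mul_add, map_add, map_add, map_add, hp, hq]

end ViscousLayer
end

/-! ### Collision invariants, conservation laws and uniqueness of `L⁻¹`. -/

noncomputable section
namespace ViscousLayer
open ProbabilityTheory MvPolynomial
open scoped RealInnerProductSpace ENNReal

/-! ### Collision invariants -/

/-- The polynomial `|v|²`. -/
def sqP : MvPolynomial (Fin 3) ℝ := ∑ k, X k * X k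

/-- The collision invariant `ρ + u·v + θ(|v|²-3)/2`. -/
def invP (ρ : ℝ) (u : Fin 3 → ℝ) (θ : ℝ) : MvPolynomial (Fin 3) ℝ :=
  C ρ + ∑ k, C (u k) * X k + C (θ / 2) * (sqP - 3)

lemma eval_sqP (v : Vel) : eval (fun i => v i) sqP = ‖v‖ ^ 2 := by
  rw [EuclideanSpace.real_norm_sq_eq]
  simp [sqP, pow_two]

lemma eval_invP (ρ : ℝ) (u : Fin 3 → ℝ) (θ : ℝ) (v : Vel) :
    eval (fun i => v i) (invP ρ u θ) = ρ + ∑ k, u k * v k + θ / 2 * (‖v‖ ^ 2 - 3) := by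
  simp [invP, eval_sqP]

lemma proj_eq (g : Vel → ℝ) : proj g = pf (invP (rho g) (fun i => vel i g) (temp g)) := by
  ext v; simp only [proj, pf, eval_invP]

lemma gm_C_mul (c : ℝ) (P : MvPolynomial (Fin 3) ℝ) : gm (C c * P) = c * gm P := by
  rw [← smul_eq_C_mul, map_smul, smul_eq_mul]

lemma gm_C (c : ℝ) : gm (C c) = c := by
  have := gm_C_mul c 1
  rwa [mul_one, gm_one, mul_one] at this

lemma gm_X (i : Fin 3) : gm (X i) = 0 := by
  have := gm_X_mul i 1
  rwa [mul_one, (pderiv i).map_one_eq_zero, map_zero] at this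

/-- Two integrations by parts. Through this identity moments of products of invariants reduce to the
product rule, without any table of Gaussian moments. -/
lemma gm_X_mul_X_mul (i j : Fin 3) (P : MvPolynomial (Fin 3) ℝ) :
    gm (X i * X j * P) = (if i = j then gm P else 0) + gm (pderiv j (pderiv i P)) := by
  rw [mul_assoc, gm_X_mul, Derivation.leibniz, smul_eq_mul, smul_eq_mul, map_add, gm_X_mul,
    pderiv_X, add_comm]
  congr 1
  by_cases h : i = j
  · subst h; simp
  · rw [Pi.single_eq_of_ne (Ne.symm h)]; simp [h]

lemma gm_sqP_mul (P : MvPolynomial (Fin 3) ℝ) :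
    gm (sqP * P) = 3 * gm P + ∑ k, gm (pderiv k (pderiv k P)) := by
  simp only [sqP, Finset.sum_mul, map_sum, gm_X_mul_X_mul, Finset.sum_add_distrib]
  simp

lemma pderiv_sqP (i : Fin 3) : pderiv i sqP = C 2 * X i := by
  simp only [sqP, Fin.sum_univ_three, map_add, Derivation.leibniz, smul_eq_mul, pderiv_X]
  fin_cases i <;> simp <;> rw [← two_mul] <;> rfl

lemma pderiv_invP (i : Fin 3) (ρ : ℝ) (u : Fin 3 → ℝ) (θ : ℝ) :
    pderiv i (invP ρ u θ) = C (u i) + C θ * X i := by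
  have h3 : pderiv i (3 : MvPolynomial (Fin 3) ℝ) = 0 := by
    have : (3 : MvPolynomial (Fin 3) ℝ) = C 3 := (map_ofNat C 3).symm
    rw [this, pderiv_C]
  have h2 : C (θ / 2) * (C 2 * X i) = (C θ * X i : MvPolynomial (Fin 3) ℝ) := by
    rw [← mul_assoc, ← C_mul]; congr 2; ring
  have h1 : pderiv i (∑ k, C (u k) * X k : MvPolynomial (Fin 3) ℝ) = C (u i) := by
    simp only [map_sum, pderiv_C_mul, pderiv_X]
    rw [Finset.sum_eq_single i]
    · simp
    · intro j _ hj; rw [Pi.single_eq_of_ne hj]; simp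
    · simp
  rw [invP, map_add, map_add, pderiv_C, zero_add, h1, pderiv_C_mul, map_sub, h3, sub_zero,
    pderiv_sqP, h2]

lemma pderiv_pderiv_invP (i j : Fin 3) (ρ : ℝ) (u : Fin 3 → ℝ) (θ : ℝ) :
    pderiv j (pderiv i (invP ρ u θ)) = if i = j then C θ else 0 := by
  rw [pderiv_invP, map_add, pderiv_C, zero_add, pderiv_C_mul, pderiv_X]
  by_cases h : i = j
  · subst h; simp
  · rw [Pi.single_eq_of_ne h]; simp [h]

lemma gm_invP (ρ : ℝ) (u : Fin 3 → ℝ) (θ : ℝ) : gm (invP ρ u θ) = ρ := by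
  have h1 := gm_sqP_mul 1
  have h2 : ∀ k : Fin 3, pderiv k (1 : MvPolynomial (Fin 3) ℝ) = 0 :=
    fun k => (pderiv k).map_one_eq_zero
  simp only [h2, map_zero, mul_one, gm_one, Finset.sum_const_zero, add_zero] at h1
  have h3 : gm 3 = 3 := by
    have : (3 : MvPolynomial (Fin 3) ℝ) = C 3 := (map_ofNat C 3).symm
    rw [this, gm_C]
  rw [invP, map_add, map_add, gm_C, gm_C_mul, map_sub, h1, h3, map_sum]
  simp [gm_C_mul, gm_X]

lemma rho_pf (P : MvPolynomial (Fin 3) ℝ) : rho (pf P) = gm P := by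
  rw [rho, ← pf_one, ip_pf, mul_one]

lemma vel_fun_eq (i : Fin 3) : (fun v : Vel => v i * sqrtM v) = pf (X i) := by
  ext v; simp [pf]

lemma temp_fun_eq : (fun v : Vel => (‖v‖ ^ 2 - 3) * sqrtM v) = pf (sqP - 3) := by
  ext v; simp [pf, eval_sqP]

lemma vel_pf (i : Fin 3) (P : MvPolynomial (Fin 3) ℝ) : vel i (pf P) = gm (pderiv i P) := by
  rw [vel, vel_fun_eq, ip_pf, mul_comm, gm_X_mul]

lemma temp_pf (P : MvPolynomial (Fin 3) ℝ) :
    temp (pf P) = (∑ k, gm (pderiv k (pderiv k P))) / 3 := by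
  have h3 : (3 : MvPolynomial (Fin 3) ℝ) = C 3 := (map_ofNat C 3).symm
  rw [temp, temp_fun_eq, ip_pf, mul_comm, sub_mul, map_sub, gm_sqP_mul, h3, gm_C_mul]
  ring

lemma rho_pf_invP (ρ : ℝ) (u : Fin 3 → ℝ) (θ : ℝ) : rho (pf (invP ρ u θ)) = ρ := by
  rw [rho_pf, gm_invP]

lemma vel_pf_invP (i : Fin 3) (ρ : ℝ) (u : Fin 3 → ℝ) (θ : ℝ) : vel i (pf (invP ρ u θ)) = u i := by
  rw [vel_pf, pderiv_invP, map_add, gm_C, gm_C_mul, gm_X, mul_zero, add_zero]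

lemma temp_pf_invP (ρ : ℝ) (u : Fin 3 → ℝ) (θ : ℝ) : temp (pf (invP ρ u θ)) = θ := by
  rw [temp_pf]
  simp [pderiv_pderiv_invP, gm_C]

lemma rho_proj (g : Vel → ℝ) : rho (proj g) = rho g := by rw [proj_eq, rho_pf_invP]
lemma vel_proj (i : Fin 3) (g : Vel → ℝ) : vel i (proj g) = vel i g := by rw [proj_eq, vel_pf_invP]
lemma temp_proj (g : Vel → ℝ) : temp (proj g) = temp g := by rw [proj_eq, temp_pf_invP]

lemma rapid_proj (g : Vel → ℝ) : Rapid (proj g) := by rw [proj_eq]; exact rapid_pf _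

lemma WL2.micro {g : Vel → ℝ} (hg : WL2 g) : WL2 (micro g) := hg.sub (rapid_proj g).wl2

lemma Rapid.micro {g : Vel → ℝ} (hg : Rapid g) : Rapid (micro g) := hg.sub (rapid_proj g)

/-! ### Linearity of the moments -/

lemma ip_add_left {g h k : Vel → ℝ} (hg : WL2 g) (hh : WL2 h) (hk : WL2 k) :
    ip (fun v => g v + h v) k = ip g k + ip h k := by
  simp only [ip, add_mul]
  exact integral_add (hg.integrable_mul hk) (hh.integrable_mul hk)

lemma ip_sub_left {g h k : Vel → ℝ} (hg : WL2 g) (hh : WL2 h) (hk : WL2 k) :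
    ip (fun v => g v - h v) k = ip g k - ip h k := by
  simp only [ip, sub_mul]
  exact integral_sub (hg.integrable_mul hk) (hh.integrable_mul hk)

lemma ip_const_mul_left (c : ℝ) (g k : Vel → ℝ) : ip (fun v => c * g v) k = c * ip g k := by
  simp only [ip, mul_assoc]
  exact integral_const_mul _ _

lemma ip_comm (g h : Vel → ℝ) : ip g h = ip h g := by simp only [ip, mul_comm]

lemma ip_congr_left {g g' : Vel → ℝ} (h : g =ᵐ[volume] g') (k : Vel → ℝ) : ip g k = ip g' k :=
  integral_congr_ae (h.mono fun v hv => by simp only [hv])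

lemma ip_congr_right {g g' : Vel → ℝ} (h : g =ᵐ[volume] g') (k : Vel → ℝ) : ip k g = ip k g' :=
  integral_congr_ae (h.mono fun v hv => by simp only [hv])

lemma wl2_vel (i : Fin 3) : WL2 fun v : Vel => v i * sqrtM v := by
  rw [vel_fun_eq]; exact (rapid_pf _).wl2

lemma wl2_temp : WL2 fun v : Vel => (‖v‖ ^ 2 - 3) * sqrtM v := by
  rw [temp_fun_eq]; exact (rapid_pf _).wl2

lemma rho_add {g h : Vel → ℝ} (hg : WL2 g) (hh : WL2 h) :
    rho (fun v => g v + h v) = rho g + rho h := ip_add_left hg hh wl2_sqrtM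
lemma vel_add {g h : Vel → ℝ} (hg : WL2 g) (hh : WL2 h) (i : Fin 3) :
    vel i (fun v => g v + h v) = vel i g + vel i h := ip_add_left hg hh (wl2_vel i)
lemma temp_add {g h : Vel → ℝ} (hg : WL2 g) (hh : WL2 h) :
    temp (fun v => g v + h v) = temp g + temp h := by
  rw [temp, ip_add_left hg hh wl2_temp, add_div]; rfl

lemma rho_sub {g h : Vel → ℝ} (hg : WL2 g) (hh : WL2 h) :
    rho (fun v => g v - h v) = rho g - rho h := ip_sub_left hg hh wl2_sqrtM
lemma vel_sub {g h : Vel → ℝ} (hg : WL2 g) (hh : WL2 h) (i : Fin 3) :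
    vel i (fun v => g v - h v) = vel i g - vel i h := ip_sub_left hg hh (wl2_vel i)
lemma temp_sub {g h : Vel → ℝ} (hg : WL2 g) (hh : WL2 h) :
    temp (fun v => g v - h v) = temp g - temp h := by
  rw [temp, ip_sub_left hg hh wl2_temp, sub_div]; rfl

lemma rho_const_mul (c : ℝ) (g : Vel → ℝ) : rho (fun v => c * g v) = c * rho g :=
  ip_const_mul_left c g _
lemma vel_const_mul (c : ℝ) (g : Vel → ℝ) (i : Fin 3) : vel i (fun v => c * g v) = c * vel i g :=
  ip_const_mul_left c g _
lemma temp_const_mul (c : ℝ) (g : Vel → ℝ) : temp (fun v => c * g v) = c * temp g := by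
  rw [temp, ip_const_mul_left, mul_div_assoc]; rfl

/-- Orthogonality to the null space of the linearized operator. -/
structure PerpN (g : Vel → ℝ) : Prop where
  rho : rho g = 0
  vel : ∀ i, vel i g = 0
  temp : temp g = 0

lemma PerpN.add {g h : Vel → ℝ} (hg : WL2 g) (hh : WL2 h) (pg : PerpN g) (ph : PerpN h) :
    PerpN fun v => g v + h v :=
  ⟨by rw [rho_add hg hh, pg.rho, ph.rho, add_zero],
   fun i => by rw [vel_add hg hh, pg.vel, ph.vel, add_zero],
   by rw [temp_add hg hh, pg.temp, ph.temp, add_zero]⟩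

lemma PerpN.sub {g h : Vel → ℝ} (hg : WL2 g) (hh : WL2 h) (pg : PerpN g) (ph : PerpN h) :
    PerpN fun v => g v - h v :=
  ⟨by rw [rho_sub hg hh, pg.rho, ph.rho, sub_zero],
   fun i => by rw [vel_sub hg hh, pg.vel, ph.vel, sub_zero],
   by rw [temp_sub hg hh, pg.temp, ph.temp, sub_zero]⟩

lemma PerpN.const_mul {g : Vel → ℝ} (pg : PerpN g) (c : ℝ) : PerpN fun v => c * g v :=
  ⟨by rw [rho_const_mul, pg.rho, mul_zero], fun i => by rw [vel_const_mul, pg.vel, mul_zero],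
   by rw [temp_const_mul, pg.temp, mul_zero]⟩

lemma perpN_micro {g : Vel → ℝ} (hg : WL2 g) : PerpN (micro g) :=
  ⟨(rho_sub hg (rapid_proj g).wl2).trans (by rw [rho_proj, sub_self]),
   fun i => (vel_sub hg (rapid_proj g).wl2 i).trans (by rw [vel_proj, sub_self]),
   (temp_sub hg (rapid_proj g).wl2).trans (by rw [temp_proj, sub_self])⟩

lemma PerpN.proj_eq_zero {g : Vel → ℝ} (h : PerpN g) (v : Vel) : proj g v = 0 := by
  simp [proj, h.rho, h.vel, h.temp]

lemma PerpN.micro_eq {g : Vel → ℝ} (h : PerpN g) : micro g = g := by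
  ext v; rw [micro, h.proj_eq_zero, sub_zero]

lemma pf_invP_eq (ρ : ℝ) (u : Fin 3 → ℝ) (θ : ℝ) : pf (invP ρ u θ)
    = fun v => ρ * sqrtM v + (u 0 * (v 0 * sqrtM v) + (u 1 * (v 1 * sqrtM v)
      + (u 2 * (v 2 * sqrtM v) + θ / 2 * ((‖v‖ ^ 2 - 3) * sqrtM v)))) := by
  ext v; simp only [pf, eval_invP, Fin.sum_univ_three]; ring

lemma ip_pf_invP {g : Vel → ℝ} (hg : WL2 g) (ρ : ℝ) (u : Fin 3 → ℝ) (θ : ℝ) :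
    ip g (pf (invP ρ u θ)) = ρ * rho g + ∑ k, u k * vel k g + 3 / 2 * (θ * temp g) := by
  have h1 := wl2_sqrtM.const_mul ρ
  have h2 := fun i => (wl2_vel i).const_mul (u i)
  have h3 := wl2_temp.const_mul (θ / 2)
  rw [pf_invP_eq, ip_comm, ip_add_left h1 ((h2 0).add ((h2 1).add ((h2 2).add h3))) hg,
    ip_add_left (h2 0) ((h2 1).add ((h2 2).add h3)) hg, ip_add_left (h2 1) ((h2 2).add h3) hg,
    ip_add_left (h2 2) h3 hg, ip_const_mul_left, ip_const_mul_left, ip_const_mul_left,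
    ip_const_mul_left, ip_const_mul_left, Fin.sum_univ_three]
  simp only [rho, vel, temp, ip_comm g]
  ring

lemma PerpN.ip_pf_invP {g : Vel → ℝ} (hg : WL2 g) (h : PerpN g) (ρ : ℝ) (u : Fin 3 → ℝ) (θ : ℝ) :
    ip g (pf (invP ρ u θ)) = 0 := by
  rw [ViscousLayer.ip_pf_invP hg, h.rho, h.temp]; simp [h.vel]

lemma PerpN.ip_proj {g : Vel → ℝ} (hg : WL2 g) (h : PerpN g) (k : Vel → ℝ) : ip g (proj k) = 0 := by
  rw [proj_eq]; exact h.ip_pf_invP hg _ _ _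

lemma PerpN.ip_micro {g k : Vel → ℝ} (hg : WL2 g) (hk : WL2 k) (h : PerpN g) :
    ip g (micro k) = ip g k := by
  have := ip_sub_left hk (rapid_proj k).wl2 hg
  rw [ip_comm g]
  refine this.trans ?_
  rw [ip_comm _ g, ip_comm _ g, h.ip_proj hg, sub_zero]

/-! ### Conservation laws -/

lemma cd_invP (ρ : ℝ) (u : Fin 3 → ℝ) (θ : ℝ) (q : Coll) : cd (quot (pf (invP ρ u θ))) q = 0 := by
  obtain ⟨⟨v, w⟩, ω⟩ := q
  have h1 := coll_add (ω : Vel) v w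
  have h2 := coll_norm_sq (norm_sph ω) v w
  simp only [cd, quot_pf, eval_invP, preV, preU, postV, postU]
  set a := (coll (ω : Vel) (v, w)).1
  set b := (coll (ω : Vel) (v, w)).2
  have h3 : ∀ i, a i + b i = v i + w i := fun i => by
    have := congrArg (fun x : Vel => x i) h1
    simpa using this
  simp only [Fin.sum_univ_three]
  linear_combination (-u 0) * h3 0 - u 1 * h3 1 - u 2 * h3 2 - θ / 2 * h2

lemma ip_GamS_invP {g h : Vel → ℝ} (hg : WL2 g) (hh : WL2 h) (ρ : ℝ) (u : Fin 3 → ℝ) (θ : ℝ) :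
    ip (GamS g h) (pf (invP ρ u θ)) = 0 := by
  rw [(integral_GamS_mul hg hh (rapid_pf _).wl2).2]
  simp [cd_invP]

lemma sqrtM_eq_pf : sqrtM = pf (invP 1 0 0) := by ext v; simp [pf, eval_invP]
lemma vel_fun_eq_pf (i : Fin 3) : (fun v : Vel => v i * sqrtM v) = pf (invP 0 (Pi.single i 1) 0) := by
  ext v; simp [pf, eval_invP, Pi.single_apply]
lemma temp_fun_eq_pf : (fun v : Vel => (‖v‖ ^ 2 - 3) * sqrtM v) = pf (invP 0 0 2) := by
  ext v; simp [pf, eval_invP]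

lemma perpN_of_forall {g : Vel → ℝ} (h : ∀ ρ u θ, ip g (pf (invP ρ u θ)) = 0) : PerpN g :=
  ⟨by rw [rho, sqrtM_eq_pf]; exact h _ _ _, fun i => by rw [vel, vel_fun_eq_pf]; exact h _ _ _,
   by rw [temp, temp_fun_eq_pf, h, zero_div]⟩

lemma energy_pf_invP (g : Vel → ℝ) (ρ : ℝ) (u : Fin 3 → ℝ) (θ : ℝ) :
    energy g (pf (invP ρ u θ)) = 0 := by
  simp [energy, cd_invP]

lemma energy_micro_right {g k : Vel → ℝ} (hg : WL2 g) (hk : WL2 k) :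
    energy g (micro k) = energy g k := by
  rw [energy_comm, energy_comm g]
  refine (energy_sub_left hk (rapid_proj k).wl2 hg).trans ?_
  rw [energy_comm (proj k), proj_eq, energy_pf_invP, sub_zero]

/-! ### Uniqueness of the inverse -/

lemma PerpN.perpInv {g : Vel → ℝ} (hg : WL2 g) (h : PerpN g) : PerpInv (quot g) := by
  have e : ∀ P, ip g (pf P) = ∫ v : Vel, quot g v * eval (fun i => v i) P ∂GV := fun P => by
    rw [ip_eq_gaussian]; simp only [quot_pf]
  have e' := fun ρ u θ => (e (invP ρ u θ)).symm.trans (h.ip_pf_invP hg ρ u θ)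
  refine ⟨hg.wg.measurable, hg.wg.memLp, ?_, fun w => ?_, ?_⟩
  · simpa [eval_invP] using e' 1 0 0
  · have := e' 0 (fun i => w i) 0
    simp only [eval_invP] at this
    rw [← this]
    refine integral_congr_ae (ae_of_all _ fun v => ?_)
    simp [PiLp.inner_apply]
  -- These parameters give the invariant `3 + (|v|² - 3) = |v|²`.
  · have := e' 3 0 2
    rw [← this]
    refine integral_congr_ae (ae_of_all _ fun v => ?_)
    simp only [eval_invP]
    simp

theorem exists_coercive : ∃ c : ℝ, 0 ≤ c ∧ ∀ g, WL2 g → PerpN g →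
    ∫ v : Vel, (1 + ‖v‖) * g v ^ 2 ≤ c * energy g g := by
  obtain ⟨c, hc, h⟩ := PerpInv.coercive
  -- The 4 compensates the factor `1/4` in `energy`.
  refine ⟨4 * c.toReal, by positivity, fun g hg hp => ?_⟩
  have hI := h _ (hp.perpInv hg)
  rw [lintegral_dissip hg.wg.measurable] at hI
  have e1 : ∫ v : Vel, (1 + ‖v‖) * g v ^ 2 = ∫ v, (1 + ‖v‖) * quot g v ^ 2 ∂GV := by
    rw [integral_gaussian]
    refine integral_congr_ae (ae_of_all _ fun v => ?_)
    simp only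
    rw [← maxwellian_mul_quot_sq]; ring
  rw [← ofReal_integral_eq_lintegral_ofReal hg.wg.integrable (ae_of_all _ fun v => by positivity),
    ← ofReal_integral_eq_lintegral_ofReal hg.memLp_cd.integrable_sq
      (ae_of_all _ fun v => by positivity), ← e1] at hI
  have h2 := ENNReal.toReal_mono (ENNReal.mul_ne_top hc ENNReal.ofReal_ne_top) hI
  rw [ENNReal.toReal_mul, ENNReal.toReal_ofReal (integral_nonneg fun v => by positivity),
    ENNReal.toReal_ofReal (integral_nonneg fun v => by positivity)] at h2
  refine h2.trans_eq ?_
  simp only [energy, pow_two]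
  ring

lemma ae_eq_zero_of_energy {g : Vel → ℝ} (hg : WL2 g) (hp : PerpN g) (h : energy g g = 0) :
    g =ᵐ[volume] 0 := by
  obtain ⟨c, -, hc⟩ := exists_coercive
  have h1 := hc g hg hp
  rw [h, mul_zero] at h1
  have h2 : ∫ v : Vel, (1 + ‖v‖) * g v ^ 2 = 0 :=
    le_antisymm h1 (integral_nonneg fun v => by positivity)
  rw [integral_eq_zero_iff_of_nonneg (fun v => by positivity) hg.integrable] at h2
  filter_upwards [h2] with v hv
  have : (1 + ‖v‖) ≠ 0 := by positivity
  simpa [this] using hv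

lemma IsLinvOf.perpN {h g : Vel → ℝ} (H : IsLinvOf h g) : PerpN g := ⟨H.rho_eq, H.vel_eq, H.temp_eq⟩

lemma IsLinvOf.ip_eq {h g k : Vel → ℝ} (H : IsLinvOf h g) (hk : WL2 k) : ip h k = energy g k := by
  rw [← (integral_linL_mul H.wl2 hk).2, ip_congr_left H.eq]

/-- The difference of two solutions has zero energy and is orthogonal to the invariants, so
coercivity applies. Statements about `Linv` thus reduce to exhibiting some solution. -/
lemma IsLinvOf.unique {h g g' : Vel → ℝ} (H : IsLinvOf h g) (H' : IsLinvOf h g') :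
    g =ᵐ[volume] g' := by
  have hd := H.wl2.sub H'.wl2
  have hE : energy (fun v => g v - g' v) (fun v => g v - g' v) = 0 := by
    rw [energy_sub_left H.wl2 H'.wl2 hd, ← H.ip_eq hd, ← H'.ip_eq hd, sub_self]
  have := ae_eq_zero_of_energy hd (H.perpN.sub H.wl2 H'.wl2 H'.perpN) hE
  filter_upwards [this] with v hv
  exact sub_eq_zero.1 hv

lemma IsLinvOf.linv {h g : Vel → ℝ} (H : IsLinvOf h g) : IsLinvOf h (Linv h) := by
  have : ∃ g, IsLinvOf h g := ⟨g, H⟩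
  rw [Linv, dif_pos this]
  exact this.choose_spec

lemma IsLinvOf.linv_ae {h g : Vel → ℝ} (H : IsLinvOf h g) : Linv h =ᵐ[volume] g :=
  H.linv.unique H

lemma IsLinvOf.congr {h h' g : Vel → ℝ} (H : IsLinvOf h g) (e : h =ᵐ[volume] h') : IsLinvOf h' g :=
  { H with eq := H.eq.trans e }

lemma isLinvOf_of {h g : Vel → ℝ} (hg : WL2 g) (hp : PerpN g) (e : linL g =ᵐ[volume] h) :
    IsLinvOf h g := ⟨hg.measurable, hg.integrable, hp.rho, hp.vel, hp.temp, e⟩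

lemma IsLinvOf.add {h g h' g' : Vel → ℝ} (H : IsLinvOf h g) (H' : IsLinvOf h' g') :
    IsLinvOf (fun v => h v + h' v) (fun v => g v + g' v) :=
  isLinvOf_of (H.wl2.add H'.wl2) (H.perpN.add H.wl2 H'.wl2 H'.perpN) (by
    filter_upwards [linL_add_ae H.wl2 H'.wl2, H.eq, H'.eq] with v h1 h2 h3
    rw [h1, h2, h3])

lemma IsLinvOf.const_mul {h g : Vel → ℝ} (H : IsLinvOf h g) (c : ℝ) :
    IsLinvOf (fun v => c * h v) (fun v => c * g v) :=
  isLinvOf_of (H.wl2.const_mul c) (H.perpN.const_mul c) (by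
    rw [linL_const_mul_ae]
    filter_upwards [H.eq] with v h1
    rw [h1])

lemma IsLinvOf.sub {h g h' g' : Vel → ℝ} (H : IsLinvOf h g) (H' : IsLinvOf h' g') :
    IsLinvOf (fun v => h v - h' v) (fun v => g v - g' v) := by
  simpa [sub_eq_add_neg] using H.add (H'.const_mul (-1))

end ViscousLayer
end

/-! ### Existence of `L⁻¹` by the Lax-Milgram theorem. -/

noncomputable section
namespace ViscousLayer
open ProbabilityTheory MvPolynomial
open scoped RealInnerProductSpace ENNReal

/-! ### Existence of the inverse -/

/-- Outside an interval of probability at most `1/4` the integrand is at least `1/8`, and `1/8 · 3/4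
= 3/32`. -/
lemma lintegral_abs_sub_ge (x : ℝ) :
    ENNReal.ofReal (3 / 32) ≤ ∫⁻ z, ENNReal.ofReal |x - z| ∂γ := by
  set s : Set ℝ := {z | |x - z| < 1 / 8} with hs
  have hm : MeasurableSet s := (isOpen_lt (by fun_prop) (by fun_prop)).measurableSet
  have h1 := gaussian_near_le x
  have h2 : ENNReal.ofReal (3 / 4) ≤ γ sᶜ := by
    rw [prob_compl_eq_one_sub hm]
    refine le_trans ?_ (tsub_le_tsub_left h1 1)
    rw [show (1 : ℝ≥0∞) / 4 = ENNReal.ofReal (1 / 4) by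
      rw [ENNReal.ofReal_div_of_pos (by norm_num)]; simp]
    rw [← ENNReal.ofReal_one, ← ENNReal.ofReal_sub _ (by norm_num)]
    norm_num
  calc ENNReal.ofReal (3 / 32) = ENNReal.ofReal (1 / 8) * ENNReal.ofReal (3 / 4) := by
        rw [← ENNReal.ofReal_mul (by norm_num)]; norm_num
    _ ≤ ENNReal.ofReal (1 / 8) * γ sᶜ := by gcongr
    _ = ∫⁻ _ in sᶜ, ENNReal.ofReal (1 / 8) ∂γ := by simp
    _ ≤ ∫⁻ z in sᶜ, ENNReal.ofReal |x - z| ∂γ := by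
        refine setLIntegral_mono' hm.compl fun z hz => ?_
        simp only [hs, Set.mem_compl_iff, Set.mem_ofPred_eq, not_lt] at hz
        exact ENNReal.ofReal_le_ofReal hz
    _ ≤ _ := setLIntegral_le_lintegral _ _

lemma lintegral_freqMeasure {F : Vel → ℝ≥0∞} (hF : Measurable F) :
    ∫⁻ v, F v ∂freqMeasure
      = ∫⁻ v, ∫⁻ u, ∫⁻ ω : Sph, ENNReal.ofReal (kern ((v, u), ω)) * F v ∂sphereMeasure ∂GV ∂GV := by
  have m : Measurable fun q : Coll => ENNReal.ofReal (kern q) * F (preV q) :=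
    continuous_kern.measurable.ennreal_ofReal.mul (hF.comp continuous_preV.measurable)
  have hc := lintegral_collMeasure (hF.comp continuous_preV.measurable)
  simp only [Function.comp_apply] at hc
  rw [freqMeasure, lintegral_map hF continuous_preV.measurable, hc, collMeasure₀,
    lintegral_prod _ m.aemeasurable, lintegral_prod _ m.lintegral_prod_right'.aemeasurable]
  rfl

lemma measurable_kern_left (v : Vel) :
    Measurable fun p : Vel × Sph => ENNReal.ofReal (kern ((v, p.1), p.2)) := by
  have h : Continuous fun p : Vel × Sph => (((v, p.1), p.2) : Coll) := by fun_prop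
  have h2 : Continuous fun p : Vel × Sph => kern ((v, p.1), p.2) := continuous_kern.comp h
  exact h2.measurable.ennreal_ofReal

lemma lintegral_kern_ge (v : Vel) (ω : Sph) :
    ENNReal.ofReal (3 / 32) ≤ ∫⁻ u, ENNReal.ofReal (kern ((v, u), ω)) ∂GV := by
  have hmp := measurePreserving_inner (norm_sph ω)
  have hf : Measurable fun z : ℝ => ENNReal.ofReal |⟪v, (ω : Vel)⟫ - z| := by fun_prop
  have h := hmp.lintegral_comp hf
  have e : ∀ u : Vel, kern ((v, u), ω) = |⟪v, (ω : Vel)⟫ - ⟪u, (ω : Vel)⟫| := fun u => by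
    rw [← inner_sub_left]; rfl
  simp only [e]
  exact (lintegral_abs_sub_ge _).trans h.ge

lemma lintegral_lintegral_kern_ge (v : Vel) :
    ENNReal.ofReal (3 / 32) * sphereMeasure Set.univ
      ≤ ∫⁻ u, ∫⁻ ω : Sph, ENNReal.ofReal (kern ((v, u), ω)) ∂sphereMeasure ∂GV := by
  have hs := lintegral_lintegral_swap (μ := GV) (ν := sphereMeasure)
    (f := fun (u : Vel) (ω : Sph) => ENNReal.ofReal (kern ((v, u), ω)))
    (measurable_kern_left v).aemeasurable
  rw [hs]
  calc ENNReal.ofReal (3 / 32) * sphereMeasure Set.univ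
      = ∫⁻ _ω : Sph, ENNReal.ofReal (3 / 32) ∂sphereMeasure := by rw [lintegral_const]
    _ ≤ _ := lintegral_mono fun ω => lintegral_kern_ge v ω

lemma lintegral_lintegral_mul_const {α β : Type*} [MeasurableSpace α] [MeasurableSpace β]
    {μ : Measure α} {ν : Measure β} [SFinite ν] {f : α → β → ℝ≥0∞}
    (hf : Measurable (Function.uncurry f)) (a : ℝ≥0∞) :
    ∫⁻ x, ∫⁻ y, f x y * a ∂ν ∂μ = (∫⁻ x, ∫⁻ y, f x y ∂ν ∂μ) * a := by
  have e : ∀ x, ∫⁻ y, f x y * a ∂ν = (∫⁻ y, f x y ∂ν) * a := fun x =>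
    lintegral_mul_const _ hf.of_uncurry_left
  simp only [e]
  exact lintegral_mul_const _ hf.lintegral_prod_right

lemma lintegral_kern_mul_indicator (v : Vel) (a : ℝ≥0∞) :
    ∫⁻ u, ∫⁻ ω : Sph, ENNReal.ofReal (kern ((v, u), ω)) * a ∂sphereMeasure ∂GV
      = (∫⁻ u, ∫⁻ ω : Sph, ENNReal.ofReal (kern ((v, u), ω)) ∂sphereMeasure ∂GV) * a :=
  lintegral_lintegral_mul_const (f := fun (u : Vel) (ω : Sph) => ENNReal.ofReal (kern ((v, u), ω)))
    (measurable_kern_left v) a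

/-- The collision frequency is bounded below. -/
lemma exists_le_freqMeasure : ∃ c : ℝ≥0∞, c ≠ ∞ ∧ GV ≤ c • freqMeasure := by
  have hσ0 : sphereMeasure (Set.univ : Set Sph) ≠ 0 := by
    rw [sphereMeasure, ne_eq, Measure.measure_univ_eq_zero]
    exact Measure.toSphere_ne_zero _
  obtain ⟨d, hd⟩ : ∃ d, d = ENNReal.ofReal (3 / 32) * sphereMeasure (Set.univ : Set Sph) := ⟨_, rfl⟩
  have hd0 : d ≠ 0 := hd ▸ mul_ne_zero (by norm_num) hσ0
  have hdt : d ≠ ∞ := hd ▸ ENNReal.mul_ne_top ENNReal.ofReal_ne_top (measure_ne_top _ _)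
  refine ⟨d⁻¹, ENNReal.inv_ne_top.2 hd0, Measure.le_intro fun s hs _ => ?_⟩
  have hm : Measurable (s.indicator (1 : Vel → ℝ≥0∞)) := measurable_one.indicator hs
  have h1 := lintegral_freqMeasure hm
  rw [lintegral_indicator_one hs] at h1
  simp only [lintegral_kern_mul_indicator] at h1
  have h3 : d * GV s ≤ freqMeasure s := by
    rw [h1, ← lintegral_indicator_one hs, ← lintegral_const_mul _ hm]
    refine lintegral_mono fun v => ?_
    rw [hd]
    exact mul_le_mul_left (lintegral_lintegral_kern_ge v) _
  calc GV s = d⁻¹ * (d * GV s) := by rw [← mul_assoc, ENNReal.inv_mul_cancel hd0 hdt, one_mul]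
    _ ≤ d⁻¹ * freqMeasure s := by gcongr
    _ = _ := by simp

/-- The collision frequency grows at most linearly. -/
lemma exists_lintegral_freqMeasure_le : ∃ c : ℝ≥0∞, c ≠ ∞ ∧ ∀ F : Vel → ℝ≥0∞, Measurable F →
    ∫⁻ v, F v ∂freqMeasure ≤ c * ∫⁻ v, ENNReal.ofReal (1 + ‖v‖) * F v ∂GV := by
  have hi : Integrable (fun u : Vel => 1 + ‖u‖) GV := by
    simpa using wg_one.integrable
  set M := ∫⁻ u : Vel, ENNReal.ofReal (1 + ‖u‖) ∂GV with hM
  have hMt : M ≠ ∞ := by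
    have h2 := hi.2
    rw [hasFiniteIntegral_iff_ofReal (ae_of_all _ fun u => by positivity)] at h2
    exact h2.ne
  refine ⟨M * sphereMeasure Set.univ, ENNReal.mul_ne_top hMt (measure_ne_top _ _), fun F hF => ?_⟩
  rw [lintegral_freqMeasure hF]
  have mF : Measurable fun v : Vel => ENNReal.ofReal (1 + ‖v‖) * F v := by fun_prop
  calc ∫⁻ v, ∫⁻ u, ∫⁻ ω : Sph, ENNReal.ofReal (kern ((v, u), ω)) * F v ∂sphereMeasure ∂GV ∂GV
      ≤ ∫⁻ v, ∫⁻ u, ∫⁻ _ω : Sph, ENNReal.ofReal (1 + ‖u‖) * (ENNReal.ofReal (1 + ‖v‖) * F v)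
          ∂sphereMeasure ∂GV ∂GV := by
        refine lintegral_mono fun v => lintegral_mono fun u => lintegral_mono fun ω => ?_
        rw [← mul_assoc, ← ENNReal.ofReal_mul (by positivity)]
        gcongr
        exact kern_le ((v, u), ω)
    _ = _ := by
        simp only [lintegral_const]
        have e : ∀ v : Vel, ∫⁻ u : Vel, ENNReal.ofReal (1 + ‖u‖) * (ENNReal.ofReal (1 + ‖v‖) * F v)
            * sphereMeasure Set.univ ∂GV
            = M * sphereMeasure Set.univ * (ENNReal.ofReal (1 + ‖v‖) * F v) := fun v => by
          rw [lintegral_mul_const _ (by fun_prop), lintegral_mul_const _ (by fun_prop)]; ring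
        simp only [e]
        rw [lintegral_const_mul _ mF]

/-- The space of square integrable functions with respect to the collision frequency. -/
abbrev FreqL2 : Type := Lp ℝ 2 freqMeasure

/-- The operator `φ ↦ φ(v) + φ(u) - φ(v') - φ(u')`. -/
def cdOp : FreqL2 →L[ℝ] Lp ℝ 2 collMeasure :=
  (Lp.compMeasurePreservingₗᵢ ℝ preV measurePreserving_preV).toContinuousLinearMap
  + (Lp.compMeasurePreservingₗᵢ ℝ preU measurePreserving_preU).toContinuousLinearMap
  - (Lp.compMeasurePreservingₗᵢ ℝ postV measurePreserving_postV).toContinuousLinearMap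
  - (Lp.compMeasurePreservingₗᵢ ℝ postU measurePreserving_postU).toContinuousLinearMap

lemma cdOp_toLp {φ : Vel → ℝ} (hφ : MemLp φ 2 freqMeasure) :
    cdOp (hφ.toLp φ) = (memLp_collDiff hφ).toLp (cd φ) := rfl

lemma inner_cdOp {φ ψ : Vel → ℝ} (hφ : MemLp φ 2 freqMeasure) (hψ : MemLp ψ 2 freqMeasure) :
    ⟪cdOp (hφ.toLp φ), cdOp (hψ.toLp ψ)⟫ = ∫ q, cd φ q * cd ψ q ∂collMeasure := by
  rw [cdOp_toLp, cdOp_toLp, L2.inner_def]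
  refine integral_congr_ae ?_
  filter_upwards [(memLp_collDiff hφ).coeFn_toLp, (memLp_collDiff hψ).coeFn_toLp] with q h1 h2
  rw [h1, h2]
  simp [mul_comm]

lemma absolutelyContinuous_freq : GV ≪ freqMeasure := by
  obtain ⟨c, _, hle⟩ := exists_le_freqMeasure
  exact (Measure.absolutelyContinuous_of_le hle).trans (Measure.smul_absolutelyContinuous)

lemma memLp_GV_of_freq {φ : Vel → ℝ} (hφ : MemLp φ 2 freqMeasure) : MemLp φ 2 GV := by
  obtain ⟨c, hc, hle⟩ := exists_le_freqMeasure
  exact hφ.of_measure_le_smul hc hle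

/-- Integration against a square integrable function. -/
def pairing (a : Vel → ℝ) (ha : MemLp a 2 GV) : FreqL2 →L[ℝ] ℝ :=
  LinearMap.mkContinuous
    { toFun := fun f => ∫ v, a v * f v ∂GV
      map_add' := fun f g => by
        have h1 := integrable_mul_of_memLp ha (memLp_GV_of_freq (Lp.memLp f))
        have h2 := integrable_mul_of_memLp ha (memLp_GV_of_freq (Lp.memLp g))
        rw [← integral_add h1 h2]
        refine integral_congr_ae ?_
        filter_upwards [absolutelyContinuous_freq.ae_le (Lp.coeFn_add f g)] with v hv
        rw [hv, Pi.add_apply]; ring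
      map_smul' := fun c f => by
        simp only [RingHom.id_apply, smul_eq_mul]
        rw [← integral_const_mul]
        refine integral_congr_ae ?_
        filter_upwards [absolutelyContinuous_freq.ae_le (Lp.coeFn_smul c f)] with v hv
        rw [hv, Pi.smul_apply, smul_eq_mul]; ring }
    (√(∫ v, a v ^ 2 ∂GV) * √(exists_le_freqMeasure.choose).toReal) (fun f => by
      obtain ⟨hc, hle⟩ := exists_le_freqMeasure.choose_spec
      set c := exists_le_freqMeasure.choose
      have hf := Lp.memLp f
      have h1 := sq_integral_mul_le ha (memLp_GV_of_freq hf)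
      have h2 : ∫ v, f v ^ 2 ∂GV ≤ c.toReal * ‖f‖ ^ 2 := by
        have e : ‖f‖ ^ 2 = ∫ v, f v ^ 2 ∂freqMeasure := by
          rw [← real_inner_self_eq_norm_sq, L2.inner_def]
          simp [pow_two]
        rw [e]
        have := integral_mono_measure (f := fun v => f v ^ 2) hle
          (ae_of_all _ fun v => sq_nonneg _) (hf.integrable_sq.smul_measure hc)
        rwa [integral_smul_measure, smul_eq_mul] at this
      simp only [LinearMap.coe_mk, AddHom.coe_mk, Real.norm_eq_abs]
      apply abs_le_of_sq_le_sq _ (by positivity)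
      rw [mul_pow, mul_pow, Real.sq_sqrt (integral_nonneg fun v => sq_nonneg _),
        Real.sq_sqrt ENNReal.toReal_nonneg, mul_assoc]
      exact h1.trans (mul_le_mul_of_nonneg_left h2 (integral_nonneg fun v => sq_nonneg _)))

lemma pairing_apply (a : Vel → ℝ) (ha : MemLp a 2 GV) (f : FreqL2) :
    pairing a ha f = ∫ v, a v * f v ∂GV := rfl

/-- Evaluation of a collision invariant. -/
def invF (p : ℝ × (Fin 3 → ℝ) × ℝ) : Vel → ℝ := quot (pf (invP p.1 p.2.1 p.2.2))

lemma wg_invF (p : ℝ × (Fin 3 → ℝ) × ℝ) : WG (invF p) := (rapid_pf _).wl2.wg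

/-- The functions that are orthogonal to the collision invariants. -/
def perpSpace : Submodule ℝ FreqL2 :=
  ⨅ p : ℝ × (Fin 3 → ℝ) × ℝ, (pairing (invF p) (wg_invF p).memLp).ker

lemma mem_perpSpace {f : FreqL2} : f ∈ perpSpace ↔ ∀ p, ∫ v, invF p v * f v ∂GV = 0 := by
  simp only [perpSpace, Submodule.mem_iInf, LinearMap.mem_ker]
  rfl

instance : CompleteSpace perpSpace := by
  have : IsClosed (perpSpace : Set FreqL2) := by
    rw [perpSpace, Submodule.coe_iInf]
    exact isClosed_iInter fun p => ContinuousLinearMap.isClosed_ker _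
  exact this.completeSpace_coe

lemma mem_perpSpace_toLp {φ : Vel → ℝ} (hφ : MemLp φ 2 freqMeasure) :
    hφ.toLp φ ∈ perpSpace ↔ ∀ p, ∫ v, invF p v * φ v ∂GV = 0 := by
  rw [mem_perpSpace]
  refine forall_congr' fun p => ?_
  have : ∫ v, invF p v * (hφ.toLp φ) v ∂GV = ∫ v, invF p v * φ v ∂GV := by
    refine integral_congr_ae ?_
    filter_upwards [absolutelyContinuous_freq.ae_le hφ.coeFn_toLp] with v hv
    rw [hv]
  rw [this]

/-- A good representative. -/
lemma exists_rep (f : FreqL2) : ∃ φ : Vel → ℝ, Measurable φ ∧ ∃ h : MemLp φ 2 freqMeasure,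
    f = h.toLp φ := by
  refine ⟨f, (Lp.stronglyMeasurable f).measurable, Lp.memLp f, ?_⟩
  exact (Lp.toLp_coeFn f _).symm

lemma perpInv_of_mem {φ : Vel → ℝ} (hm : Measurable φ) (hφ : MemLp φ 2 freqMeasure)
    (h : hφ.toLp φ ∈ perpSpace) : PerpInv φ := by
  rw [mem_perpSpace_toLp] at h
  have h' : ∀ (ρ : ℝ) (u : Fin 3 → ℝ) (θ : ℝ), ∫ v : Vel, (ρ + ∑ k, u k * v k + θ / 2 * (‖v‖ ^ 2 - 3)) * φ v ∂GV = 0 :=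
    fun ρ u θ => by
      have := h (ρ, u, θ)
      simpa only [invF, quot_pf, eval_invP] using this
  refine ⟨hm, memLp_GV_of_freq hφ, ?_, fun w => ?_, ?_⟩
  · simpa using h' 1 0 0
  · rw [← h' 0 (fun i => w i) 0]
    refine integral_congr_ae (ae_of_all _ fun v => ?_)
    simp [PiLp.inner_apply, mul_comm]
  · rw [← h' 3 0 2]
    refine integral_congr_ae (ae_of_all _ fun v => ?_)
    simp [mul_comm]

/-- The collision frequency is at most linear in `|v|`, so its norm is dominated by the norm with
weight `1 + |v|`, which coercivity controls. -/
lemma exists_bound_perpSpace : ∃ C : ℝ, 0 < C ∧ ∀ f ∈ perpSpace, C * ‖f‖ ^ 2 ≤ ‖cdOp f‖ ^ 2 := by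
  obtain ⟨c₁, hc₁, h₁⟩ := exists_lintegral_freqMeasure_le
  obtain ⟨c₂, hc₂, h₂⟩ := PerpInv.coercive
  have hK : ∀ f ∈ perpSpace, ‖f‖ ^ 2 ≤ (c₁ * c₂).toReal * ‖cdOp f‖ ^ 2 := by
    intro f hf
    obtain ⟨φ, hm, hφ, rfl⟩ := exists_rep f
    have hp := perpInv_of_mem hm hφ hf
    have e1 : ‖hφ.toLp φ‖ ^ 2 = (∫⁻ v, ENNReal.ofReal (φ v ^ 2) ∂freqMeasure).toReal := by
      rw [← real_inner_self_eq_norm_sq, L2.inner_def,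
        ← integral_eq_lintegral_of_nonneg_ae (ae_of_all _ fun v => sq_nonneg _)
          (hm.pow_const 2).aestronglyMeasurable]
      refine integral_congr_ae ?_
      filter_upwards [hφ.coeFn_toLp] with v hv
      rw [hv]; simp [pow_two]
    have e2 : ‖cdOp (hφ.toLp φ)‖ ^ 2
        = (∫⁻ q, ENNReal.ofReal (cd φ q ^ 2) ∂collMeasure).toReal := by
      rw [← real_inner_self_eq_norm_sq, inner_cdOp,
        ← integral_eq_lintegral_of_nonneg_ae (ae_of_all _ fun v => sq_nonneg _)
          ((measurable_cd hm).pow_const 2).aestronglyMeasurable]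
      simp only [pow_two]
    have hfin : ∫⁻ q, ENNReal.ofReal (cd φ q ^ 2) ∂collMeasure ≠ ∞ := by
      have := (memLp_collDiff hφ).integrable_sq.2
      rw [hasFiniteIntegral_iff_ofReal (ae_of_all _ fun v => sq_nonneg _)] at this
      exact this.ne
    have h3 := h₂ φ hp
    rw [lintegral_dissip hm] at h3
    have h4 := h₁ (fun v => ENNReal.ofReal (φ v ^ 2)) (by fun_prop)
    have h5 : ∫⁻ v, ENNReal.ofReal (φ v ^ 2) ∂freqMeasure
        ≤ c₁ * c₂ * ∫⁻ q, ENNReal.ofReal (cd φ q ^ 2) ∂collMeasure := by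
      refine h4.trans ?_
      rw [mul_assoc]
      gcongr
      refine le_trans (le_of_eq ?_) h3
      refine lintegral_congr fun v => ?_
      rw [ENNReal.ofReal_mul (by positivity)]
    rw [e1, e2, ← ENNReal.toReal_mul]
    exact ENNReal.toReal_mono (ENNReal.mul_ne_top (ENNReal.mul_ne_top hc₁ hc₂) hfin) h5
  set K := (c₁ * c₂).toReal
  -- The added 1 avoids an inspection of the case `K = 0`.
  refine ⟨(K + 1)⁻¹, by positivity, fun f hf => ?_⟩
  rw [inv_mul_le_iff₀ (by positivity)]
  refine (hK f hf).trans ?_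
  gcongr
  linarith

/-- The linearized collision operator is invertible on the orthogonal complement of its null
space. -/
theorem exists_isLinvOf {h : Vel → ℝ} (hh : WL2 h) (hp : PerpN h) : ∃ g, IsLinvOf h g := by
  set D : perpSpace →L[ℝ] Lp ℝ 2 collMeasure := cdOp.comp perpSpace.subtypeL with hD
  set B : perpSpace →L[ℝ] perpSpace →L[ℝ] ℝ :=
    ((isBoundedBilinearMap_inner (𝕜 := ℝ) (E := Lp ℝ 2 collMeasure)).toContinuousLinearMap).bilinearComp
      D D with hB
  have hBapp : ∀ f g, B f g = ⟪cdOp f, cdOp g⟫ := fun f g => rfl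
  have hco : IsCoercive B := by
    obtain ⟨C, hC, hle⟩ := exists_bound_perpSpace
    refine ⟨C, hC, fun f => ?_⟩
    rw [hBapp, real_inner_self_eq_norm_sq, mul_assoc, ← pow_two]
    exact hle f f.2
  set ℓ : perpSpace →L[ℝ] ℝ := (pairing (quot h) hh.wg.memLp).comp perpSpace.subtypeL with hℓ
  set f := hco.continuousLinearEquivOfBilin.symm ((InnerProductSpace.toDual ℝ perpSpace).symm ℓ)
    with hf
  have hsol : ∀ g : perpSpace, ⟪cdOp f, cdOp g⟫ = ∫ v, quot h v * (g : FreqL2) v ∂GV := by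
    intro g
    rw [← hBapp, ← hco.continuousLinearEquivOfBilin_apply, hf,
      ContinuousLinearEquiv.apply_symm_apply, InnerProductSpace.toDual_symm_apply]
    rfl
  obtain ⟨φ, hm, hφ, hfφ⟩ := exists_rep f
  have hmem : hφ.toLp φ ∈ perpSpace := hfφ ▸ f.2
  have hpi := perpInv_of_mem hm hφ hmem
  -- The variational solution is square integrable only against the collision frequency, for which
  -- merely a constant lower bound is at hand. Its dissipation is finite, so coercivity supplies the
  -- weight `1 + |v|`.
  have hwg : WG φ := by
    obtain ⟨c₂, hc₂, h₂⟩ := PerpInv.coercive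
    refine ⟨hm, Measurable.aestronglyMeasurable (by fun_prop), ?_⟩
    rw [hasFiniteIntegral_iff_ofReal (ae_of_all _ fun v => by positivity)]
    refine (h₂ φ hpi).trans_lt (ENNReal.mul_lt_top hc₂.lt_top ?_)
    rw [lintegral_dissip hm]
    have := (memLp_collDiff hφ).integrable_sq.2
    rwa [hasFiniteIntegral_iff_ofReal (ae_of_all _ fun v => sq_nonneg _)] at this
  set g : Vel → ℝ := fun v => sqrtM v * φ v with hg
  have hgw : WL2 g := hwg.wl2
  have hq : quot g = φ := quot_sqrtM_mul φ
  have hgp : PerpN g := by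
    refine perpN_of_forall fun ρ u θ => ?_
    rw [ip_eq_gaussian, hq]
    have := (mem_perpSpace_toLp hφ).1 hmem (ρ, u, θ)
    rw [← this]
    simp only [invF, mul_comm]
  -- The variational equation is tested only with functions orthogonal to the invariants. Both sides
  -- ignore the invariant part of `k`, so it extends to all `k`. The factor `1/4` comes from
  -- `energy`, which is why `4 g` is the solution.
  have key : ∀ k, WL2 k → energy g k = 1 / 4 * ip h k := by
    intro k hk
    have hk' := hk.micro
    have hkp := perpN_micro hk
    have hmk : (hk'.wg.memLp_freq).toLp (quot (micro k)) ∈ perpSpace := by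
      rw [mem_perpSpace_toLp]
      intro p
      have := hkp.ip_pf_invP hk' p.1 p.2.1 p.2.2
      rw [ip_eq_gaussian] at this
      rw [← this]
      simp only [invF, mul_comm]
    have h1 := hsol ⟨_, hmk⟩
    rw [hfφ] at h1
    simp only at h1
    rw [inner_cdOp] at h1
    have h2 : ∫ v, quot h v * (hk'.wg.memLp_freq.toLp (quot (micro k)) : FreqL2) v ∂GV
        = ip h (micro k) := by
      rw [ip_eq_gaussian]
      refine integral_congr_ae ?_
      filter_upwards [absolutelyContinuous_freq.ae_le hk'.wg.memLp_freq.coeFn_toLp] with v hv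
      rw [hv]
    rw [h2, hp.ip_micro hh hk] at h1
    rw [← energy_micro_right hgw hk, energy, hq, h1]
  refine ⟨fun v => 4 * g v, isLinvOf_of (hgw.const_mul 4) (hgp.const_mul 4) ?_⟩
  have e : ∀ k : Vel → ℝ, (fun v => (linL (fun v => 4 * g v) v - h v) * k v)
      = fun v => linL (fun v => 4 * g v) v * k v - h v * k v := by
    intro k; ext v; ring
  have hz := ae_eq_zero_of_forall_ip (w := fun v => linL (fun v => 4 * g v) v - h v) ?_ ?_
  · filter_upwards [hz] with v hv
    exact sub_eq_zero.1 hv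
  · intro k hk
    rw [e]
    exact (integral_linL_mul (hgw.const_mul 4) hk).1.sub (hh.integrable_mul hk)
  · intro k hk
    obtain ⟨i1, e1⟩ := integral_linL_mul (hgw.const_mul 4) hk
    rw [ip] at e1
    rw [ip, e, integral_sub i1 (hh.integrable_mul hk), e1, energy_const_mul_left, key k hk, ip]
    ring

end ViscousLayer
end

/-! ### Pointwise algebra of the collision operator and its rotational invariance. -/

noncomputable section
namespace ViscousLayer
open ProbabilityTheory MvPolynomial
open scoped RealInnerProductSpace ENNReal

/-! ### Bilinearity of the collision operator -/

lemma integrable_one_add_norm_inv_pow_four : Integrable fun v : Vel => ((1 + ‖v‖) ^ 4)⁻¹ := by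
  have h4 : Integrable (fun v : Vel => (1 + ‖v‖) ^ (-(4 : ℝ))) :=
    integrable_one_add_norm (by simp; norm_num)
  refine h4.congr (ae_of_all _ fun v => ?_)
  have h0 : (0 : ℝ) < 1 + ‖v‖ := by positivity
  simp only
  rw [Real.rpow_neg h0.le, ← Real.rpow_natCast]; norm_num

lemma Rapid.integrable_pow_mul {g : Vel → ℝ} (hg : Rapid g) (q : ℕ) :
    Integrable fun v : Vel => (1 + ‖v‖) ^ q * g v := by
  obtain ⟨C, hC⟩ := hg.bound (q + 4)
  refine (integrable_one_add_norm_inv_pow_four.const_mul C).mono' ?_ (ae_of_all _ fun v => ?_)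
  · have := hg.measurable
    exact Measurable.aestronglyMeasurable (by fun_prop)
  · have h0 : (0 : ℝ) < 1 + ‖v‖ := by positivity
    rw [← div_eq_mul_inv, le_div_iff₀ (by positivity), Real.norm_eq_abs, abs_mul,
      abs_of_pos (pow_pos h0 q)]
    calc _ = (1 + ‖v‖) ^ (q + 4) * |g v| := by ring
      _ ≤ C := hC v

lemma Rapid.bounded {g : Vel → ℝ} (hg : Rapid g) : ∃ C, ∀ v, |g v| ≤ C := by
  simpa using hg.bound 0

lemma continuous_coll_left (v : Vel) : Continuous fun p : Vel × Sph => (((v, p.1), p.2) : Coll) := by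
  fun_prop

/-- Growth like `1/√μ(u)` is admissible since the Gaussian density leaves a factor `√μ(u)`. -/
lemma integrable_kern_mul (v : Vel) {Φ : Vel × Sph → ℝ} (hm : Measurable Φ) {C : ℝ}
    (hC : ∀ p, |Φ p| ≤ C / sqrtM p.1) :
    Integrable (fun p : Vel × Sph => kern ((v, p.1), p.2) * Φ p) (GV.prod sphereMeasure) := by
  have h1 : Integrable (fun u : Vel => (1 + ‖v‖) * C * ((1 + ‖u‖) / sqrtM u)) GV := by
    rw [integrable_gaussian_iff]
    refine ((rapid_sqrtM.integrable_pow_mul 1).const_mul ((1 + ‖v‖) * C)).congr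
      (ae_of_all _ fun u => ?_)
    have := (sqrtM_pos u).ne'
    simp only
    rw [← sqrtM_mul_self]
    field_simp
  have h2 : Integrable (fun p : Vel × Sph => (1 + ‖v‖) * C * ((1 + ‖p.1‖) / sqrtM p.1))
      (GV.prod sphereMeasure) := h1.comp_fst sphereMeasure
  have mk : Measurable fun p : Vel × Sph => kern ((v, p.1), p.2) :=
    continuous_kern.measurable.comp (continuous_coll_left v).measurable
  refine h2.mono' (mk.mul hm).aestronglyMeasurable (ae_of_all _ fun p => ?_)
  rw [Real.norm_eq_abs, abs_mul, abs_of_nonneg (kern_nonneg _)]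
  calc kern ((v, p.1), p.2) * |Φ p| ≤ ((1 + ‖p.1‖) * (1 + ‖v‖)) * (C / sqrtM p.1) :=
        mul_le_mul (kern_le _) (hC p) (abs_nonneg _) (by positivity)
    _ = _ := by ring

/-- The two factors in the collision integral. -/
def gainP (g h : Vel → ℝ) (v : Vel) (p : Vel × Sph) : ℝ :=
  quot g (postU ((v, p.1), p.2)) * quot h (postV ((v, p.1), p.2)) - quot g p.1 * quot h v

lemma measurable_quot {g : Vel → ℝ} (hg : Measurable g) : Measurable (quot g) :=
  hg.div measurable_sqrtM

/-- As `√μ(u')√μ(v') = √μ(u)√μ(v)`, boundedness of `g` and `h` bounds the product of quotients by a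
multiple of `1/√μ(u)` for fixed `v`. -/
lemma integrable_gain {g h : Vel → ℝ} (hg : Rapid g) (hh : Rapid h) (v : Vel) :
    Integrable (fun p : Vel × Sph => kern ((v, p.1), p.2)
      * (quot g (postU ((v, p.1), p.2)) * quot h (postV ((v, p.1), p.2))))
      (GV.prod sphereMeasure) := by
  obtain ⟨C, hC⟩ := hg.bounded
  obtain ⟨C', hC'⟩ := hh.bounded
  have h0 : 0 ≤ C := (abs_nonneg _).trans (hC 0)
  refine integrable_kern_mul v (C := C * C' / sqrtM v) ?_ fun p => ?_
  · exact ((measurable_quot hg.measurable).comp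
      (continuous_postU.measurable.comp (continuous_coll_left v).measurable)).mul
      ((measurable_quot hh.measurable).comp
      (continuous_postV.measurable.comp (continuous_coll_left v).measurable))
  · have e := sqrtM_coll (norm_sph p.2) v p.1
    have p1 := sqrtM_pos (postU ((v, p.1), p.2))
    have p2 := sqrtM_pos (postV ((v, p.1), p.2))
    have : |quot g (postU ((v, p.1), p.2)) * quot h (postV ((v, p.1), p.2))|
        = |g (postU ((v, p.1), p.2))| * |h (postV ((v, p.1), p.2))| / (sqrtM v * sqrtM p.1) := by
      rw [← e, abs_mul, quot, quot, abs_div, abs_div, abs_of_pos p1, abs_of_pos p2, div_mul_div_comm,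
        mul_comm (sqrtM (postU _))]
      rfl
    rw [this, div_div]
    have := mul_pos (sqrtM_pos v) (sqrtM_pos p.1)
    gcongr
    · exact hC _
    · exact hC' _

lemma integrable_loss {g : Vel → ℝ} (hg : Rapid g) (v : Vel) (a : ℝ) :
    Integrable (fun p : Vel × Sph => kern ((v, p.1), p.2) * (quot g p.1 * a))
      (GV.prod sphereMeasure) := by
  obtain ⟨C, hC⟩ := hg.bounded
  refine integrable_kern_mul v (C := C * |a|) ?_ fun p => ?_
  · exact ((measurable_quot hg.measurable).comp measurable_fst).mul_const a
  · have p1 := sqrtM_pos p.1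
    rw [abs_mul, quot, abs_div, abs_of_pos p1, div_mul_eq_mul_div]
    gcongr
    exact hC _

lemma integrable_kern_gainP {g h : Vel → ℝ} (hg : Rapid g) (hh : Rapid h) (v : Vel) :
    Integrable (fun p : Vel × Sph => kern ((v, p.1), p.2) * gainP g h v p)
      (GV.prod sphereMeasure) := by
  refine ((integrable_gain hg hh v).sub' (integrable_loss hg v (quot h v))).congr
    (ae_of_all _ fun p => ?_)
  simp only [gainP]; ring

lemma Gam_eq_prod {g h : Vel → ℝ} (hg : Rapid g) (hh : Rapid h) (v : Vel) :
    Gam g h v = sqrtM v * ∫ p, kern ((v, p.1), p.2) * gainP g h v p ∂(GV.prod sphereMeasure) := by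
  have i1 := integrable_gain hg hh v
  have i2 := integrable_loss hg v (quot h v)
  rw [Gam_eq', gaussColl]
  congr 1
  have e1 := integral_prod _ i1
  have e2 := integral_prod _ i2
  simp only at e1 e2
  rw [← e1, ← e2, ← integral_sub i1 i2]
  refine integral_congr_ae (ae_of_all _ fun p => ?_)
  simp only [gainP]; ring

/-- In contrast to `linL_add_ae` this holds at every velocity, because the collision integrals of
rapidly decreasing functions converge absolutely. -/
lemma Gam_add_left {g g' h : Vel → ℝ} (hg : Rapid g) (hg' : Rapid g') (hh : Rapid h) :
    Gam (fun v => g v + g' v) h = fun v => Gam g h v + Gam g' h v := by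
  ext v
  rw [Gam_eq_prod (hg.add hg') hh, Gam_eq_prod hg hh, Gam_eq_prod hg' hh, ← mul_add,
    ← integral_add (integrable_kern_gainP hg hh v) (integrable_kern_gainP hg' hh v)]
  congr 1
  refine integral_congr_ae (ae_of_all _ fun p => ?_)
  simp only [gainP, quot_add]; ring

lemma Gam_add_right {g h h' : Vel → ℝ} (hg : Rapid g) (hh : Rapid h) (hh' : Rapid h') :
    Gam g (fun v => h v + h' v) = fun v => Gam g h v + Gam g h' v := by
  ext v
  rw [Gam_eq_prod hg (hh.add hh'), Gam_eq_prod hg hh, Gam_eq_prod hg hh', ← mul_add,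
    ← integral_add (integrable_kern_gainP hg hh v) (integrable_kern_gainP hg hh' v)]
  congr 1
  refine integral_congr_ae (ae_of_all _ fun p => ?_)
  simp only [gainP, quot_add]; ring

lemma Gam_const_mul_left {g h : Vel → ℝ} (hg : Rapid g) (hh : Rapid h) (c : ℝ) :
    Gam (fun v => c * g v) h = fun v => c * Gam g h v := by
  ext v
  rw [Gam_eq_prod (hg.const_mul c) hh, Gam_eq_prod hg hh, mul_left_comm]
  congr 1
  rw [← integral_const_mul]
  refine integral_congr_ae (ae_of_all _ fun p => ?_)
  simp only [gainP, quot_const_mul]; ring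

lemma Gam_const_mul_right {g h : Vel → ℝ} (hg : Rapid g) (hh : Rapid h) (c : ℝ) :
    Gam g (fun v => c * h v) = fun v => c * Gam g h v := by
  ext v
  rw [Gam_eq_prod hg (hh.const_mul c), Gam_eq_prod hg hh, mul_left_comm]
  congr 1
  rw [← integral_const_mul]
  refine integral_congr_ae (ae_of_all _ fun p => ?_)
  simp only [gainP, quot_const_mul]; ring

lemma GamS_comm (g h : Vel → ℝ) : GamS g h = GamS h g := by
  ext v; simp only [GamS, add_comm]

lemma GamS_add_left {g g' h : Vel → ℝ} (hg : Rapid g) (hg' : Rapid g') (hh : Rapid h) (v : Vel) :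
    GamS (fun v => g v + g' v) h v = GamS g h v + GamS g' h v := by
  simp only [GamS, Gam_add_left hg hg' hh, Gam_add_right hh hg hg']; ring

lemma GamS_add_right {g h h' : Vel → ℝ} (hg : Rapid g) (hh : Rapid h) (hh' : Rapid h') (v : Vel) :
    GamS g (fun v => h v + h' v) v = GamS g h v + GamS g h' v := by
  simp only [GamS, Gam_add_left hh hh' hg, Gam_add_right hg hh hh']; ring

lemma GamS_const_mul_left {g h : Vel → ℝ} (hg : Rapid g) (hh : Rapid h) (c : ℝ) (v : Vel) :
    GamS (fun v => c * g v) h v = c * GamS g h v := by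
  simp only [GamS, Gam_const_mul_left hg hh, Gam_const_mul_right hh hg]; ring

lemma GamS_sub_left {g g' h : Vel → ℝ} (hg : Rapid g) (hg' : Rapid g') (hh : Rapid h) (v : Vel) :
    GamS (fun v => g v - g' v) h v = GamS g h v - GamS g' h v := by
  have := GamS_add_left hg (hg'.const_mul (-1)) hh v
  rw [GamS_const_mul_left hg' hh] at this
  simpa [sub_eq_add_neg] using this

lemma GamS_sub_right {g h h' : Vel → ℝ} (hg : Rapid g) (hh : Rapid h) (hh' : Rapid h') (v : Vel) :
    GamS g (fun v => h v - h' v) v = GamS g h v - GamS g h' v := by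
  rw [GamS_comm, GamS_sub_left hh hh' hg, GamS_comm h, GamS_comm h']

lemma GamS_zero_left {h : Vel → ℝ} (hh : Rapid h) (v : Vel) : GamS (fun _ => 0) h v = 0 := by
  have := GamS_const_mul_left rapid_zero hh 0 v
  simpa using this

lemma GamS_zero_right {h : Vel → ℝ} (hh : Rapid h) (v : Vel) : GamS h (fun _ => 0) v = 0 := by
  rw [GamS_comm, GamS_zero_left hh]

lemma linL_sub {g h : Vel → ℝ} (hg : Rapid g) (hh : Rapid h) (v : Vel) :
    linL (fun v => g v - h v) v = linL g v - linL h v := by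
  rw [linL_eq, linL_eq, linL_eq, GamS_sub_right rapid_sqrtM hg hh]; ring

lemma GamS_eq_prod {g h : Vel → ℝ} (hg : Rapid g) (hh : Rapid h) (v : Vel) :
    GamS g h v = sqrtM v * ∫ p, kern ((v, p.1), p.2) * (gainP g h v p + gainP h g v p)
      ∂(GV.prod sphereMeasure) := by
  rw [GamS, Gam_eq_prod hg hh, Gam_eq_prod hh hg, ← mul_add,
    ← integral_add (integrable_kern_gainP hg hh v) (integrable_kern_gainP hh hg v)]
  congr 1
  refine integral_congr_ae (ae_of_all _ fun p => ?_)
  simp only; ring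

/-- The linearized operator applied to the product of two collision invariants. -/
lemma GamS_invP_eq_linL (ρ ρ' : ℝ) (u u' : Fin 3 → ℝ) (θ θ' : ℝ) (v : Vel) :
    GamS (pf (invP ρ u θ)) (pf (invP ρ' u' θ')) v
      = linL (pf (invP ρ u θ * invP ρ' u' θ')) v := by
  rw [linL_eq, ← pf_one, GamS_eq_prod (rapid_pf _) (rapid_pf _),
    GamS_eq_prod (rapid_pf _) (rapid_pf _), ← mul_neg, ← integral_neg]
  congr 1
  refine integral_congr_ae (ae_of_all _ fun p => ?_)
  have h1 := cd_invP ρ u θ ((v, p.1), p.2)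
  have h2 := cd_invP ρ' u' θ' ((v, p.1), p.2)
  simp only [cd, preV, preU] at h1 h2
  simp only [gainP]
  set V := postV ((v, p.1), p.2)
  set U := postU ((v, p.1), p.2)
  simp only [quot_pf, map_mul, map_one] at h1 h2 ⊢
  set a := eval (fun i => v i) (invP ρ u θ)
  set a' := eval (fun i => p.1 i) (invP ρ u θ)
  set b := eval (fun i => V i) (invP ρ u θ)
  set b' := eval (fun i => U i) (invP ρ u θ)
  set c := eval (fun i => v i) (invP ρ' u' θ')
  set c' := eval (fun i => p.1 i) (invP ρ' u' θ')
  set d := eval (fun i => V i) (invP ρ' u' θ')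
  set d' := eval (fun i => U i) (invP ρ' u' θ')
  -- The sums `a + a'` and `c + c'` are conserved, hence so is their product. Its mixed terms give
  -- `Γˢ` and its diagonal terms give `-L` of the product, so the two agree up to sign.
  linear_combination kern ((v, p.1), p.2) * (-(c + c') * h1 - (b + b') * h2)

lemma linL_pf_invP (ρ : ℝ) (u : Fin 3 → ℝ) (θ : ℝ) (v : Vel) : linL (pf (invP ρ u θ)) v = 0 := by
  rw [linL_eq, ← pf_one, GamS_eq_prod (rapid_pf _) (rapid_pf _), neg_eq_zero]
  convert mul_zero _
  rw [← integral_zero (Vel × Sph) ℝ (μ := GV.prod sphereMeasure)]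
  refine integral_congr_ae (ae_of_all _ fun p => ?_)
  have h1 := cd_invP ρ u θ ((v, p.1), p.2)
  simp only [cd, preV, preU] at h1
  simp only [gainP]
  simp only [quot_pf, map_one] at h1 ⊢
  linear_combination -kern ((v, p.1), p.2) * h1

lemma linL_proj (g : Vel → ℝ) (v : Vel) : linL (proj g) v = 0 := by
  rw [proj_eq, linL_pf_invP]

lemma linL_micro {g : Vel → ℝ} (hg : Rapid g) (v : Vel) : linL (micro g) v = linL g v := by
  have := linL_sub hg (rapid_proj g) v
  rw [linL_proj, sub_zero] at this
  exact this

lemma isLinvOf_linL {g : Vel → ℝ} (hg : Rapid g) : IsLinvOf (linL g) (micro g) :=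
  isLinvOf_of hg.wl2.micro (perpN_micro hg.wl2) (ae_of_all _ fun v => linL_micro hg v)

/-- `L⁻¹ Γˢ` on collision invariants. -/
lemma isLinvOf_GamS_proj (g h : Vel → ℝ) :
    IsLinvOf (GamS (proj g) (proj h))
      (micro (pf (invP (rho g) (fun i => vel i g) (temp g)
        * invP (rho h) (fun i => vel i h) (temp h)))) := by
  have := isLinvOf_linL (rapid_pf (invP (rho g) (fun i => vel i g) (temp g)
        * invP (rho h) (fun i => vel i h) (temp h)))
  refine this.congr (ae_of_all _ fun v => ?_)
  rw [proj_eq, proj_eq, GamS_invP_eq_linL]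

/-- The null space of the linearized operator. -/
lemma micro_ae_eq_zero_of_linL {g : Vel → ℝ} (hg : Rapid g) (h : linL g =ᵐ[volume] 0) :
    micro g =ᵐ[volume] 0 := by
  refine ae_eq_zero_of_energy hg.wl2.micro (perpN_micro hg.wl2) ?_
  rw [← (integral_linL_mul hg.wl2.micro hg.wl2.micro).2]
  have : linL (micro g) =ᵐ[volume] fun _ => 0 := by
    filter_upwards [h] with v hv
    rw [linL_micro hg, hv]; rfl
  rw [ip_congr_left this]
  simp [ip]

lemma continuous_proj (g : Vel → ℝ) : Continuous (proj g) := by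
  have := continuous_sqrtM
  unfold proj
  fun_prop

/-- Coercivity gives equality almost everywhere, and continuity in `v` upgrades it. -/
lemma eq_proj_of_linL {g : Vel → ℝ} (hg : Rapid g) (hc : Continuous g) (h : ∀ v, linL g v = 0) :
    g = proj g := by
  have h1 := micro_ae_eq_zero_of_linL hg (ae_of_all _ h)
  have hcm : Continuous (micro g) := hc.sub (continuous_proj g)
  have h2 := (Continuous.ae_eq_iff_eq volume hcm continuous_zero).1 h1
  ext v
  have := congrFun h2 v
  exact sub_eq_zero.1 this

/-! ### Invariance under isometries -/

lemma integral_rotSph (R : Vel ≃ₗᵢ[ℝ] Vel) (f : Sph → ℝ) :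
    ∫ ω, f (rotSph R ω) ∂sphereMeasure = ∫ ω, f ω ∂sphereMeasure := by
  have hinj : Function.LeftInverse (rotSph R.symm) (rotSph R) := fun ω => by ext1; simp
  have hinj' : Function.RightInverse (rotSph R.symm) (rotSph R) := fun ω => by ext1; simp
  let e : Sph ≃ₜ Sph := ⟨⟨rotSph R, rotSph R.symm, hinj, hinj'⟩, continuous_rotSph R,
    continuous_rotSph R.symm⟩
  exact (measurePreserving_rotSph R).integral_comp e.measurableEmbedding f

lemma integral_rot (R : Vel ≃ₗᵢ[ℝ] Vel) (f : Vel → ℝ) : ∫ v, f (R v) = ∫ v, f v :=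
  R.measurePreserving.integral_comp R.toHomeomorph.measurableEmbedding f

lemma integral_integral_rot (R : Vel ≃ₗᵢ[ℝ] Vel) (f : Vel → Sph → ℝ) :
    ∫ u, ∫ ω, f (R u) (rotSph R ω) ∂sphereMeasure = ∫ u, ∫ ω, f u ω ∂sphereMeasure := by
  have e := integral_rot R fun u => ∫ ω, f u ω ∂sphereMeasure
  rw [← e]
  exact integral_congr_ae (ae_of_all _ fun u => integral_rotSph R (f (R u)))

lemma collision_rot (R : Vel ≃ₗᵢ[ℝ] Vel) (F G : Vel → ℝ) (v : Vel) :
    collision (fun v => F (R v)) (fun v => G (R v)) v = collision F G (R v) := by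
  have h : ∀ (u : Vel) (ω : Sph), ⟪R v - R u, R ω⟫ = ⟪v - u, (ω : Vel)⟫ := fun u ω => by
    rw [← map_sub, LinearIsometryEquiv.inner_map_map]
  have e1 := integral_integral_rot R fun u ω => |⟪R v - u, (ω : Vel)⟫| *
    (F (u + ⟪R v - u, (ω : Vel)⟫ • (ω : Vel)) * G (R v - ⟪R v - u, (ω : Vel)⟫ • (ω : Vel)))
  have e2 := integral_integral_rot R fun u ω => |⟪R v - u, (ω : Vel)⟫| * (F u * G (R v))
  simp only [coe_rotSph, h] at e1 e2
  unfold collision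
  rw [← e1, ← e2]
  simp

lemma Gam_rot (R : Vel ≃ₗᵢ[ℝ] Vel) (g h : Vel → ℝ) (v : Vel) :
    Gam (fun v => g (R v)) (fun v => h (R v)) v = Gam g h (R v) := by
  unfold Gam
  rw [← collision_rot, sqrtM_rot]
  simp only [sqrtM_rot]

lemma GamS_rot (R : Vel ≃ₗᵢ[ℝ] Vel) (g h : Vel → ℝ) (v : Vel) :
    GamS (fun v => g (R v)) (fun v => h (R v)) v = GamS g h (R v) := by
  rw [GamS, GamS, Gam_rot, Gam_rot]

lemma linL_rot (R : Vel ≃ₗᵢ[ℝ] Vel) (g : Vel → ℝ) (v : Vel) :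
    linL (fun v => g (R v)) v = linL g (R v) := by
  rw [linL_eq, linL_eq, ← GamS_rot]
  simp only [sqrtM_rot]

lemma ip_rot (R : Vel ≃ₗᵢ[ℝ] Vel) (g h : Vel → ℝ) :
    ip (fun v => g (R v)) (fun v => h (R v)) = ip g h :=
  integral_rot R fun v => g v * h v

lemma WL2.rot {g : Vel → ℝ} (hg : WL2 g) (R : Vel ≃ₗᵢ[ℝ] Vel) : WL2 fun v => g (R v) where
  measurable := hg.measurable.comp R.continuous.measurable
  integrable := by
    have := R.measurePreserving.integrable_comp_of_integrable hg.integrable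
    simpa [Function.comp_def] using this

lemma norm_sq_eq (v : Vel) : ‖v‖ ^ 2 = v 0 ^ 2 + v 1 ^ 2 + v 2 ^ 2 := by
  rw [EuclideanSpace.norm_sq_eq, Fin.sum_univ_three]; simp

/-- A description of orthogonality through `L` alone, so that its invariance under isometries
follows from that of `L` without computing moments. -/
lemma perpN_iff_forall {g : Vel → ℝ} (hg : WL2 g) :
    PerpN g ↔ ∀ k, linL k =ᵐ[volume] 0 → WL2 k → ip g k = 0 := by
  constructor
  · intro h k hk hk2
    have e : energy k k = 0 := by
      rw [← (integral_linL_mul hk2 hk2).2, ip_congr_left hk]; simp [ip]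
    have e2 : energy (micro k) (micro k) = 0 := by
      rw [energy_micro_right hk2.micro hk2, energy_comm, energy_micro_right hk2 hk2, e]
    have := ae_eq_zero_of_energy hk2.micro (perpN_micro hk2) e2
    rw [← h.ip_micro hg hk2, ip_congr_right this]
    simp [ip]
  · intro h
    exact perpN_of_forall fun ρ u θ => h _ (ae_of_all _ fun v => linL_pf_invP ρ u θ v)
      (rapid_pf _).wl2

lemma PerpN.rot {g : Vel → ℝ} (hg : WL2 g) (h : PerpN g) (R : Vel ≃ₗᵢ[ℝ] Vel) :
    PerpN fun v => g (R v) := by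
  rw [perpN_iff_forall (hg.rot R)]
  rw [perpN_iff_forall hg] at h
  intro k hk hk2
  have e := ip_rot R g (fun v => k (R.symm v))
  simp only [LinearIsometryEquiv.symm_apply_apply] at e
  rw [e]
  refine h _ ?_ (hk2.rot R.symm)
  have := R.symm.measurePreserving.quasiMeasurePreserving.ae hk
  filter_upwards [this] with v hv
  rw [linL_rot R.symm, hv]; rfl

lemma IsLinvOf.rot {h g : Vel → ℝ} (H : IsLinvOf h g) (R : Vel ≃ₗᵢ[ℝ] Vel) :
    IsLinvOf (fun v => h (R v)) fun v => g (R v) := by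
  refine isLinvOf_of (H.wl2.rot R) (H.perpN.rot H.wl2 R) ?_
  have := R.measurePreserving.quasiMeasurePreserving.ae H.eq
  filter_upwards [this] with v hv
  rw [linL_rot R, hv]

end ViscousLayer
end

/-! ### Burnett functions and transport coefficients. -/

noncomputable section
namespace ViscousLayer
open ProbabilityTheory MvPolynomial
open scoped RealInnerProductSpace ENNReal

/-! ### The Burnett functions -/

def polyA (i j : Fin 3) : MvPolynomial (Fin 3) ℝ :=
  X i * X j - (if i = j then C (1 / 3) * sqP else 0)

def polyB (i : Fin 3) : MvPolynomial (Fin 3) ℝ := C (1 / 2) * (X i * sqP) - C (5 / 2) * X i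

lemma burnettA_eq (i j : Fin 3) : burnettA i j = pf (polyA i j) := by
  ext v
  simp only [burnettA, pf, polyA, map_sub, map_mul, eval_X]
  split_ifs <;> simp [eval_sqP]
  left; ring

lemma burnettB_eq (i : Fin 3) : burnettB i = pf (polyB i) := by
  ext v
  simp only [burnettB, pf, polyB, map_sub, map_mul, eval_X, eval_C, eval_sqP]
  ring

lemma rapid_burnettA (i j : Fin 3) : Rapid (burnettA i j) := by
  rw [burnettA_eq]; exact rapid_pf _

lemma rapid_burnettB (i : Fin 3) : Rapid (burnettB i) := by
  rw [burnettB_eq]; exact rapid_pf _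

lemma burnettA_comm (i j : Fin 3) : burnettA i j = burnettA j i := by
  ext v
  simp only [burnettA, mul_comm (v i), eq_comm (a := i)]

/-- Pairing with `𝒜_{ij}` takes the trace-free part of the mean Hessian. -/
lemma gm_polyA_mul (i j : Fin 3) (P : MvPolynomial (Fin 3) ℝ) :
    gm (polyA i j * P) = gm (pderiv j (pderiv i P))
      - (if i = j then (∑ k, gm (pderiv k (pderiv k P))) / 3 else 0) := by
  rw [polyA, sub_mul, map_sub, gm_X_mul_X_mul]
  split_ifs with h
  · rw [mul_assoc, gm_C_mul, gm_sqP_mul]; ring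
  · simp

/-- The linear term of `ℬ_i` is exactly what cancels the first order contributions of integration by
parts. -/
lemma gm_polyB_mul (i : Fin 3) (P : MvPolynomial (Fin 3) ℝ) :
    gm (polyB i * P) = (∑ k, gm (pderiv k (pderiv k (pderiv i P)))) / 2 := by
  rw [polyB, sub_mul, map_sub, mul_assoc, gm_C_mul, mul_assoc, mul_assoc, gm_C_mul, gm_X_mul,
    gm_X_mul, Derivation.leibniz, smul_eq_mul, smul_eq_mul, map_add, gm_sqP_mul, pderiv_sqP,
    mul_comm P, mul_assoc, gm_C_mul, gm_X_mul]
  ring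

lemma gm_linear_mul_linear (i j : Fin 3) (a b c d : ℝ) :
    gm ((C a + C b * X i) * (C c + C d * X j)) = a * c + if i = j then b * d else 0 := by
  have e : (C a + C b * X i) * (C c + C d * X j)
      = C (a * c) + (C (a * d) * X j + (C (b * c) * X i + C (b * d) * (X i * X j * 1))) := by
    simp only [map_mul]; ring
  rw [e, map_add, map_add, map_add, gm_C, gm_C_mul, gm_C_mul, gm_C_mul, gm_X, gm_X,
    gm_X_mul_X_mul]
  simp [gm_one]

lemma gm_pderiv_pderiv_mul (i j : Fin 3) (ρ ρ' : ℝ) (u u' : Fin 3 → ℝ) (θ θ' : ℝ) :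
    gm (pderiv j (pderiv i (invP ρ u θ * invP ρ' u' θ')))
      = (if i = j then ρ * θ' + ρ' * θ + 2 * (θ * θ') else 0) + u i * u' j + u j * u' i := by
  rw [Derivation.leibniz, map_add, smul_eq_mul, smul_eq_mul, Derivation.leibniz, Derivation.leibniz]
  simp only [smul_eq_mul, map_add, pderiv_pderiv_invP]
  simp only [pderiv_invP, gm_linear_mul_linear]
  by_cases h : i = j
  · subst h
    simp only [if_true, mul_comm _ (C _), gm_C_mul, gm_invP]
    ring
  · simp only [h, if_false, mul_zero, map_zero]
    ring

/-- Densities and temperatures enter the mean Hessian only as multiples of the identity, which the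
trace-free part removes. -/
lemma ip_burnettA_mul_invP (i j : Fin 3) (ρ ρ' : ℝ) (u u' : Fin 3 → ℝ) (θ θ' : ℝ) :
    ip (burnettA i j) (pf (invP ρ u θ * invP ρ' u' θ'))
      = u i * u' j + u j * u' i - (if i = j then 2 / 3 * ∑ k, u k * u' k else 0) := by
  rw [burnettA_eq, ip_pf, gm_polyA_mul]
  simp only [gm_pderiv_pderiv_mul, if_true, Fin.sum_univ_three]
  split_ifs <;> ring

lemma gm_pderiv_pderiv_mul_linear (k i : Fin 3) (ρ : ℝ) (u : Fin 3 → ℝ) (θ a b : ℝ) :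
    gm (pderiv k (pderiv k (invP ρ u θ * (C a + C b * X i))))
      = θ * a + if k = i then 2 * (u k * b) else 0 := by
  have e : (C a + C b * X i : MvPolynomial (Fin 3) ℝ) = invP a (Pi.single i b) 0 := by
    simp [invP, Pi.single_apply, apply_ite, ite_mul]
  rw [e, gm_pderiv_pderiv_mul]
  simp only [if_true, Pi.single_apply]
  split_ifs <;> ring

lemma ip_burnettB_mul_invP (i : Fin 3) (ρ ρ' : ℝ) (u u' : Fin 3 → ℝ) (θ θ' : ℝ) :
    ip (burnettB i) (pf (invP ρ u θ * invP ρ' u' θ')) = 5 / 2 * (u i * θ' + u' i * θ) := by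
  rw [burnettB_eq, ip_pf, gm_polyB_mul]
  have e : pderiv i (invP ρ u θ * invP ρ' u' θ')
      = invP ρ u θ * (C (u' i) + C θ' * X i) + invP ρ' u' θ' * (C (u i) + C θ * X i) := by
    rw [Derivation.leibniz, smul_eq_mul, smul_eq_mul, pderiv_invP, pderiv_invP]
  rw [e]
  have e2 : ∀ k, gm (pderiv k (pderiv k (invP ρ u θ * (C (u' i) + C θ' * X i)
      + invP ρ' u' θ' * (C (u i) + C θ * X i))))
      = (θ * u' i + if k = i then 2 * (u k * θ') else 0)
        + (θ' * u i + if k = i then 2 * (u' k * θ) else 0) := fun k => by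
    rw [map_add, map_add, map_add, gm_pderiv_pderiv_mul_linear, gm_pderiv_pderiv_mul_linear]
  simp only [e2]
  simp only [Finset.sum_add_distrib, Finset.sum_const, Finset.sum_ite_eq', Finset.mem_univ, if_true,
    Finset.card_univ, Fintype.card_fin, nsmul_eq_mul]
  push_cast
  ring

lemma perpN_burnettA (i j : Fin 3) : PerpN (burnettA i j) := by
  refine perpN_of_forall fun ρ u θ => ?_
  rw [burnettA_eq, ip_pf, gm_polyA_mul]
  simp only [pderiv_pderiv_invP, apply_ite gm, gm_C, map_zero]
  split_ifs <;> simp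

lemma perpN_burnettB (i : Fin 3) : PerpN (burnettB i) := by
  refine perpN_of_forall fun ρ u θ => ?_
  rw [burnettB_eq, ip_pf, gm_polyB_mul]
  simp [pderiv_invP, pderiv_X, Pi.single_apply, apply_ite]

/-- The stress and heat flux that belong to a streaming invariant. -/
lemma micro_coord_mul_invP (i : Fin 3) (ρ : ℝ) (u : Fin 3 → ℝ) (θ : ℝ) (v : Vel) :
    micro (fun v => v i * pf (invP ρ u θ) v) v
      = ∑ j, u j * burnettA i j v + θ * burnettB i v := by
  have e : (fun v : Vel => v i * pf (invP ρ u θ) v)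
      = pf (invP 0 (Pi.single i 1) 0 * invP ρ u θ) := by
    ext v
    simp [pf, eval_invP, Pi.single_apply, mul_assoc]
  have hr : rho (pf (invP 0 (Pi.single i 1) 0 * invP ρ u θ)) = u i := by
    have := gm_X_mul i (invP ρ u θ)
    have e2 : invP 0 (Pi.single i 1) 0 = X i := by simp [invP, Pi.single_apply, apply_ite, ite_mul]
    rw [rho_pf, e2, this, pderiv_invP]
    simp [gm_C, gm_C_mul, gm_X]
  have hv : ∀ j, vel j (pf (invP 0 (Pi.single i 1) 0 * invP ρ u θ))
      = if i = j then ρ + θ else 0 := by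
    intro j
    rw [vel_pf, Derivation.leibniz]
    have e2 : invP 0 (Pi.single i 1) 0 = C 0 + C 1 * X i := by
      simp [invP, Pi.single_apply, apply_ite, ite_mul]
    simp only [smul_eq_mul, pderiv_invP, map_add]
    rw [e2, gm_linear_mul_linear]
    simp only [map_zero, zero_mul, add_zero, mul_comm (invP ρ u θ), gm_C_mul, gm_invP,
      Pi.single_apply, eq_comm (a := j)]
    split_ifs <;> ring
  have ht : temp (pf (invP 0 (Pi.single i 1) 0 * invP ρ u θ)) = 2 / 3 * u i := by
    rw [temp_pf]
    simp only [gm_pderiv_pderiv_mul, if_true, Pi.single_apply, Fin.sum_univ_three]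
    fin_cases i <;> simp <;> ring
  rw [e, micro, proj, hr, ht]
  simp only [hv, pf, map_mul, eval_invP, burnettA, burnettB, norm_sq_eq, Fin.sum_univ_three]
  fin_cases i <;> simp <;> ring

/-- Splitting the momentum flux tensor into its trace-free part and the pressure `ρ + θ`. -/
lemma ip_vel_mul (i j : Fin 3) {g : Vel → ℝ} (hg : Rapid g) :
    vel j (fun v => v i * g v) = ip (burnettA i j) g + if i = j then rho g + temp g else 0 := by
  have e : rho g + temp g = ip g (fun v => ‖v‖ ^ 2 / 3 * sqrtM v) := by
    have : ip g (fun v => ‖v‖ ^ 2 / 3 * sqrtM v)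
        = ip (fun v => sqrtM v + 1 / 3 * ((‖v‖ ^ 2 - 3) * sqrtM v)) g := by
      rw [ip_comm]
      refine integral_congr_ae (ae_of_all _ fun v => ?_)
      simp only; ring
    rw [this, ip_add_left wl2_sqrtM (wl2_temp.const_mul _) hg.wl2, ip_const_mul_left, rho, temp,
      ip_comm sqrtM, ip_comm _ g]
    ring
  have h3 : Integrable fun v : Vel => ‖v‖ ^ 2 / 3 * sqrtM v * g v := by
    have : WL2 fun v : Vel => ‖v‖ ^ 2 / 3 * sqrtM v := by
      have h := wl2_sqrtM.add (wl2_temp.const_mul (1 / 3))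
      refine (congrArg WL2 (funext fun v => ?_)).mp h
      ring
    exact this.integrable_mul hg.wl2
  have h1 : Integrable fun v => burnettA i j v * g v := (rapid_burnettA i j).wl2.integrable_mul hg.wl2
  split_ifs with h
  · rw [e, ip_comm g, ip, ip, ← integral_add h1 h3, vel, ip]
    refine integral_congr_ae (ae_of_all _ fun v => ?_)
    simp only [burnettA, h, if_true]; ring
  · rw [add_zero, vel, ip, ip]
    refine integral_congr_ae (ae_of_all _ fun v => ?_)
    simp only [burnettA, h, if_false]; ring

/-- The moment with the weight `(|v|²-5)/2`. -/
def enth (g : Vel → ℝ) : ℝ := 3 / 2 * temp g - rho g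

lemma enth_eq_ip {g : Vel → ℝ} (hg : Rapid g) :
    enth g = ip g (fun v => (‖v‖ ^ 2 - 5) / 2 * sqrtM v) := by
  have : ip g (fun v => (‖v‖ ^ 2 - 5) / 2 * sqrtM v)
      = ip (fun v => 1 / 2 * ((‖v‖ ^ 2 - 3) * sqrtM v) - sqrtM v) g := by
    rw [ip_comm]
    refine integral_congr_ae (ae_of_all _ fun v => ?_)
    simp only; ring
  rw [this, ip_sub_left (wl2_temp.const_mul _) wl2_sqrtM hg.wl2, ip_const_mul_left, enth, rho, temp,
    ip_comm sqrtM, ip_comm _ g]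
  ring

lemma rho_coord_mul (i : Fin 3) (g : Vel → ℝ) : rho (fun v => v i * g v) = vel i g := by
  refine integral_congr_ae (ae_of_all _ fun v => ?_)
  simp only; ring

/-- The weight `(|v|² - 5)/2` is used in place of the temperature because its flux is precisely the
Burnett function, with no multiple of the velocity left over. -/
lemma enth_coord_mul (i : Fin 3) {g : Vel → ℝ} (hg : Rapid g) :
    enth (fun v => v i * g v) = ip (burnettB i) g := by
  rw [enth_eq_ip (hg.coord_mul i)]
  refine integral_congr_ae (ae_of_all _ fun v => ?_)
  simp only [burnettB]; ring

/-! ### Parity -/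

/-- The reflection in the coordinate `i`. -/
def flip (i : Fin 3) : Vel ≃ₗᵢ[ℝ] Vel :=
  LinearIsometryEquiv.piLpCongrRight 2 fun j =>
    if j = i then LinearIsometryEquiv.neg ℝ else LinearIsometryEquiv.refl ℝ ℝ

lemma flip_apply (i j : Fin 3) (v : Vel) : flip i v j = if j = i then -v j else v j := by
  simp only [flip, LinearIsometryEquiv.piLpCongrRight_apply]
  split_ifs <;> rfl

/-- The permutation of the coordinates. -/
def permute (σ : Equiv.Perm (Fin 3)) : Vel ≃ₗᵢ[ℝ] Vel :=
  LinearIsometryEquiv.piLpCongrLeft 2 ℝ ℝ σ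

lemma permute_apply (σ : Equiv.Perm (Fin 3)) (v : Vel) (j : Fin 3) :
    permute σ v j = v (σ.symm j) := by
  simp [permute, LinearIsometryEquiv.piLpCongrLeft_apply, Equiv.piCongrLeft']

/-- By uniqueness `L⁻¹` preserves parity, so `g` is even almost everywhere and is paired with an odd
function. -/
lemma ip_eq_zero_of_odd {h k g : Vel → ℝ} (R : Vel ≃ₗᵢ[ℝ] Vel) (hh : ∀ v, h (R v) = -h v)
    (hk : ∀ v, k (R v) = k v) (H : IsLinvOf k g) : ip h g = 0 := by
  have H2 := H.rot R
  simp only [hk] at H2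
  have e := ip_rot R h g
  simp only [hh] at e
  rw [ip_congr_right (H2.unique H)] at e
  have e2 : ip (fun v => -h v) g = -ip h g := by
    simp [ip, integral_neg]
  linarith

lemma burnettA_flip (i j k : Fin 3) (v : Vel) :
    burnettA i j (flip k v) = (if i = k then -1 else 1) * (if j = k then -1 else 1)
      * burnettA i j v := by
  have : sqrtM (flip k v) = sqrtM v := sqrtM_rot _ v
  simp only [burnettA, this, LinearIsometryEquiv.norm_map, flip_apply]
  by_cases h : i = j
  · subst h; split_ifs <;> simp
  · simp only [h, if_false]; split_ifs <;> ring

lemma burnettB_flip (i k : Fin 3) (v : Vel) :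
    burnettB i (flip k v) = (if i = k then -1 else 1) * burnettB i v := by
  have : sqrtM (flip k v) = sqrtM v := sqrtM_rot _ v
  simp only [burnettB, this, LinearIsometryEquiv.norm_map, flip_apply]
  split_ifs <;> ring

lemma burnettA_permute (i j : Fin 3) (σ : Equiv.Perm (Fin 3)) (v : Vel) :
    burnettA i j (permute σ v) = burnettA (σ.symm i) (σ.symm j) v := by
  have : sqrtM (permute σ v) = sqrtM v := sqrtM_rot _ v
  simp [burnettA, this, permute_apply]

lemma burnettB_permute (i : Fin 3) (σ : Equiv.Perm (Fin 3)) (v : Vel) :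
    burnettB i (permute σ v) = burnettB (σ.symm i) v := by
  have : sqrtM (permute σ v) = sqrtM v := sqrtM_rot _ v
  simp [burnettB, this, permute_apply]

lemma isLinvOf_Linv {h : Vel → ℝ} (hh : WL2 h) (hp : PerpN h) : IsLinvOf h (Linv h) := by
  obtain ⟨g, hg⟩ := exists_isLinvOf hh hp
  exact hg.linv

lemma isLinvOf_burnettA (i j : Fin 3) : IsLinvOf (burnettA i j) (Linv (burnettA i j)) :=
  isLinvOf_Linv (rapid_burnettA i j).wl2 (perpN_burnettA i j)

lemma isLinvOf_burnettB (i : Fin 3) : IsLinvOf (burnettB i) (Linv (burnettB i)) :=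
  isLinvOf_Linv (rapid_burnettB i).wl2 (perpN_burnettB i)

/-- Used with permutations of the coordinates, this makes `λ` and `κ` independent of the indices. -/
lemma ip_Linv_rot {h k : Vel → ℝ} (R : Vel ≃ₗᵢ[ℝ] Vel) (e : ∀ v, h (R v) = k v)
    (H : IsLinvOf h (Linv h)) : ip k (Linv k) = ip h (Linv h) := by
  have H2 := H.rot R
  simp only [e] at H2
  rw [ip_congr_right H2.linv_ae, ← ip_rot R h]
  simp only [e]

lemma exists_perm_pair {i j : Fin 3} (h : i ≠ j) :
    ∃ σ : Equiv.Perm (Fin 3), σ.symm 0 = i ∧ σ.symm 1 = j := by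
  revert i j; decide

lemma ip_burnettA_Linv {i j : Fin 3} (h : i ≠ j) :
    ip (burnettA i j) (Linv (burnettA i j)) = viscosity := by
  obtain ⟨σ, h0, h1⟩ := exists_perm_pair h
  refine ip_Linv_rot (permute σ) (fun v => ?_) (isLinvOf_burnettA 0 1)
  rw [burnettA_permute, h0, h1]

lemma ip_burnettB_Linv (i : Fin 3) : ip (burnettB i) (Linv (burnettB i)) = conductivity := by
  refine ip_Linv_rot (permute (Equiv.swap 0 i)) (fun v => ?_) (isLinvOf_burnettB 0)
  rw [burnettB_permute]; simp

/-- If the energy of `g` vanished then `g = 0` almost everywhere; pairing `L g = h` with `h` would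
give `h = 0`. -/
lemma IsLinvOf.ip_pos {h g : Vel → ℝ} (H : IsLinvOf h g) (hh : WL2 h) (hc : Continuous h)
    (hne : ∃ v, h v ≠ 0) : 0 < ip h g := by
  rw [H.ip_eq H.wl2]
  refine lt_of_le_of_ne (energy_self_nonneg g) fun h0 => ?_
  have hz := ae_eq_zero_of_energy H.wl2 H.perpN h0.symm
  have e1 := H.ip_eq hh
  rw [energy_comm, ← (integral_linL_mul hh H.wl2).2, ip_congr_right hz] at e1
  have e2 : ∫ v, h v ^ 2 = 0 := by
    simpa [ip, pow_two] using e1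
  have hi : Integrable fun v => h v ^ 2 := hh.memLp.integrable_sq
  rw [integral_eq_zero_iff_of_nonneg (fun v => sq_nonneg _) hi] at e2
  have e3 : (fun v => h v ^ 2) = 0 :=
    (Continuous.ae_eq_iff_eq volume (hc.pow 2) continuous_zero).1 e2
  obtain ⟨v, hv⟩ := hne
  exact hv (pow_eq_zero_iff two_ne_zero |>.1 (congrFun e3 v))

lemma continuous_pf (P : MvPolynomial (Fin 3) ℝ) : Continuous (pf P) := by
  have h : Continuous fun v : Vel => eval (fun i => v i) P :=
    (MvPolynomial.continuous_eval P).comp (by fun_prop)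
  exact h.mul continuous_sqrtM

lemma viscosity_pos : 0 < viscosity := by
  refine (isLinvOf_burnettA 0 1).ip_pos (rapid_burnettA 0 1).wl2 ?_
    ⟨WithLp.toLp 2 ![1, 1, 0], ?_⟩
  · rw [burnettA_eq]; exact continuous_pf _
  · simp [burnettA, (sqrtM_pos _).ne']

lemma conductivity_pos : 0 < conductivity := by
  refine (isLinvOf_burnettB 0).ip_pos (rapid_burnettB 0).wl2 ?_
    ⟨WithLp.toLp 2 ![1, 0, 0], ?_⟩
  · rw [burnettB_eq]; exact continuous_pf _
  · simp only [burnettB, norm_sq_eq]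
    have := (sqrtM_pos (WithLp.toLp 2 ![1, 0, 0])).ne'
    simp [this]
    norm_num

/-! ### Fluxes across the layer -/

/-- Reflecting the tangential coordinate `i` changes the sign of one factor only, unless both are
the same shear component. -/
lemma ip_burnettA_Linv_normal (i : Fin 2) (j : Fin 3) :
    ip (burnettA 2 i.castSucc) (Linv (burnettA 2 j)) = if j = i.castSucc then viscosity else 0 := by
  have h2 : (2 : Fin 3) ≠ i.castSucc := by fin_cases i <;> decide
  split_ifs with h
  · rw [h, ip_burnettA_Linv h2]
  · refine ip_eq_zero_of_odd (flip i.castSucc) (fun v => ?_) (fun v => ?_) (isLinvOf_burnettA 2 j)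
    · rw [burnettA_flip, if_neg h2, if_pos rfl]; ring
    · rw [burnettA_flip, if_neg h2, if_neg h]; ring

lemma ip_burnettA_Linv_burnettB_normal (i : Fin 2) :
    ip (burnettA 2 i.castSucc) (Linv (burnettB 2)) = 0 := by
  have h2 : (2 : Fin 3) ≠ i.castSucc := by fin_cases i <;> decide
  refine ip_eq_zero_of_odd (flip i.castSucc) (fun v => ?_) (fun v => ?_) (isLinvOf_burnettB 2)
  · rw [burnettA_flip, if_neg h2, if_pos rfl]; ring
  · rw [burnettB_flip, if_neg h2]; ring

lemma ip_burnettB_Linv_burnettA_normal (j : Fin 3) :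
    ip (burnettB 2) (Linv (burnettA 2 j)) = 0 := by
  by_cases h : j = 2
  · subst h
    refine ip_eq_zero_of_odd (flip 2) (fun v => ?_) (fun v => ?_) (isLinvOf_burnettA 2 2)
    · rw [burnettB_flip, if_pos rfl]; ring
    · rw [burnettA_flip, if_pos rfl]; ring
  · have H := (isLinvOf_burnettA 2 j)
    -- Symmetry of the energy form moves `L⁻¹` to the other factor, so that the function outside
    -- `L⁻¹` is the one odd in the coordinate `j`.
    rw [H.ip_eq (k := Linv (burnettB 2)) (isLinvOf_burnettB 2).wl2 |> fun e => (by
      rw [(isLinvOf_burnettB 2).ip_eq H.wl2, energy_comm, ← e] :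
        ip (burnettB 2) (Linv (burnettA 2 j)) = ip (burnettA 2 j) (Linv (burnettB 2)))]
    refine ip_eq_zero_of_odd (flip j) (fun v => ?_) (fun v => ?_) (isLinvOf_burnettB 2)
    · rw [burnettA_flip, if_neg (Ne.symm h), if_pos rfl]; ring
    · rw [burnettB_flip, if_neg (Ne.symm h)]; ring

end ViscousLayer
end

/-! ### Partial derivatives up to the boundary. -/

noncomputable section
namespace ViscousLayer
open ProbabilityTheory MvPolynomial
open scoped RealInnerProductSpace ENNReal

/-! ### Partial derivatives -/

/-- `q` has the partial derivative `q'` at `z`. -/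
def HasPd (D : Set Pt) (i : Fin 4) (q : Pt → ℝ) (q' : ℝ) (z : Pt) : Prop :=
  HasLineDerivWithinAt ℝ q q' D z (Pi.single i 1)

/-- Domains on which partial derivatives are unique. -/
structure GoodDomain (D : Set Pt) : Prop where
  unique : UniqueDiffOn ℝ D
  line : ∀ z ∈ D, ∀ i : Fin 4,
    UniqueDiffWithinAt ℝ ((fun t : ℝ => z + t • (Pi.single i 1 : Pt)) ⁻¹' D) 0

variable {D : Set Pt} {i : Fin 4} {q p : Pt → ℝ} {q' p' : ℝ} {z : Pt}

lemma HasPd.pd_eq (h : HasPd D i q q' z) (hD : GoodDomain D) (hz : z ∈ D) : pd D i q z = q' :=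
  HasDerivWithinAt.derivWithin h (hD.line z hz i)

lemma HasPd.partialDiff (h : HasPd D i q q' z) : PartialDiff D i q z :=
  HasLineDerivWithinAt.lineDifferentiableWithinAt h

lemma HasPd.add (h : HasPd D i q q' z) (h' : HasPd D i p p' z) :
    HasPd D i (fun z => q z + p z) (q' + p') z :=
  HasDerivWithinAt.fun_add h h'

lemma HasPd.sub (h : HasPd D i q q' z) (h' : HasPd D i p p' z) :
    HasPd D i (fun z => q z - p z) (q' - p') z :=
  HasDerivWithinAt.fun_sub h h'

lemma HasPd.const_mul (h : HasPd D i q q' z) (c : ℝ) : HasPd D i (fun z => c * q z) (c * q') z :=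
  HasDerivWithinAt.const_mul c h

lemma HasPd.mul_const (h : HasPd D i q q' z) (c : ℝ) : HasPd D i (fun z => q z * c) (q' * c) z :=
  HasDerivWithinAt.mul_const h c

lemma HasPd.mul (h : HasPd D i q q' z) (h' : HasPd D i p p' z) :
    HasPd D i (fun z => q z * p z) (q' * p z + q z * p') z := by
  have := HasDerivWithinAt.fun_mul h h'
  simp only [zero_smul, add_zero] at this
  exact this

lemma hasPd_const (c : ℝ) : HasPd D i (fun _ => c) 0 z := hasDerivWithinAt_const _ _ _

lemma HasPd.sum {ι : Type*} {s : Finset ι} {q : ι → Pt → ℝ} {q' : ι → ℝ}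
    (h : ∀ j ∈ s, HasPd D i (q j) (q' j) z) :
    HasPd D i (fun z => ∑ j ∈ s, q j z) (∑ j ∈ s, q' j) z :=
  HasDerivWithinAt.fun_sum h

lemma HasPd.congr (h : HasPd D i q q' z) (hz : z ∈ D) (e : ∀ z ∈ D, p z = q z) :
    HasPd D i p q' z :=
  HasLineDerivWithinAt.congr' h e hz

lemma pd_congr (hz : z ∈ D) (e : ∀ z ∈ D, p z = q z) : pd D i p z = pd D i q z :=
  lineDerivWithin_congr' e hz

lemma hasPd_coord (j : Fin 4) : HasPd D i (fun z => z j) (if j = i then 1 else 0) z := by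
  have h : HasDerivAt (fun t : ℝ => (z + t • (Pi.single i 1 : Pt)) j) (if j = i then 1 else 0) 0 := by
    simp only [Pi.add_apply, Pi.smul_apply, Pi.single_apply, smul_eq_mul]
    split_ifs
    · simpa using (hasDerivAt_id (0 : ℝ)).const_add (z j)
    · simpa using hasDerivAt_const (0 : ℝ) (z j)
  exact h.hasDerivWithinAt

lemma hasPd_of_eq_const {c : ℝ} (e : ∀ t : ℝ, q (z + t • (Pi.single i 1 : Pt)) = c) :
    HasPd D i q 0 z := by
  unfold HasPd HasLineDerivWithinAt
  simp only [e]
  exact hasDerivWithinAt_const _ _ _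

lemma hasPd_of_differentiableWithinAt (h : DifferentiableWithinAt ℝ q D z) :
    HasPd D i q (fderivWithin ℝ q D z (Pi.single i 1)) z :=
  h.hasFDerivWithinAt.hasLineDerivWithinAt _

/-- Iterated partial derivatives and iterated Fréchet derivatives. -/
lemma iterate_pd_eq (hD : GoodDomain D) {r : ℕ} (h : ContDiffOn ℝ r q D) (l : ℕ) (hl : l ≤ r) :
    ∀ z ∈ D, (pd D i)^[l] q z = iteratedFDerivWithin ℝ l q D z fun _ => Pi.single i 1 := by
  induction l with
  | zero => intro z _; simp
  | succ l ih =>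
    intro z hz
    have ih' := ih (by omega)
    have hd : DifferentiableOn ℝ (iteratedFDerivWithin ℝ l q D) D :=
      h.differentiableOn_iteratedFDerivWithin (by exact_mod_cast hl) hD.unique
    rw [Function.iterate_succ_apply', pd_congr hz ih', iteratedFDerivWithin_succ_apply_left]
    have h1 := (hd z hz).hasFDerivWithinAt
    have h2 : HasFDerivWithinAt
        (fun z => iteratedFDerivWithin ℝ l q D z fun _ => (Pi.single i 1 : Pt))
        ((ContinuousMultilinearMap.apply ℝ (fun _ : Fin l => Pt) ℝ fun _ => (Pi.single i 1 : Pt)).comp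
          (fderivWithin ℝ (iteratedFDerivWithin ℝ l q D) D z)) D z :=
      (ContinuousMultilinearMap.apply ℝ (fun _ : Fin l => Pt) ℝ
        fun _ => (Pi.single i 1 : Pt)).hasFDerivAt.comp_hasFDerivWithinAt z h1
    have h3 : HasPd D i (fun z => iteratedFDerivWithin ℝ l q D z fun _ => (Pi.single i 1 : Pt)) _ z :=
      h2.hasLineDerivWithinAt (Pi.single i 1)
    rw [h3.pd_eq hD hz]
    rfl

lemma hasPd_iterate (hD : GoodDomain D) {r : ℕ} (h : ContDiffOn ℝ r q D) {l : ℕ} (hl : l < r)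
    (hz : z ∈ D) : HasPd D i ((pd D i)^[l] q) ((pd D i)^[l + 1] q z) z := by
  have hd : DifferentiableOn ℝ (iteratedFDerivWithin ℝ l q D) D :=
    h.differentiableOn_iteratedFDerivWithin (by exact_mod_cast hl) hD.unique
  have h1 : DifferentiableWithinAt ℝ
      (fun z => iteratedFDerivWithin ℝ l q D z fun _ => (Pi.single i 1 : Pt)) D z :=
    (ContinuousMultilinearMap.apply ℝ (fun _ : Fin l => Pt) ℝ
        fun _ => (Pi.single i 1 : Pt)).differentiableAt.comp_differentiableWithinAt z (hd z hz)
  have h2 := (hasPd_of_differentiableWithinAt (i := i) h1).congr hz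
    (iterate_pd_eq hD h l hl.le)
  have h3 := h2.pd_eq hD hz
  rw [Function.iterate_succ_apply']
  rw [h3]
  exact h2

lemma norm_iterate_pd_le (hD : GoodDomain D) {r : ℕ} (h : ContDiffOn ℝ r q D) {l : ℕ} (hl : l ≤ r)
    (hz : z ∈ D) : |(pd D i)^[l] q z| ≤ ‖iteratedFDerivWithin ℝ l q D z‖ := by
  rw [iterate_pd_eq hD h l hl z hz, ← Real.norm_eq_abs]
  refine (ContinuousMultilinearMap.le_opNorm _ _).trans ?_
  have : ‖(Pi.single i 1 : Pt)‖ = 1 := by rw [Pi.norm_single]; simp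
  simp [this]

/-- Partial derivatives of families of measurable functions are measurable. -/
lemma measurable_of_hasPd (hD : GoodDomain D) {G : Pt → Vel → ℝ} {g : Vel → ℝ}
    (hG : ∀ z ∈ D, Measurable (G z)) (hz : z ∈ D) (h : ∀ v, HasPd D i (fun z => G z v) (g v) z) :
    Measurable g := by
  classical
  set s : Set ℝ := (fun t : ℝ => z + t • (Pi.single i 1 : Pt)) ⁻¹' D with hs
  have hne : (𝓝[s \ {0}] (0 : ℝ)).NeBot := by
    have := (hD.line z hz i).accPt
    rwa [accPt_principal_iff_nhdsWithin] at this
  -- The derivative is a pointwise limit of difference quotients along the line. They are set to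
  -- zero for `t` outside the domain, where `G` is not known to be measurable.
  set F : ℝ → Vel → ℝ := fun t v => if t ∈ s then
    slope (fun t : ℝ => G (z + t • (Pi.single i 1 : Pt)) v) 0 t else 0 with hF
  refine measurable_of_tendsto_metrizable' (𝓝[s \ {0}] (0 : ℝ)) (f := F) (fun t => ?_) ?_
  · by_cases ht : t ∈ s
    · simp only [hF, ht, if_true, slope_def_field, zero_smul, add_zero]
      exact ((hG _ ht).sub (hG z hz)).div_const _
    · simp only [hF, ht, if_false]
      exact measurable_const
  · rw [tendsto_pi_nhds]
    intro v
    have h1 := hasDerivWithinAt_iff_tendsto_slope.1 (h v)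
    refine h1.congr' ?_
    filter_upwards [self_mem_nhdsWithin] with t ht
    have hts : t ∈ s := ht.1
    simp only [hF, hts, if_true]

variable {r : ℕ} {g : Pt → Vel → ℝ}

lemma RegularOn.bound_iterate (hg : RegularOn D r g) (hD : GoodDomain D) {l : ℕ} (hl : l ≤ r)
    {K : Set Pt} (hK : K ⊆ D) (hc : IsCompact K) (m : ℕ) :
    ∃ C : ℝ, ∀ z ∈ K, ∀ v : Vel, (1 + ‖v‖) ^ m * |(pd D i)^[l] (fun z => g z v) z| ≤ C := by
  obtain ⟨C, hC⟩ := hg.decay K hK hc l hl m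
  refine ⟨C, fun z hz v => le_trans ?_ (hC z hz v)⟩
  gcongr
  exact norm_iterate_pd_le hD (hg.contDiffOn v) hl (hK hz)

lemma RegularOn.hasPd_iterate (hg : RegularOn D r g) (hD : GoodDomain D) {l : ℕ} (hl : l < r)
    (hz : z ∈ D) (v : Vel) :
    HasPd D i ((pd D i)^[l] fun z => g z v) ((pd D i)^[l + 1] (fun z => g z v) z) z :=
  ViscousLayer.hasPd_iterate hD (hg.contDiffOn v) hl hz

lemma RegularOn.measurable_iterate (hg : RegularOn D r g) (hD : GoodDomain D) {l : ℕ} (hl : l ≤ r) :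
    ∀ z ∈ D, Measurable fun v => (pd D i)^[l] (fun z => g z v) z := by
  induction l with
  | zero => intro z hz; exact (hg.continuous_vel z hz).measurable
  | succ l ih =>
    intro z hz
    exact measurable_of_hasPd hD (ih (by omega)) hz fun v => hg.hasPd_iterate hD (by omega) hz v

lemma RegularOn.rapid_iterate (hg : RegularOn D r g) (hD : GoodDomain D) {l : ℕ} (hl : l ≤ r)
    (hz : z ∈ D) : Rapid fun v => (pd D i)^[l] (fun z => g z v) z where
  measurable := hg.measurable_iterate hD hl z hz
  bound m := by
    obtain ⟨C, hC⟩ := hg.bound_iterate (i := i) hD hl (Set.singleton_subset_iff.2 hz)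
      isCompact_singleton m
    exact ⟨C, fun v => hC z rfl v⟩

lemma RegularOn.rapid (hg : RegularOn D r g) (hD : GoodDomain D) (hz : z ∈ D) : Rapid (g z) :=
  hg.rapid_iterate (i := 0) (l := 0) hD (Nat.zero_le r) hz

/-- Differentiation of moments. -/
lemma hasPd_ip (ho : IsOpen D) {G G' : Pt → Vel → ℝ} (hG : ∀ z ∈ D, Rapid (G z))
    (hG' : ∀ z ∈ D, Measurable (G' z))
    (hd : ∀ z ∈ D, ∀ v, HasPd D i (fun z => G z v) (G' z v) z)
    (hb : ∀ K ⊆ D, IsCompact K → ∃ C : ℝ, ∀ z ∈ K, ∀ v : Vel, |G' z v| ≤ C)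
    {k : Vel → ℝ} (hk : Rapid k) (hz : z ∈ D) :
    HasPd D i (fun z => ip (G z) k) (ip (G' z) k) z := by
  -- A compact ball inside the open domain provides the uniform bound for dominated convergence.
  obtain ⟨ε, hε, hsub⟩ := Metric.nhds_basis_closedBall.mem_iff.1 (ho.mem_nhds hz)
  obtain ⟨C, hC⟩ := hb _ hsub (isCompact_closedBall z ε)
  have he : ‖(Pi.single i 1 : Pt)‖ = 1 := by rw [Pi.norm_single]; simp
  have hmem : ∀ t ∈ Metric.ball (0 : ℝ) ε,
      z + t • (Pi.single i 1 : Pt) ∈ Metric.closedBall z ε := by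
    intro t ht
    rw [Metric.mem_closedBall, dist_eq_norm, add_sub_cancel_left, norm_smul, he, mul_one]
    rw [Metric.mem_ball, dist_zero_right] at ht
    exact ht.le
  have key := hasDerivAt_integral_of_dominated_loc_of_deriv_le (μ := (volume : Measure Vel))
    (F := fun t v => G (z + t • (Pi.single i 1 : Pt)) v * k v)
    (F' := fun t v => G' (z + t • (Pi.single i 1 : Pt)) v * k v) (x₀ := (0 : ℝ))
    (bound := fun v => C * |k v|) (Metric.ball_mem_nhds 0 hε) ?_ ?_ ?_ ?_ ?_ ?_
  · have h2 := key.2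
    simp only [zero_smul, add_zero] at h2
    exact HasDerivAt.hasDerivWithinAt h2
  · filter_upwards [Metric.ball_mem_nhds (0 : ℝ) hε] with t ht
    exact ((hG _ (hsub (hmem t ht))).measurable.mul hk.measurable).aestronglyMeasurable
  · simp only [zero_smul, add_zero]
    exact (hG z hz).wl2.integrable_mul hk.wl2
  · simp only [zero_smul, add_zero]
    exact ((hG' z hz).mul hk.measurable).aestronglyMeasurable
  · refine ae_of_all _ fun v t ht => ?_
    rw [Real.norm_eq_abs, abs_mul]
    gcongr
    exact hC _ (hmem t ht) v
  · have := (hk.integrable_pow_mul 0).abs.const_mul C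
    simpa using this
  · refine ae_of_all _ fun v t ht => ?_
    have hw := hsub (hmem t ht)
    have h1 : HasLineDerivAt ℝ (fun z => G z v) (G' (z + t • (Pi.single i 1 : Pt)) v)
        (z + t • (Pi.single i 1 : Pt)) (Pi.single i 1) :=
      HasLineDerivWithinAt.hasLineDerivAt (hd _ hw v) (ho.mem_nhds hw)
    have h2 : HasDerivAt (fun s : ℝ => G (z + t • (Pi.single i 1 : Pt)
        + s • (Pi.single i 1 : Pt)) v) (G' (z + t • (Pi.single i 1 : Pt)) v) (t - t) := by
      rw [sub_self]; exact h1
    have h3 := h2.comp_sub_const t t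
    refine (h3.congr_of_eventuallyEq (Eventually.of_forall fun s => ?_)).mul_const (k v)
    simp only
    congr 1
    module

/-! ### The channel and the layer -/

lemma isOpen_layer (τ : ℝ) : IsOpen (layer τ) := by
  have : layer τ = {z | 0 < z 0} ∩ {z | z 0 < τ} ∩ {z | 0 < z 3} := by
    ext z; simp [layer, and_assoc]
  rw [this]
  exact ((isOpen_lt continuous_const (continuous_apply 0)).inter
    (isOpen_lt (continuous_apply 0) continuous_const)).inter
    (isOpen_lt continuous_const (continuous_apply 3))

lemma goodDomain_layer (τ : ℝ) : GoodDomain (layer τ) where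
  unique := (isOpen_layer τ).uniqueDiffOn
  line z hz i := by
    have hc : Continuous fun t : ℝ => z + t • (Pi.single i 1 : Pt) := by fun_prop
    refine ((isOpen_layer τ).preimage hc).uniqueDiffWithinAt ?_
    simpa using hz

lemma channel_eq (τ : ℝ) : channel τ
    = Set.pi Set.univ ![Set.Ioo 0 τ, Set.univ, Set.univ, Set.Icc 0 1] := by
  ext z
  simp [channel, Set.mem_pi, Fin.forall_fin_succ, and_assoc]

lemma goodDomain_channel (τ : ℝ) : GoodDomain (channel τ) := by
  have hu : ∀ j : Fin 4, UniqueDiffOn ℝ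
      ((![Set.Ioo 0 τ, Set.univ, Set.univ, Set.Icc 0 1] : Fin 4 → Set ℝ) j) := by
    intro j
    fin_cases j
    · exact uniqueDiffOn_Ioo 0 τ
    · exact uniqueDiffOn_univ
    · exact uniqueDiffOn_univ
    · exact uniqueDiffOn_Icc zero_lt_one
  refine ⟨?_, fun z hz i => ?_⟩
  · rw [channel_eq]
    exact UniqueDiffOn.univ_pi fun j => hu j
  · rw [channel_eq] at hz ⊢
    set S : Fin 4 → Set ℝ := ![Set.Ioo 0 τ, Set.univ, Set.univ, Set.Icc 0 1]
    have e : (fun t : ℝ => z + t • (Pi.single i 1 : Pt)) ⁻¹' Set.pi Set.univ S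
        = (fun t => z i + t) ⁻¹' S i := by
      ext t
      simp only [Set.mem_preimage, Set.mem_pi, Set.mem_univ, true_imp_iff, Pi.add_apply,
        Pi.smul_apply, smul_eq_mul]
      constructor
      · intro h; simpa using h i
      · intro h j
        by_cases hj : j = i
        · subst hj; simpa using h
        · simpa [Pi.single_apply, hj] using hz j (Set.mem_univ _)
    rw [e]
    have hi := hz i (Set.mem_univ _)
    have h0 : (0 : ℝ) ∈ (fun t => z i + t) ⁻¹' S i := by simpa using hi
    fin_cases i
    · exact ((isOpen_Ioo (a := (0 : ℝ)) (b := τ)).preimage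
        (by fun_prop : Continuous fun t : ℝ => z 0 + t)).uniqueDiffWithinAt h0
    · exact uniqueDiffWithinAt_univ
    · exact uniqueDiffWithinAt_univ
    · have e3 : (fun t => z 3 + t) ⁻¹' Set.Icc (0 : ℝ) 1 = Set.Icc (0 - z 3) (1 - z 3) :=
        Set.preimage_const_add_Icc _ _ _
      have h3 : (0 : ℝ) ∈ Set.Icc (0 - z 3) (1 - z 3) := e3 ▸ h0
      show UniqueDiffWithinAt ℝ ((fun t => z 3 + t) ⁻¹' Set.Icc (0 : ℝ) 1) 0
      rw [e3]
      exact uniqueDiffOn_Icc (by linarith) 0 h3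

end ViscousLayer
end

/-! ### Smooth families of distributions and the leading interior terms. -/

noncomputable section
namespace ViscousLayer
open ProbabilityTheory MvPolynomial
open scoped RealInnerProductSpace ENNReal

/-! ### Functionals that annihilate the collision invariants -/

/-- Functions that pair with the weighted `L²` space and annihilate the collision invariants. -/
structure PerpD (w : Vel → ℝ) : Prop where
  integrable : ∀ k, WL2 k → Integrable fun v => w v * k v
  ip_eq : ∀ ρ u θ, ip w (pf (invP ρ u θ)) = 0

lemma PerpD.add {w w' : Vel → ℝ} (h : PerpD w) (h' : PerpD w') : PerpD fun v => w v + w' v where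
  integrable k hk := ((h.integrable k hk).fun_add (h'.integrable k hk)).congr
    (ae_of_all _ fun v => by simp only; ring)
  ip_eq ρ u θ := by
    have i1 := h.integrable _ (rapid_pf (invP ρ u θ)).wl2
    have i2 := h'.integrable _ (rapid_pf (invP ρ u θ)).wl2
    have e1 := h.ip_eq ρ u θ
    have e2 := h'.ip_eq ρ u θ
    simp only [ip] at *
    simp only [add_mul]
    rw [integral_add i1 i2, e1, e2, add_zero]

lemma PerpD.const_mul {w : Vel → ℝ} (h : PerpD w) (c : ℝ) : PerpD fun v => c * w v where
  integrable k hk := ((h.integrable k hk).const_mul c).congr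
    (ae_of_all _ fun v => by simp only; ring)
  ip_eq ρ u θ := by rw [ip_const_mul_left, h.ip_eq, mul_zero]

lemma PerpD.neg {w : Vel → ℝ} (h : PerpD w) : PerpD fun v => -w v := by
  simpa using h.const_mul (-1)

lemma perpD_zero : PerpD fun _ => 0 :=
  ⟨fun _ _ => by simp, fun ρ u θ => by simp [ip]⟩

lemma PerpD.sum {ι : Type*} (s : Finset ι) {w : ι → Vel → ℝ} (h : ∀ i ∈ s, PerpD (w i)) :
    PerpD fun v => ∑ i ∈ s, w i v := by
  classical
  induction s using Finset.induction_on with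
  | empty => simpa using perpD_zero
  | insert a s ha ih =>
    simp only [Finset.sum_insert ha]
    exact (h a (by simp)).add (ih fun i hi => h i (by simp [hi]))

lemma perpD_GamS {g h : Vel → ℝ} (hg : Rapid g) (hh : Rapid h) : PerpD (GamS g h) where
  integrable k hk := (integral_GamS_mul hg.wl2 hh.wl2 hk).1
  ip_eq ρ u θ := ip_GamS_invP hg.wl2 hh.wl2 ρ u θ

lemma perpD_linL {g : Vel → ℝ} (hg : Rapid g) : PerpD (linL g) := by
  have : linL g = fun v => -GamS sqrtM g v := funext fun v => linL_eq g v
  rw [this]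
  exact (perpD_GamS rapid_sqrtM hg).neg

lemma PerpD.perpN {w : Vel → ℝ} (h : PerpD w) : PerpN w := perpN_of_forall h.ip_eq

lemma enth_add {g h : Vel → ℝ} (hg : WL2 g) (hh : WL2 h) :
    enth (fun v => g v + h v) = enth g + enth h := by
  simp only [enth, rho_add hg hh, temp_add hg hh]; ring

lemma enth_const_mul (c : ℝ) (g : Vel → ℝ) : enth (fun v => c * g v) = c * enth g := by
  simp only [enth, rho_const_mul, temp_const_mul]; ring

lemma PerpN.enth {g : Vel → ℝ} (h : PerpN g) : enth g = 0 := by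
  rw [ViscousLayer.enth, h.temp, h.rho]; ring

lemma micro_add {g h : Vel → ℝ} (hg : WL2 g) (hh : WL2 h) (v : Vel) :
    micro (fun v => g v + h v) v = micro g v + micro h v := by
  simp only [micro, proj, rho_add hg hh, vel_add hg hh, temp_add hg hh, Fin.sum_univ_three]; ring

lemma micro_sub {g h : Vel → ℝ} (hg : WL2 g) (hh : WL2 h) (v : Vel) :
    micro (fun v => g v - h v) v = micro g v - micro h v := by
  simp only [micro, proj, rho_sub hg hh, vel_sub hg hh, temp_sub hg hh, Fin.sum_univ_three]; ring

lemma micro_const_mul (c : ℝ) (g : Vel → ℝ) (v : Vel) :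
    micro (fun v => c * g v) v = c * micro g v := by
  simp only [micro, proj, rho_const_mul, vel_const_mul, temp_const_mul, Fin.sum_univ_three]; ring

/-! ### Differentiable families of distribution functions -/

/-- `G` is a family of rapidly decreasing functions with the partial derivative `G'`. -/
structure Family (D : Set Pt) (i : Fin 4) (G G' : Pt → Vel → ℝ) : Prop where
  rapid : ∀ z ∈ D, Rapid (G z)
  rapid_deriv : ∀ z ∈ D, Rapid (G' z)
  hasPd : ∀ z ∈ D, ∀ v, HasPd D i (fun z => G z v) (G' z v) z
  bound : ∀ K ⊆ D, IsCompact K → ∀ q : ℕ, ∃ C : ℝ, ∀ z ∈ K, ∀ v : Vel, (1 + ‖v‖) ^ q * |G' z v| ≤ C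

lemma RegularOn.family {D : Set Pt} {r : ℕ} {g : Pt → Vel → ℝ} (hg : RegularOn D r g)
    (hD : GoodDomain D) (i : Fin 4) {l : ℕ} (hl : l < r) :
    Family D i (fun z v => (pd D i)^[l] (fun z => g z v) z)
      (fun z v => (pd D i)^[l + 1] (fun z => g z v) z) where
  rapid _ hz := hg.rapid_iterate hD hl.le hz
  rapid_deriv _ hz := hg.rapid_iterate hD hl hz
  hasPd _ hz v := hg.hasPd_iterate hD hl hz v
  bound _ hK hc q := hg.bound_iterate hD hl hK hc q

section
variable {D : Set Pt} {i : Fin 4} {G G' : Pt → Vel → ℝ} {z : Pt}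

lemma Family.coord_mul (h : Family D i G G') (j : Fin 3) :
    Family D i (fun z v => v j * G z v) (fun z v => v j * G' z v) where
  rapid z hz := (h.rapid z hz).coord_mul j
  rapid_deriv z hz := (h.rapid_deriv z hz).coord_mul j
  hasPd z hz v := (h.hasPd z hz v).const_mul (v j)
  bound K hK hc q := by
    obtain ⟨C, hC⟩ := h.bound K hK hc (q + 1)
    refine ⟨C, fun z hz v => le_trans ?_ (hC z hz v)⟩
    have h1 : |v j| ≤ 1 + ‖v‖ := by
      have := PiLp.norm_apply_le v j
      rw [Real.norm_eq_abs] at this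
      linarith
    rw [abs_mul, pow_succ, mul_assoc]
    gcongr

lemma Family.hasPd_ip (h : Family D i G G') (ho : IsOpen D) {k : Vel → ℝ} (hk : Rapid k)
    (hz : z ∈ D) : HasPd D i (fun z => ip (G z) k) (ip (G' z) k) z :=
  ViscousLayer.hasPd_ip ho h.rapid (fun z hz => (h.rapid_deriv z hz).measurable) h.hasPd
    (fun K hK hc => by simpa using h.bound K hK hc 0) hk hz

lemma Family.hasPd_ip' (h : Family D i G G') (ho : IsOpen D) {k : Vel → ℝ} (hk : Rapid k)
    (hz : z ∈ D) : HasPd D i (fun z => ip k (G z)) (ip k (G' z)) z := by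
  simpa only [ip_comm k] using h.hasPd_ip ho hk hz

lemma Family.hasPd_rho (h : Family D i G G') (ho : IsOpen D) (hz : z ∈ D) :
    HasPd D i (fun z => rho (G z)) (rho (G' z)) z := h.hasPd_ip ho rapid_sqrtM hz

lemma Family.hasPd_vel (h : Family D i G G') (ho : IsOpen D) (hz : z ∈ D) (j : Fin 3) :
    HasPd D i (fun z => vel j (G z)) (vel j (G' z)) z :=
  h.hasPd_ip ho (rapid_sqrtM.coord_mul j) hz

lemma Family.hasPd_temp (h : Family D i G G') (ho : IsOpen D) (hz : z ∈ D) :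
    HasPd D i (fun z => temp (G z)) (temp (G' z)) z := by
  have hk : Rapid fun v : Vel => (‖v‖ ^ 2 - 3) * sqrtM v := by
    rw [temp_fun_eq]; exact rapid_pf _
  have := (h.hasPd_ip ho hk hz).mul_const (1 / 3)
  simpa [temp, div_eq_mul_inv] using this

lemma Family.hasPd_enth (h : Family D i G G') (ho : IsOpen D) (hz : z ∈ D) :
    HasPd D i (fun z => enth (G z)) (enth (G' z)) z :=
  ((h.hasPd_temp ho hz).const_mul (3 / 2)).sub (h.hasPd_rho ho hz)

end

/-! ### Solutions -/

/-- A solution with admissible parameters. -/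
structure Admissible (D : LayerData) : Prop where
  sol : D.IsSolution
  hn : 3 ≤ D.n
  hb : 1 ≤ D.b

namespace Admissible

variable {D : LayerData} (H : Admissible D) {z : Pt}

include H

lemma toWall_mem (hz : z ∈ layer D.τ) : D.toWall z ∈ channel D.τ := by
  have : D.s.wall = 0 ∨ D.s.wall = 1 := by cases D.s <;> simp [Side.wall]
  simp only [LayerData.toWall, channel, Set.mem_ofPred_eq]
  refine ⟨by simpa using hz.1, by simpa using hz.2.1, ?_, ?_⟩ <;>
    (rw [Function.update_self]; rcases this with h | h <;> rw [h] <;> norm_num)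

lemma hasPd_toWall {i : Fin 4} (hi : i ≠ 3) {q : Pt → ℝ} {q' : ℝ}
    (h : HasPd (channel D.τ) i q q' (D.toWall z)) :
    HasPd (layer D.τ) i (fun z => q (D.toWall z)) q' z := by
  have e : ∀ t : ℝ, D.toWall (z + t • (Pi.single i 1 : Pt))
      = D.toWall z + t • (Pi.single i 1 : Pt) := by
    intro t
    ext j
    simp only [LayerData.toWall, Function.update_apply, Pi.add_apply, Pi.smul_apply,
      Pi.single_apply, smul_eq_mul]
    split_ifs with h1 h2 <;> simp_all
  have h1 : HasPd (layer D.τ) i (fun z => q (D.toWall z)) q' z := by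
    unfold HasPd HasLineDerivWithinAt at h ⊢
    simp only [e]
    refine h.mono fun t ht => ?_
    simp only [Set.mem_preimage] at ht ⊢
    rw [← e]
    exact H.toWall_mem ht
  exact h1

lemma hasPd_toWall_normal (q : Pt → ℝ) : HasPd (layer D.τ) 3 (fun z => q (D.toWall z)) 0 z := by
  refine hasPd_of_eq_const (c := q (D.toWall z)) fun t => ?_
  congr 1
  ext j
  simp only [LayerData.toWall, Function.update_apply, Pi.add_apply, Pi.smul_apply,
    Pi.single_apply, smul_eq_mul]
  split_ifs <;> simp

lemma dl_eq {i : Fin 4} {q : Pt → ℝ} {q' : ℝ} (h : HasPd (layer D.τ) i q q' z)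
    (hz : z ∈ layer D.τ) : D.dl i q z = q' := h.pd_eq (goodDomain_layer _) hz

lemma f_zero {i : ℤ} (hi : i < 0) (z : Pt) (v : Vel) : D.f i z v = 0 := by
  rw [H.sol.interior.zero i hi]; rfl

lemma fb_zero {i : ℤ} (hi : i ≤ 0) (z : Pt) (v : Vel) : D.fb i z v = 0 := by
  rw [H.sol.viscous.zero i hi]; rfl

lemma rapid_f (i : ℤ) (hz : z ∈ channel D.τ) : Rapid (D.f i z) :=
  (H.sol.interior.regular i).rapid (goodDomain_channel _) hz

lemma rapid_fw (i : ℤ) (hz : z ∈ layer D.τ) : Rapid (D.fw i z) := H.rapid_f i (H.toWall_mem hz)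

lemma rapid_dfw {l : ℕ} (hl : l ≤ D.b) (i : ℤ) (hz : z ∈ layer D.τ) : Rapid (D.dfw l i z) :=
  (H.sol.interior.regular i).rapid_iterate (goodDomain_channel _) hl (H.toWall_mem hz)

lemma rapid_fb (i : ℤ) (hz : z ∈ layer D.τ) : Rapid (D.fb i z) :=
  (H.sol.viscous.regular i).rapid (goodDomain_layer _) hz

lemma family_fb (m : ℤ) (i : Fin 4) :
    Family (layer D.τ) i (D.fb m) (fun z v => D.dl i (fun z => D.fb m z v) z) :=
  (H.sol.viscous.regular m).family (goodDomain_layer _) i (l := 0) (by norm_num)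

lemma family_dfb (m : ℤ) (i : Fin 4) :
    Family (layer D.τ) i (fun z v => D.dl i (fun z => D.fb m z v) z)
      (fun z v => D.dl i (D.dl i (fun z => D.fb m z v)) z) :=
  (H.sol.viscous.regular m).family (goodDomain_layer _) i (l := 1) (by norm_num)

lemma rapid_dl (i : Fin 4) (m : ℤ) (hz : z ∈ layer D.τ) :
    Rapid fun v => D.dl i (fun z => D.fb m z v) z := (H.family_fb m i).rapid_deriv z hz

lemma rapid_dtfb (m : ℤ) (hz : z ∈ layer D.τ) : Rapid (D.dtfb m z) := H.rapid_dl 0 m hz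

lemma rapid_tangfb (m : ℤ) (hz : z ∈ layer D.τ) : Rapid (D.tangfb m z) :=
  Rapid.sum _ fun j _ => (H.rapid_dl j.castSucc.succ m hz).coord_mul j.castSucc

lemma rapid_normfb (m : ℤ) (hz : z ∈ layer D.τ) : Rapid (D.normfb m z) :=
  (H.rapid_dl 3 m hz).coord_mul 2

lemma hasPd_rho (m : ℤ) (i : Fin 4) (hz : z ∈ layer D.τ) :
    HasPd (layer D.τ) i (fun z => rho (D.fb m z)) (rho fun v => D.dl i (fun z => D.fb m z v) z) z :=
  (H.family_fb m i).hasPd_rho (isOpen_layer _) hz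

lemma hasPd_vel (m : ℤ) (i : Fin 4) (j : Fin 3) (hz : z ∈ layer D.τ) :
    HasPd (layer D.τ) i (fun z => vel j (D.fb m z))
      (vel j fun v => D.dl i (fun z => D.fb m z v) z) z :=
  (H.family_fb m i).hasPd_vel (isOpen_layer _) hz j

lemma hasPd_temp (m : ℤ) (i : Fin 4) (hz : z ∈ layer D.τ) :
    HasPd (layer D.τ) i (fun z => temp (D.fb m z))
      (temp fun v => D.dl i (fun z => D.fb m z v) z) z :=
  (H.family_fb m i).hasPd_temp (isOpen_layer _) hz

lemma hasPd_ip (m : ℤ) (i : Fin 4) {k : Vel → ℝ} (hk : Rapid k) (hz : z ∈ layer D.τ) :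
    HasPd (layer D.τ) i (fun z => ip k (D.fb m z))
      (ip k fun v => D.dl i (fun z => D.fb m z v) z) z :=
  (H.family_fb m i).hasPd_ip' (isOpen_layer _) hk hz

/-! ### Leading order interior terms -/

lemma pd_f_zero {i : ℤ} (hi : i < 0) (j : Fin 4) (hz : z ∈ channel D.τ) (v : Vel) :
    pd (channel D.τ) j (fun z => D.f i z v) z = 0 := by
  simp only [H.f_zero hi]
  exact (hasPd_const 0).pd_eq (goodDomain_channel _) hz

/-- At order `-n` the transport terms have negative index and, as `n ≥ 3`, the collision sum is
empty. -/
lemma linL_f0 (hz : z ∈ channel D.τ) (v : Vel) : linL (D.f 0 z) v = 0 := by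
  have hn := H.hn
  have e := H.sol.interior.eq (-D.n) z hz v
  rw [H.pd_f_zero (by omega) _ hz, Finset.Icc_eq_empty (by omega)] at e
  simp only [H.pd_f_zero (show -D.n < 0 by omega) _ hz, neg_add_cancel] at e
  simpa using e

lemma f0_eq (hz : z ∈ channel D.τ) : D.f 0 z = proj (D.f 0 z) :=
  eq_proj_of_linL (H.rapid_f 0 hz) ((H.sol.interior.regular 0).continuous_vel z hz)
    (H.linL_f0 hz)

lemma fw0_eq (hz : z ∈ layer D.τ) : D.fw 0 z = proj (D.fw 0 z) := H.f0_eq (H.toWall_mem hz)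

lemma slip (hz : z ∈ layer D.τ) : vel 2 (D.fw 0 z) = 0 := by
  refine H.sol.interior.slip _ (H.toWall_mem hz) ?_
  simp only [LayerData.toWall, Function.update_self]
  cases D.s <;> simp [Side.wall]

/-- At order `1 - n` a collision term survives only for `n = 3`, and it involves `f_0` alone. It
serves to show that `(I-P) f_1` is even in `v₃` at the wall. -/
lemma linL_f1 (hz : z ∈ channel D.τ) (v : Vel) :
    linL (D.f 1 z) v = if D.n = 3 then 1 / 2 * GamS (D.f 0 z) (D.f 0 z) v else 0 := by
  have hn := H.hn
  have e := H.sol.interior.eq (1 - D.n) z hz v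
  rw [H.pd_f_zero (by omega) _ hz] at e
  simp only [H.pd_f_zero (show 1 - D.n < 0 by omega) _ hz, sub_add_cancel, mul_zero,
    Finset.sum_const_zero, add_zero] at e
  split_ifs with h3
  · rw [h3] at e
    norm_num at e
    linarith
  · rw [Finset.Icc_eq_empty (by omega)] at e
    simp at e
    linarith

lemma hasPd_f (i : ℤ) (j : Fin 4) (hz : z ∈ channel D.τ) (v : Vel) :
    HasPd (channel D.τ) j (fun z => D.f i z v) (pd (channel D.τ) j (fun z => D.f i z v) z) z :=
  (H.sol.interior.regular i).hasPd_iterate (goodDomain_channel _) (l := 0) H.hb hz v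

lemma f0_apply (hz : z ∈ channel D.τ) (v : Vel) : D.f 0 z v / sqrtM v
    = rho (D.f 0 z) + ∑ k, vel k (D.f 0 z) * v k + temp (D.f 0 z) / 2 * (‖v‖ ^ 2 - 3) := by
  have h := congrFun (H.f0_eq hz) v
  rw [h, proj, mul_div_cancel_right₀ _ (sqrtM_pos v).ne']

/-- The macroscopic part of `f_0` is differentiable. -/
lemma exists_hasPd_f0 (j : Fin 4) (hz : z ∈ channel D.τ) : ∃ (ρ : ℝ) (u : Fin 3 → ℝ) (θ : ℝ),
    HasPd (channel D.τ) j (fun z => rho (D.f 0 z)) ρ z ∧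
    (∀ k, HasPd (channel D.τ) j (fun z => vel k (D.f 0 z)) (u k) z) ∧
    HasPd (channel D.τ) j (fun z => temp (D.f 0 z)) θ z ∧
    ∀ v, pd (channel D.τ) j (fun z => D.f 0 z v) z = pf (invP ρ u θ) v := by
  -- The channel is not open, so `hasPd_ip` is not available up to the wall. But `f_0/√μ` is a
  -- polynomial in `v`, and its coefficients are combinations of the values at `0` and `±E k`, which
  -- are differentiable.
  set E : Fin 3 → Vel := fun k => EuclideanSpace.single k 1 with hE
  set F : Vel → Pt → ℝ := fun v z => D.f 0 z v * (sqrtM v)⁻¹ with hF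
  set F' : Vel → ℝ := fun v => pd (channel D.τ) j (fun z => D.f 0 z v) z * (sqrtM v)⁻¹ with hF'
  have hd : ∀ v, HasPd (channel D.τ) j (F v) (F' v) z := fun v =>
    (H.hasPd_f 0 j hz v).mul_const _
  have hFa : ∀ v, ∀ z ∈ channel D.τ, F v z
      = rho (D.f 0 z) + ∑ k, vel k (D.f 0 z) * v k + temp (D.f 0 z) / 2 * (‖v‖ ^ 2 - 3) :=
    fun v z hz => H.f0_apply hz v
  have hE1 : ∀ k l, E k l = if l = k then 1 else 0 := fun k l => by simp [hE]
  have hEn : ∀ k, ‖E k‖ = 1 := fun k => by simp [hE]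
  have hu : ∀ k, HasPd (channel D.τ) j (fun z => vel k (D.f 0 z))
      (1 / 2 * (F' (E k) - F' (-E k))) z := fun k => by
    refine (((hd (E k)).sub (hd (-E k))).const_mul (1 / 2)).congr hz fun z hz => ?_
    rw [hFa _ z hz, hFa _ z hz]
    simp only [norm_neg, PiLp.neg_apply, hE1, Fin.sum_univ_three]
    fin_cases k <;> simp <;> ring
  have hθ : HasPd (channel D.τ) j (fun z => temp (D.f 0 z))
      (F' (E 0) + F' (-E 0) - 2 * F' 0) z := by
    refine (((hd (E 0)).add (hd (-E 0))).sub ((hd 0).const_mul 2)).congr hz fun z hz => ?_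
    rw [hFa _ z hz, hFa _ z hz, hFa _ z hz]
    simp only [norm_neg, PiLp.neg_apply, hE1, hEn, Fin.sum_univ_three]
    simp; ring
  have hρ : HasPd (channel D.τ) j (fun z => rho (D.f 0 z))
      (F' 0 + 3 / 2 * (F' (E 0) + F' (-E 0) - 2 * F' 0)) z := by
    refine ((hd 0).add (hθ.const_mul (3 / 2))).congr hz fun z hz => ?_
    rw [hFa _ z hz]
    simp; ring
  refine ⟨_, _, _, hρ, hu, hθ, fun v => ?_⟩
  refine HasPd.pd_eq ?_ (goodDomain_channel _) hz
  have h1 := ((hρ.add (HasPd.sum (s := Finset.univ) fun k _ => (hu k).mul_const (v k))).add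
    ((hθ.mul_const (1 / 2)).mul_const (‖v‖ ^ 2 - 3))).mul_const (sqrtM v)
  have h2 := h1.congr (p := fun z => D.f 0 z v) hz fun z hz => by
    have := H.f0_apply hz v
    rw [div_eq_iff (sqrtM_pos v).ne'] at this
    rw [this]; ring
  convert h2 using 1
  rw [pf, eval_invP]; ring

/-- The leading order interior velocity is divergence free. -/
lemma div_f0 (hz : z ∈ channel D.τ) :
    ∑ j : Fin 3, pd (channel D.τ) j.succ (fun z => vel j (D.f 0 z)) z = 0 := by
  have hn := H.hn
  choose ρ u θ hρ hu hθ hpf using fun j : Fin 4 => H.exists_hasPd_f0 j hz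
  have e := fun v => H.sol.interior.eq 0 z hz v
  simp only [zero_add, H.pd_f_zero (show 2 - D.n < 0 by omega) _ hz, hpf] at e
  have hr : Rapid fun v : Vel => ∑ j : Fin 3, v j * pf (invP (ρ j.succ) (u j.succ) (θ j.succ)) v :=
    Rapid.sum _ fun j _ => (rapid_pf _).coord_mul j
  have hp : PerpD fun v : Vel => ∑ j : Fin 3, v j * pf (invP (ρ j.succ) (u j.succ) (θ j.succ)) v := by
    simp only [e]
    exact (perpD_linL (H.rapid_f _ hz)).neg.add
      (PerpD.sum _ fun i _ => (perpD_GamS (H.rapid_f _ hz) (H.rapid_f _ hz)).const_mul _)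
  have h0 := hp.perpN.rho
  simp only [Fin.sum_univ_three] at h0 ⊢
  rw [rho_add (((rapid_pf _).coord_mul _).add ((rapid_pf _).coord_mul _)).wl2
    ((rapid_pf _).coord_mul _).wl2, rho_add ((rapid_pf _).coord_mul _).wl2
    ((rapid_pf _).coord_mul _).wl2] at h0
  simp only [rho_coord_mul, vel_pf_invP] at h0
  rw [(hu _ _).pd_eq (goodDomain_channel _) hz, (hu _ _).pd_eq (goodDomain_channel _) hz,
    (hu _ _).pd_eq (goodDomain_channel _) hz]
  exact h0

end Admissible

end ViscousLayer
end

/-! ### Balance laws, far field and the microscopic part of the layer. -/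

noncomputable section
namespace ViscousLayer
open ProbabilityTheory MvPolynomial
open scoped RealInnerProductSpace ENNReal

/-- `L⁻¹ Γˢ(P g, P h)`. -/
def prodMicro (g h : Vel → ℝ) : Vel → ℝ :=
  micro (pf (invP (rho g) (fun i => vel i g) (temp g) * invP (rho h) (fun i => vel i h) (temp h)))

lemma isLinvOf_prodMicro (g h : Vel → ℝ) : IsLinvOf (GamS (proj g) (proj h)) (prodMicro g h) :=
  isLinvOf_GamS_proj g h

lemma ip_burnettA_micro (i j : Fin 3) {g : Vel → ℝ} (hg : WL2 g) :
    ip (burnettA i j) (micro g) = ip (burnettA i j) g :=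
  (perpN_burnettA i j).ip_micro (rapid_burnettA i j).wl2 hg

lemma ip_burnettB_micro (i : Fin 3) {g : Vel → ℝ} (hg : WL2 g) :
    ip (burnettB i) (micro g) = ip (burnettB i) g :=
  (perpN_burnettB i).ip_micro (rapid_burnettB i).wl2 hg

lemma ip_burnettA_prodMicro (i j : Fin 3) (g h : Vel → ℝ) :
    ip (burnettA i j) (prodMicro g h) = vel i g * vel j h + vel j g * vel i h
      - (if i = j then 2 / 3 * ∑ k, vel k g * vel k h else 0) := by
  rw [prodMicro, ip_burnettA_micro _ _ (rapid_pf _).wl2, ip_burnettA_mul_invP]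

lemma ip_burnettB_prodMicro (i : Fin 3) (g h : Vel → ℝ) :
    ip (burnettB i) (prodMicro g h) = 5 / 2 * (vel i g * temp h + vel i h * temp g) := by
  rw [prodMicro, ip_burnettB_micro _ (rapid_pf _).wl2, ip_burnettB_mul_invP]

lemma rapid_prodMicro (g h : Vel → ℝ) : Rapid (prodMicro g h) := (rapid_pf _).micro

lemma micro_eq_add (g : Vel → ℝ) (v : Vel) : g v = proj g v + micro g v := by
  simp only [micro]; ring

namespace Admissible

variable {D : LayerData} (H : Admissible D) {z : Pt}

include H

omit H in
lemma sg_mul_sg : D.sg * D.sg = 1 := by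
  unfold LayerData.sg
  cases D.s <;> simp [Side.sgn]

/-! ### The moments of the layer hierarchy -/

omit H in
/-- The transport terms of order `m - 2`. -/
lemma layer_eq (H : Admissible D) (m : ℤ) (hz : z ∈ layer D.τ) (v : Vel) :
    D.dtfb (m - D.n) z v + D.tangfb (m - 2) z v - D.sg * D.normfb (m - 1) z v
    = -linL (D.fb (m - 2 + D.n) z) v
      + ∑ i ∈ Finset.Icc (0 : ℤ) (m - 1), GamS (D.fw i z) (D.fb (m - i) z) v
      + ∑ l ∈ Finset.Icc 1 D.b, ∑ i ∈ Finset.Icc (0 : ℤ) (m - 1 - l),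
          D.taylorCoeff l z * GamS (D.dfw l i z) (D.fb (m - l - i) z) v
      + ∑ i ∈ Finset.Icc (1 : ℤ) (m - 1), 1 / 2 * GamS (D.fb i z) (D.fb (m - i) z) v := by
  have h := H.sol.viscous.eq (m - 2) z hz v
  rw [show m - 2 + 2 = m by ring, show m - 2 + 1 = m - 1 by ring] at h
  exact h

/-- The transport terms. -/
def transport (_ : Admissible D) (m : ℤ) (z : Pt) (v : Vel) : ℝ :=
  D.dtfb (m - D.n) z v + D.tangfb (m - 2) z v - D.sg * D.normfb (m - 1) z v

/-- The transport terms equal collision terms, all of which conserve mass, momentum and energy. The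
balance laws are the vanishing moments. -/
lemma perpN_transport (m : ℤ) (hz : z ∈ layer D.τ) : PerpN (H.transport m z) := by
  have e : H.transport m z = _ := funext fun v => H.layer_eq m hz v
  rw [e]
  refine PerpD.perpN ?_
  refine (((perpD_linL (H.rapid_fb _ hz)).neg.add (PerpD.sum _ fun i _ =>
    perpD_GamS (H.rapid_fw _ hz) (H.rapid_fb _ hz))).add (PerpD.sum _ fun l hl =>
    PerpD.sum _ fun i _ => (perpD_GamS (H.rapid_dfw ?_ _ hz) (H.rapid_fb _ hz)).const_mul _)).add
    (PerpD.sum _ fun i _ => (perpD_GamS (H.rapid_fb _ hz) (H.rapid_fb _ hz)).const_mul _)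
  exact (Finset.mem_Icc.1 hl).2

lemma transport_eq (k : ℤ) (z : Pt) : H.transport (k + 2) z = fun v =>
    (D.dl 0 (fun z => D.fb (k + 2 - D.n) z v) z + (v 0 * D.dl 1 (fun z => D.fb k z v) z
      + v 1 * D.dl 2 (fun z => D.fb k z v) z))
      + (-D.sg) * (v 2 * D.dl 3 (fun z => D.fb (k + 1) z v) z) := by
  ext v
  rw [transport, LayerData.tangfb, Fin.sum_univ_two, show k + 2 - 2 = k by ring,
    show k + 2 - 1 = k + 1 by ring, neg_mul, ← sub_eq_add_neg]
  rfl

lemma mass_balance (k : ℤ) (hz : z ∈ layer D.τ) :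
    D.dl 0 (fun z => rho (D.fb (k + 2 - D.n) z)) z + D.divb k z
      - D.sg * D.dl 3 (fun z => vel 2 (D.fb (k + 1) z)) z = 0 := by
  have h := (H.perpN_transport (k + 2) hz).rho
  have r0 := H.rapid_dl 0 (k + 2 - D.n) hz
  have r1 := H.rapid_dl 1 k hz
  have r2 := H.rapid_dl 2 k hz
  have r3 := H.rapid_dl 3 (k + 1) hz
  have r01 := r0.add ((r1.coord_mul 0).add (r2.coord_mul 1))
  rw [H.transport_eq, rho_add r01.wl2 ((r3.coord_mul 2).const_mul _).wl2,
    rho_add r0.wl2 ((r1.coord_mul 0).add (r2.coord_mul 1)).wl2,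
    rho_add (r1.coord_mul 0).wl2 (r2.coord_mul 1).wl2, rho_const_mul] at h
  rw [rho_coord_mul, rho_coord_mul, rho_coord_mul] at h
  rw [LayerData.divb, Fin.sum_univ_two, H.dl_eq (H.hasPd_rho _ 0 hz) hz, H.dl_eq (H.hasPd_vel _ 3 2 hz) hz,
    H.dl_eq (H.hasPd_vel k _ _ hz) hz, H.dl_eq (H.hasPd_vel k _ _ hz) hz]
  rw [← h, neg_mul, ← sub_eq_add_neg]
  rfl

lemma hasPd_pbar (m : ℤ) (i : Fin 4) (hz : z ∈ layer D.τ) :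
    HasPd (layer D.τ) i (D.pbar m) (D.dl i (D.pbar m) z) z := by
  have h := (H.hasPd_rho m i hz).add (H.hasPd_temp m i hz)
  have e := H.dl_eq h hz
  rw [← e] at h
  exact h

/-- The flux of the momentum `i` in the direction `j`. -/
def momentumFlux (D : LayerData) (j i : Fin 3) (k : ℤ) (z : Pt) : ℝ :=
  ip (burnettA j i) (D.fb k z) + if j = i then D.pbar k z else 0

lemma hasPd_momentumFlux (m : ℤ) (j i : Fin 3) (l : Fin 4) (hz : z ∈ layer D.τ) :
    HasPd (layer D.τ) l (momentumFlux D j i m)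
      (vel i fun v => v j * D.dl l (fun z => D.fb m z v) z) z := by
  refine (((H.family_fb m l).coord_mul j).hasPd_vel (isOpen_layer _) hz i).congr hz fun z hz => ?_
  rw [ip_vel_mul j i (H.rapid_fb m hz)]
  rfl

lemma momentum_balance (i : Fin 3) (k : ℤ) (hz : z ∈ layer D.τ) :
    D.dl 0 (fun z => vel i (D.fb (k + 2 - D.n) z)) z
      + ∑ j : Fin 2, D.dl j.castSucc.succ (momentumFlux D j.castSucc i k) z
      - D.sg * D.dl 3 (momentumFlux D 2 i (k + 1)) z = 0 := by
  have h := (H.perpN_transport (k + 2) hz).vel i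
  have r0 := H.rapid_dl 0 (k + 2 - D.n) hz
  have r1 := H.rapid_dl 1 k hz
  have r2 := H.rapid_dl 2 k hz
  have r3 := H.rapid_dl 3 (k + 1) hz
  have r01 := r0.add ((r1.coord_mul 0).add (r2.coord_mul 1))
  rw [H.transport_eq, vel_add r01.wl2 ((r3.coord_mul 2).const_mul _).wl2,
    vel_add r0.wl2 ((r1.coord_mul 0).add (r2.coord_mul 1)).wl2,
    vel_add (r1.coord_mul 0).wl2 (r2.coord_mul 1).wl2, vel_const_mul] at h
  rw [Fin.sum_univ_two, H.dl_eq (H.hasPd_vel _ 0 i hz) hz,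
    H.dl_eq (H.hasPd_momentumFlux _ _ _ _ hz) hz, H.dl_eq (H.hasPd_momentumFlux _ _ _ _ hz) hz,
    H.dl_eq (H.hasPd_momentumFlux _ _ _ _ hz) hz]
  rw [← h, neg_mul, ← sub_eq_add_neg]
  rfl

lemma hasPd_heatFlux (m : ℤ) (j : Fin 3) (l : Fin 4) (hz : z ∈ layer D.τ) :
    HasPd (layer D.τ) l (fun z => ip (burnettB j) (D.fb m z))
      (enth fun v => v j * D.dl l (fun z => D.fb m z v) z) z := by
  refine (((H.family_fb m l).coord_mul j).hasPd_enth (isOpen_layer _) hz).congr hz fun z hz => ?_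
  rw [enth_coord_mul j (H.rapid_fb m hz)]

lemma hasPd_enth (m : ℤ) (i : Fin 4) (hz : z ∈ layer D.τ) :
    HasPd (layer D.τ) i (fun z => enth (D.fb m z))
      (enth fun v => D.dl i (fun z => D.fb m z v) z) z :=
  (H.family_fb m i).hasPd_enth (isOpen_layer _) hz

lemma energy_balance (k : ℤ) (hz : z ∈ layer D.τ) :
    D.dl 0 (fun z => enth (D.fb (k + 2 - D.n) z)) z
      + ∑ j : Fin 2, D.dl j.castSucc.succ (fun z => ip (burnettB j.castSucc) (D.fb k z)) z
      - D.sg * D.dl 3 (fun z => ip (burnettB 2) (D.fb (k + 1) z)) z = 0 := by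
  have h := (H.perpN_transport (k + 2) hz).enth
  have r0 := H.rapid_dl 0 (k + 2 - D.n) hz
  have r1 := H.rapid_dl 1 k hz
  have r2 := H.rapid_dl 2 k hz
  have r3 := H.rapid_dl 3 (k + 1) hz
  have r01 := r0.add ((r1.coord_mul 0).add (r2.coord_mul 1))
  rw [H.transport_eq, enth_add r01.wl2 ((r3.coord_mul 2).const_mul _).wl2,
    enth_add r0.wl2 ((r1.coord_mul 0).add (r2.coord_mul 1)).wl2,
    enth_add (r1.coord_mul 0).wl2 (r2.coord_mul 1).wl2, enth_const_mul] at h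
  rw [Fin.sum_univ_two, H.dl_eq (H.hasPd_enth _ 0 hz) hz,
    H.dl_eq (H.hasPd_heatFlux _ _ _ hz) hz, H.dl_eq (H.hasPd_heatFlux _ _ _ hz) hz,
    H.dl_eq (H.hasPd_heatFlux _ _ _ hz) hz]
  rw [← h, neg_mul, ← sub_eq_add_neg]
  rfl

/-! ### The far field -/

omit H in
lemma update_mem {y : ℝ} (hz : z ∈ layer D.τ) (hy : 0 < y) : Function.update z 3 y ∈ layer D.τ := by
  refine ⟨by simpa using hz.1, by simpa using hz.2.1, by simpa using hy⟩

omit H in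
lemma hasDerivAt_update {q q' : Pt → ℝ} (hq : ∀ z ∈ layer D.τ, HasPd (layer D.τ) 3 q (q' z) z)
    (hz : z ∈ layer D.τ) {y : ℝ} (hy : 0 < y) :
    HasDerivAt (fun y => q (Function.update z 3 y)) (q' (Function.update z 3 y)) y := by
  have hm := update_mem hz hy
  have h1 : HasLineDerivAt ℝ q (q' (Function.update z 3 y)) (Function.update z 3 y)
      (Pi.single 3 1) :=
    HasLineDerivWithinAt.hasLineDerivAt (hq _ hm) ((isOpen_layer _).mem_nhds hm)
  have h2 : HasDerivAt (fun t : ℝ => q (Function.update z 3 y + t • (Pi.single 3 1 : Pt)))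
      (q' (Function.update z 3 y)) (y - y) := by rw [sub_self]; exact h1
  have h3 := h2.comp_sub_const y y
  refine h3.congr_of_eventuallyEq (Eventually.of_forall fun s => ?_)
  simp only
  congr 1
  ext j
  simp only [Function.update_apply, Pi.add_apply, Pi.smul_apply, Pi.single_apply, smul_eq_mul]
  split_ifs <;> simp

/-- Cauchy-Schwarz against the decay of the `L²` norm in `v`. -/
lemma tendsto_ip (m : ℤ) {k : Vel → ℝ} (hk : Rapid k) (hz : z ∈ layer D.τ) :
    Tendsto (fun y : ℝ => ip (D.fb m (Function.update z 3 y)) k) atTop (𝓝 0) := by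
  have h1 := (H.sol.viscous.farField m z hz).mul_const (∫ v, k v ^ 2)
  rw [zero_mul] at h1
  have h2 : Tendsto (fun y : ℝ => ip (D.fb m (Function.update z 3 y)) k ^ 2) atTop (𝓝 0) := by
    refine squeeze_zero' (Eventually.of_forall fun y => sq_nonneg _) ?_ h1
    filter_upwards [eventually_gt_atTop 0] with y hy
    exact sq_integral_mul_le (H.rapid_fb m (update_mem hz hy)).wl2.memLp hk.wl2.memLp
  have h3 := h2.sqrt
  simp only [Real.sqrt_sq_eq_abs, Real.sqrt_zero] at h3
  exact (tendsto_zero_iff_abs_tendsto_zero _).2 h3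

lemma tendsto_vel (m : ℤ) (j : Fin 3) (hz : z ∈ layer D.τ) :
    Tendsto (fun y : ℝ => vel j (D.fb m (Function.update z 3 y))) atTop (𝓝 0) :=
  H.tendsto_ip m (rapid_sqrtM.coord_mul j) hz

lemma tendsto_pbar (m : ℤ) (hz : z ∈ layer D.τ) :
    Tendsto (fun y : ℝ => D.pbar m (Function.update z 3 y)) atTop (𝓝 0) := by
  have hk : Rapid fun v : Vel => (‖v‖ ^ 2 - 3) * sqrtM v := by
    rw [temp_fun_eq]; exact rapid_pf _
  have h := (H.tendsto_ip m rapid_sqrtM hz).add ((H.tendsto_ip m hk hz).div_const 3)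
  simpa [LayerData.pbar, rho, temp] using h

/-! ### The first layer term -/

lemma dl_fb_zero {m : ℤ} (hm : m ≤ 0) (i : Fin 4) (hz : z ∈ layer D.τ) (v : Vel) :
    D.dl i (fun z => D.fb m z v) z = 0 := by
  simp only [H.fb_zero hm]
  exact H.dl_eq (hasPd_const 0) hz

/-- In the equation of order `1 - n`, in which `L f̄_1` appears, every collision sum is empty and
every transport term has index at most 0. Thus `L f̄_1 = 0`. -/
lemma micro_fb_one (hz : z ∈ layer D.τ) : D.fb 1 z = proj (D.fb 1 z) := by
  have hn := H.hn
  refine eq_proj_of_linL (H.rapid_fb 1 hz) ((H.sol.viscous.regular 1).continuous_vel z hz)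
    fun v => ?_
  have e := H.layer_eq (3 - D.n) hz v
  rw [show 3 - D.n - 2 + D.n = 1 by ring,
    Finset.Icc_eq_empty (show ¬ (0 : ℤ) ≤ 3 - D.n - 1 by omega),
    Finset.Icc_eq_empty (show ¬ (1 : ℤ) ≤ 3 - D.n - 1 by omega)] at e
  have e2 : ∀ l ∈ Finset.Icc 1 D.b, ∑ i ∈ Finset.Icc (0 : ℤ) (3 - D.n - 1 - l),
      D.taylorCoeff l z * GamS (D.dfw l i z) (D.fb (3 - D.n - l - i) z) v = 0 := fun l hl => by
    have := (Finset.mem_Icc.1 hl).1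
    rw [Finset.Icc_eq_empty (by omega), Finset.sum_empty]
  rw [Finset.sum_eq_zero e2] at e
  simp only [LayerData.dtfb, LayerData.tangfb, LayerData.normfb,
    H.dl_fb_zero (show 3 - D.n - D.n ≤ 0 by omega) _ hz,
    H.dl_fb_zero (show 3 - D.n - 2 ≤ 0 by omega) _ hz,
    H.dl_fb_zero (show 3 - D.n - 1 ≤ 0 by omega) _ hz] at e
  simp at e
  linarith

omit H in
/-- A function with vanishing normal derivative and far field vanishes. -/
lemma eq_zero_of_normal {q : Pt → ℝ} (hq : ∀ z ∈ layer D.τ, HasPd (layer D.τ) 3 q 0 z)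
    (hz : z ∈ layer D.τ)
    (ht : Tendsto (fun y : ℝ => q (Function.update z 3 y)) atTop (𝓝 0)) : q z = 0 := by
  have hd : ∀ y ∈ Set.Ioi (0 : ℝ), HasDerivAt (fun y => q (Function.update z 3 y)) 0 y :=
    fun y hy => hasDerivAt_update (q' := fun _ => 0) hq hz hy
  have hc : ∀ y ∈ Set.Ioi (0 : ℝ), q (Function.update z 3 y) = q z := by
    intro y hy
    have := isOpen_Ioi.is_const_of_deriv_eq_zero isPreconnected_Ioi
      (fun y hy => (hd y hy).differentiableAt.differentiableWithinAt)
      (fun y hy => (hd y hy).deriv) hy (show z 3 ∈ Set.Ioi (0 : ℝ) from hz.2.2)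
    simpa using this
  have h2 : Tendsto (fun _ : ℝ => q z) atTop (𝓝 0) := by
    refine ht.congr' ?_
    filter_upwards [eventually_gt_atTop 0] with y hy
    exact hc y hy
  exact tendsto_nhds_unique tendsto_const_nhds h2

/-- Mass balance at order 0 reads `∂_y ū_{1,3} = 0`, because `n ≥ 3` and the layer terms of index at
most 0 vanish; the far field condition fixes the constant. -/
lemma vel_fb_one (hz : z ∈ layer D.τ) : vel 2 (D.fb 1 z) = 0 := by
  have hn := H.hn
  refine eq_zero_of_normal (q := fun z => vel 2 (D.fb 1 z)) (fun z hz => ?_) hz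
    (H.tendsto_vel 1 2 hz)
  have h := H.mass_balance 0 hz
  have h1 := H.hasPd_vel 1 3 2 hz
  have e1 := H.dl_eq h1 hz
  rw [zero_add, zero_add] at h
  have e2 : D.dl 0 (fun z => rho (D.fb (2 - D.n) z)) z = 0 := by
    refine H.dl_eq ((hasPd_const 0).congr hz fun z _ => ?_) hz
    simp [rho, ip, H.fb_zero (show 2 - D.n ≤ 0 by omega)]
  have e3 : D.divb 0 z = 0 := by
    refine Finset.sum_eq_zero fun j _ => H.dl_eq ((hasPd_const 0).congr hz fun z _ => ?_) hz
    simp [vel, ip, H.fb_zero (le_refl 0)]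
  rw [e2, e3, e1, add_zero, zero_sub, neg_eq_zero] at h
  have h2 : (vel 2 fun v => D.dl 3 (fun z => D.fb 1 z v) z) = 0 := by
    have := congrArg (D.sg * ·) h
    simpa [← mul_assoc, sg_mul_sg] using this
  rw [h2] at h1
  exact h1

/-! ### The microscopic part and `W` -/

lemma GamS_fw0_fb (k : ℤ) (hz : z ∈ layer D.τ) (v : Vel) :
    GamS (D.fw 0 z) (D.fb k z) v
      = GamS (D.fw 0 z) (proj (D.fb k z)) v + GamS (D.fw 0 z) (micro (D.fb k z)) v := by
  have h := GamS_add_right (H.rapid_fw 0 hz) (rapid_proj (D.fb k z)) (H.rapid_fb k hz).micro v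
  rw [← h]
  congr 1
  ext w
  exact micro_eq_add _ w

lemma GamS_zero_fb {k : ℤ} (hk : k ≤ 0) {g : Vel → ℝ} (hg : Rapid g) (z : Pt) (v : Vel) :
    GamS g (D.fb k z) v = 0 := by
  rw [H.sol.viscous.zero k hk]
  exact GamS_zero_right hg v

/-- The definition of `WArg` contains everything in this order except the interaction of `f_0` with
the macroscopic part of `f̄_m`. Applying `I - P` to the transport terms is free, since they are
orthogonal to the invariants. -/
lemma linL_fb (m : ℤ) (hz : z ∈ layer D.τ) (v : Vel) :
    linL (D.fb (m + D.n - 2) z) v = D.WArg m z v + GamS (D.fw 0 z) (proj (D.fb m z)) v := by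
  have e := H.layer_eq m hz v
  have hp := (H.perpN_transport m hz).micro_eq
  have r0 := H.rapid_dtfb (m - D.n) hz
  have r1 := H.rapid_tangfb (m - 2) hz
  have r3 := H.rapid_normfb (m - 1) hz
  have e1 := congrFun hp v
  unfold transport at e1
  rw [micro_sub (r0.add r1).wl2 (r3.const_mul _).wl2, micro_const_mul] at e1
  have e2 : ∑ i ∈ Finset.Icc (0 : ℤ) (m - 1), GamS (D.fw i z) (D.fb (m - i) z) v
      = GamS (D.fw 0 z) (D.fb m z) v
        + ∑ i ∈ Finset.Icc (1 : ℤ) (m - 1), GamS (D.fw i z) (D.fb (m - i) z) v := by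
    rcases le_or_gt m 0 with hm | hm
    · rw [Finset.Icc_eq_empty (by omega), Finset.Icc_eq_empty (by omega),
        H.GamS_zero_fb hm (H.rapid_fw 0 hz)]
      simp
    · have : Finset.Icc (0 : ℤ) (m - 1) = insert 0 (Finset.Icc 1 (m - 1)) := by
        ext i; simp only [Finset.mem_Icc, Finset.mem_insert]; omega
      rw [this, Finset.sum_insert (by simp), sub_zero]
  rw [e2, H.GamS_fw0_fb m hz] at e
  rw [show m + D.n - 2 = m - 2 + D.n by ring]
  unfold LayerData.WArg
  linarith

/-- The representation of `W`. -/
lemma isLinvOf_WArg (m : ℤ) (hz : z ∈ layer D.τ) :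
    IsLinvOf (D.WArg m z)
      (fun v => micro (D.fb (m + D.n - 2) z) v - prodMicro (D.fw 0 z) (D.fb m z) v) := by
  have h := (isLinvOf_linL (H.rapid_fb (m + D.n - 2) hz)).sub
    (isLinvOf_prodMicro (D.fw 0 z) (D.fb m z))
  rw [← H.fw0_eq hz] at h
  refine h.congr (ae_of_all _ fun v => ?_)
  simp only
  rw [H.linL_fb m hz]; ring

lemma W_spec (m : ℤ) (hz : z ∈ layer D.τ) : IsLinvOf (D.WArg m z) (D.W (m - 1) z) := by
  unfold LayerData.W
  rw [sub_add_cancel]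
  exact (H.isLinvOf_WArg m hz).linv

lemma W_ae (m : ℤ) (hz : z ∈ layer D.τ) : D.W (m - 1) z =ᵐ[volume]
    fun v => micro (D.fb (m + D.n - 2) z) v - prodMicro (D.fw 0 z) (D.fb m z) v :=
  (H.W_spec m hz).unique (H.isLinvOf_WArg m hz)

/-- The flux of order `m + n - 2` differs from that of `W` by explicit products with `u_0`. By the
slip condition only tangential components contribute to the trace. -/
lemma ip_burnettA_W (i j : Fin 3) (m : ℤ) (hz : z ∈ layer D.τ) :
    ip (burnettA i j) (D.W (m - 1) z) = ip (burnettA i j) (D.fb (m + D.n - 2) z)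
      - (vel i (D.fw 0 z) * vel j (D.fb m z) + vel j (D.fw 0 z) * vel i (D.fb m z)
      - (if i = j then 2 / 3 * D.u0dot m z else 0)) := by
  rw [ip_congr_right (H.W_ae m hz), ip_comm,
    ip_sub_left (H.rapid_fb _ hz).micro.wl2 (rapid_prodMicro _ _).wl2 (rapid_burnettA i j).wl2,
    ip_comm, ip_burnettA_micro _ _ (H.rapid_fb _ hz).wl2, ip_comm (prodMicro _ _),
    ip_burnettA_prodMicro]
  simp only [LayerData.u0dot, Fin.sum_univ_three, Fin.sum_univ_two, H.slip hz, zero_mul, add_zero]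
  rfl

lemma ip_burnettB_W (i : Fin 3) (m : ℤ) (hz : z ∈ layer D.τ) :
    ip (burnettB i) (D.W (m - 1) z) = ip (burnettB i) (D.fb (m + D.n - 2) z)
      - 5 / 2 * (vel i (D.fw 0 z) * temp (D.fb m z) + vel i (D.fb m z) * temp (D.fw 0 z)) := by
  rw [ip_congr_right (H.W_ae m hz), ip_comm,
    ip_sub_left (H.rapid_fb _ hz).micro.wl2 (rapid_prodMicro _ _).wl2 (rapid_burnettB i).wl2,
    ip_comm, ip_burnettB_micro _ (H.rapid_fb _ hz).wl2, ip_comm (prodMicro _ _),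
    ip_burnettB_prodMicro]

end Admissible

end ViscousLayer
end

/-! ### The pressure in the layer and the improper integrals. -/

noncomputable section
namespace ViscousLayer
open ProbabilityTheory MvPolynomial
open scoped RealInnerProductSpace ENNReal

lemma HasPd.self {D : LayerData} {i : Fin 4} {q : Pt → ℝ} {q' : ℝ} {z : Pt}
    (h : HasPd (layer D.τ) i q q' z) (hz : z ∈ layer D.τ) :
    HasPd (layer D.τ) i q (D.dl i q z) z := by
  have e : D.dl i q z = q' := h.pd_eq (goodDomain_layer _) hz
  rwa [e]

namespace Admissible

variable {D : LayerData} (H : Admissible D) {z : Pt}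

include H

/-! ### Derivatives of macroscopic quantities -/

lemma pd_vel (m : ℤ) (i : Fin 4) (j : Fin 3) (hz : z ∈ layer D.τ) :
    HasPd (layer D.τ) i (fun z => vel j (D.fb m z)) (D.dl i (fun z => vel j (D.fb m z)) z) z :=
  (H.hasPd_vel m i j hz).self hz

lemma pd_temp (m : ℤ) (i : Fin 4) (hz : z ∈ layer D.τ) :
    HasPd (layer D.τ) i (fun z => temp (D.fb m z)) (D.dl i (fun z => temp (D.fb m z)) z) z :=
  (H.hasPd_temp m i hz).self hz

lemma pd_rho (m : ℤ) (i : Fin 4) (hz : z ∈ layer D.τ) :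
    HasPd (layer D.τ) i (fun z => rho (D.fb m z)) (D.dl i (fun z => rho (D.fb m z)) z) z :=
  (H.hasPd_rho m i hz).self hz

lemma pd_ip (m : ℤ) (i : Fin 4) {k : Vel → ℝ} (hk : Rapid k) (hz : z ∈ layer D.τ) :
    HasPd (layer D.τ) i (fun z => ip k (D.fb m z)) (D.dl i (fun z => ip k (D.fb m z)) z) z :=
  (H.hasPd_ip m i hk hz).self hz

lemma pd_dl_vel (m : ℤ) (i : Fin 4) (j : Fin 3) (hz : z ∈ layer D.τ) :
    HasPd (layer D.τ) i (D.dl i fun z => vel j (D.fb m z))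
      (D.dl i (D.dl i fun z => vel j (D.fb m z)) z) z := by
  have h := ((H.family_dfb m i).hasPd_vel (isOpen_layer _) hz j).congr
    (p := D.dl i fun z => vel j (D.fb m z)) hz fun z hz => H.dl_eq (H.hasPd_vel m i j hz) hz
  exact h.self hz

lemma pd_dl_temp (m : ℤ) (i : Fin 4) (hz : z ∈ layer D.τ) :
    HasPd (layer D.τ) i (D.dl i fun z => temp (D.fb m z))
      (D.dl i (D.dl i fun z => temp (D.fb m z)) z) z := by
  have h := ((H.family_dfb m i).hasPd_temp (isOpen_layer _) hz).congr
    (p := D.dl i fun z => temp (D.fb m z)) hz fun z hz => H.dl_eq (H.hasPd_temp m i hz) hz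
  exact h.self hz

lemma pd_dl_rho (m : ℤ) (i : Fin 4) (hz : z ∈ layer D.τ) :
    HasPd (layer D.τ) i (D.dl i fun z => rho (D.fb m z))
      (D.dl i (D.dl i fun z => rho (D.fb m z)) z) z := by
  have h := ((H.family_dfb m i).hasPd_rho (isOpen_layer _) hz).congr
    (p := D.dl i fun z => rho (D.fb m z)) hz fun z hz => H.dl_eq (H.hasPd_rho m i hz) hz
  exact h.self hz

lemma pd_u0 (i : Fin 4) (j : Fin 3) (hz : z ∈ layer D.τ) :
    HasPd (layer D.τ) i (fun z => vel j (D.fw 0 z)) (D.dl i (fun z => vel j (D.fw 0 z)) z) z := by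
  by_cases hi : i = 3
  · subst hi
    exact (H.hasPd_toWall_normal fun z => vel j (D.f 0 z)).self hz
  · obtain ⟨_, u, _, _, hu, _, _⟩ := H.exists_hasPd_f0 i (H.toWall_mem hz)
    exact (H.hasPd_toWall hi (hu j)).self hz

lemma pd_theta0 (i : Fin 4) (hz : z ∈ layer D.τ) :
    HasPd (layer D.τ) i (fun z => temp (D.fw 0 z)) (D.dl i (fun z => temp (D.fw 0 z)) z) z := by
  by_cases hi : i = 3
  · subst hi
    exact (H.hasPd_toWall_normal fun z => temp (D.f 0 z)).self hz
  · obtain ⟨_, _, _, _, _, hθ, _⟩ := H.exists_hasPd_f0 i (H.toWall_mem hz)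
    exact (H.hasPd_toWall hi hθ).self hz

/-- Traces do not depend on the normal variable. -/
lemma pd_trace (q : Pt → ℝ) (z : Pt) : HasPd (layer D.τ) 3 (fun z => q (D.toWall z)) 0 z :=
  H.hasPd_toWall_normal q

/-- The solenoidal condition at the wall. -/
lemma div_wall (hz : z ∈ layer D.τ) :
    ∑ j : Fin 2, D.dl j.castSucc.succ (fun z => vel j.castSucc (D.fw 0 z)) z
      + D.normalTrace (fun z => vel 2 (D.f 0 z)) z = 0 := by
  have hw := H.toWall_mem hz
  have h := H.div_f0 hw
  have e : ∀ (i : Fin 4) (_ : i ≠ 3) (j : Fin 3), D.dl i (fun z => vel j (D.fw 0 z)) z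
      = pd (channel D.τ) i (fun z => vel j (D.f 0 z)) (D.toWall z) := fun i hi j => by
    obtain ⟨_, u, _, _, hu, _, _⟩ := H.exists_hasPd_f0 i hw
    rw [(hu j).pd_eq (goodDomain_channel _) hw]
    exact H.dl_eq (H.hasPd_toWall hi (hu j)) hz
  rw [Fin.sum_univ_three] at h
  rw [Fin.sum_univ_two, e _ (by decide), e _ (by decide)]
  exact h

/-- The normal derivative of the leading order interior term. -/
lemma dfw_eq (hz : z ∈ layer D.τ) : D.dfw 1 0 z = proj (D.dfw 1 0 z) ∧
    (∀ j, vel j (D.dfw 1 0 z) = D.normalTrace (fun z => vel j (D.f 0 z)) z) ∧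
    temp (D.dfw 1 0 z) = D.normalTrace (fun z => temp (D.f 0 z)) z := by
  have hw := H.toWall_mem hz
  obtain ⟨ρ, u, θ, hρ, hu, hθ, hpf⟩ := H.exists_hasPd_f0 3 hw
  have e : D.dfw 1 0 z = pf (invP ρ u θ) := funext fun v => hpf v
  refine ⟨?_, fun j => ?_, ?_⟩
  · rw [e, proj_eq, rho_pf_invP, temp_pf_invP]
    simp only [vel_pf_invP]
  · rw [e, vel_pf_invP]
    exact ((hu j).pd_eq (goodDomain_channel _) hw).symm
  · rw [e, temp_pf_invP]
    exact (hθ.pd_eq (goodDomain_channel _) hw).symm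

lemma pd_u0dot (m : ℤ) (i : Fin 4) (hz : z ∈ layer D.τ) :
    HasPd (layer D.τ) i (D.u0dot m) (D.dl i (D.u0dot m) z) z := by
  have h : HasPd (layer D.τ) i (D.u0dot m) _ z := HasPd.sum (s := Finset.univ)
    fun j : Fin 2 => fun _ => (H.pd_u0 i j.castSucc hz).mul (H.pd_vel m i j.castSucc hz)
  exact h.self hz

/-! ### The pressure -/

omit H in
/-- The part of the pressure that is determined by lower orders. -/
def excess (D : LayerData) (m : ℤ) (z : Pt) : ℝ := D.pbar (m + D.n - 1) z - 2 / 3 * D.u0dot (m + 1) z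

lemma pd_excess (m : ℤ) (i : Fin 4) (hz : z ∈ layer D.τ) :
    HasPd (layer D.τ) i (excess D m)
      (D.dl i (D.pbar (m + D.n - 1)) z - 2 / 3 * D.dl i (D.u0dot (m + 1)) z) z :=
  (H.hasPd_pbar _ i hz).sub ((H.pd_u0dot _ i hz).const_mul _)

/-- This gives continuity of `H` in `y`, hence its integrability on bounded intervals. -/
lemma dl_dl_excess (m : ℤ) (hz : z ∈ layer D.τ) :
    ∃ c, HasPd (layer D.τ) 3 (D.dl 3 (excess D m)) c z := by
  have h1 := ((H.pd_dl_rho (m + D.n - 1) 3 hz).add (H.pd_dl_temp (m + D.n - 1) 3 hz)).sub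
    ((HasPd.sum (s := Finset.univ) fun j : Fin 2 => fun _ =>
      (H.pd_u0 3 j.castSucc hz).mul (H.pd_dl_vel (m + 1) 3 j.castSucc hz)).const_mul (2 / 3))
  refine ⟨_, h1.congr hz fun z hz => ?_⟩
  have h2 := ((H.pd_rho (m + D.n - 1) 3 hz).add (H.pd_temp (m + D.n - 1) 3 hz)).sub
    ((HasPd.sum (s := Finset.univ) fun j : Fin 2 => fun _ =>
      (H.pd_u0 3 j.castSucc hz).mul (H.pd_vel (m + 1) 3 j.castSucc hz)).const_mul (2 / 3))
  rw [H.dl_eq (q := excess D m) h2 hz]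
  have h0 : ∀ j : Fin 3, D.dl 3 (fun z => vel j (D.fw 0 z)) z = 0 := fun j =>
    H.dl_eq (H.pd_trace (fun z => vel j (D.f 0 z)) z) hz
  simp [h0]

lemma pd_ip_burnettA_W (a b : Fin 3) (m : ℤ) (i : Fin 4) (hz : z ∈ layer D.τ) :
    HasPd (layer D.τ) i (fun z => ip (burnettA a b) (D.W (m - 1) z))
      (D.dl i (fun z => ip (burnettA a b) (D.fb (m + D.n - 2) z)) z
        - (D.dl i (fun z => vel a (D.fw 0 z)) z * vel b (D.fb m z)
          + vel a (D.fw 0 z) * D.dl i (fun z => vel b (D.fb m z)) z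
          + (D.dl i (fun z => vel b (D.fw 0 z)) z * vel a (D.fb m z)
          + vel b (D.fw 0 z) * D.dl i (fun z => vel a (D.fb m z)) z)
          - (if a = b then 2 / 3 else 0) * D.dl i (D.u0dot m) z)) z := by
  refine ((H.pd_ip (m + D.n - 2) i (rapid_burnettA a b) hz).sub
    ((((H.pd_u0 i a hz).mul (H.pd_vel m i b hz)).add ((H.pd_u0 i b hz).mul (H.pd_vel m i a hz))).sub
    ((H.pd_u0dot m i hz).const_mul (if a = b then 2 / 3 else 0)))).congr hz fun z hz => ?_
  rw [H.ip_burnettA_W a b m hz]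
  split_ifs <;> ring

/-- The normal momentum balance of order `m + n - 2`. Once the stress of order `m + n - 1` is
expressed by `W`, what remains under `∂_y` is the pressure minus `2/3 u_0 · ū`. -/
lemma H_eq (m : ℤ) (hz : z ∈ layer D.τ) : D.H m z = -(D.sg * D.dl 3 (excess D m) z) := by
  have hm := H.momentum_balance 2 (m + D.n - 2) hz
  rw [show m + D.n - 2 + 2 - D.n = m by ring, show m + D.n - 2 + 1 = m + D.n - 1 by ring] at hm
  have e1 : ∀ j : Fin 2, D.dl j.castSucc.succ (momentumFlux D j.castSucc 2 (m + D.n - 2)) z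
      = D.dl j.castSucc.succ
        (fun z => ip (burnettA 2 j.castSucc) (micro (D.fb (m + D.n - 2) z))) z := by
    intro j
    refine pd_congr hz fun z hz => ?_
    have hj : j.castSucc ≠ (2 : Fin 3) := by fin_cases j <;> decide
    rw [momentumFlux, if_neg hj, add_zero, burnettA_comm, ip_burnettA_micro _ _ (H.rapid_fb _ hz).wl2]
  have e2 : D.dl 3 (momentumFlux D 2 2 (m + D.n - 1)) z
      = D.dl 3 (fun z => ip (burnettA 2 2) (D.fb (m + D.n - 1) z)) z
        + D.dl 3 (D.pbar (m + D.n - 1)) z := by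
    refine H.dl_eq (((H.pd_ip _ 3 (rapid_burnettA 2 2) hz).add (H.hasPd_pbar _ 3 hz)).congr hz
      fun z _ => ?_) hz
    rw [momentumFlux, if_pos rfl]
  have e3 := H.dl_eq (H.pd_ip_burnettA_W 2 2 (m + 1) 3 hz) hz
  have h0 : D.dl 3 (fun z => vel 2 (D.fw 0 z)) z = 0 :=
    H.dl_eq (H.pd_trace (fun z => vel 2 (D.f 0 z)) z) hz
  rw [h0, H.slip hz, if_pos rfl, show m + 1 - 1 = m by ring,
    show m + 1 + D.n - 2 = m + D.n - 1 by ring] at e3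
  rw [H.dl_eq (H.pd_excess m 3 hz) hz, LayerData.H, e3]
  simp only [e1, e2] at hm
  linear_combination -hm

/-- `H` is the `y`-derivative of a multiple of `excess`, which tends to zero at infinity, so the
improper integral is a boundary value at `y`. -/
lemma tail_spec (m : ℤ) (hz : z ∈ layer D.τ) :
    (∀ R > z 3, IntervalIntegrable (fun s => D.H m (Function.update z 3 s)) volume (z 3) R) ∧
    Tendsto (D.intH m z) atTop (𝓝 (D.sg * excess D m z)) := by
  have hz3 : 0 < z 3 := hz.2.2
  have hd : ∀ y, 0 < y → HasDerivAt (fun y => -(D.sg * excess D m (Function.update z 3 y)))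
      (D.H m (Function.update z 3 y)) y := fun y hy => by
    have h := hasDerivAt_update (q := excess D m) (q' := D.dl 3 (excess D m))
      (fun z hz => (H.pd_excess m 3 hz).self hz) hz hy
    rw [H.H_eq m (update_mem hz hy)]
    exact (h.const_mul D.sg).neg
  have hc : ContinuousOn (fun s => D.H m (Function.update z 3 s)) (Set.Ioi 0) := by
    have h1 : ContinuousOn (fun s => -(D.sg * D.dl 3 (excess D m) (Function.update z 3 s)))
        (Set.Ioi 0) := by
      intro y hy
      choose! c hc using fun z (hz : z ∈ layer D.τ) => H.dl_dl_excess m hz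
      have h := (hasDerivAt_update hc hz hy).continuousAt
      exact (h.const_mul D.sg).neg.continuousWithinAt
    exact h1.congr fun y hy => H.H_eq m (update_mem hz hy)
  have hi : ∀ R > z 3, IntervalIntegrable (fun s => D.H m (Function.update z 3 s)) volume (z 3) R := by
    intro R hR
    refine (hc.mono fun y hy => ?_).intervalIntegrable
    rw [Set.uIcc_of_le hR.le] at hy
    exact hz3.trans_le hy.1
  refine ⟨hi, ?_⟩
  have hI : ∀ R > z 3, D.intH m z R
      = -(D.sg * excess D m (Function.update z 3 R)) - -(D.sg * excess D m z) := by
    intro R hR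
    have h := intervalIntegral.integral_eq_sub_of_hasDerivAt (a := z 3) (b := R)
      (fun y hy => hd y (by
        rw [Set.uIcc_of_le hR.le] at hy
        exact hz3.trans_le hy.1)) (hi R hR)
    rw [LayerData.intH, h, Function.update_eq_self]
  have ht : Tendsto (fun y : ℝ => excess D m (Function.update z 3 y)) atTop (𝓝 0) := by
    have hu : ∀ j : Fin 3, ∀ y : ℝ, vel j (D.fw 0 (Function.update z 3 y)) = vel j (D.fw 0 z) := by
      intro j y
      simp only [LayerData.fw, LayerData.toWall, Function.update_idem]
    have h1 := (H.tendsto_pbar (m + D.n - 1) hz).sub ((tendsto_finsetSum (Finset.univ (α := Fin 2))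
      fun j _ => (H.tendsto_vel (m + 1) j.castSucc hz).const_mul
        (vel j.castSucc (D.fw 0 z))).const_mul (2 / 3))
    simp only [mul_zero, Finset.sum_const_zero, sub_zero] at h1
    simpa only [excess, LayerData.u0dot, hu] using h1
  have h2 := (ht.const_mul D.sg).neg.sub_const (-(D.sg * excess D m z))
  rw [mul_zero, neg_zero, zero_sub, neg_neg] at h2
  refine h2.congr' ?_
  filter_upwards [eventually_gt_atTop (z 3)] with R hR
  rw [hI R hR]

lemma tailH_eq (m : ℤ) (hz : z ∈ layer D.τ) : D.tailH m z = D.sg * excess D m z :=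
  (H.tail_spec m hz).2.limUnder_eq

lemma tailConverges (m : ℤ) (hz : z ∈ layer D.τ) : D.TailConverges m z := by
  refine ⟨(H.tail_spec m hz).1, ?_⟩
  rw [H.tailH_eq m hz]
  exact (H.tail_spec m hz).2

lemma pd_tailH (m : ℤ) (i : Fin 4) (hz : z ∈ layer D.τ) :
    HasPd (layer D.τ) i (D.tailH m)
      (D.sg * (D.dl i (D.pbar (m + D.n - 1)) z - 2 / 3 * D.dl i (D.u0dot (m + 1)) z)) z :=
  ((H.pd_excess m i hz).const_mul D.sg).congr hz fun _ hz => H.tailH_eq m hz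

/-- With the index `k + 1 - n` the excess involves precisely the pressure of order `k`. -/
lemma pbar_eq_srcP (k : ℤ) (hz : z ∈ layer D.τ) : D.pbar k z = D.srcP k z := by
  rw [LayerData.srcP, H.tailH_eq _ hz, excess, ← mul_assoc, sg_mul_sg,
    show k + 1 - D.n + D.n - 1 = k by ring, show k + 1 - D.n + 1 = k + 2 - D.n by ring]
  ring

lemma dl_pbar (k : ℤ) (hz : z ∈ layer D.τ) :
    D.dl 3 (D.pbar (D.n - 2 + k)) z = 2 / 3 * D.dl 3 (D.u0dot k) z - D.sg * D.H (k - 1) z := by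
  rw [H.H_eq _ hz, H.dl_eq (H.pd_excess _ 3 hz) hz, show k - 1 + D.n - 1 = D.n - 2 + k by ring,
    show k - 1 + 1 = k by ring]
  linear_combination (D.dl 3 (D.pbar (D.n - 2 + k)) z - 2 / 3 * D.dl 3 (D.u0dot k) z)
    * (-sg_mul_sg (D := D))

lemma dl_vel_normal (k : ℤ) (hz : z ∈ layer D.τ) : D.dl 3 (fun z => vel 2 (D.fb (k + 1) z)) z
    = D.sg * D.dl 0 (fun z => rho (D.fb (k + 2 - D.n) z)) z + D.sg * D.divb k z := by
  linear_combination (-D.sg) * H.mass_balance k hz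
    - D.dl 3 (fun z => vel 2 (D.fb (k + 1) z)) z * sg_mul_sg (D := D)

end Admissible

end ViscousLayer
end

/-! ### The microscopic part one order higher, and its fluxes. -/

noncomputable section
namespace ViscousLayer
open ProbabilityTheory MvPolynomial
open scoped RealInnerProductSpace ENNReal

namespace Admissible

variable {D : LayerData} (H : Admissible D) {z : Pt}

include H

/-! ### The representation of `J` -/

lemma hasPd_proj (k : ℤ) (hz : z ∈ layer D.τ) (v : Vel) :
    HasPd (layer D.τ) 3 (fun z => proj (D.fb k z) v)
      (pf (invP (D.dl 3 (fun z => rho (D.fb k z)) z) (fun j => D.dl 3 (fun z => vel j (D.fb k z)) z)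
        (D.dl 3 (fun z => temp (D.fb k z)) z)) v) z := by
  have h := (((H.pd_rho k 3 hz).add (HasPd.sum (s := Finset.univ)
    fun j : Fin 3 => fun _ => (H.pd_vel k 3 j hz).mul_const (v j))).add
    (((H.pd_temp k 3 hz).mul_const (1 / 2)).mul_const (‖v‖ ^ 2 - 3))).mul_const (sqrtM v)
  convert h.congr hz (p := fun z => proj (D.fb k z) v) (fun z _ => by rw [proj]; ring) using 1
  rw [pf, eval_invP]; ring

/-- The macroscopic part is split off because its streaming produces the viscous stress and the heat
flux explicitly. -/
lemma normfb_eq (k : ℤ) (hz : z ∈ layer D.τ) (v : Vel) : D.normfb k z v = D.normMicrofb k z v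
    + v 2 * pf (invP (D.dl 3 (fun z => rho (D.fb k z)) z)
        (fun j => D.dl 3 (fun z => vel j (D.fb k z)) z) (D.dl 3 (fun z => temp (D.fb k z)) z)) v := by
  have h := ((H.family_fb k 3).hasPd z hz v).sub (H.hasPd_proj k hz v)
  rw [LayerData.normMicrofb, H.dl_eq (q := fun z => micro (D.fb k z) v) h hz, LayerData.normfb]
  ring

lemma rapid_normMicrofb (k : ℤ) (hz : z ∈ layer D.τ) : Rapid (D.normMicrofb k z) := by
  have h := (H.rapid_normfb k hz).sub ((rapid_pf (invP (D.dl 3 (fun z => rho (D.fb k z)) z)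
    (fun j => D.dl 3 (fun z => vel j (D.fb k z)) z) (D.dl 3 (fun z => temp (D.fb k z)) z))).coord_mul 2)
  refine (congrArg Rapid (funext fun v => ?_)).mp h
  rw [H.normfb_eq k hz v]; ring

/-- The viscous stress and the heat flux across the layer. -/
def normalStress (D : LayerData) (k : ℤ) (z : Pt) (v : Vel) : ℝ :=
  ∑ j, D.dl 3 (fun z => vel j (D.fb k z)) z * burnettA 2 j v
    + D.dl 3 (fun z => temp (D.fb k z)) z * burnettB 2 v

def LinvNormalStress (D : LayerData) (k : ℤ) (z : Pt) (v : Vel) : ℝ :=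
  ∑ j, D.dl 3 (fun z => vel j (D.fb k z)) z * Linv (burnettA 2 j) v
    + D.dl 3 (fun z => temp (D.fb k z)) z * Linv (burnettB 2) v

omit H in
lemma isLinvOf_normalStress (k : ℤ) (z : Pt) :
    IsLinvOf (normalStress D k z) (LinvNormalStress D k z) := by
  have h : ∀ j, IsLinvOf (fun v => D.dl 3 (fun z => vel j (D.fb k z)) z * burnettA 2 j v)
      (fun v => D.dl 3 (fun z => vel j (D.fb k z)) z * Linv (burnettA 2 j) v) :=
    fun j => (isLinvOf_burnettA 2 j).const_mul _
  have h2 := (((h 0).add (h 1)).add (h 2)).add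
    ((isLinvOf_burnettB 2).const_mul (D.dl 3 (fun z => temp (D.fb k z)) z))
  have e1 : normalStress D k z = _ := funext fun v => by
    rw [normalStress, Fin.sum_univ_three]
  have e2 : LinvNormalStress D k z = _ := funext fun v => by
    rw [LinvNormalStress, Fin.sum_univ_three]
  rw [e1, e2]
  exact h2

lemma micro_normfb (k : ℤ) (hz : z ∈ layer D.τ) (v : Vel) :
    micro (D.normfb k z) v = micro (D.normMicrofb k z) v + normalStress D k z v := by
  have e : D.normfb k z = _ := funext fun v => H.normfb_eq k hz v
  rw [e, micro_add (H.rapid_normMicrofb k hz).wl2 ((rapid_pf _).coord_mul 2).wl2,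
    micro_coord_mul_invP]
  rfl

lemma GamS_left_fb (k : ℤ) (hz : z ∈ layer D.τ) {g : Vel → ℝ} (hg : Rapid g) (v : Vel) :
    GamS g (D.fb k z) v = GamS g (proj (D.fb k z)) v + GamS g (micro (D.fb k z)) v := by
  have h := GamS_add_right hg (rapid_proj (D.fb k z)) (H.rapid_fb k hz).micro v
  rw [← h]
  congr 1
  ext w
  exact micro_eq_add _ w

omit H in
lemma GamS_split_proj {g h : Vel → ℝ} (hg : Rapid g) (v : Vel) :
    GamS g (proj h) v = GamS (proj g) (proj h) v + GamS (micro g) (proj h) v := by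
  have h := GamS_add_left (rapid_proj g) hg.micro (rapid_proj h) v
  rw [← h]
  congr 1
  ext w
  exact micro_eq_add _ w

/-- The weight of the self-interaction of the first layer term. -/
def selfWeight (k : ℤ) : ℝ := if k = 1 then 1 / 2 else 1

/-- The terms `i = 1` and `i = k` coincide by symmetry of `Γˢ`. For `k = 1` they are a single term,
so the weight is `1/2`, and its microscopic part is absent. -/
lemma self_sum {k : ℤ} (hk : 1 ≤ k) (hz : z ∈ layer D.τ) (v : Vel) :
    ∑ i ∈ Finset.Icc (1 : ℤ) k, 1 / 2 * GamS (D.fb i z) (D.fb (k + 1 - i) z) v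
      = selfWeight k * GamS (D.fb 1 z) (proj (D.fb k z)) v
        + GamS (D.fb 1 z) (micro (D.fb k z)) v
        + ∑ i ∈ Finset.Icc (2 : ℤ) (k - 1), 1 / 2 * GamS (D.fb i z) (D.fb (k + 1 - i) z) v := by
  rcases hk.eq_or_lt with rfl | hk
  · have h0 : micro (D.fb 1 z) = fun _ => 0 := by
      ext v
      have := congrFun (H.micro_fb_one hz) v
      simp only [micro]
      linarith
    rw [h0, GamS_zero_right (H.rapid_fb 1 hz), ← H.micro_fb_one hz]
    simp [selfWeight]
  · have e : Finset.Icc (1 : ℤ) k = insert 1 (insert k (Finset.Icc 2 (k - 1))) := by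
      ext i; simp only [Finset.mem_Icc, Finset.mem_insert]; omega
    have h1 : (1 : ℤ) ∉ insert k (Finset.Icc 2 (k - 1)) := by
      simp only [Finset.mem_Icc, Finset.mem_insert]; omega
    have h2 : k ∉ Finset.Icc 2 (k - 1) := by simp only [Finset.mem_Icc]; omega
    rw [e, Finset.sum_insert h1, Finset.sum_insert h2, show k + 1 - 1 = k by ring,
      show k + 1 - k = 1 by ring, GamS_comm (D.fb k z), H.GamS_left_fb k hz (H.rapid_fb 1 hz),
      selfWeight, if_neg (by omega)]
    ring

/-- Indexed by the order `j` of the layer term, only `l = 1` reaches `j = k`, and there with `f_0`: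
this is the source of the factor linear in `y`. -/
lemma taylor_sum {k : ℤ} (hk : 1 ≤ k) (z : Pt) (v : Vel) :
    ∑ l ∈ Finset.Icc 1 D.b, ∑ i ∈ Finset.Icc (0 : ℤ) (k - l),
        D.taylorCoeff l z * GamS (D.dfw l i z) (D.fb (k + 1 - l - i) z) v
      = ∑ l ∈ Finset.Icc 1 D.b, ∑ j ∈ Finset.Icc (1 : ℤ) (min (k - 1) (k + 1 - l)),
          D.taylorCoeff l z * GamS (D.dfw l (k + 1 - l - j) z) (D.fb j z) v
        - D.sg * z 3 * GamS (D.dfw 1 0 z) (D.fb k z) v := by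
  have hl : ∀ l ∈ Finset.Icc 1 D.b, ∑ i ∈ Finset.Icc (0 : ℤ) (k - l),
        D.taylorCoeff l z * GamS (D.dfw l i z) (D.fb (k + 1 - l - i) z) v
      = ∑ j ∈ Finset.Icc (1 : ℤ) (min (k - 1) (k + 1 - l)),
          D.taylorCoeff l z * GamS (D.dfw l (k + 1 - l - j) z) (D.fb j z) v
        + if l = 1 then -(D.sg * z 3) * GamS (D.dfw 1 0 z) (D.fb k z) v else 0 := by
    intro l hl
    have h1 := (Finset.mem_Icc.1 hl).1
    have e : ∑ i ∈ Finset.Icc (0 : ℤ) (k - l),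
        D.taylorCoeff l z * GamS (D.dfw l i z) (D.fb (k + 1 - l - i) z) v
        = ∑ j ∈ Finset.Icc (1 : ℤ) (k + 1 - l),
          D.taylorCoeff l z * GamS (D.dfw l (k + 1 - l - j) z) (D.fb j z) v := by
      refine Finset.sum_bij' (fun i _ => k + 1 - l - i) (fun j _ => k + 1 - l - j) ?_ ?_ ?_ ?_ ?_
      · intro i hi; simp only [Finset.mem_Icc] at hi ⊢; omega
      · intro i hi; simp only [Finset.mem_Icc] at hi ⊢; omega
      · intro i _; ring
      · intro i _; ring
      · intro i _
        rw [show k + 1 - (l : ℤ) - (k + 1 - l - i) = i by ring]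
    rw [e]
    split_ifs with h
    · subst h
      have e2 : Finset.Icc (1 : ℤ) (k + 1 - (1 : ℕ))
          = insert k (Finset.Icc 1 (min (k - 1) (k + 1 - (1 : ℕ)))) := by
        ext i
        simp only [Finset.mem_Icc, Finset.mem_insert, le_min_iff]
        push_cast
        omega
      have h2 : k ∉ Finset.Icc (1 : ℤ) (min (k - 1) (k + 1 - (1 : ℕ))) := by
        simp only [Finset.mem_Icc, le_min_iff]; omega
      rw [e2, Finset.sum_insert h2, show k + 1 - ((1 : ℕ) : ℤ) - k = 0 by push_cast; ring, add_comm]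
      simp [LayerData.taylorCoeff]
    · rw [min_eq_right (by omega), add_zero]
  rw [Finset.sum_congr rfl hl, Finset.sum_add_distrib, Finset.sum_ite_eq', if_pos
    (Finset.mem_Icc.2 ⟨le_refl 1, H.hb⟩)]
  ring

lemma interior_sum {k : ℤ} (hk : 1 ≤ k) (hz : z ∈ layer D.τ) (v : Vel) :
    ∑ i ∈ Finset.Icc (0 : ℤ) k, GamS (D.fw i z) (D.fb (k + 1 - i) z) v
      = GamS (D.fw 0 z) (proj (D.fb (k + 1) z)) v + GamS (D.fw 0 z) (micro (D.fb (k + 1) z)) v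
        + (GamS (proj (D.fw 1 z)) (proj (D.fb k z)) v
          + GamS (micro (D.fw 1 z)) (proj (D.fb k z)) v + GamS (D.fw 1 z) (micro (D.fb k z)) v)
        + ∑ i ∈ Finset.Icc (2 : ℤ) k, GamS (D.fw i z) (D.fb (k + 1 - i) z) v := by
  have e : Finset.Icc (0 : ℤ) k = insert 0 (insert 1 (Finset.Icc 2 k)) := by
    ext i; simp only [Finset.mem_Icc, Finset.mem_insert]; omega
  have h1 : (0 : ℤ) ∉ insert 1 (Finset.Icc 2 k) := by
    simp only [Finset.mem_Icc, Finset.mem_insert]; omega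
  have h2 : (1 : ℤ) ∉ Finset.Icc 2 k := by simp only [Finset.mem_Icc]; omega
  rw [e, Finset.sum_insert h1, Finset.sum_insert h2, show k + 1 - 1 = k by ring, sub_zero,
    H.GamS_left_fb k hz (H.rapid_fw 1 hz), H.GamS_left_fb (k + 1) hz (H.rapid_fw 0 hz),
    GamS_split_proj (H.rapid_fw 1 hz)]
  ring

/-- The part of the microscopic flux that is explicit in the macroscopic quantities. -/
def explicitFlux (D : LayerData) (k : ℤ) (z : Pt) (v : Vel) : ℝ :=
  D.sg * LinvNormalStress D k z v + prodMicro (D.fw 0 z) (D.fb (k + 1) z) v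
    + prodMicro (D.fw 1 z) (D.fb k z) v + (-(D.sg * z 3)) * prodMicro (D.dfw 1 0 z) (D.fb k z) v
    + selfWeight k * prodMicro (D.fb 1 z) (D.fb k z) v

/-- In the equation that determines `L f̄_{k+n-1}`, every term absent from `JArg` is either the
streaming of a macroscopic part or a product of two macroscopic parts; `L⁻¹` of these is explicit.
Here `f_0`, `∂_{x₃} f_0` at the wall and `f̄_1` are purely macroscopic. -/
lemma isLinvOf_JArg {k : ℤ} (hk : 1 ≤ k) (hz : z ∈ layer D.τ) :
    IsLinvOf (D.JArg k z)
      (fun v => micro (D.fb (k + D.n - 1) z) v - explicitFlux D k z v) := by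
  have h := (isLinvOf_linL (H.rapid_fb (k + D.n - 1) hz)).sub
    ((((((isLinvOf_normalStress (D := D) k z).const_mul D.sg).add
      (isLinvOf_prodMicro (D.fw 0 z) (D.fb (k + 1) z))).add
      (isLinvOf_prodMicro (D.fw 1 z) (D.fb k z))).add
      ((isLinvOf_prodMicro (D.dfw 1 0 z) (D.fb k z)).const_mul (-(D.sg * z 3)))).add
      ((isLinvOf_prodMicro (D.fb 1 z) (D.fb k z)).const_mul (selfWeight k)))
  refine h.congr (ae_of_all _ fun v => ?_)
  simp only
  have hb1 := H.rapid_dfw H.hb 0 hz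
  have e := H.layer_eq (k + 1) hz v
  have hp := (H.perpN_transport (k + 1) hz).micro_eq
  have r0 := H.rapid_dtfb (k + 1 - D.n) hz
  have r1 := H.rapid_tangfb (k + 1 - 2) hz
  have r3 := H.rapid_normfb (k + 1 - 1) hz
  have e1 := congrFun hp v
  unfold transport at e1
  rw [micro_sub (r0.add r1).wl2 (r3.const_mul _).wl2, micro_const_mul] at e1
  rw [show k + 1 - 1 = k by ring, show k + 1 - 2 = k - 1 by ring] at e e1
  rw [show k - 1 + D.n = k + D.n - 1 by ring, H.taylor_sum hk, H.interior_sum hk hz,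
    H.self_sum hk hz, H.GamS_left_fb k hz hb1] at e
  rw [H.micro_normfb k hz] at e1
  rw [← H.fw0_eq hz, ← (H.dfw_eq hz).1, ← H.micro_fb_one hz]
  unfold LayerData.JArg
  linear_combination e1 + e

lemma J_spec {k : ℤ} (hk : 1 ≤ k) (hz : z ∈ layer D.τ) : IsLinvOf (D.JArg k z) (D.J (k - 1) z) := by
  unfold LayerData.J
  rw [sub_add_cancel]
  exact (H.isLinvOf_JArg hk hz).linv

omit H in
lemma wl2_explicitFlux (k : ℤ) (z : Pt) : WL2 (explicitFlux D k z) :=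
  (((((isLinvOf_normalStress (D := D) k z).wl2.const_mul D.sg).add (rapid_prodMicro _ _).wl2).add
    (rapid_prodMicro _ _).wl2).add ((rapid_prodMicro _ _).wl2.const_mul _)).add
    ((rapid_prodMicro _ _).wl2.const_mul _)

omit H in
lemma ip_LinvNormalStress {h : Vel → ℝ} (hh : Rapid h) (k : ℤ) (z : Pt) :
    ip h (LinvNormalStress D k z)
      = ∑ j, D.dl 3 (fun z => vel j (D.fb k z)) z * ip h (Linv (burnettA 2 j))
        + D.dl 3 (fun z => temp (D.fb k z)) z * ip h (Linv (burnettB 2)) := by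
  have w : ∀ j, WL2 fun v => D.dl 3 (fun z => vel j (D.fb k z)) z * Linv (burnettA 2 j) v :=
    fun j => (isLinvOf_burnettA 2 j).wl2.const_mul _
  have wB : WL2 fun v => D.dl 3 (fun z => temp (D.fb k z)) z * Linv (burnettB 2) v :=
    (isLinvOf_burnettB 2).wl2.const_mul _
  have e2 : LinvNormalStress D k z = _ := funext fun v => by
    rw [LinvNormalStress, Fin.sum_univ_three]
  rw [e2, ip_comm, ip_add_left (((w 0).add (w 1)).add (w 2)) wB hh.wl2,
    ip_add_left ((w 0).add (w 1)) (w 2) hh.wl2, ip_add_left (w 0) (w 1) hh.wl2]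
  simp only [ip_const_mul_left, ip_comm h, Fin.sum_univ_three]

omit H in
lemma ip_explicitFlux {h : Vel → ℝ} (hh : Rapid h) (k : ℤ) (z : Pt) :
    ip h (explicitFlux D k z) = D.sg * ip h (LinvNormalStress D k z)
      + ip h (prodMicro (D.fw 0 z) (D.fb (k + 1) z)) + ip h (prodMicro (D.fw 1 z) (D.fb k z))
      + (-(D.sg * z 3)) * ip h (prodMicro (D.dfw 1 0 z) (D.fb k z))
      + selfWeight k * ip h (prodMicro (D.fb 1 z) (D.fb k z)) := by
  have w0 := (isLinvOf_normalStress (D := D) k z).wl2.const_mul D.sg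
  have w1 := (rapid_prodMicro (D.fw 0 z) (D.fb (k + 1) z)).wl2
  have w2 := (rapid_prodMicro (D.fw 1 z) (D.fb k z)).wl2
  have w3 := (rapid_prodMicro (D.dfw 1 0 z) (D.fb k z)).wl2.const_mul (-(D.sg * z 3))
  have w4 := (rapid_prodMicro (D.fb 1 z) (D.fb k z)).wl2.const_mul (selfWeight k)
  have e : explicitFlux D k z = _ := funext fun v => by rw [explicitFlux]
  rw [e, ip_comm, ip_add_left (((w0.add w1).add w2).add w3) w4 hh.wl2,
    ip_add_left ((w0.add w1).add w2) w3 hh.wl2, ip_add_left (w0.add w1) w2 hh.wl2,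
    ip_add_left w0 w1 hh.wl2]
  simp only [ip_const_mul_left, ip_comm h]

lemma ip_J {h : Vel → ℝ} (hh : Rapid h) (hp : PerpN h) {k : ℤ} (hk : 1 ≤ k) (hz : z ∈ layer D.τ) :
    ip h (D.J (k - 1) z) = ip h (D.fb (k + D.n - 1) z) - ip h (explicitFlux D k z) := by
  rw [ip_congr_right ((H.J_spec hk hz).unique (H.isLinvOf_JArg hk hz)), ip_comm,
    ip_sub_left (H.rapid_fb _ hz).micro.wl2 (wl2_explicitFlux k z) hh.wl2, ip_comm,
    hp.ip_micro hh.wl2 (H.rapid_fb _ hz).wl2, ip_comm (explicitFlux D k z)]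

/-- As `ū_{1,3} = 0`, the self-interaction contributes to the normal fluxes only with the factor
`ū_{k,3}`, which vanishes in the one case where the weight differs from 1. -/
lemma selfWeight_mul (k : ℤ) (hz : z ∈ layer D.τ) (a : ℝ) :
    selfWeight k * (a * vel 2 (D.fb k z)) = a * vel 2 (D.fb k z) := by
  unfold selfWeight
  split_ifs with h
  · rw [h, H.vel_fb_one hz]; ring
  · ring

/-- By parity only the shear `∂_y ū_{k,i}` passes through `L⁻¹`, with coefficient `λ`. The slip
condition and `ū_{1,3} = 0` remove half of each product with `f_0` and with `f̄_1`. -/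
lemma ip_burnettA_J (i : Fin 2) {k : ℤ} (hk : 1 ≤ k) (hz : z ∈ layer D.τ) :
    ip (burnettA 2 i.castSucc) (D.J (k - 1) z)
      = ip (burnettA 2 i.castSucc) (D.fb (k + D.n - 1) z)
        - (D.sg * (viscosity * D.dl 3 (fun z => vel i.castSucc (D.fb k z)) z)
          + vel i.castSucc (D.fw 0 z) * vel 2 (D.fb (k + 1) z)
          + (vel 2 (D.fw 1 z) * vel i.castSucc (D.fb k z)
            + vel i.castSucc (D.fw 1 z) * vel 2 (D.fb k z))
          - D.sg * z 3 * (D.normalTrace (fun z => vel 2 (D.f 0 z)) z * vel i.castSucc (D.fb k z)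
            + D.normalTrace (fun z => vel i.castSucc (D.f 0 z)) z * vel 2 (D.fb k z))
          + vel i.castSucc (D.fb 1 z) * vel 2 (D.fb k z)) := by
  have h2 : (2 : Fin 3) ≠ i.castSucc := by fin_cases i <;> decide
  rw [H.ip_J (rapid_burnettA _ _) (perpN_burnettA _ _) hk hz, ip_explicitFlux (rapid_burnettA _ _),
    ip_LinvNormalStress (rapid_burnettA _ _)]
  simp only [ip_burnettA_Linv_normal, ip_burnettA_Linv_burnettB_normal, ip_burnettA_prodMicro,
    if_neg h2, (H.dfw_eq hz).2.1, H.slip hz, H.vel_fb_one hz, mul_ite, mul_zero,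
    Finset.sum_ite_eq', Finset.mem_univ, if_true, zero_mul, sub_zero, add_zero, zero_add,
    H.selfWeight_mul k hz]
  ring

lemma ip_burnettB_J {k : ℤ} (hk : 1 ≤ k) (hz : z ∈ layer D.τ) :
    ip (burnettB 2) (D.J (k - 1) z)
      = ip (burnettB 2) (D.fb (k + D.n - 1) z)
        - (D.sg * (conductivity * D.dl 3 (fun z => temp (D.fb k z)) z)
          + 5 / 2 * (temp (D.fw 0 z) * vel 2 (D.fb (k + 1) z)
          + (vel 2 (D.fw 1 z) * temp (D.fb k z) + temp (D.fw 1 z) * vel 2 (D.fb k z))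
          - D.sg * z 3 * (D.normalTrace (fun z => vel 2 (D.f 0 z)) z * temp (D.fb k z)
            + D.normalTrace (fun z => temp (D.f 0 z)) z * vel 2 (D.fb k z))
          + temp (D.fb 1 z) * vel 2 (D.fb k z))) := by
  have hs := H.selfWeight_mul k hz (temp (D.fb 1 z))
  rw [H.ip_J (rapid_burnettB _) (perpN_burnettB _) hk hz, ip_explicitFlux (rapid_burnettB _),
    ip_LinvNormalStress (rapid_burnettB _)]
  simp only [ip_burnettB_Linv_burnettA_normal, ip_burnettB_Linv, ip_burnettB_prodMicro,
    (H.dfw_eq hz).2.1, (H.dfw_eq hz).2.2, H.slip hz, H.vel_fb_one hz, mul_zero,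
    Finset.sum_const_zero, zero_mul, zero_add]
  linear_combination -(5 / 2) * hs

end Admissible

end ViscousLayer
end

/-! ### The velocity and temperature equations. -/

noncomputable section
namespace ViscousLayer
open ProbabilityTheory MvPolynomial
open scoped RealInnerProductSpace ENNReal

namespace Admissible

variable {D : LayerData} (H : Admissible D) {z : Pt}

include H

/-! ### The equations of the layer -/

omit H in
lemma sg_eq (D : LayerData) : D.sg = 1 ∨ D.sg = -1 := by
  unfold LayerData.sg
  cases D.s <;> simp [Side.sgn]

lemma pd_ip_burnettB_W (a : Fin 3) (m : ℤ) (i : Fin 4) (hz : z ∈ layer D.τ) :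
    HasPd (layer D.τ) i (fun z => ip (burnettB a) (D.W (m - 1) z))
      (D.dl i (fun z => ip (burnettB a) (D.fb (m + D.n - 2) z)) z
        - 5 / 2 * (D.dl i (fun z => vel a (D.fw 0 z)) z * temp (D.fb m z)
          + vel a (D.fw 0 z) * D.dl i (fun z => temp (D.fb m z)) z
          + (D.dl i (fun z => vel a (D.fb m z)) z * temp (D.fw 0 z)
          + vel a (D.fb m z) * D.dl i (fun z => temp (D.fw 0 z)) z))) z :=
  ((H.pd_ip (m + D.n - 2) i (rapid_burnettB a) hz).sub
    ((((H.pd_u0 i a hz).mul (H.pd_temp m i hz)).add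
      ((H.pd_vel m i a hz).mul (H.pd_theta0 i hz))).const_mul (5 / 2))).congr hz
    fun _ hz => H.ip_burnettB_W a m hz

/-- Products of traces with the normal variable. -/
lemma pd_weighted_trace (q : Pt → ℝ) (c : ℝ) (z : Pt) :
    HasPd (layer D.τ) 3 (fun z => c * z 3 * q (D.toWall z)) (c * q (D.toWall z)) z := by
  have h := ((hasPd_coord (D := layer D.τ) (i := 3) (z := z) 3).const_mul c).mul (H.pd_trace q z)
  simpa using h

lemma pd_ip_burnettA_J (i : Fin 2) {k : ℤ} (hk : 1 ≤ k) (hz : z ∈ layer D.τ) :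
    HasPd (layer D.τ) 3 (fun z => ip (burnettA 2 i.castSucc) (D.J (k - 1) z))
      (D.dl 3 (fun z => ip (burnettA 2 i.castSucc) (D.fb (k + D.n - 1) z)) z
        - (D.sg * (viscosity * D.dl 3 (D.dl 3 fun z => vel i.castSucc (D.fb k z)) z)
          + vel i.castSucc (D.fw 0 z) * D.dl 3 (fun z => vel 2 (D.fb (k + 1) z)) z
          + (vel 2 (D.fw 1 z) * D.dl 3 (fun z => vel i.castSucc (D.fb k z)) z
            + vel i.castSucc (D.fw 1 z) * D.dl 3 (fun z => vel 2 (D.fb k z)) z)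
          - (D.sg * D.normalTrace (fun z => vel 2 (D.f 0 z)) z * vel i.castSucc (D.fb k z)
            + D.sg * z 3 * D.normalTrace (fun z => vel 2 (D.f 0 z)) z
              * D.dl 3 (fun z => vel i.castSucc (D.fb k z)) z)
          - (D.sg * D.normalTrace (fun z => vel i.castSucc (D.f 0 z)) z * vel 2 (D.fb k z)
            + D.sg * z 3 * D.normalTrace (fun z => vel i.castSucc (D.f 0 z)) z
              * D.dl 3 (fun z => vel 2 (D.fb k z)) z)
          + (D.dl 3 (fun z => vel i.castSucc (D.fb 1 z)) z * vel 2 (D.fb k z)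
            + vel i.castSucc (D.fb 1 z) * D.dl 3 (fun z => vel 2 (D.fb k z)) z))) z := by
  have v := H.pd_vel k 3 i.castSucc hz
  have v2 := H.pd_vel k 3 2 hz
  have t := fun q : Pt → ℝ => H.pd_trace q z
  have h := (H.pd_ip (k + D.n - 1) 3 (rapid_burnettA 2 i.castSucc) hz).sub
    ((((((((H.pd_dl_vel k 3 i.castSucc hz).const_mul viscosity).const_mul D.sg).add
      ((t fun z => vel i.castSucc (D.f 0 z)).mul (H.pd_vel (k + 1) 3 2 hz))).add
      (((t fun z => vel 2 (D.f 1 z)).mul v).add ((t fun z => vel i.castSucc (D.f 1 z)).mul v2))).sub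
      ((H.pd_weighted_trace (pd (channel D.τ) 3 fun z => vel 2 (D.f 0 z)) D.sg z).mul v)).sub
      ((H.pd_weighted_trace (pd (channel D.τ) 3 fun z => vel i.castSucc (D.f 0 z)) D.sg z).mul v2)).add
      ((H.pd_vel 1 3 i.castSucc hz).mul v2))
  convert h.congr (p := fun z => ip (burnettA 2 i.castSucc) (D.J (k - 1) z)) hz
    (fun z hz => ?_) using 1
  · simp only [LayerData.fw, LayerData.normalTrace]; ring
  · rw [H.ip_burnettA_J i hk hz]
    simp only [LayerData.fw, LayerData.normalTrace]; ring

lemma pd_ip_burnettB_J {k : ℤ} (hk : 1 ≤ k) (hz : z ∈ layer D.τ) :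
    HasPd (layer D.τ) 3 (fun z => ip (burnettB 2) (D.J (k - 1) z))
      (D.dl 3 (fun z => ip (burnettB 2) (D.fb (k + D.n - 1) z)) z
        - (D.sg * (conductivity * D.dl 3 (D.dl 3 fun z => temp (D.fb k z)) z)
          + 5 / 2 * (temp (D.fw 0 z) * D.dl 3 (fun z => vel 2 (D.fb (k + 1) z)) z
          + (vel 2 (D.fw 1 z) * D.dl 3 (fun z => temp (D.fb k z)) z
            + temp (D.fw 1 z) * D.dl 3 (fun z => vel 2 (D.fb k z)) z)
          - (D.sg * D.normalTrace (fun z => vel 2 (D.f 0 z)) z * temp (D.fb k z)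
            + D.sg * z 3 * D.normalTrace (fun z => vel 2 (D.f 0 z)) z
              * D.dl 3 (fun z => temp (D.fb k z)) z)
          - (D.sg * D.normalTrace (fun z => temp (D.f 0 z)) z * vel 2 (D.fb k z)
            + D.sg * z 3 * D.normalTrace (fun z => temp (D.f 0 z)) z
              * D.dl 3 (fun z => vel 2 (D.fb k z)) z)
          + (D.dl 3 (fun z => temp (D.fb 1 z)) z * vel 2 (D.fb k z)
            + temp (D.fb 1 z) * D.dl 3 (fun z => vel 2 (D.fb k z)) z)))) z := by
  have v := H.pd_temp k 3 hz
  have v2 := H.pd_vel k 3 2 hz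
  have t := fun q : Pt → ℝ => H.pd_trace q z
  have h := (H.pd_ip (k + D.n - 1) 3 (rapid_burnettB 2) hz).sub
    ((((H.pd_dl_temp k 3 hz).const_mul conductivity).const_mul D.sg).add
      (((((((t fun z => temp (D.f 0 z)).mul (H.pd_vel (k + 1) 3 2 hz))).add
      (((t fun z => vel 2 (D.f 1 z)).mul v).add ((t fun z => temp (D.f 1 z)).mul v2))).sub
      ((H.pd_weighted_trace (pd (channel D.τ) 3 fun z => vel 2 (D.f 0 z)) D.sg z).mul v)).sub
      ((H.pd_weighted_trace (pd (channel D.τ) 3 fun z => temp (D.f 0 z)) D.sg z).mul v2)).add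
      ((H.pd_temp 1 3 hz).mul v2) |>.const_mul (5 / 2)))
  convert h.congr (p := fun z => ip (burnettB 2) (D.J (k - 1) z)) hz
    (fun z hz => ?_) using 1
  · simp only [LayerData.fw, LayerData.normalTrace]; ring
  · rw [H.ip_burnettB_J hk hz]
    simp only [LayerData.fw, LayerData.normalTrace]; ring

/-- Tangential fluxes in terms of `W`: the products with `u_0` become the transport terms, and the
trace correction joins the pressure to form the excess, hence the gradient of the tail integral. -/
lemma dl_momentumFlux (i j : Fin 2) (k : ℤ) (hz : z ∈ layer D.τ) :
    D.dl j.castSucc.succ (momentumFlux D j.castSucc i.castSucc (k + D.n - 2)) z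
      = D.dl j.castSucc.succ (fun z => ip (burnettA i.castSucc j.castSucc) (D.W (k - 1) z)) z
        + vel j.castSucc (D.fb k z) * D.dl j.castSucc.succ (fun z => vel i.castSucc (D.fw 0 z)) z
        + vel i.castSucc (D.fw 0 z) * D.dl j.castSucc.succ (fun z => vel j.castSucc (D.fb k z)) z
        + vel i.castSucc (D.fb k z) * D.dl j.castSucc.succ (fun z => vel j.castSucc (D.fw 0 z)) z
        + vel j.castSucc (D.fw 0 z) * D.dl j.castSucc.succ (fun z => vel i.castSucc (D.fb k z)) z
        + if j = i then D.sg * D.dl i.castSucc.succ (D.tailH (k - 1)) z else 0 := by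
  have e1 := H.dl_eq (H.pd_ip_burnettA_W i.castSucc j.castSucc k j.castSucc.succ hz) hz
  have hA := H.pd_ip (k + D.n - 2) j.castSucc.succ (rapid_burnettA j.castSucc i.castSucc) hz
  rw [e1]
  by_cases hij : j = i
  · subst hij
    have e2 := H.dl_eq (H.pd_tailH (k - 1) j.castSucc.succ hz) hz
    rw [show k - 1 + D.n - 1 = k + D.n - 2 by ring, show k - 1 + 1 = k by ring] at e2
    have e3 : D.dl j.castSucc.succ (momentumFlux D j.castSucc j.castSucc (k + D.n - 2)) z = _ :=
      H.dl_eq ((hA.add (H.hasPd_pbar (k + D.n - 2) j.castSucc.succ hz)).congr hz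
        fun z _ => by rw [momentumFlux, if_pos rfl]) hz
    rw [e3, e2, if_pos rfl, if_pos rfl]
    linear_combination -(D.dl j.castSucc.succ (D.pbar (k + D.n - 2)) z
      - 2 / 3 * D.dl j.castSucc.succ (D.u0dot k) z) * sg_mul_sg (D := D)
  · have hij' : j.castSucc ≠ i.castSucc := fun h => hij (Fin.castSucc_injective _ h)
    have e3 : D.dl j.castSucc.succ (momentumFlux D j.castSucc i.castSucc (k + D.n - 2)) z = _ :=
      H.dl_eq (hA.congr hz fun z _ => by rw [momentumFlux, if_neg hij', add_zero]) hz
    rw [e3, if_neg hij, if_neg hij'.symm, burnettA_comm j.castSucc i.castSucc]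
    ring

/-- The equation of the tangential velocity. -/
lemma velocity_equation (i : Fin 2) {k : ℤ} (hk : 1 ≤ k) (hz : z ∈ layer D.τ) :
    D.dl 0 (fun z => vel i.castSucc (D.fb k z)) z
      + D.driftCoeff z * D.dl 3 (fun z => vel i.castSucc (D.fb k z)) z
      - viscosity * D.dl 3 (D.dl 3 (fun z => vel i.castSucc (D.fb k z))) z
      + D.adv0 (fun z => vel i.castSucc (D.fb k z)) z
      + D.advb k (fun z => vel i.castSucc (D.fw 0 z)) z
    = D.srcU k i z := by
  have hm := H.momentum_balance i.castSucc (k + D.n - 2) hz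
  rw [show k + D.n - 2 + 2 - D.n = k by ring, show k + D.n - 2 + 1 = k + D.n - 1 by ring] at hm
  simp only [H.dl_momentumFlux i _ k hz, Finset.sum_add_distrib, Finset.sum_ite_eq',
    Finset.mem_univ, if_true, ← Finset.mul_sum] at hm
  have h2 : (2 : Fin 3) ≠ i.castSucc := by fin_cases i <;> decide
  have e2 : D.dl 3 (momentumFlux D 2 i.castSucc (k + D.n - 1)) z = _ :=
    H.dl_eq ((H.pd_ip (k + D.n - 1) 3 (rapid_burnettA 2 i.castSucc) hz).congr hz
      fun z _ => by rw [momentumFlux, if_neg h2, add_zero]) hz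
  have e3 := H.dl_eq (H.pd_ip_burnettA_J i hk hz) hz
  have e4 := H.dl_eq ((((H.pd_trace (fun z => vel i.castSucc (D.f 1 z)) z).sub
    (H.pd_weighted_trace (pd (channel D.τ) 3 fun z => vel i.castSucc (D.f 0 z)) D.sg z)).add
    (H.pd_vel 1 3 i.castSucc hz)).mul (H.pd_vel k 3 2 hz)) hz
  have e5 := H.div_wall hz
  have e6 := H.dl_vel_normal k hz
  -- Mass balance eliminates `ū_{k+1,3}`. Its divergence part cancels the term `u_{0,i} div ū_k`
  -- from the tangential fluxes, and its time part is the last term of the source.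
  rw [e6] at e3
  rw [e2] at hm
  rw [LayerData.srcU, LayerData.driftCoeff]
  unfold LayerData.adv0 LayerData.advb
  unfold LayerData.divb at e3
  simp only [LayerData.fw, LayerData.normalTrace] at *
  rw [e4, e3]
  -- The zero order terms in `ū_{k,i}`, from the tangential divergence of `u_0` and from `∂_y` of
  -- the linearly growing drift, cancel by `div u_0 = 0`.
  rcases sg_eq D with h | h <;> rw [h] at hm ⊢ <;>
    linear_combination hm - vel i.castSucc (D.fb k z) * e5

/-- The equation of the temperature. -/
lemma temperature_equation {k : ℤ} (hk : 1 ≤ k) (hz : z ∈ layer D.τ) :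
    D.dl 0 (fun z => temp (D.fb k z)) z
      + D.driftCoeff z * D.dl 3 (fun z => temp (D.fb k z)) z
      - 2 / 5 * conductivity * D.dl 3 (D.dl 3 (fun z => temp (D.fb k z))) z
      + D.adv0 (fun z => temp (D.fb k z)) z
      + D.advb k (fun z => temp (D.fw 0 z)) z
    = D.srcTheta k z := by
  have hm := H.energy_balance (k + D.n - 2) hz
  rw [show k + D.n - 2 + 2 - D.n = k by ring, show k + D.n - 2 + 1 = k + D.n - 1 by ring] at hm
  -- The density is replaced by the pressure, `3/2 θ - ρ = 5/2 θ - (ρ + θ)`, which puts the time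
  -- derivative of the pressure into the source.
  have e0 : D.dl 0 (fun z => enth (D.fb k z)) z = _ :=
    H.dl_eq ((((H.pd_temp k 0 hz).const_mul (5 / 2)).sub (H.hasPd_pbar k 0 hz)).congr hz
      fun z _ => by simp only [enth, LayerData.pbar]; ring) hz
  have e1 : ∀ j : Fin 2,
      D.dl j.castSucc.succ (fun z => ip (burnettB j.castSucc) (D.fb (k + D.n - 2) z)) z
      = D.dl j.castSucc.succ (fun z => ip (burnettB j.castSucc) (D.W (k - 1) z)) z
        + 5 / 2 * (temp (D.fb k z) * D.dl j.castSucc.succ (fun z => vel j.castSucc (D.fw 0 z)) z)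
        + 5 / 2 * (vel j.castSucc (D.fw 0 z) * D.dl j.castSucc.succ (fun z => temp (D.fb k z)) z)
        + 5 / 2 * (temp (D.fw 0 z) * D.dl j.castSucc.succ (fun z => vel j.castSucc (D.fb k z)) z)
        + 5 / 2 * (vel j.castSucc (D.fb k z)
          * D.dl j.castSucc.succ (fun z => temp (D.fw 0 z)) z) := fun j => by
    rw [H.dl_eq (H.pd_ip_burnettB_W j.castSucc k j.castSucc.succ hz) hz]; ring
  simp only [e0, e1, Finset.sum_add_distrib, ← Finset.mul_sum] at hm
  have e3 := H.dl_eq (H.pd_ip_burnettB_J hk hz) hz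
  have e4 := H.dl_eq ((((H.pd_weighted_trace
    (pd (channel D.τ) 3 fun z => temp (D.f 0 z)) (-D.sg) z).add
    (H.pd_temp 1 3 hz)).add (H.pd_trace (fun z => temp (D.f 1 z)) z)).mul (H.pd_vel k 3 2 hz)) hz
  have e5 := H.div_wall hz
  have e6 := H.dl_vel_normal k hz
  rw [e6] at e3
  rw [LayerData.srcTheta, LayerData.driftCoeff]
  unfold LayerData.adv0 LayerData.advb
  unfold LayerData.divb at e3
  simp only [LayerData.fw, LayerData.normalTrace, ← neg_mul] at *
  rw [e4, e3]
  rcases sg_eq D with h | h <;> rw [h] at hm ⊢ <;>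
    linear_combination 2 / 5 * hm - temp (D.fb k z) * e5

lemma sourcesMeaningful {k : ℤ} (hk : 1 ≤ k) (hz : z ∈ layer D.τ) : D.SourcesMeaningful k z where
  W_spec := H.W_spec k hz
  J_spec := H.J_spec hk hz
  diff_AW _ _ := (H.pd_ip_burnettA_W _ _ k _ hz).partialDiff
  diff_AW₃ := (H.pd_ip_burnettA_W _ _ k _ hz).partialDiff
  diff_BW _ := (H.pd_ip_burnettB_W _ k _ hz).partialDiff
  diff_AJ i := (H.pd_ip_burnettA_J i hk hz).partialDiff
  diff_BJ := (H.pd_ip_burnettB_J hk hz).partialDiff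
  tail := H.tailConverges _ hz
  tail' := H.tailConverges _ hz
  diff_tail _ := (H.pd_tailH _ _ hz).partialDiff

lemma isLinvOf_GamS_fw0_proj (k : ℤ) (hz : z ∈ layer D.τ) :
    IsLinvOf (GamS (D.fw 0 z) (proj (D.fb k z))) (prodMicro (D.fw 0 z) (D.fb k z)) := by
  have h := isLinvOf_prodMicro (D.fw 0 z) (D.fb k z)
  rwa [← H.fw0_eq hz] at h

/-- The microscopic part in terms of lower orders. -/
lemma micro_fb_ae (k : ℤ) (hz : z ∈ layer D.τ) : micro (D.fb (k + D.n - 2) z) =ᵐ[volume]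
    fun v => Linv (GamS (D.fw 0 z) (proj (D.fb k z))) v + D.W (k - 1) z v := by
  have h := H.isLinvOf_GamS_fw0_proj k hz
  filter_upwards [H.W_ae k hz, h.linv.unique h] with v h1 h2
  rw [h1, h2]; ring

end Admissible

end ViscousLayer
end

/-! ### Dependence of the sources on lower orders. -/

noncomputable section
namespace ViscousLayer
open ProbabilityTheory MvPolynomial
open scoped RealInnerProductSpace ENNReal

/-! ### Even functions -/

/-- Uniqueness gives invariance almost everywhere; continuity makes it hold at each velocity. -/
lemma IsLinvOf.even {h g : Vel → ℝ} (H : IsLinvOf h g) (hc : Continuous g) (R : Vel ≃ₗᵢ[ℝ] Vel)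
    (hh : ∀ v, h (R v) = h v) (v : Vel) : g (R v) = g v := by
  have H2 := H.rot R
  simp only [hh] at H2
  exact congrFun ((Continuous.ae_eq_iff_eq volume (hc.comp R.continuous) hc).1 (H2.unique H)) v

lemma GamS_even {g h : Vel → ℝ} (R : Vel ≃ₗᵢ[ℝ] Vel) (hg : ∀ v, g (R v) = g v)
    (hh : ∀ v, h (R v) = h v) (v : Vel) : GamS g h (R v) = GamS g h v := by
  rw [← GamS_rot]
  simp only [hg, hh]

/-- The only odd part of an invariant is its normal momentum. Hence macroscopic parts with the same
normal velocity differ by a function even in `v₃`. -/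
lemma proj_sub_even {g h : Vel → ℝ} (e : vel 2 g = vel 2 h) (v : Vel) :
    proj g (flip 2 v) - proj h (flip 2 v) = proj g v - proj h v := by
  have hs : sqrtM (flip 2 v) = sqrtM v := sqrtM_rot _ v
  simp only [proj, hs, LinearIsometryEquiv.norm_map, flip_apply, Fin.sum_univ_three, e, if_true,
    show (0 : Fin 3) ≠ 2 by decide, show (1 : Fin 3) ≠ 2 by decide, if_false]
  ring

lemma proj_even {g : Vel → ℝ} (e : vel 2 g = 0) (v : Vel) : proj g (flip 2 v) = proj g v := by
  have hs : sqrtM (flip 2 v) = sqrtM v := sqrtM_rot _ v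
  simp only [proj, hs, LinearIsometryEquiv.norm_map, flip_apply, Fin.sum_univ_three, e, if_true,
    show (0 : Fin 3) ≠ 2 by decide, show (1 : Fin 3) ≠ 2 by decide, if_false]
  ring

lemma continuous_micro {g : Vel → ℝ} (hg : Continuous g) : Continuous (micro g) :=
  hg.sub (continuous_proj g)

lemma micro_eq_of_linL {g h : Vel → ℝ} (hg : Rapid g) (hh : Rapid h) (cg : Continuous g)
    (ch : Continuous h) (e : ∀ v, linL g v = linL h v) : micro g = micro h := by
  have h1 := (isLinvOf_linL hg).unique ((isLinvOf_linL hh).congr (ae_of_all _ fun v => (e v).symm))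
  exact (Continuous.ae_eq_iff_eq volume (continuous_micro cg) (continuous_micro ch)).1 h1

/-! ### Comparison of two solutions -/

/-- The terms of the expansions `D` and `E` that determine the sources with index `k - 1`
coincide. -/
structure Agree (D E : LayerData) (k : ℤ) : Prop where
  pos : 1 ≤ k
  n : E.n = D.n
  b : E.b = D.b
  τ : E.τ = D.τ
  s : E.s = D.s
  f : ∀ i ≤ k, ∀ z ∈ channel D.τ, E.f i z = D.f i z
  fb : ∀ j ≤ k - 1, ∀ z ∈ layer D.τ, E.fb j z = D.fb j z

namespace Agree

variable {D E : LayerData} {k : ℤ} (A : Agree D E k) {z : Pt}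

include A

lemma sg : E.sg = D.sg := by simp only [LayerData.sg, A.s]

lemma toWall (z : Pt) : E.toWall z = D.toWall z := by simp only [LayerData.toWall, A.s]

lemma mem (hz : z ∈ layer D.τ) : z ∈ layer E.τ := by rwa [A.τ]

lemma dl (i : Fin 4) {p q : Pt → ℝ} (hz : z ∈ layer D.τ) (e : ∀ z ∈ layer D.τ, p z = q z) :
    E.dl i p z = D.dl i q z := by
  unfold LayerData.dl
  rw [A.τ]
  exact pd_congr hz e

lemma taylorCoeff (l : ℕ) (z : Pt) : E.taylorCoeff l z = D.taylorCoeff l z := by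
  simp only [LayerData.taylorCoeff, A.sg]

lemma fw (H : Admissible D) {i : ℤ} (hi : i ≤ k) (hz : z ∈ layer D.τ) : E.fw i z = D.fw i z := by
  simp only [LayerData.fw, A.toWall]
  exact A.f i hi _ (H.toWall_mem hz)

lemma iterate_pd {i : ℤ} (hi : i ≤ k) (v : Vel) (l : ℕ) : ∀ z ∈ channel D.τ,
    (pd (channel D.τ) 3)^[l] (fun z => E.f i z v) z = (pd (channel D.τ) 3)^[l] (fun z => D.f i z v) z := by
  induction l with
  | zero => intro z hz; exact congrFun (A.f i hi z hz) v
  | succ l ih =>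
    intro z hz
    simp only [Function.iterate_succ_apply']
    exact pd_congr hz ih

lemma dfw (H : Admissible D) (l : ℕ) {i : ℤ} (hi : i ≤ k) (hz : z ∈ layer D.τ) :
    E.dfw l i z = D.dfw l i z := by
  ext v
  simp only [LayerData.dfw, A.toWall, A.τ]
  exact A.iterate_pd hi v l _ (H.toWall_mem hz)

lemma normalTrace (H : Admissible D) {p q : Pt → ℝ} (hz : z ∈ layer D.τ)
    (e : ∀ z ∈ channel D.τ, p z = q z) : E.normalTrace p z = D.normalTrace q z := by
  simp only [LayerData.normalTrace, A.toWall, A.τ]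
  exact pd_congr (H.toWall_mem hz) e

lemma dl_fb (i : Fin 4) {j : ℤ} (hj : j ≤ k - 1) (hz : z ∈ layer D.τ) (v : Vel) :
    E.dl i (fun z => E.fb j z v) z = D.dl i (fun z => D.fb j z v) z :=
  A.dl i hz fun z hz => by rw [A.fb j hj z hz]

lemma dtfb {j : ℤ} (hj : j ≤ k - 1) (hz : z ∈ layer D.τ) : E.dtfb j z = D.dtfb j z :=
  funext fun v => A.dl_fb 0 hj hz v

lemma tangfb {j : ℤ} (hj : j ≤ k - 1) (hz : z ∈ layer D.τ) : E.tangfb j z = D.tangfb j z :=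
  funext fun v => Finset.sum_congr rfl fun i _ => by rw [A.dl_fb _ hj hz v]

lemma normfb {j : ℤ} (hj : j ≤ k - 1) (hz : z ∈ layer D.τ) : E.normfb j z = D.normfb j z :=
  funext fun v => by rw [LayerData.normfb, LayerData.normfb, A.dl_fb _ hj hz v]

lemma divb {m : ℤ} (hz : z ∈ layer D.τ) (hv : ∀ z ∈ layer D.τ, ∀ i : Fin 2,
    vel i.castSucc (E.fb m z) = vel i.castSucc (D.fb m z)) : E.divb m z = D.divb m z :=
  Finset.sum_congr rfl fun i _ => A.dl _ hz fun z hz => hv z hz i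

/-- `WArg m` contains the layer term of index `m` only through its microscopic part; all other
indices are at most `m - 1`. -/
lemma WArg (H : Admissible D) {m : ℤ} (hm : m ≤ k) (hz : z ∈ layer D.τ)
    (e : micro (E.fb m z) = micro (D.fb m z)) : E.WArg m z = D.WArg m z := by
  have hn := H.hn
  have hk := A.pos
  ext v
  unfold LayerData.WArg
  rw [A.n, A.b, A.sg, A.dtfb (show m - D.n ≤ k - 1 by omega) hz,
    A.tangfb (show m - 2 ≤ k - 1 by omega) hz, A.normfb (show m - 1 ≤ k - 1 by omega) hz, e]
  have e1 : ∑ i ∈ Finset.Icc (1 : ℤ) (m - 1), GamS (E.fw i z) (E.fb (m - i) z) v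
      = ∑ i ∈ Finset.Icc (1 : ℤ) (m - 1), GamS (D.fw i z) (D.fb (m - i) z) v := by
    refine Finset.sum_congr rfl fun i hi => ?_
    rw [Finset.mem_Icc] at hi
    rw [A.fw H (by omega) hz, A.fb _ (by omega) z hz]
  have e2 : ∑ i ∈ Finset.Icc (1 : ℤ) (m - 1), 1 / 2 * GamS (E.fb i z) (E.fb (m - i) z) v
      = ∑ i ∈ Finset.Icc (1 : ℤ) (m - 1), 1 / 2 * GamS (D.fb i z) (D.fb (m - i) z) v := by
    refine Finset.sum_congr rfl fun i hi => ?_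
    rw [Finset.mem_Icc] at hi
    rw [A.fb i (by omega) z hz, A.fb _ (by omega) z hz]
  have e3 : ∑ l ∈ Finset.Icc 1 D.b, ∑ i ∈ Finset.Icc (0 : ℤ) (m - 1 - l),
        E.taylorCoeff l z * GamS (E.dfw l i z) (E.fb (m - l - i) z) v
      = ∑ l ∈ Finset.Icc 1 D.b, ∑ i ∈ Finset.Icc (0 : ℤ) (m - 1 - l),
        D.taylorCoeff l z * GamS (D.dfw l i z) (D.fb (m - l - i) z) v := by
    refine Finset.sum_congr rfl fun l hl => Finset.sum_congr rfl fun i hi => ?_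
    rw [Finset.mem_Icc] at hi hl
    rw [A.taylorCoeff, A.dfw H l (by omega) hz, A.fb _ (by omega) z hz]
  rw [e1, e2, e3]
  rw [A.fw H (by omega) hz]

variable (H : Admissible D) (hE : Admissible E)

include H hE

lemma linL_fb {m : ℤ} (hm : m ≤ k) (hz : z ∈ layer D.τ) (e : micro (E.fb m z) = micro (D.fb m z))
    (v : Vel) : linL (E.fb (m + D.n - 2) z) v - linL (D.fb (m + D.n - 2) z) v
      = GamS (D.fw 0 z) (proj (E.fb m z)) v - GamS (D.fw 0 z) (proj (D.fb m z)) v := by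
  have hk := A.pos
  have h := hE.linL_fb m (A.mem hz) v
  rw [A.n, A.WArg H hm hz e, A.fw H (by omega) hz] at h
  rw [h, H.linL_fb m hz v]
  ring

lemma continuous_fb (m : ℤ) (hz : z ∈ layer D.τ) : Continuous (D.fb m z) ∧ Continuous (E.fb m z) :=
  ⟨(H.sol.viscous.regular m).continuous_vel z hz,
    (hE.sol.viscous.regular m).continuous_vel z (A.mem hz)⟩

lemma micro_fb_add {m : ℤ} (hm : m ≤ k) (hz : z ∈ layer D.τ)
    (e : micro (E.fb m z) = micro (D.fb m z)) (e' : proj (E.fb m z) = proj (D.fb m z)) :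
    micro (E.fb (m + D.n - 2) z) = micro (D.fb (m + D.n - 2) z) := by
  have hc := A.continuous_fb H hE (m + D.n - 2) hz
  refine micro_eq_of_linL (hE.rapid_fb _ (A.mem hz)) (H.rapid_fb _ hz) hc.2 hc.1 fun v => ?_
  have h := A.linL_fb H hE hm hz e v
  rw [e', sub_self] at h
  exact sub_eq_zero.1 h

/-- Microscopic parts are determined by layer terms of index lower by `n - 2 ≥ 1`, so those up to
index `k + n - 3` agree, in particular the one of index `k`. -/
lemma micro_fb {m : ℤ} (hm : m ≤ k + D.n - 3) (hz : z ∈ layer D.τ) :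
    micro (E.fb m z) = micro (D.fb m z) := by
  have e := A.fb (m + 2 - D.n) (by omega) z hz
  have h := A.micro_fb_add H hE (m := m + 2 - D.n) (by have := H.hn; omega) hz (by rw [e]) (by rw [e])
  rwa [show m + 2 - D.n + D.n - 2 = m by ring] at h

lemma WArg' {m : ℤ} (hm : m ≤ k) (hz : z ∈ layer D.τ) : E.WArg m z = D.WArg m z :=
  A.WArg H hm hz (A.micro_fb H hE (by have := H.hn; omega) hz)

lemma W {m : ℤ} (hm : m ≤ k - 1) (hz : z ∈ layer D.τ) : E.W m z = D.W m z := by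
  simp only [LayerData.W, A.WArg' H hE (show m + 1 ≤ k by omega) hz]

/-- The normal velocity is determined by lower orders. -/
lemma vel_normal {m : ℤ} (hm : m ≤ k) (hv : ∀ z ∈ layer D.τ, ∀ i : Fin 2,
    vel i.castSucc (E.fb m z) = vel i.castSucc (D.fb m z)) (hz : z ∈ layer D.τ) :
    vel 2 (E.fb (m + 1) z) = vel 2 (D.fb (m + 1) z) := by
  have hn := H.hn
  refine sub_eq_zero.1 (Admissible.eq_zero_of_normal
    (q := fun z => vel 2 (E.fb (m + 1) z) - vel 2 (D.fb (m + 1) z)) (fun z hz => ?_) hz ?_)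
  · have h1 := hE.pd_vel (m + 1) 3 2 (A.mem hz)
    rw [hE.dl_vel_normal m (A.mem hz), A.sg, A.n, A.divb hz hv, A.dl 0 (q := fun z =>
      rho (D.fb (m + 2 - D.n) z)) hz fun z hz => by rw [A.fb _ (by omega) z hz], A.τ] at h1
    have h2 := H.pd_vel (m + 1) 3 2 hz
    rw [H.dl_vel_normal m hz] at h2
    have h := h1.sub h2
    rwa [sub_self] at h
  · have h := (hE.tendsto_vel (m + 1) 2 (A.mem hz)).sub (H.tendsto_vel (m + 1) 2 hz)
    rwa [sub_zero] at h

lemma vel_normal' (hz : z ∈ layer D.τ) : vel 2 (E.fb k z) = vel 2 (D.fb k z) := by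
  have h := A.vel_normal H hE (m := k - 1) (by omega)
    (fun z hz i => by rw [A.fb (k - 1) le_rfl z hz]) hz
  rwa [sub_add_cancel] at h

lemma H_eq {m : ℤ} (hm : m ≤ k - 1) (hz : z ∈ layer D.τ) : E.H m z = D.H m z := by
  unfold LayerData.H
  rw [A.sg, A.n, A.dl 0 (q := fun z => vel 2 (D.fb m z)) hz fun z hz => by rw [A.fb m hm z hz],
    A.dl 3 (q := fun z => ip (burnettA 2 2) (D.W m z)) hz fun z hz => by rw [A.W H hE hm hz]]
  congr 2
  refine Finset.sum_congr rfl fun j _ => A.dl _ hz fun z hz => ?_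
  rw [A.micro_fb H hE (by omega) hz]

lemma tailH {m : ℤ} (hm : m ≤ k - 1) (hz : z ∈ layer D.τ) : E.tailH m z = D.tailH m z := by
  have h1 := (hE.tailConverges m (A.mem hz)).2
  refine tendsto_nhds_unique (h1.congr' ?_) (H.tailConverges m hz).2
  filter_upwards [eventually_gt_atTop (z 3)] with R hR
  refine intervalIntegral.integral_congr fun s hs => ?_
  rw [Set.uIcc_of_le hR.le] at hs
  exact A.H_eq H hE hm (Admissible.update_mem hz (hz.2.2.trans_le hs.1))

omit hE in
lemma u0dot {m : ℤ} (hz : z ∈ layer D.τ) (hv : ∀ i : Fin 2,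
    vel i.castSucc (E.fb m z) = vel i.castSucc (D.fb m z)) : E.u0dot m z = D.u0dot m z := by
  have hk := A.pos
  simp only [LayerData.u0dot, A.fw H (show 0 ≤ k by omega) hz, hv]

lemma srcP (hz : z ∈ layer D.τ) : E.srcP k z = D.srcP k z := by
  have hn := H.hn
  rw [LayerData.srcP, LayerData.srcP, A.n, A.sg, A.tailH H hE (by omega) hz,
    A.u0dot H hz fun i => by rw [A.fb _ (by omega) z hz]]

lemma pbar (hz : z ∈ layer D.τ) : E.pbar k z = D.pbar k z := by
  rw [hE.pbar_eq_srcP k (A.mem hz), H.pbar_eq_srcP k hz, A.srcP H hE hz]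

/-! ### The dependence of `J` -/

omit A hE in
lemma fw0_even (hz : z ∈ layer D.τ) (v : Vel) : D.fw 0 z (flip 2 v) = D.fw 0 z v := by
  rw [H.fw0_eq hz]
  exact proj_even (H.slip hz) v

-- `L f_1` is zero or half of `Γˢ(f_0, f_0)`, and `f_0` is even in `v₃` at the wall by the slip
-- condition.
omit A hE in
lemma micro_fw1_even (hz : z ∈ layer D.τ) (v : Vel) :
    micro (D.fw 1 z) (flip 2 v) = micro (D.fw 1 z) v := by
  have hw := H.toWall_mem hz
  refine (isLinvOf_linL (H.rapid_fw 1 hz)).even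
    (continuous_micro ((H.sol.interior.regular 1).continuous_vel _ hw)) _ (fun v => ?_) v
  have e : ∀ v, linL (D.fw 1 z) v = _ := H.linL_f1 hw
  rw [e, e]
  split_ifs
  · exact congrArg (1 / 2 * ·) (GamS_even _ (fw0_even H hz) (fw0_even H hz) v)
  · rfl

omit A H hE in
lemma GamS_proj_sub_even {g h h' : Vel → ℝ} (hg : Rapid g) (eg : ∀ v, g (flip 2 v) = g v)
    (e : vel 2 h = vel 2 h') (v : Vel) :
    GamS g (proj h) (flip 2 v) - GamS g (proj h') (flip 2 v)
      = GamS g (proj h) v - GamS g (proj h') v := by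
  rw [← GamS_sub_right hg (rapid_proj h) (rapid_proj h'), ←
    GamS_sub_right hg (rapid_proj h) (rapid_proj h')]
  exact GamS_even _ eg (proj_sub_even e) v

/-- The difference of `L f̄_{k+1}` is `Γˢ` of `f_0` with the difference of the macroscopic parts of
index `k + 3 - n ≤ k`. These have equal normal velocities, so everything is even in `v₃`. For `n =
3` the index is `k` and the difference need not vanish. -/
lemma micro_fb_sub_even (hz : z ∈ layer D.τ) (v : Vel) :
    micro (E.fb (k + 1) z) (flip 2 v) - micro (D.fb (k + 1) z) (flip 2 v)
      = micro (E.fb (k + 1) z) v - micro (D.fb (k + 1) z) v := by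
  have hn := H.hn
  have hm : k + 3 - D.n ≤ k := by omega
  have hi : k + 3 - D.n + D.n - 2 = k + 1 := by ring
  have hc := A.continuous_fb H hE (k + 1) hz
  have hv : vel 2 (E.fb (k + 3 - D.n) z) = vel 2 (D.fb (k + 3 - D.n) z) := by
    rcases eq_or_lt_of_le hm with h | h
    · rw [h, A.vel_normal' H hE hz]
    · rw [A.fb _ (by omega) z hz]
  have e := fun v => A.linL_fb H hE hm hz (A.micro_fb H hE (by omega) hz) v
  rw [hi] at e
  refine ((isLinvOf_linL (hE.rapid_fb (k + 1) (A.mem hz))).sub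
    (isLinvOf_linL (H.rapid_fb (k + 1) hz))).even
    ((continuous_micro hc.2).sub (continuous_micro hc.1)) (flip 2) (fun v => ?_) v
  rw [e, e]
  exact GamS_proj_sub_even (H.rapid_fw 0 hz) (fw0_even H hz) hv v

/-- This isolates the two terms of `JArg` that the given functions do not determine. -/
lemma JArg_sub (hz : z ∈ layer D.τ) (v : Vel) : E.JArg k z v - D.JArg k z v
    = GamS (D.fw 0 z) (fun v => micro (E.fb (k + 1) z) v - micro (D.fb (k + 1) z) v) v
      + (GamS (micro (D.fw 1 z)) (proj (E.fb k z)) v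
        - GamS (micro (D.fw 1 z)) (proj (D.fb k z)) v) := by
  have hn := H.hn
  have hk := A.pos
  have em : ∀ z ∈ layer D.τ, micro (E.fb k z) = micro (D.fb k z) :=
    fun z hz => A.micro_fb H hE (by omega) hz
  have en : E.normMicrofb k z = D.normMicrofb k z := funext fun v => by
    rw [LayerData.normMicrofb, LayerData.normMicrofb,
      A.dl 3 (q := fun z => micro (D.fb k z) v) hz fun z hz => by rw [em z hz]]
  have e1 : ∑ i ∈ Finset.Icc (2 : ℤ) k, GamS (E.fw i z) (E.fb (k + 1 - i) z) v
      = ∑ i ∈ Finset.Icc (2 : ℤ) k, GamS (D.fw i z) (D.fb (k + 1 - i) z) v := by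
    refine Finset.sum_congr rfl fun i hi => ?_
    rw [Finset.mem_Icc] at hi
    rw [A.fw H (by omega) hz, A.fb _ (by omega) z hz]
  have e2 : ∑ i ∈ Finset.Icc (2 : ℤ) (k - 1), 1 / 2 * GamS (E.fb i z) (E.fb (k + 1 - i) z) v
      = ∑ i ∈ Finset.Icc (2 : ℤ) (k - 1), 1 / 2 * GamS (D.fb i z) (D.fb (k + 1 - i) z) v := by
    refine Finset.sum_congr rfl fun i hi => ?_
    rw [Finset.mem_Icc] at hi
    rw [A.fb i (by omega) z hz, A.fb _ (by omega) z hz]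
  have e3 : ∑ l ∈ Finset.Icc 1 D.b, ∑ j ∈ Finset.Icc (1 : ℤ) (min (k - 1) (k + 1 - l)),
        E.taylorCoeff l z * GamS (E.dfw l (k + 1 - l - j) z) (E.fb j z) v
      = ∑ l ∈ Finset.Icc 1 D.b, ∑ j ∈ Finset.Icc (1 : ℤ) (min (k - 1) (k + 1 - l)),
        D.taylorCoeff l z * GamS (D.dfw l (k + 1 - l - j) z) (D.fb j z) v := by
    refine Finset.sum_congr rfl fun l hl => Finset.sum_congr rfl fun j hj => ?_
    rw [Finset.mem_Icc] at hj hl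
    rw [A.taylorCoeff, A.dfw H l (by omega) hz, A.fb j (by omega) z hz]
  -- For `k = 1` the functions `f̄_1` may differ, but their microscopic part is zero.
  have e4 : GamS (E.fb 1 z) (micro (D.fb k z)) v = GamS (D.fb 1 z) (micro (D.fb k z)) v := by
    rcases eq_or_lt_of_le hk with h | h
    · have h0 : micro (D.fb k z) = fun _ => 0 := by
        ext w
        rw [← h, micro, ← H.micro_fb_one hz, sub_self]
      rw [h0, GamS_zero_right (H.rapid_fb 1 hz), GamS_zero_right (hE.rapid_fb 1 (A.mem hz))]
    · rw [A.fb 1 (by omega) z hz]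
  have e5 := GamS_sub_right (H.rapid_fw 0 hz) (hE.rapid_fb (k + 1) (A.mem hz)).micro
    (H.rapid_fb (k + 1) hz).micro v
  unfold LayerData.JArg
  rw [A.n, A.b, A.sg, A.dtfb (show k + 1 - D.n ≤ k - 1 by omega) hz,
    A.tangfb (show k - 1 ≤ k - 1 from le_rfl) hz, en, e1, e2, e3, em z hz, e4,
    A.fw H (show 0 ≤ k by omega) hz, A.fw H (show 1 ≤ k from hk) hz,
    A.dfw H 1 (show 0 ≤ k by omega) hz, e5]
  ring

/-- The arguments of `L⁻¹` differ by a function even in `v₃`, so moments against functions odd in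
`v₃` agree. These are the only moments of `J` in the sources. -/
lemma ip_J {h : Vel → ℝ} (hh : Rapid h) (ho : ∀ v, h (flip 2 v) = -h v) (hz : z ∈ layer D.τ) :
    ip h (E.J (k - 1) z) = ip h (D.J (k - 1) z) := by
  have hk := A.pos
  have h1 := hE.J_spec hk (A.mem hz)
  have h2 := H.J_spec hk hz
  have h0 := ip_eq_zero_of_odd (flip 2) ho (fun v => ?_) (h1.sub h2)
  · rw [ip_comm, ip_sub_left h1.wl2 h2.wl2 hh.wl2, sub_eq_zero] at h0
    rw [ip_comm h, h0, ip_comm h]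
  · rw [A.JArg_sub H hE hz, A.JArg_sub H hE hz,
      GamS_even _ (fw0_even H hz) (A.micro_fb_sub_even H hE hz),
      GamS_proj_sub_even (H.rapid_fw 1 hz).micro (micro_fw1_even H hz) (A.vel_normal' H hE hz)]

/-! ### The dependence of the sources -/

/-- `c` stands for a moment of `f̄_1`, which is prescribed only for `k ≥ 2`. For `k = 1` it is
multiplied by `ū_{1,3} = 0`. -/
lemma mul_vel_normal {a a' c c' : ℝ} (hz : z ∈ layer D.τ) (ha : a = a') (hc : 2 ≤ k → c = c') :
    (a + c) * vel 2 (E.fb k z) = (a' + c') * vel 2 (D.fb k z) := by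
  rw [A.vel_normal' H hE hz]
  rcases eq_or_lt_of_le A.pos with h | h
  · rw [← h, H.vel_fb_one hz, mul_zero, mul_zero]
  · rw [ha, hc (by omega)]

lemma srcU (i : Fin 2) (hz : z ∈ layer D.τ) : E.srcU k i z = D.srcU k i z := by
  have hn := H.hn
  have hk := A.pos
  unfold LayerData.srcU
  rw [A.sg, A.n, A.fw H (show 0 ≤ k by omega) hz]
  congr 1
  · congr 1
    · congr 1
      · congr 1
        · congr 1
          refine A.dl 3 hz fun z hz => A.mul_vel_normal H hE hz ?_ fun h => ?_
          · rw [A.fw H hk hz, A.normalTrace H (q := fun z => vel i.castSucc (D.f 0 z)) hz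
              fun z hz => by rw [A.f 0 (by omega) z hz]]
          · rw [A.fb 1 (by omega) z hz]
        · refine Finset.sum_congr rfl fun j _ => A.dl _ hz fun z hz => ?_
          rw [A.W H hE le_rfl hz]
      · congr 1
        refine A.dl 3 hz fun z hz => A.ip_J H hE (rapid_burnettA _ _) (fun v => ?_) hz
        have h2 : i.castSucc ≠ (2 : Fin 3) := by fin_cases i <;> decide
        rw [burnettA_flip, if_pos rfl, if_neg h2]; ring
    · congr 1
      exact A.dl _ hz fun z hz => A.tailH H hE le_rfl hz
  · congr 1
    exact A.dl 0 hz fun z hz => by rw [A.fb _ (by omega) z hz]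

lemma srcTheta (hz : z ∈ layer D.τ) : E.srcTheta k z = D.srcTheta k z := by
  have hn := H.hn
  have hk := A.pos
  unfold LayerData.srcTheta
  rw [A.sg, A.n, A.fw H (show 0 ≤ k by omega) hz]
  congr 1
  · congr 1
    · congr 1
      · congr 1
        · congr 1
          exact A.dl 0 hz fun z hz => A.pbar H hE hz
        · congr 1
          refine A.dl 3 hz fun z hz => ?_
          have h := A.mul_vel_normal H hE hz
            (a := -(D.sg * z 3) * E.normalTrace (fun z => temp (E.f 0 z)) z + temp (E.fw 1 z))
            (a' := -(D.sg * z 3) * D.normalTrace (fun z => temp (D.f 0 z)) z + temp (D.fw 1 z))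
            (c := temp (E.fb 1 z)) (c' := temp (D.fb 1 z))
            (by rw [A.fw H hk hz, A.normalTrace H (q := fun z => temp (D.f 0 z)) hz
              fun z hz => by rw [A.f 0 (by omega) z hz]])
            fun h => by rw [A.fb 1 (by omega) z hz]
          linear_combination h
      · congr 1
        refine A.dl 3 hz fun z hz => A.ip_J H hE (rapid_burnettB _) (fun v => ?_) hz
        rw [burnettB_flip, if_pos rfl]; ring
    · congr 1
      refine Finset.sum_congr rfl fun j _ => A.dl _ hz fun z hz => ?_
      rw [A.W H hE le_rfl hz]
  · congr 1
    exact A.dl 0 hz fun z hz => by rw [A.fb _ (by omega) z hz]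

/-- The density follows from the temperature because the pressure is determined by lower orders, and
the normal velocity is determined as well. -/
lemma proj_fb (hz : z ∈ layer D.τ)
    (hv : ∀ i : Fin 2, vel i.castSucc (E.fb k z) = vel i.castSucc (D.fb k z))
    (ht : temp (E.fb k z) = temp (D.fb k z)) : proj (E.fb k z) = proj (D.fb k z) := by
  have hp := A.pbar H hE hz
  simp only [LayerData.pbar, ht, add_left_inj] at hp
  have h0 : vel 0 (E.fb k z) = vel 0 (D.fb k z) := hv 0
  have h1 : vel 1 (E.fb k z) = vel 1 (D.fb k z) := hv 1
  ext v
  simp only [proj, hp, ht, Fin.sum_univ_three, h0, h1, A.vel_normal' H hE hz]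

lemma micro_fb_next (hz : z ∈ layer D.τ)
    (hv : ∀ i : Fin 2, vel i.castSucc (E.fb k z) = vel i.castSucc (D.fb k z))
    (ht : temp (E.fb k z) = temp (D.fb k z)) :
    micro (E.fb (k + D.n - 2) z) = micro (D.fb (k + D.n - 2) z) :=
  A.micro_fb_add H hE le_rfl hz (A.micro_fb H hE (by have := H.hn; omega) hz)
    (A.proj_fb H hE hz hv ht)

lemma dl_pbar (hz : z ∈ layer D.τ) (hv : ∀ z ∈ layer D.τ, ∀ i : Fin 2,
    vel i.castSucc (E.fb k z) = vel i.castSucc (D.fb k z)) :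
    E.dl 3 (E.pbar (D.n - 2 + k)) z = D.dl 3 (D.pbar (D.n - 2 + k)) z := by
  have h := hE.dl_pbar k (A.mem hz)
  rw [A.n, A.sg, A.H_eq H hE le_rfl hz, A.dl 3 (q := D.u0dot k) hz
    fun z hz => A.u0dot H hz (hv z hz)] at h
  rw [h, H.dl_pbar k hz]

end Agree

end ViscousLayer
end

theorem proposition3p1 (D : LayerData) (hn : 3 ≤ D.n) (hb : 1 ≤ D.b) (hD : D.IsSolution)
    (k : ℤ) (hk : 1 ≤ k) :
    -- the coefficients are well defined and positive
    ((∀ i j : Fin 3, i ≠ j → IsLinvOf (burnettA i j) (Linv (burnettA i j)) ∧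
        ip (burnettA i j) (Linv (burnettA i j)) = viscosity) ∧
      (∀ i : Fin 3, IsLinvOf (burnettB i) (Linv (burnettB i)) ∧
        ip (burnettB i) (Linv (burnettB i)) = conductivity) ∧
      0 < viscosity ∧ 0 < conductivity) ∧
    (∀ z ∈ layer D.τ,
      D.SourcesMeaningful k z ∧
      -- the tangential velocity
      (∀ i : Fin 2,
        D.dl 0 (fun z => vel i.castSucc (D.fb k z)) z
          + D.driftCoeff z * D.dl 3 (fun z => vel i.castSucc (D.fb k z)) z
          - viscosity * D.dl 3 (D.dl 3 (fun z => vel i.castSucc (D.fb k z))) z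
          + D.adv0 (fun z => vel i.castSucc (D.fb k z)) z
          + D.advb k (fun z => vel i.castSucc (D.fw 0 z)) z
        = D.srcU k i z) ∧
      -- the temperature
      (D.dl 0 (fun z => temp (D.fb k z)) z
          + D.driftCoeff z * D.dl 3 (fun z => temp (D.fb k z)) z
          - 2 / 5 * conductivity * D.dl 3 (D.dl 3 (fun z => temp (D.fb k z))) z
          + D.adv0 (fun z => temp (D.fb k z)) z
          + D.advb k (fun z => temp (D.fw 0 z)) z
        = D.srcTheta k z) ∧
      -- the pressure
      D.pbar k z = D.srcP k z ∧
      -- the next order quantities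
      D.dl 3 (fun z => vel 2 (D.fb (k + 1) z)) z
        = D.sg * D.dl 0 (fun z => rho (D.fb (k + 2 - D.n) z)) z + D.sg * D.divb k z ∧
      (micro (D.fb (k + D.n - 2) z) =ᵐ[volume]
        fun v => Linv (GamS (D.fw 0 z) (proj (D.fb k z))) v + D.W (k - 1) z v) ∧
      IsLinvOf (GamS (D.fw 0 z) (proj (D.fb k z)))
        (Linv (GamS (D.fw 0 z) (proj (D.fb k z)))) ∧
      D.dl 3 (D.pbar (D.n - 2 + k)) z = 2 / 3 * D.dl 3 (D.u0dot k) z - D.sg * D.H (k - 1) z) ∧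
    -- dependence on `f_i` (`0 ≤ i ≤ k`) and `f̄_j` (`1 ≤ j ≤ k - 1`) only
    (∀ f' fb' : ℤ → Pt → Vel → ℝ,
      ({ D with f := f', fb := fb' } : LayerData).IsSolution →
      (∀ i, 0 ≤ i → i ≤ k → ∀ z ∈ channel D.τ, f' i z = D.f i z) →
      (∀ j, 1 ≤ j → j ≤ k - 1 → ∀ z ∈ layer D.τ, fb' j z = D.fb j z) →
      (∀ z ∈ layer D.τ,
        (∀ i, ({ D with f := f', fb := fb' } : LayerData).srcU k i z = D.srcU k i z) ∧
        ({ D with f := f', fb := fb' } : LayerData).srcTheta k z = D.srcTheta k z ∧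
        ({ D with f := f', fb := fb' } : LayerData).srcP k z = D.srcP k z) ∧
      ((∀ z ∈ layer D.τ, (∀ i : Fin 2, vel i.castSucc (fb' k z) = vel i.castSucc (D.fb k z)) ∧
          temp (fb' k z) = temp (D.fb k z)) →
        ∀ z ∈ layer D.τ,
          vel 2 (fb' (k + 1) z) = vel 2 (D.fb (k + 1) z) ∧
          ({ D with f := f', fb := fb' } : LayerData).dl 3
              (({ D with f := f', fb := fb' } : LayerData).pbar (D.n - 2 + k)) z
            = D.dl 3 (D.pbar (D.n - 2 + k)) z ∧
          micro (fb' (k + D.n - 2) z) = micro (D.fb (k + D.n - 2) z))) := by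
  have H : Admissible D := ⟨hD, hn, hb⟩
  refine ⟨⟨fun i j hij => ⟨isLinvOf_burnettA i j, ip_burnettA_Linv hij⟩,
      fun i => ⟨isLinvOf_burnettB i, ip_burnettB_Linv i⟩, viscosity_pos, conductivity_pos⟩,
    fun z hz => ⟨H.sourcesMeaningful hk hz, fun i => H.velocity_equation i hk hz,
      H.temperature_equation hk hz, H.pbar_eq_srcP k hz, H.dl_vel_normal k hz, H.micro_fb_ae k hz,
      (H.isLinvOf_GamS_fw0_proj k hz).linv, H.dl_pbar k hz⟩,
    fun f' fb' hE' hf hfb => ?_⟩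
  have hE : Admissible { D with f := f', fb := fb' } := ⟨hE', hn, hb⟩
  have A : Agree D { D with f := f', fb := fb' } k :=
    { pos := hk, n := rfl, b := rfl, τ := rfl, s := rfl
      -- Terms of negative index vanish in both solutions, and likewise layer terms of index at most
      -- 0, so agreement extends to all smaller indices.
      f := fun i hi z hz => by
        rcases lt_or_ge i 0 with h | h
        · rw [hE'.interior.zero i h, hD.interior.zero i h]
        · exact hf i h hi z hz
      fb := fun j hj z hz => by
        rcases le_or_gt j 0 with h | h
        · rw [hE'.viscous.zero j h, hD.viscous.zero j h]
        · exact hfb j h hj z hz }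
  refine ⟨fun z hz => ⟨fun i => A.srcU H hE i hz, A.srcTheta H hE hz, A.srcP H hE hz⟩,
    fun h z hz => ⟨A.vel_normal H hE le_rfl (fun z hz => (h z hz).1) hz,
      A.dl_pbar H hE hz fun z hz => (h z hz).1, A.micro_fb_next H hE hz (h z hz).1 (h z hz).2⟩⟩
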